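/- Let $\hat Q=(0,1)^2$ and $\hat T=\{(x_1,x_2):0<x_1<1,\ 0<x_2<x_1\}$, let $\hat K\in\{\hat Q,\hat T\}$, and let $\|\cdot\|_{0,\hat K}$ be the norm of $L^2(\hat K)$. For $0<s<1$ and an interval or plane domain $D\subset\mathbb R^n$ let $|v|_{H^s(D)}^2=\int_D\int_D\frac{|v(x)-v(y)|^2}{|x-y|^{n+2s}}\,dx\,dy$, and let $|v|_{H^1(D)}=\|\nabla v\|_{0,D}$; $H^s(D)$ is the space of $v\in L^2(D)$ with $|v|_{H^s(D)}<\infty$. Let $\mathbf H^s(\hat K)=H^s(\hat K)^2$ and $\mathbf H(\mathrm{div},\hat K)=\{\mathbf u\in L^2(\hat K)^2:\mathrm{div}\,\mathbf u\in L^2(\hat K)\}$ (weak divergence). For $0<s\le 1/2$ put $$|v|_{AH_1^s(\hat Q)}^2=\int_0^1|v(\cdot,x_2)|_{H^s(0,1)}^2\,dx_2,\qquad |v|_{AH_2^s(\hat Q)}^2=\int_0^1|v(x_1,\cdot)|_{H^s(0,1)}^2\,dx_1,$$ $$|v|_{AH_1^s(\hat T)}^2=\int_0^1|v(\cdot,x_2)|_{H^s(x_2,1)}^2\,dx_2,\qquad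 |v|_{AH_2^s(\hat T)}^2=\int_0^1|v(x_1,\cdot)|_{H^s(0,x_1)}^2\,dx_1.$$ Let $\mathcal{RT}_0(\hat Q)=\{(a+cx_1,\,b+dx_2)\}$ and $\mathcal{RT}_0(\hat T)=\{(a,b)+c(x_1,x_2)\}$ with real coefficients. The lowest order Raviart–Thomas interpolant $\hat\Pi\mathbf u\in\mathcal{RT}_0(\hat K)$ is the field with $\int_e\hat\Pi\mathbf u\cdot\mathbf n\,ds=(\mathbf u\cdot\mathbf n,1)_{0,e}$ for all edges $e$ of $\hat K$, where $\mathbf n$ is the outward unit normal. For $\mathbf u\in\mathbf H^s(\hat K)\cap\mathbf H(\mathrm{div},\hat K)$, $s>0$, the right-hand side is defined by Green's formula, $$(\mathbf u\cdot\mathbf n,1)_{0,e}=(\mathbf u,\nabla\varphi)_{0,\hat K}+\int_{\hat K}\varphi\,\mathrm{div}\,\mathbf u ,$$ with any function $\varphi$ such that $\varphi=1$ on $e$ and $\varphi=0$ on the other edges, where $\varphi$ is bounded, $C^1$ in $\hat K$, continuous on the closure of $\hat K$ without the two end points of $e$, and $|\nabla\varphi|$ is at most a constant times the inverse distance to these end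 points (so $\varphi\in H^{1-\varepsilon}(\hat K)$ for all $\varepsilon>0$); for $\mathbf u\in\mathbf H^s(\hat K)$ with $1/2<s\le 1$ it is the integral over $e$ of the trace of $\mathbf u\cdot\mathbf n$. Then $\hat\Pi\mathbf u$ exists and is unique in all cases below (with the two definitions in agreement in case (i) on $\hat Q$ if also $\mathbf u\in\mathbf H(\mathrm{div},\hat Q)$), and for every $s$ in the stated range there is a constant $C$, depending on $s$ only, such that for all $\mathbf u=(u_1,u_2)$ as stated and $l=1,2$ (indices modulo $2$) the following hold. **Reference square.** (i) If $1/2<s\le1$ and $\mathbf u\in\mathbf H^s(\hat Q)$, then $\|u_l-(\hat\Pi\mathbf u)_l\|_{0,\hat Q}\le C\,|u_l|_{H^s(\hat Q)}$. (ii) If $0<s\le1/2$ and $\mathbf u\in\mathbf H^s(\hat Q)\cap\mathbf H(\mathrm{div},\hat Q)$, then $$\|u_l-(\hat\Pi\mathbf u)_l\|_{0,\hat Q}\le C\big(|u_l|_{H^s(\hat Q)}+|u_{l+1}|_{AH^s_{l+1}(\hat Q)}+\|\mathrm{div}\,\mathbf u\|_{0,\hat Q}\big).$$ **Reference triangle.**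 (i) If $1/2<s\le1$ and $\mathbf u\in\mathbf H^s(\hat T)\cap\mathbf H(\mathrm{div},\hat T)$, then $$\|u_l-(\hat\Pi\mathbf u)_l\|_{0,\hat T}\le C\big(|u_l|_{H^s(\hat T)}+\|\mathrm{div}\,\mathbf u\|_{0,\hat T}\big).$$ (ii) If $0<s\le1/2$ and $\mathbf u\in\mathbf H^s(\hat T)\cap\mathbf H(\mathrm{div},\hat T)$, then $$\|u_l-(\hat\Pi\mathbf u)_l\|_{0,\hat T}\le C\big(|u_l|_{H^s(\hat T)}+|u_{l+1}|_{AH^s_{l+1}(\hat T)}+\|\mathrm{div}\,\mathbf u\|_{0,\hat T}\big).$$ -/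

import Mathlib

open Set Filter Topology MeasureTheory
open scoped ENNReal NNReal

noncomputable section

namespace RTInterp

/-- A (real) vector field in the plane, given by its two components. The indices `0, 1 : Fin 2`
stand for the components 1, 2, so that `l + 1` is the index modulo 2. -/
abbrev Field2 : Type := Fin 2 → ℝ × ℝ → ℝ

/-- The reference square `(0,1)²`. -/
def refSquare : Set (ℝ × ℝ) := {x | 0 < x.1 ∧ x.1 < 1 ∧ 0 < x.2 ∧ x.2 < 1}

/-- The reference triangle `{0 < x₁ < 1, 0 < x₂ < x₁}`. -/
def refTriangle : Set (ℝ × ℝ) := {x | 0 < x.1 ∧ x.1 < 1 ∧ 0 < x.2 ∧ x.2 < x.1}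

/-- Euclidean distance in the plane (Mathlib's `dist` on `ℝ × ℝ` is the maximum distance). -/
def eucl (x y : ℝ × ℝ) : ℝ := Real.sqrt ((x.1 - y.1) ^ 2 + (x.2 - y.2) ^ 2)

/-- The norm of `L²(K)`. -/
def l2Norm (K : Set (ℝ × ℝ)) (v : ℝ × ℝ → ℝ) : ℝ≥0∞ := eLpNorm v 2 (volume.restrict K)

/-! ### Sobolev spaces of order `0 < s ≤ 1` -/

/-- The unit coordinate vectors. -/
def unitVec (i : Fin 2) : ℝ × ℝ := if i = 0 then (1, 0) else (0, 1)

/-- The classical partial derivative `∂ᵢ φ`. -/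
def pderiv (i : Fin 2) (φ : ℝ × ℝ → ℝ) (x : ℝ × ℝ) : ℝ := fderiv ℝ φ x (unitVec i)

/-- Test functions: `φ ∈ C_c^∞(K)`. -/
def IsTest (K : Set (ℝ × ℝ)) (φ : ℝ × ℝ → ℝ) : Prop :=
  ContDiff ℝ (⊤ : ℕ∞) φ ∧ HasCompactSupport φ ∧ tsupport φ ⊆ K

/-- `g` is the weak partial derivative `∂ᵢ v` in `K` (for `v, g ∈ L²(K)`). -/
def IsWeakPartial (K : Set (ℝ × ℝ)) (i : Fin 2) (v g : ℝ × ℝ → ℝ) : Prop :=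
  ∀ φ, IsTest K φ → ∫ x in K, v x * pderiv i φ x = -∫ x in K, g x * φ x

/-- `d` is the weak divergence of `u` in `K` (for `u ∈ L²(K)²`, `d ∈ L²(K)`). -/
def IsWeakDiv (K : Set (ℝ × ℝ)) (u : Field2) (d : ℝ × ℝ → ℝ) : Prop :=
  ∀ φ, IsTest K φ →
    ∫ x in K, (u 0 x * pderiv 0 φ x + u 1 x * pderiv 1 φ x) = -∫ x in K, d x * φ x

/-- `u ∈ H(div, K)` with `div u = d`: the components and `d` are in `L²(K)`, and `d` is the weak
divergence of `u`. -/
def HasDiv (K : Set (ℝ × ℝ)) (u : Field2) (d : ℝ × ℝ → ℝ) : Prop :=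
  (∀ j, MemLp (u j) 2 (volume.restrict K)) ∧ MemLp d 2 (volume.restrict K) ∧ IsWeakDiv K u d

/-- The Sobolev–Slobodeckij seminorm of order `0 < s < 1` on a plane domain:
`|v|² = ∬ |v(x) - v(y)|² / |x - y|^{2+2s}`. -/
def slobodeckij (K : Set (ℝ × ℝ)) (s : ℝ) (v : ℝ × ℝ → ℝ) : ℝ≥0∞ :=
  (∫⁻ x in K, ∫⁻ y in K,
    ENNReal.ofReal ((v x - v y) ^ 2 / eucl x y ^ (2 + 2 * s))) ^ (1 / 2 : ℝ)

/-- The seminorm `‖∇v‖` of `H¹(K)`; it is `∞` if `v` has no weak gradient in `L²(K)²`. (The weak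
gradient is unique up to null sets, so that the infimum is over equal values.) -/
def h1Seminorm (K : Set (ℝ × ℝ)) (v : ℝ × ℝ → ℝ) : ℝ≥0∞ :=
  ⨅ (g : Field2) (_ : ∀ i, MemLp (g i) 2 (volume.restrict K) ∧ IsWeakPartial K i v (g i)),
    (∑ i, l2Norm K (g i) ^ 2) ^ (1 / 2 : ℝ)

/-- The seminorm `|v|_{H^s(K)}`, used for `0 < s ≤ 1` only. -/
def hSeminorm (K : Set (ℝ × ℝ)) (s : ℝ) (v : ℝ × ℝ → ℝ) : ℝ≥0∞ :=
  if s < 1 then slobodeckij K s v else h1Seminorm K v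

/-- `v ∈ H^s(K)`, for `0 < s ≤ 1`. -/
def MemH (K : Set (ℝ × ℝ)) (s : ℝ) (v : ℝ × ℝ → ℝ) : Prop :=
  MemLp v 2 (volume.restrict K) ∧ hSeminorm K s v < ⊤

/-! ### Anisotropic seminorms -/

/-- The square of the Slobodeckij seminorm of order `0 < s < 1` on an interval `S`. -/
def slobodeckijSq1 (S : Set ℝ) (s : ℝ) (f : ℝ → ℝ) : ℝ≥0∞ :=
  ∫⁻ r in S, ∫⁻ r' in S, ENNReal.ofReal ((f r - f r') ^ 2 / |r - r'| ^ (1 + 2 * s))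

/-- The point with `j`-th coordinate `r` and other coordinate `t`. -/
def pt (j : Fin 2) (r t : ℝ) : ℝ × ℝ := if j = 0 then (r, t) else (t, r)

/-- The anisotropic seminorm `|v|_{AH_j^s(K)}`: the `H^s` seminorm in the variable `x_j` on the
section of `K` at height `t`, square integrated over the other variable `t ∈ (0,1)`. The section is
`(0,1)` for the square, and `(t,1)` (`j = 1`) or `(0,t)` (`j = 2`) for the triangle. -/
def anisoSeminorm (K : Set (ℝ × ℝ)) (s : ℝ) (j : Fin 2) (v : ℝ × ℝ → ℝ) : ℝ≥0∞ :=
  (∫⁻ t in Ioo (0 : ℝ) 1,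
    slobodeckijSq1 {r | pt j r t ∈ K} s (fun r => v (pt j r t))) ^ (1 / 2 : ℝ)

/-! ### Edges and Raviart–Thomas spaces -/

/-- An edge, given by its end points. All boundaries are traversed counterclockwise. -/
abbrev Edge : Type := (ℝ × ℝ) × (ℝ × ℝ)

/-- The edges of the reference square (bottom, right, top, left). -/
def squareEdge : Fin 4 → Edge :=
  ![((0, 0), (1, 0)), ((1, 0), (1, 1)), ((1, 1), (0, 1)), ((0, 1), (0, 0))]

/-- The edges of the reference triangle (on the `x₁`-axis, parallel to the `x₂`-axis, oblique). -/
def triangleEdge : Fin 3 → Edge :=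
  ![((0, 0), (1, 0)), ((1, 0), (1, 1)), ((1, 1), (0, 0))]

/-- The point `a + t (b - a)` of the edge from `a` to `b`. -/
def edgePt (e : Edge) (t : ℝ) : ℝ × ℝ := e.1 + t • (e.2 - e.1)

/-- `∫_e q · n ds` for `q` given along the parametrized edge from `a` to `b`. For a counterclockwise
edge the outward unit normal `n` times `|b - a|` is `(b₂ - a₂, a₁ - b₁)`. -/
def edgeIntegral (e : Edge) (q : Fin 2 → ℝ → ℝ) : ℝ :=
  ∫ t in (0 : ℝ)..1, (q 0 t * (e.2.2 - e.1.2) + q 1 t * (e.1.1 - e.2.1))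

/-- `∫_e p · n ds` for a continuous field `p`. -/
def edgeFlux (e : Edge) (p : Field2) : ℝ := edgeIntegral e (fun j t => p j (edgePt e t))

/-- Lowest order Raviart–Thomas space of the square: `(a + c x₁, b + d x₂)`. -/
def squareRT0 : Set Field2 :=
  {p | ∃ a b c d : ℝ, p = ![fun x => a + c * x.1, fun x => b + d * x.2]}

/-- Lowest order Raviart–Thomas space of the triangle: `(a, b) + c (x₁, x₂)`. -/
def triangleRT0 : Set Field2 :=
  {p | ∃ a b c : ℝ, p = ![fun x => a + c * x.1, fun x => b + c * x.2]}

/-! ### Normal fluxes of fields of low regularity -/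

/-- `φ` is an admissible function for Green's formula on the edge `i`: it is `1` on this edge and
`0` on the other edges, `C¹` in `K`, bounded, continuous up to the boundary except at the two end
points of the edge, and its gradient is of the order of the inverse distance to these end points.
Then `∇φ ∈ L^q(K)` for all `q < 2`, so that `φ ∈ H^{1-ε}(K)` for all `ε > 0`. No function with these
boundary values is in `H¹(K)`. -/
def IsEdgeCutoff {n : ℕ} (K : Set (ℝ × ℝ)) (edge : Fin n → Edge) (i : Fin n)
    (φ : ℝ × ℝ → ℝ) : Prop :=
  ContDiffOn ℝ 1 φ K ∧
  ContinuousOn φ (closure K \ {(edge i).1, (edge i).2}) ∧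
  (∃ M : ℝ, ∀ x ∈ K, |φ x| ≤ M ∧
    ‖fderiv ℝ φ x‖ * min (dist x (edge i).1) (dist x (edge i).2) ≤ M) ∧
  (∀ x ∈ openSegment ℝ (edge i).1 (edge i).2, φ x = 1) ∧
  (∀ j, j ≠ i → ∀ x ∈ openSegment ℝ (edge j).1 (edge j).2, φ x = 0)

/-- `F = (u · n, 1)_e` for the edge `e` with index `i` and a field `u ∈ H^s(K)²`, `s > 0`, with
`div u = d ∈ L²(K)`, defined by Green's formula `F = (u, ∇φ) + ∫ d φ` with `φ = 1` on `e` and `φ = 0`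
on the other edges. The pairing `(u, ∇φ)` is an integral, since `H^s(K) ⊆ L^p(K)` for some `p > 2`.
The value does not depend on `φ`. -/
def IsGreenFlux {n : ℕ} (K : Set (ℝ × ℝ)) (edge : Fin n → Edge) (i : Fin n)
    (u : Field2) (d : ℝ × ℝ → ℝ) (F : ℝ) : Prop :=
  ∀ φ, IsEdgeCutoff K edge i φ →
    IntegrableOn (fun x => u 0 x * pderiv 0 φ x + u 1 x * pderiv 1 φ x) K ∧
    IntegrableOn (fun x => d x * φ x) K ∧
    F = (∫ x in K, (u 0 x * pderiv 0 φ x + u 1 x * pderiv 1 φ x)) + ∫ x in K, d x * φ x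

/-- `p` is the Raviart–Thomas interpolant, in the space `V`, of the field `u` with `div u = d`. -/
def IsRTInterpolant {n : ℕ} (K : Set (ℝ × ℝ)) (edge : Fin n → Edge) (V : Set Field2)
    (u : Field2) (d : ℝ × ℝ → ℝ) (p : Field2) : Prop :=
  p ∈ V ∧ ∀ i, IsGreenFlux K edge i u d (edgeFlux (edge i) p)

/-! ### Traces and interpolation for `s > 1/2` -/

/-- `g ∈ L²(e)` (as a function of the parameter) is the trace on the edge `e` of `v ∈ H^s(K)`,
`s > 1/2`: the trace operator is the continuous extension to `H^s(K)` of the restriction to `e` of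
functions that are smooth up to the boundary. -/
def HasTrace (K : Set (ℝ × ℝ)) (s : ℝ) (e : Edge) (v : ℝ × ℝ → ℝ) (g : ℝ → ℝ) : Prop :=
  MemLp g 2 (volume.restrict (Ioo (0 : ℝ) 1)) ∧
  ∃ w : ℕ → ℝ × ℝ → ℝ, (∀ k, ContDiff ℝ (⊤ : ℕ∞) (w k)) ∧
    Tendsto (fun k => l2Norm K (fun x => w k x - v x)) atTop (𝓝 0) ∧
    Tendsto (fun k => hSeminorm K s (fun x => w k x - v x)) atTop (𝓝 0) ∧
    Tendsto (fun k => eLpNorm (fun t => w k (edgePt e t) - g t) 2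
      (volume.restrict (Ioo (0 : ℝ) 1))) atTop (𝓝 0)

/-- `p` is the Raviart–Thomas interpolant, in the space `V`, of the field `u ∈ H^s(K)²`, `s > 1/2`
(no condition on the divergence): the degrees of freedom are the integrals over the edges of the
trace of `u · n`. -/
def IsTraceRTInterpolant {n : ℕ} (K : Set (ℝ × ℝ)) (edge : Fin n → Edge) (V : Set Field2) (s : ℝ)
    (u : Field2) (p : Field2) : Prop :=
  p ∈ V ∧ ∀ i, ∃ g : Fin 2 → ℝ → ℝ,
    (∀ j, HasTrace K s (edge i) (u j) (g j)) ∧ edgeFlux (edge i) p = edgeIntegral (edge i) g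

end RTInterp

end

noncomputable section

namespace RTInterp

/-! ### Elementary inequalities for lower integrals -/

/-! The interpolant is determined by its edge fluxes `F`. On the square its component `l` is the
linear interpolation between the signed fluxes of the two edges normal to `e_l`. On the triangle it
is given by the flux of the single axis-parallel edge normal to `e_l`, up to a term bounded by the
total flux, and the total flux is `∫ div u`. So for every constant `m` the distance of `m` from the
interpolated component is bounded by quantities `|F - σ m|` on axis-parallel edges and, on the
triangle, by `‖div u‖`. With `m` the mean of `u_l` and Poincaré's inequality, everything reduces to
estimating `F - σ m` by seminorms.

For `s > 1/2` the flux is controlled by the normal component alone. Green's formula does not see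
which cutoff `φ` is used, so `φ` may be multiplied by a cutoff `χ_k` to a strip of width `2⁻ᵏ` along
the edge. As `k → ∞` every term in which `χ_k` is not differentiated disappears. What remains is an
average of `u_l` over the strip (`tendsto_stripFlux`). Halving the strip changes its average by at
most a multiple of `2^(-k (s - 1/2))` times the seminorm, so the averages are bounded uniformly in
`k` (`exists_strip_interval`). The same bound gives the trace inequality, hence the traces on the
square and their agreement with Green's formula.

For `s ≤ 1/2` one fixes `φ` and splits `F - σ m = ∫ (u_l - m) ∂_l φ + ∫ u_{l+1} ∂_{l+1} φ + ∫ φ div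
u`. Since `∇φ` is of the order of the inverse distance to the end points of the edge, a Hardy type
inequality `∫ |v| / |x - a| ≤ C ‖v‖_{H^s}`, valid for all `s > 0`, handles the first integral. It is
proved on lines (`exists_hardy_interval`) and needs differences along these lines only. For the
second integral, the lines parallel to the edge end on other edges, where `φ = 0`. Thus `∂_{l+1} φ`
has mean zero on each of them and the mean of `u_{l+1}` on the line can be subtracted. Poincaré on
the line then leaves only the anisotropic seminorm (`exists_integral_tangential_sq_le`).

Two facts support this. First, on the square the anisotropic seminorms are bounded by the isotropic
one (`anisoSq_le_slobSq`), and functions on the triangle are reflected to the square. Second,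
Green's formula is independent of the cutoff: the difference of two cutoffs vanishes on the open
edges but is singular at the corners, and has to be approximated by compactly supported functions
whose gradients stay below a multiple of the inverse distance to the corners
(`integral_green_eq_zero`). Hardy's inequality supplies the dominating function. The case `s = 1` is
reduced to order `3/4`. -/

lemma enorm_sq_eq (a : ℝ) : ‖a‖ₑ ^ 2 = ENNReal.ofReal (a ^ 2) := by
  rw [← ofReal_norm, ← ENNReal.ofReal_pow (norm_nonneg _), Real.norm_eq_abs, sq_abs]

lemma enorm_eq_ofReal_abs (a : ℝ) : ‖a‖ₑ = ENNReal.ofReal |a| := by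
  rw [← ofReal_norm, Real.norm_eq_abs]

lemma ennreal_add_sq_le (a b : ℝ≥0∞) : (a + b) ^ 2 ≤ 2 * (a ^ 2 + b ^ 2) := by
  rcases eq_or_ne a ⊤ with rfl | ha
  · simp [ENNReal.mul_top]
  rcases eq_or_ne b ⊤ with rfl | hb
  · simp [ENNReal.mul_top]
  lift a to ℝ≥0 using ha
  lift b to ℝ≥0 using hb
  norm_cast
  exact add_sq_le

lemma ennreal_sq_le_sq {a b : ℝ≥0∞} (h : a ≤ b) : a ^ 2 ≤ b ^ 2 := by gcongr

lemma ennreal_le_of_sq_le {a b : ℝ≥0∞} (h : a ^ 2 ≤ b ^ 2) : a ≤ b :=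
  (ENNReal.pow_le_pow_left_iff two_ne_zero).1 h

lemma ennreal_rpow_half_sq (a : ℝ≥0∞) : (a ^ (1 / 2 : ℝ)) ^ 2 = a := by
  rw [← ENNReal.rpow_natCast, ← ENNReal.rpow_mul]; norm_num

/-- The Cauchy–Schwarz inequality. -/
lemma lintegral_mul_sq_le {α : Type*} [MeasurableSpace α] {μ : Measure α} {f g : α → ℝ≥0∞}
    (hf : AEMeasurable f μ) (hg : AEMeasurable g μ) :
    (∫⁻ x, f x * g x ∂μ) ^ 2 ≤ (∫⁻ x, f x ^ 2 ∂μ) * ∫⁻ x, g x ^ 2 ∂μ := by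
  have h := ENNReal.lintegral_mul_le_Lp_mul_Lq μ Real.HolderConjugate.two_two hf hg
  refine (ennreal_sq_le_sq h).trans ?_
  rw [mul_pow, ennreal_rpow_half_sq, ennreal_rpow_half_sq]
  simp

lemma sq_lintegral_le {α : Type*} [MeasurableSpace α] {μ : Measure α} {f : α → ℝ≥0∞}
    (hf : AEMeasurable f μ) :
    (∫⁻ x, f x ∂μ) ^ 2 ≤ μ univ * ∫⁻ x, f x ^ 2 ∂μ := by
  have h := lintegral_mul_sq_le (f := fun _ => 1) aemeasurable_const hf
  simpa using h

/-- Poincaré's inequality, with the double integral of the squared differences. -/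
lemma lintegral_sub_mean_sq_le {α : Type*} [MeasurableSpace α] {μ : Measure α} [IsFiniteMeasure μ]
    (h0 : μ univ ≠ 0) {f : α → ℝ} (hf : Integrable f μ) :
    ∫⁻ x, ‖f x - (μ.real univ)⁻¹ * ∫ y, f y ∂μ‖ₑ ^ 2 ∂μ ≤
      (μ univ)⁻¹ * ∫⁻ x, ∫⁻ y, ‖f x - f y‖ₑ ^ 2 ∂μ ∂μ := by
  have hr : μ.real univ ≠ 0 := by
    simp [Measure.real, ENNReal.toReal_eq_zero_iff, h0]
  have hinv : ‖(μ.real univ)⁻¹‖ₑ = (μ univ)⁻¹ := by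
    rw [enorm_inv hr, Measure.real, enorm_eq_ofReal_abs, abs_of_nonneg ENNReal.toReal_nonneg,
      ENNReal.ofReal_toReal (measure_ne_top _ _)]
  rw [← lintegral_const_mul' _ _ (ENNReal.inv_ne_top.2 h0)]
  refine lintegral_mono fun x => ?_
  have h1 : f x - (μ.real univ)⁻¹ * ∫ y, f y ∂μ = (μ.real univ)⁻¹ * ∫ y, (f x - f y) ∂μ := by
    rw [integral_sub (integrable_const _) hf, integral_const, smul_eq_mul, mul_sub,
      inv_mul_cancel_left₀ hr]
  rw [h1, enorm_mul, hinv, mul_pow]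
  have hm : AEMeasurable (fun y => ‖f x - f y‖ₑ) μ := (aestronglyMeasurable_const.sub hf.1).enorm
  calc (μ univ)⁻¹ ^ 2 * ‖∫ y, (f x - f y) ∂μ‖ₑ ^ 2
      ≤ (μ univ)⁻¹ ^ 2 * (μ univ * ∫⁻ y, ‖f x - f y‖ₑ ^ 2 ∂μ) := by
        gcongr
        exact (ennreal_sq_le_sq (enorm_integral_le_lintegral_enorm _)).trans (sq_lintegral_le hm)
    _ = (μ univ)⁻¹ * ∫⁻ y, ‖f x - f y‖ₑ ^ 2 ∂μ := by
        rw [← mul_assoc, sq, mul_assoc (μ univ)⁻¹, ENNReal.inv_mul_cancel h0 (measure_ne_top _ _),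
          mul_one]

/-! ### Squared norms -/

/-- The square of the norm of `L²(K)`. -/
def nsq (K : Set (ℝ × ℝ)) (v : ℝ × ℝ → ℝ) : ℝ≥0∞ := ∫⁻ x in K, ‖v x‖ₑ ^ 2

/-- The square of the Slobodeckij seminorm. -/
def slobSq (K : Set (ℝ × ℝ)) (s : ℝ) (v : ℝ × ℝ → ℝ) : ℝ≥0∞ :=
  ∫⁻ x in K, ∫⁻ y in K, ENNReal.ofReal ((v x - v y) ^ 2 / eucl x y ^ (2 + 2 * s))

/-- The square of the anisotropic seminorm. -/
def anisoSq (K : Set (ℝ × ℝ)) (s : ℝ) (j : Fin 2) (v : ℝ × ℝ → ℝ) : ℝ≥0∞ :=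
  ∫⁻ t in Ioo (0 : ℝ) 1, slobodeckijSq1 {r | pt j r t ∈ K} s (fun r => v (pt j r t))

lemma l2Norm_eq (K : Set (ℝ × ℝ)) (v : ℝ × ℝ → ℝ) : l2Norm K v = nsq K v ^ (1 / 2 : ℝ) := by
  rw [l2Norm, eLpNorm_eq_lintegral_rpow_enorm_toReal two_ne_zero ENNReal.ofNat_ne_top, nsq]
  simp

lemma l2Norm_sq (K : Set (ℝ × ℝ)) (v : ℝ × ℝ → ℝ) : l2Norm K v ^ 2 = nsq K v := by
  rw [l2Norm_eq, ennreal_rpow_half_sq]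

lemma slobodeckij_sq (K : Set (ℝ × ℝ)) (s : ℝ) (v : ℝ × ℝ → ℝ) :
    slobodeckij K s v ^ 2 = slobSq K s v := by
  rw [slobodeckij, ennreal_rpow_half_sq, slobSq]

lemma anisoSeminorm_sq (K : Set (ℝ × ℝ)) (s : ℝ) (j : Fin 2) (v : ℝ × ℝ → ℝ) :
    anisoSeminorm K s j v ^ 2 = anisoSq K s j v := by
  rw [anisoSeminorm, ennreal_rpow_half_sq, anisoSq]

lemma nsq_lt_top {K : Set (ℝ × ℝ)} {v : ℝ × ℝ → ℝ} (hv : MemLp v 2 (volume.restrict K)) :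
    nsq K v < ⊤ := by
  rw [← l2Norm_sq]
  exact ENNReal.pow_lt_top hv.2

lemma nsq_add_le (K : Set (ℝ × ℝ)) {v w : ℝ × ℝ → ℝ} (hv : Measurable v) :
    nsq K (fun x => v x + w x) ≤ 2 * (nsq K v + nsq K w) := by
  rw [nsq, nsq, nsq, ← lintegral_add_left (by fun_prop), ← lintegral_const_mul' _ _ (by simp)]
  refine lintegral_mono fun x => ?_
  exact (ennreal_sq_le_sq (enorm_add_le _ _)).trans (ennreal_add_sq_le _ _)

/-! ### Geometry -/

lemma eucl_nonneg (x y : ℝ × ℝ) : 0 ≤ eucl x y := Real.sqrt_nonneg _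

lemma eucl_le (x y : ℝ × ℝ) : eucl x y ≤ |x.1 - y.1| + |x.2 - y.2| := by
  unfold eucl
  rw [Real.sqrt_le_left (by positivity)]
  have := mul_nonneg (abs_nonneg (x.1 - y.1)) (abs_nonneg (x.2 - y.2))
  nlinarith [sq_abs (x.1 - y.1), sq_abs (x.2 - y.2)]

lemma dist_le_eucl (x y : ℝ × ℝ) : dist x y ≤ eucl x y := by
  rw [Prod.dist_eq, Real.dist_eq, Real.dist_eq]
  exact max_le (Real.abs_le_sqrt (by nlinarith [sq_nonneg (x.2 - y.2)]))
    (Real.abs_le_sqrt (by nlinarith [sq_nonneg (x.1 - y.1)]))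

lemma eucl_le_dist (x y : ℝ × ℝ) : eucl x y ≤ 2 * dist x y := by
  refine (eucl_le x y).trans ?_
  rw [Prod.dist_eq, Real.dist_eq, Real.dist_eq]
  linarith [le_max_left |x.1 - y.1| |x.2 - y.2|, le_max_right |x.1 - y.1| |x.2 - y.2|]

lemma eucl_eq_zero {x y : ℝ × ℝ} (h : eucl x y = 0) : x = y := by
  have := dist_le_eucl x y
  exact dist_le_zero.1 (h ▸ this)

@[fun_prop]
lemma measurable_eucl : Measurable (fun p : (ℝ × ℝ) × (ℝ × ℝ) => eucl p.1 p.2) := by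
  unfold eucl; fun_prop

lemma isOpen_refSquare : IsOpen refSquare := by
  unfold refSquare
  simp only [ofPred_and]
  refine IsOpen.inter ?_ (IsOpen.inter ?_ (IsOpen.inter ?_ ?_)) <;>
    exact isOpen_lt (by fun_prop) (by fun_prop)

lemma isOpen_refTriangle : IsOpen refTriangle := by
  unfold refTriangle
  simp only [ofPred_and]
  refine IsOpen.inter ?_ (IsOpen.inter ?_ (IsOpen.inter ?_ ?_)) <;>
    exact isOpen_lt (by fun_prop) (by fun_prop)

lemma convex_refSquare : Convex ℝ refSquare := by
  intro x hx y hy a b ha hb hab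
  simp only [refSquare, mem_ofPred_eq, Prod.fst_add, Prod.snd_add, Prod.smul_fst, Prod.smul_snd,
    smul_eq_mul] at *
  obtain ⟨h1, h2, h3, h4⟩ := hx
  obtain ⟨k1, k2, k3, k4⟩ := hy
  have hb' : b = 1 - a := by linarith
  subst hb'
  rcases ha.eq_or_lt with rfl | ha'
  · simp_all
  refine ⟨?_, ?_, ?_, ?_⟩ <;> nlinarith

lemma convex_refTriangle : Convex ℝ refTriangle := by
  intro x hx y hy a b ha hb hab
  simp only [refTriangle, mem_ofPred_eq, Prod.fst_add, Prod.snd_add, Prod.smul_fst, Prod.smul_snd,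
    smul_eq_mul] at *
  obtain ⟨h1, h2, h3, h4⟩ := hx
  obtain ⟨k1, k2, k3, k4⟩ := hy
  have hb' : b = 1 - a := by linarith
  subst hb'
  rcases ha.eq_or_lt with rfl | ha'
  · simp_all
  refine ⟨?_, ?_, ?_, ?_⟩ <;> nlinarith

lemma refTriangle_subset : refTriangle ⊆ refSquare := fun _ hx =>
  ⟨hx.1, hx.2.1, hx.2.2.1, hx.2.2.2.trans hx.2.1⟩

lemma mem_refSquare_pt {j : Fin 2} {r t : ℝ} :
    pt j r t ∈ refSquare ↔ r ∈ Ioo (0 : ℝ) 1 ∧ t ∈ Ioo (0 : ℝ) 1 := by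
  fin_cases j <;> simp [pt, refSquare] <;> tauto

lemma refSquare_section (j : Fin 2) {t : ℝ} (ht : t ∈ Ioo (0 : ℝ) 1) :
    {r | pt j r t ∈ refSquare} = Ioo 0 1 := by
  ext r; simp only [mem_ofPred_eq, mem_refSquare_pt, ht, and_true]

lemma refTriangle_section_zero {t : ℝ} (ht : t ∈ Ioo (0 : ℝ) 1) :
    {r | pt 0 r t ∈ refTriangle} = Ioo t 1 := by
  ext r; simp only [pt, refTriangle, mem_ofPred_eq, if_true, mem_Ioo]
  obtain ⟨h1, h2⟩ := ht
  constructor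
  · tauto
  · rintro ⟨h3, h4⟩; exact ⟨by linarith, h4, h1, h3⟩

lemma refTriangle_section_one {t : ℝ} (ht : t ∈ Ioo (0 : ℝ) 1) :
    {r | pt 1 r t ∈ refTriangle} = Ioo 0 t := by
  ext r; simp only [pt, refTriangle, mem_ofPred_eq, mem_Ioo, one_ne_zero, if_false]
  obtain ⟨h1, h2⟩ := ht
  tauto

lemma closure_refSquare_subset :
    closure refSquare ⊆ {x | 0 ≤ x.1 ∧ x.1 ≤ 1 ∧ 0 ≤ x.2 ∧ x.2 ≤ 1} := by
  refine closure_minimal (fun x hx => ⟨hx.1.le, hx.2.1.le, hx.2.2.1.le, hx.2.2.2.le⟩) ?_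
  simp only [ofPred_and]
  refine IsClosed.inter ?_ (IsClosed.inter ?_ (IsClosed.inter ?_ ?_)) <;>
    exact isClosed_le (by fun_prop) (by fun_prop)

lemma closure_refTriangle_subset :
    closure refTriangle ⊆ {x | 0 ≤ x.1 ∧ x.1 ≤ 1 ∧ 0 ≤ x.2 ∧ x.2 ≤ x.1} := by
  refine closure_minimal (fun x hx => ⟨hx.1.le, hx.2.1.le, hx.2.2.1.le, hx.2.2.2.le⟩) ?_
  simp only [ofPred_and]
  refine IsClosed.inter ?_ (IsClosed.inter ?_ (IsClosed.inter ?_ ?_)) <;>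
    exact isClosed_le (by fun_prop) (by fun_prop)

lemma volume_refSquare_lt_top : volume refSquare < ⊤ := by
  refine (measure_mono ?_).trans_lt
    (isCompact_Icc (a := ((0 : ℝ), (0 : ℝ))) (b := ((1 : ℝ), (1 : ℝ)))).measure_lt_top
  intro x hx
  exact ⟨⟨hx.1.le, hx.2.2.1.le⟩, ⟨hx.2.1.le, hx.2.2.2.le⟩⟩

lemma volume_lt_top_of_subset {K : Set (ℝ × ℝ)} (hK : K ⊆ refSquare) : volume K < ⊤ :=
  (measure_mono hK).trans_lt volume_refSquare_lt_top

lemma refTriangle_nonempty : refTriangle.Nonempty := ⟨(1 / 2, 1 / 4), by norm_num [refTriangle]⟩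

lemma refSquare_nonempty : refSquare.Nonempty := refTriangle_nonempty.mono refTriangle_subset

lemma dist_lt_one_of_mem {x y : ℝ × ℝ} (hx : x ∈ refSquare) (hy : y ∈ refSquare) :
    dist x y ≤ 1 := by
  obtain ⟨h1, h2, h3, h4⟩ := hx
  obtain ⟨k1, k2, k3, k4⟩ := hy
  rw [Prod.dist_eq, Real.dist_eq, Real.dist_eq]
  exact max_le (abs_le.2 ⟨by linarith, by linarith⟩) (abs_le.2 ⟨by linarith, by linarith⟩)

/-! ### Integration over sections -/

@[fun_prop]
lemma measurable_pt (j : Fin 2) : Measurable (fun p : ℝ × ℝ => pt j p.2 p.1) := by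
  unfold pt; split_ifs <;> fun_prop

@[fun_prop]
lemma continuous_pt (j : Fin 2) : Continuous (fun p : ℝ × ℝ => pt j p.2 p.1) := by
  unfold pt; split_ifs <;> fun_prop

lemma measurePreserving_pt (j : Fin 2) :
    MeasurePreserving (fun p : ℝ × ℝ => pt j p.2 p.1) volume volume := by
  by_cases hj : j = 0
  · have : (fun p : ℝ × ℝ => pt j p.2 p.1) = Prod.swap := by
      ext p <;> simp [pt, hj]
    rw [this]
    exact Measure.measurePreserving_swap
  · have : (fun p : ℝ × ℝ => pt j p.2 p.1) = id := by
      ext p <;> simp [pt, hj]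
    rw [this]
    exact MeasurePreserving.id _

lemma measurableEmbedding_pt (j : Fin 2) :
    MeasurableEmbedding (fun p : ℝ × ℝ => pt j p.2 p.1) := by
  by_cases hj : j = 0
  · have : (fun p : ℝ × ℝ => pt j p.2 p.1) = Prod.swap := by
      ext p <;> simp [pt, hj]
    rw [this]
    exact MeasurableEquiv.prodComm.measurableEmbedding
  · have : (fun p : ℝ × ℝ => pt j p.2 p.1) = id := by
      ext p <;> simp [pt, hj]
    rw [this]
    exact MeasurableEmbedding.id

lemma measurableSet_section {K : Set (ℝ × ℝ)} (hK : MeasurableSet K) (j : Fin 2) (t : ℝ) :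
    MeasurableSet {r | pt j r t ∈ K} := by
  have : Measurable (fun r : ℝ => pt j r t) := (measurable_pt j).comp measurable_prodMk_left
  exact this hK

lemma pt_mem_Ioo {K : Set (ℝ × ℝ)} (hK : K ⊆ refSquare) {j : Fin 2} {r t : ℝ}
    (h : pt j r t ∈ K) : t ∈ Ioo (0 : ℝ) 1 := (mem_refSquare_pt.1 (hK h)).2

lemma lintegral_sections {K : Set (ℝ × ℝ)} (hKm : MeasurableSet K) (hK : K ⊆ refSquare)
    (j : Fin 2) {F : ℝ × ℝ → ℝ≥0∞} (hF : Measurable F) :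
    ∫⁻ x in K, F x = ∫⁻ t in Ioo (0 : ℝ) 1, ∫⁻ r in {r | pt j r t ∈ K}, F (pt j r t) := by
  rw [← lintegral_indicator hKm, ← (measurePreserving_pt j).lintegral_comp (hF.indicator hKm),
    Measure.volume_eq_prod]
  refine (lintegral_prod _ ((hF.indicator hKm).comp (measurable_pt j)).aemeasurable).trans ?_
  rw [← lintegral_indicator measurableSet_Ioo]
  refine lintegral_congr fun t => ?_
  by_cases ht : t ∈ Ioo (0 : ℝ) 1
  · rw [indicator_of_mem ht, ← lintegral_indicator (measurableSet_section hKm j t)]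
    rfl
  · rw [indicator_of_notMem ht]
    refine (lintegral_congr fun r => ?_).trans lintegral_zero
    exact indicator_of_notMem (fun h => ht (pt_mem_Ioo hK h)) _

lemma integral_sections {K : Set (ℝ × ℝ)} (hKm : MeasurableSet K) (hK : K ⊆ refSquare)
    (j : Fin 2) {F : ℝ × ℝ → ℝ} (hF : IntegrableOn F K) :
    ∫ x in K, F x = ∫ t in Ioo (0 : ℝ) 1, ∫ r in {r | pt j r t ∈ K}, F (pt j r t) := by
  rw [← integral_indicator hKm, ← (measurePreserving_pt j).integral_comp
    (measurableEmbedding_pt j), Measure.volume_eq_prod, integral_prod,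
    ← integral_indicator measurableSet_Ioo]
  · refine integral_congr_ae (ae_of_all _ fun t => ?_)
    by_cases ht : t ∈ Ioo (0 : ℝ) 1
    · simp only
      rw [indicator_of_mem ht, ← integral_indicator (measurableSet_section hKm j t)]
      rfl
    · simp only
      rw [indicator_of_notMem ht]
      refine (integral_congr_ae (ae_of_all _ fun r => ?_)).trans (integral_zero _ _)
      exact indicator_of_notMem (fun h => ht (pt_mem_Ioo hK h)) _
  · rw [← Measure.volume_eq_prod]
    exact ((measurePreserving_pt j).integrable_comp_emb (measurableEmbedding_pt j)).2
      ((integrable_indicator_iff hKm).2 hF)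

/-! ### Poincaré inequalities -/

/-- For `e > 0` one multiplies and divides by `e ^ p`. At `e = 0` the quotient carries no
information, and `h0` makes the left-hand side vanish. -/
lemma enorm_sub_sq_le_kernel {a b e p c : ℝ} (he : 0 ≤ e) (h0 : e = 0 → a = b)
    (hc : e ^ p ≤ c) :
    ‖a - b‖ₑ ^ 2 ≤ ENNReal.ofReal c * ENNReal.ofReal ((a - b) ^ 2 / e ^ p) := by
  rw [enorm_sq_eq, ← ENNReal.ofReal_mul ((Real.rpow_nonneg he p).trans hc)]
  refine ENNReal.ofReal_le_ofReal ?_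
  rcases he.eq_or_lt with h | h
  · rw [h0 h.symm]; simp
  · have hp : 0 < e ^ p := Real.rpow_pos_of_pos h p
    calc (a - b) ^ 2 = e ^ p * ((a - b) ^ 2 / e ^ p) := by field_simp
      _ ≤ _ := by gcongr

lemma eucl_rpow_le {K : Set (ℝ × ℝ)} (hK : K ⊆ refSquare) {s : ℝ} (h0 : 0 < s) (h1 : s ≤ 1)
    {x y : ℝ × ℝ} (hx : x ∈ K) (hy : y ∈ K) : eucl x y ^ (2 + 2 * s) ≤ 16 := by
  have h2 : eucl x y ≤ 2 := by
    linarith [eucl_le_dist x y, dist_lt_one_of_mem (hK hx) (hK hy)]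
  calc eucl x y ^ (2 + 2 * s) ≤ 2 ^ (2 + 2 * s) := by
        exact Real.rpow_le_rpow (eucl_nonneg _ _) h2 (by linarith)
    _ ≤ 2 ^ (4 : ℝ) := Real.rpow_le_rpow_of_exponent_le (by norm_num) (by linarith)
    _ = 16 := by norm_num

/-- Poincaré's inequality on a plane domain. -/
lemma exists_nsq_sub_const_le {K : Set (ℝ × ℝ)} (hKo : IsOpen K) (hK : K ⊆ refSquare)
    (hne : K.Nonempty) {s : ℝ} (h0 : 0 < s) (h1 : s ≤ 1) :
    ∃ C : ℝ≥0, ∀ v : ℝ × ℝ → ℝ, MemLp v 2 (volume.restrict K) →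
      ∃ m : ℝ, nsq K (fun x => v x - m) ≤ C * slobSq K s v := by
  have hKt := volume_lt_top_of_subset hK
  have : IsFiniteMeasure (volume.restrict K) := ⟨by simpa using hKt⟩
  have hK0 : volume K ≠ 0 := (hKo.measure_pos volume hne).ne'
  -- The constant `m` is the mean of `v`, and 16 bounds the denominator of the kernel on `K`
  -- (`eucl_rpow_le`).
  refine ⟨((volume K)⁻¹ * 16).toNNReal, fun v hv =>
    ⟨((volume.restrict K).real univ)⁻¹ * ∫ y in K, v y, ?_⟩⟩
  · have := lintegral_sub_mean_sq_le (μ := volume.restrict K) (by simpa using hK0)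
      (hv.integrable one_le_two)
    refine this.trans ?_
    rw [ENNReal.coe_toNNReal (ENNReal.mul_ne_top (ENNReal.inv_ne_top.2 hK0) (by simp)), mul_assoc,
      Measure.restrict_apply_univ]
    gcongr
    rw [slobSq, ← lintegral_const_mul' _ _ (by simp)]
    refine setLIntegral_mono' hKo.measurableSet fun x hx => ?_
    rw [← lintegral_const_mul' _ _ (by simp)]
    refine setLIntegral_mono' hKo.measurableSet fun y hy => ?_
    have := enorm_sub_sq_le_kernel (eucl_nonneg x y) (fun h => by rw [eucl_eq_zero h])
      (eucl_rpow_le hK h0 h1 hx hy) (a := v x) (b := v y)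
    simpa using this

/-- Poincaré's inequality on an interval. -/
lemma lintegral_sub_mean_sq_le_slobodeckijSq1 {α β s : ℝ} (h : α < β) (hl : β - α ≤ 1)
    (h0 : 0 < s) {f : ℝ → ℝ} (hf : IntegrableOn f (Ioo α β)) :
    ∫⁻ r in Ioo α β, ‖f r - (β - α)⁻¹ * ∫ y in Ioo α β, f y‖ₑ ^ 2 ≤
      slobodeckijSq1 (Ioo α β) s f := by
  have hv : volume (Ioo α β) = ENNReal.ofReal (β - α) := Real.volume_Ioo
  have hpos : 0 < β - α := by linarith
  have := lintegral_sub_mean_sq_le (μ := volume.restrict (Ioo α β))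
    (by simpa [hv] using h) hf
  rw [measureReal_def, Measure.restrict_apply_univ, hv, ENNReal.toReal_ofReal hpos.le] at this
  refine this.trans ?_
  rw [slobodeckijSq1, ← lintegral_const_mul' _ _ (by simpa using h)]
  refine setLIntegral_mono' measurableSet_Ioo fun x hx => ?_
  rw [← lintegral_const_mul' _ _ (by simpa using h)]
  refine setLIntegral_mono' measurableSet_Ioo fun y hy => ?_
  have hd : |x - y| ≤ β - α := abs_le.2 ⟨by linarith [hx.1, hy.2], by linarith [hx.2, hy.1]⟩
  -- One factor `β - α` is kept to cancel the inverse length that comes from the mean. The constant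
  -- is therefore 1 for all lengths up to 1, including the short sections near the corners of the
  -- triangle.
  have hc : |x - y| ^ (1 + 2 * s) ≤ β - α :=
    calc |x - y| ^ (1 + 2 * s) ≤ (β - α) ^ (1 + 2 * s) :=
          Real.rpow_le_rpow (abs_nonneg _) hd (by linarith)
      _ ≤ (β - α) ^ (1 : ℝ) := Real.rpow_le_rpow_of_exponent_ge hpos hl (by linarith)
      _ = β - α := Real.rpow_one _
  have h2 := enorm_sub_sq_le_kernel (abs_nonneg (x - y))
    (fun h => by rw [sub_eq_zero.1 (abs_eq_zero.1 h)]) hc (a := f x) (b := f y)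
  calc (ENNReal.ofReal (β - α))⁻¹ * ‖f x - f y‖ₑ ^ 2
      ≤ (ENNReal.ofReal (β - α))⁻¹ * (ENNReal.ofReal (β - α) *
          ENNReal.ofReal ((f x - f y) ^ 2 / |x - y| ^ (1 + 2 * s))) := by gcongr
    _ = _ := by
      rw [← mul_assoc, ENNReal.inv_mul_cancel (by simpa using h) (by simp), one_mul]

/-! ### Functions on an interval -/

/-- Cauchy–Schwarz on `X × Y` after dividing the difference by `|x - y| ^ (1/2 + s)` and giving this
power to the weight. -/
lemma lintegral_lintegral_sub_mul_sq_le {S X Y : Set ℝ} (hX : X ⊆ S) (hY : Y ⊆ S) {s : ℝ}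
    (hs : 0 < s) {f : ℝ → ℝ} (hf : Measurable f) {w : ℝ → ℝ≥0∞} (hw : Measurable w) :
    (∫⁻ x in X, ∫⁻ y in Y, ‖f x - f y‖ₑ * w x) ^ 2 ≤
      slobodeckijSq1 S s f *
        ∫⁻ x in X, ∫⁻ y in Y, ENNReal.ofReal (|x - y| ^ (1 + 2 * s)) * w x ^ 2 := by
  set μ := (volume.restrict X).prod (volume.restrict Y) with hμ
  set p := 1 + 2 * s with hp
  have hp0 : 0 < p := by positivity
  have hsq : ∀ r : ℝ, (|r| ^ (p / 2)) ^ 2 = |r| ^ p := fun r => by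
    rw [← Real.rpow_natCast, ← Real.rpow_mul (abs_nonneg r)]; congr 1; push_cast; ring
  have hma : Measurable fun z : ℝ × ℝ => |f z.1 - f z.2| / |z.1 - z.2| ^ (p / 2) := by fun_prop
  have hmb : Measurable fun z : ℝ × ℝ => |z.1 - z.2| ^ (p / 2) := by fun_prop
  have h1 : ∫⁻ x in X, ∫⁻ y in Y, ‖f x - f y‖ₑ * w x
      ≤ ∫⁻ z, ENNReal.ofReal (|f z.1 - f z.2| / |z.1 - z.2| ^ (p / 2)) *
          (ENNReal.ofReal (|z.1 - z.2| ^ (p / 2)) * w z.1) ∂μ := by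
    rw [lintegral_prod _ (by fun_prop)]
    refine lintegral_mono fun x => lintegral_mono fun y => ?_
    simp only
    rw [← mul_assoc]
    gcongr
    rw [← ENNReal.ofReal_mul (by positivity), enorm_eq_ofReal_abs]
    refine ENNReal.ofReal_le_ofReal ?_
    rcases eq_or_ne x y with rfl | hxy
    · simp
    · have : 0 < |x - y| ^ (p / 2) := Real.rpow_pos_of_pos (abs_pos.2 (sub_ne_zero.2 hxy)) _
      rw [div_mul_cancel₀ _ this.ne']
  refine (ennreal_sq_le_sq h1).trans ((lintegral_mul_sq_le (by fun_prop) (by fun_prop)).trans ?_)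
  rw [lintegral_prod _ (by fun_prop), lintegral_prod _ (by fun_prop)]
  refine mul_le_mul' ?_ (le_of_eq ?_)
  · rw [slobodeckijSq1]
    refine (lintegral_mono_set hX).trans (lintegral_mono fun x => (lintegral_mono_set hY).trans ?_)
    refine lintegral_mono fun y => le_of_eq ?_
    simp only
    rw [← ENNReal.ofReal_pow (by positivity), div_pow, sq_abs, hsq]
  · refine lintegral_congr fun x => lintegral_congr fun y => ?_
    simp only
    rw [mul_pow, ← ENNReal.ofReal_pow (by positivity), hsq]

lemma volume_inter_ball_endpoint {α β e ρ : ℝ} (he : e = α ∨ e = β) (h0 : 0 < ρ)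
    (h1 : ρ ≤ β - α) : volume (Ioo α β ∩ Metric.ball e ρ) = ENNReal.ofReal ρ := by
  rw [Real.ball_eq_Ioo, Ioo_inter_Ioo, Real.volume_Ioo]
  rcases he with rfl | rfl
  · rw [max_eq_left (by linarith), min_eq_right (by linarith)]; congr 1; ring
  · rw [max_eq_right (by linarith), min_eq_left (by linarith)]; congr 1; ring

lemma lintegral_abs_rpow_lt_top {p : ℝ} (hp : -1 < p) :
    ∫⁻ x in Ioo (-1 : ℝ) 1, ENNReal.ofReal (|x| ^ p) < ⊤ := by
  have h1 : IntegrableOn (fun x : ℝ => x ^ p) (Ioo 0 1) :=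
    (intervalIntegral.integrableOn_Ioo_rpow_iff one_pos).2 hp
  have h2 : ∫⁻ x in Ioo (0 : ℝ) 1, ENNReal.ofReal (|x| ^ p) < ⊤ := by
    have := h1.lintegral_lt_top
    refine lt_of_le_of_lt (le_of_eq ?_) this
    refine setLIntegral_congr_fun measurableSet_Ioo fun x hx => ?_
    simp only [abs_of_pos hx.1]
  have h3 : ∫⁻ x in Ioo (-1 : ℝ) 0, ENNReal.ofReal (|x| ^ p) < ⊤ := by
    refine lt_of_le_of_lt (le_of_eq ?_) h2
    rw [← (Measure.measurePreserving_neg (volume : Measure ℝ)).setLIntegral_comp_preimage_emb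
      (MeasurableEquiv.neg ℝ).measurableEmbedding (fun x => ENNReal.ofReal (|x| ^ p))]
    simp
  have h4 : Ioo (-1 : ℝ) 1 ⊆ Ioo (-1) 0 ∪ {0} ∪ Ioo 0 1 := by
    intro x hx
    rcases lt_trichotomy x 0 with h | h | h
    · exact Or.inl (Or.inl ⟨hx.1, h⟩)
    · exact Or.inl (Or.inr h)
    · exact Or.inr ⟨h, hx.2⟩
  refine (lintegral_mono_set h4).trans_lt ?_
  refine (lintegral_union_le _ _ _).trans_lt (ENNReal.add_lt_top.2 ⟨?_, h2⟩)
  exact (lintegral_union_le _ _ _).trans_lt (ENNReal.add_lt_top.2 ⟨h3, by simp⟩)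

lemma lintegral_abs_sub_rpow_le {α β e p : ℝ} (he : e = α ∨ e = β) (hl : β - α ≤ 1) :
    ∫⁻ x in Ioo α β, ENNReal.ofReal (|x - e| ^ p) ≤
      ∫⁻ x in Ioo (-1 : ℝ) 1, ENNReal.ofReal (|x| ^ p) := by
  rw [← (measurePreserving_sub_right volume e).setLIntegral_comp_preimage_emb
    (MeasurableEquiv.subRight e).measurableEmbedding (fun x => ENNReal.ofReal (|x| ^ p))]
  refine lintegral_mono_set fun x hx => ?_
  simp only [mem_preimage, mem_Ioo]
  rcases he with rfl | rfl <;> constructor <;> linarith [hx.1, hx.2]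

/-- Both `t` and `x` are at most `t + x`. The bound separates the weight into a power of `t`, which
leaves the integral, and a power of `x` with an exponent of one's choice. -/
lemma inv_add_le_rpow_mul_rpow {t x a b : ℝ} (ht : 0 < t) (hx : 0 < x) (ha : 0 ≤ a) (hb : 0 ≤ b)
    (hab : a + b = 1) : (t + x)⁻¹ ≤ t ^ (-a) * x ^ (-b) := by
  rw [Real.rpow_neg ht.le, Real.rpow_neg hx.le, ← mul_inv]
  refine inv_anti₀ (by positivity) ?_
  calc t ^ a * x ^ b ≤ (t + x) ^ a * (t + x) ^ b := by
        gcongr <;> linarith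
    _ = t + x := by rw [← Real.rpow_add (by positivity), hab, Real.rpow_one]

/-- Where the weight is at most `ρ⁻¹` the `L²` norm is enough, because the interval has length at
most one. -/
lemma hardy_far {α β e t ρ : ℝ} (hl : β - α ≤ 1) (h0 : 0 < ρ)
    {f : ℝ → ℝ} (hf : Measurable f) {X : Set ℝ} (hX : X ⊆ Ioo α β) (hXm : MeasurableSet X)
    (hfar : ∀ x ∈ X, ρ ≤ t + |x - e|) :
    (∫⁻ y in X, ‖f y‖ₑ * ENNReal.ofReal (t + |y - e|)⁻¹) ^ 2 ≤
      ENNReal.ofReal ((ρ ^ 2)⁻¹) * ∫⁻ y in Ioo α β, ‖f y‖ₑ ^ 2 := by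
  have h1 : ∫⁻ y in X, ‖f y‖ₑ * ENNReal.ofReal (t + |y - e|)⁻¹ ≤
      ∫⁻ y in X, ENNReal.ofReal ρ⁻¹ * ‖f y‖ₑ := by
    refine setLIntegral_mono' hXm fun y hy => ?_
    rw [mul_comm]
    gcongr
    exact hfar y hy
  have hv : volume X ≤ 1 := by
    refine (measure_mono hX).trans ?_
    rw [Real.volume_Ioo]
    exact ENNReal.ofReal_le_one.2 hl
  refine (ennreal_sq_le_sq h1).trans ((sq_lintegral_le (by fun_prop)).trans ?_)
  rw [Measure.restrict_apply_univ]
  calc volume X * ∫⁻ y in X, (ENNReal.ofReal ρ⁻¹ * ‖f y‖ₑ) ^ 2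
      ≤ 1 * ∫⁻ y in Ioo α β, (ENNReal.ofReal ρ⁻¹ * ‖f y‖ₑ) ^ 2 := by gcongr
    _ = _ := by
      simp_rw [mul_pow, one_mul]
      rw [lintegral_const_mul _ (by fun_prop), ← ENNReal.ofReal_pow (by positivity), inv_pow]

/-- A Hardy type inequality on an interval, with a weight that is concentrated near an end point. -/
lemma exists_hardy_interval {s : ℝ} (h0 : 0 < s) (h1 : s ≤ 1) :
    ∃ C : ℝ≥0, ∀ (α β e t : ℝ) (f : ℝ → ℝ), Measurable f → (e = α ∨ e = β) → 0 < t → t < 1 →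
      β - α ≤ 1 → 1 - t ≤ β - α →
      (∫⁻ y in Ioo α β, ‖f y‖ₑ * ENNReal.ofReal (t + |y - e|)⁻¹) ^ 2 ≤
        C * ENNReal.ofReal (t ^ (s / 4 - 1)) *
          ((∫⁻ y in Ioo α β, ‖f y‖ₑ ^ 2) + slobodeckijSq1 (Ioo α β) s f) := by
  set J : ℝ → ℝ≥0∞ := fun p => ∫⁻ x in Ioo (-1 : ℝ) 1, ENNReal.ofReal (|x| ^ p) with hJ
  have hJ1 : J (-1 + s / 4) ≠ ⊤ := (lintegral_abs_rpow_lt_top (by linarith)).ne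
  have hJ2 : J (-(3 / 4)) ≠ ⊤ := (lintegral_abs_rpow_lt_top (by norm_num)).ne
  have hCt : 2 * (4 + 2 * (2 * J (-1 + s / 4) + 2 * J (-(3 / 4)) ^ 2)) ≠ ⊤ := by
    finiteness
  refine ⟨(2 * (4 + 2 * (2 * J (-1 + s / 4) + 2 * J (-(3 / 4)) ^ 2))).toNNReal,
    fun α β e t f hf he ht ht1 hl hl' => ?_⟩
  rw [ENNReal.coe_toNNReal hCt]
  set P := ∫⁻ y in Ioo α β, ‖f y‖ₑ ^ 2 with hP
  set N := slobodeckijSq1 (Ioo α β) s f with hN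
  set k := ENNReal.ofReal (t ^ (s / 4 - 1)) with hk
  have hpow : ∀ q : ℝ, s / 4 - 1 ≤ q → ENNReal.ofReal (t ^ q) ≤ k := fun q hq =>
    ENNReal.ofReal_le_ofReal (Real.rpow_le_rpow_of_exponent_ge ht ht1.le hq)
  -- For `t ≥ 1/2` the weight is at most 2. In the other case the interval is longer than `1/2`,
  -- which leaves room for the neighbourhood `X` of `e`.
  rcases le_or_gt (1 / 2) t with htt | htt
  · have := hardy_far (e := e) (t := t) (ρ := 1 / 2) hl (by norm_num) hf subset_rfl measurableSet_Ioo
      (fun x _ => by linarith [abs_nonneg (x - e)])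
    refine this.trans ?_
    have hk1 : 1 ≤ k := by
      refine le_trans ?_ (hpow 0 (by linarith))
      simp
    calc ENNReal.ofReal (((1 / 2 : ℝ) ^ 2)⁻¹) * P = 4 * 1 * P := by
          norm_num
      _ ≤ 2 * (4 + 2 * (2 * J (-1 + s / 4) + 2 * J (-(3 / 4)) ^ 2)) * k * (P + N) := by
          gcongr
          · rw [mul_add]
            refine le_trans ?_ le_self_add
            norm_num
          · exact le_self_add
  -- Near `e`, up to the distance `ρ`, the function is compared with its average. The radius has to
  -- be a positive power of `t`, so that the gain `ρ ^ (2 s)` beats the loss in the weight, but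
  -- `ρ⁻²` has to remain integrable in `t`. With the exponent `1/4` the far part, the average and
  -- the differences contribute `t ^ (-1/2)`, `t ^ (-3/4)` and `t ^ (s/4 - 1)`. The last of these
  -- dominates because `s ≤ 1`.
  set ρ := t ^ (1 / 4 : ℝ) / 2 with hρ
  have hρ0 : 0 < ρ := by positivity
  have hρ1 : ρ ≤ 1 / 2 := by
    rw [hρ]
    have : t ^ (1 / 4 : ℝ) ≤ 1 := Real.rpow_le_one ht.le ht1.le (by norm_num)
    linarith
  have h2ρ : 2 * ρ = t ^ (1 / 4 : ℝ) := by rw [hρ]; ring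
  set X := Ioo α β ∩ Metric.ball e ρ with hX
  have hXm : MeasurableSet X := measurableSet_Ioo.inter Metric.isOpen_ball.measurableSet
  have hXv : volume X = ENNReal.ofReal ρ := volume_inter_ball_endpoint he hρ0 (by linarith)
  set w : ℝ → ℝ≥0∞ := fun y => ENNReal.ofReal (t + |y - e|)⁻¹ with hw
  have hwm : Measurable w := by fun_prop
  have hXe : ∀ x ∈ X, 0 < |x - e| := by
    rintro x ⟨hx, -⟩
    refine abs_pos.2 (sub_ne_zero.2 ?_)
    rcases he with rfl | rfl
    · exact hx.1.ne'
    · exact hx.2.ne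
  have hXd : ∀ x ∈ X, |x - e| < ρ := fun x hx => by
    have := hx.2; rwa [Metric.mem_ball, Real.dist_eq] at this
  have hfar : (∫⁻ y in Ioo α β \ X, ‖f y‖ₑ * w y) ^ 2 ≤ 4 * k * P := by
    refine (hardy_far hl hρ0 hf sdiff_subset (measurableSet_Ioo.diff hXm) ?_).trans ?_
    · rintro x ⟨hx, hx'⟩
      have : ¬ |x - e| < ρ := fun h => hx' ⟨hx, by rwa [Metric.mem_ball, Real.dist_eq]⟩
      linarith
    · gcongr
      have : (ρ ^ 2)⁻¹ = 4 * t ^ (-(1 / 2) : ℝ) := by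
        rw [hρ, div_pow, ← Real.rpow_natCast, ← Real.rpow_mul ht.le, Real.rpow_neg ht.le]
        norm_num
        ring
      rw [this, ENNReal.ofReal_mul (by norm_num)]
      gcongr
      · norm_num
      · exact hpow _ (by linarith)
  -- Write `f x = (f x - f y) + f y` and integrate over `y ∈ X`; the factor `ρ` is the length of
  -- `X`.
  have hsplit : ENNReal.ofReal ρ * ∫⁻ x in X, ‖f x‖ₑ * w x ≤
      (∫⁻ x in X, ∫⁻ y in X, ‖f x - f y‖ₑ * w x) +
        (∫⁻ y in X, ‖f y‖ₑ) * ∫⁻ x in X, w x := by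
    rw [← hXv, ← lintegral_const_mul _ (by fun_prop), ← lintegral_const_mul _ (by fun_prop)]
    rw [← lintegral_add_right _ (by fun_prop)]
    refine lintegral_mono fun x => ?_
    rw [← lintegral_mul_const _ (by fun_prop), ← lintegral_add_right _ (by fun_prop)]
    calc volume X * (‖f x‖ₑ * w x) = ∫⁻ y in X, ‖f x‖ₑ * w x := by
          rw [setLIntegral_const, mul_comm]
      _ ≤ _ := by
          refine lintegral_mono fun y => ?_
          rw [← add_mul]
          gcongr
          calc ‖f x‖ₑ = ‖(f x - f y) + f y‖ₑ := by rw [sub_add_cancel]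
            _ ≤ _ := enorm_add_le _ _
  have hD : (∫⁻ x in X, ∫⁻ y in X, ‖f x - f y‖ₑ * w x) ^ 2 ≤
      N * (ENNReal.ofReal ((2 * ρ) ^ (1 + 2 * s) * ρ * t ^ (-1 - s / 4)) * J (-1 + s / 4)) := by
    refine (lintegral_lintegral_sub_mul_sq_le inter_subset_left inter_subset_left h0 hf hwm).trans ?_
    gcongr
    calc ∫⁻ x in X, ∫⁻ y in X, ENNReal.ofReal (|x - y| ^ (1 + 2 * s)) * w x ^ 2
        ≤ ∫⁻ x in X, ∫⁻ y in X, ENNReal.ofReal ((2 * ρ) ^ (1 + 2 * s)) *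
          ENNReal.ofReal (t ^ (-1 - s / 4) * |x - e| ^ (-1 + s / 4)) := by
          refine setLIntegral_mono' hXm fun x hx => setLIntegral_mono' hXm fun y hy => ?_
          gcongr
          · have h1 := hXd x hx
            have h2 := hXd y hy
            have : |x - y| ≤ |x - e| + |y - e| := by
              rw [abs_sub_comm y e]; exact abs_sub_le x e y
            linarith
          · rw [← ENNReal.ofReal_pow (by positivity)]
            refine ENNReal.ofReal_le_ofReal ?_
            -- After squaring, `|x - e|` appears with the exponent `-1 + s/4`, just integrable, and
            -- the loss in `t` is only slightly more than `t⁻¹`.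
            have := inv_add_le_rpow_mul_rpow ht (hXe x hx) (a := (1 + s / 4) / 2)
              (b := (1 - s / 4) / 2) (by linarith) (by linarith) (by ring)
            refine (pow_le_pow_left₀ (by positivity) this 2).trans (le_of_eq ?_)
            rw [mul_pow, ← Real.rpow_natCast, ← Real.rpow_natCast, ← Real.rpow_mul ht.le,
              ← Real.rpow_mul (abs_nonneg _)]
            congr 2 <;> (push_cast; ring)
      _ = ENNReal.ofReal ((2 * ρ) ^ (1 + 2 * s)) * ENNReal.ofReal ρ *
          ENNReal.ofReal (t ^ (-1 - s / 4)) * ∫⁻ x in X, ENNReal.ofReal (|x - e| ^ (-1 + s / 4)) := by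
          rw [← lintegral_const_mul _ (by fun_prop)]
          refine lintegral_congr fun x => ?_
          rw [setLIntegral_const, hXv, ENNReal.ofReal_mul (by positivity)]
          ring
      _ ≤ _ := by
          rw [ENNReal.ofReal_mul (by positivity), ENNReal.ofReal_mul (by positivity)]
          gcongr
          exact (lintegral_mono_set inter_subset_left).trans (lintegral_abs_sub_rpow_le he hl)
  have hE1 : (∫⁻ y in X, ‖f y‖ₑ) ^ 2 ≤ ENNReal.ofReal ρ * P := by
    refine (sq_lintegral_le (by fun_prop)).trans ?_
    rw [Measure.restrict_apply_univ, hXv]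
    exact mul_le_mul_right (lintegral_mono_set inter_subset_left) _
  have hE2 : ∫⁻ x in X, w x ≤ ENNReal.ofReal (t ^ (-(1 / 4) : ℝ)) * J (-(3 / 4)) := by
    calc ∫⁻ x in X, w x ≤ ∫⁻ x in X, ENNReal.ofReal (t ^ (-(1 / 4) : ℝ)) *
          ENNReal.ofReal (|x - e| ^ (-(3 / 4) : ℝ)) := by
          refine setLIntegral_mono' hXm fun x hx => ?_
          rw [← ENNReal.ofReal_mul (by positivity)]
          exact ENNReal.ofReal_le_ofReal (inv_add_le_rpow_mul_rpow ht (hXe x hx) (by norm_num)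
            (by norm_num) (by norm_num))
      _ ≤ _ := by
          rw [lintegral_const_mul _ (by fun_prop)]
          gcongr
          exact (lintegral_mono_set inter_subset_left).trans (lintegral_abs_sub_rpow_le he hl)
  have hnear : (∫⁻ x in X, ‖f x‖ₑ * w x) ^ 2 ≤
      2 * (2 * k * J (-1 + s / 4) * N + 2 * k * J (-(3 / 4)) ^ 2 * P) := by
    set A := ∫⁻ x in X, ‖f x‖ₑ * w x
    have hA : A ^ 2 = ENNReal.ofReal ((ρ ^ 2)⁻¹) * (ENNReal.ofReal ρ * A) ^ 2 := by
      rw [mul_pow, ← mul_assoc, ← ENNReal.ofReal_pow hρ0.le, ← ENNReal.ofReal_mul (by positivity),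
        inv_mul_cancel₀ (by positivity), ENNReal.ofReal_one, one_mul]
    rw [hA]
    refine (mul_le_mul_right ((ennreal_sq_le_sq hsplit).trans (ennreal_add_sq_le _ _)) _).trans ?_
    rw [mul_left_comm, mul_add]
    gcongr 2 * (?_ + ?_)
    · refine (mul_le_mul_right hD _).trans (le_of_eq ?_)
      rw [mul_left_comm, ← mul_assoc (ENNReal.ofReal _), ← ENNReal.ofReal_mul (by positivity), hk]
      have : (ρ ^ 2)⁻¹ * ((2 * ρ) ^ (1 + 2 * s) * ρ * t ^ (-1 - s / 4)) = 2 * t ^ (s / 4 - 1) := by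
        have : (2 * ρ) ^ (1 + 2 * s) = (2 * ρ) * t ^ (s / 2) := by
          rw [Real.rpow_add (by positivity), Real.rpow_one, h2ρ, ← Real.rpow_mul ht.le]
          congr 2; ring
        rw [this, show s / 4 - 1 = s / 2 + (-1 - s / 4) by ring, Real.rpow_add ht]
        field_simp
      rw [this, ENNReal.ofReal_mul (by norm_num)]
      simp only [ENNReal.ofReal_ofNat]
      ring
    · rw [mul_pow]
      refine (mul_le_mul_right (mul_le_mul' hE1 (ennreal_sq_le_sq hE2)) _).trans ?_
      rw [mul_pow, ← ENNReal.ofReal_pow (by positivity)]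
      calc ENNReal.ofReal (ρ ^ 2)⁻¹ * (ENNReal.ofReal ρ * P *
            (ENNReal.ofReal ((t ^ (-(1 / 4) : ℝ)) ^ 2) * J (-(3 / 4)) ^ 2))
          = ENNReal.ofReal ((ρ ^ 2)⁻¹ * ρ * (t ^ (-(1 / 4) : ℝ)) ^ 2) * J (-(3 / 4)) ^ 2 * P := by
            rw [ENNReal.ofReal_mul (by positivity), ENNReal.ofReal_mul (by positivity)]; ring
        _ = 2 * ENNReal.ofReal (t ^ (-(3 / 4) : ℝ)) * J (-(3 / 4)) ^ 2 * P := by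
            congr 2
            have : (ρ ^ 2)⁻¹ * ρ * (t ^ (-(1 / 4) : ℝ)) ^ 2 = 2 * t ^ (-(3 / 4) : ℝ) := by
              have h4 : (ρ ^ 2)⁻¹ * ρ = 2 * t ^ (-(1 / 4) : ℝ) := by
                rw [Real.rpow_neg ht.le, hρ]; field_simp
              rw [h4, ← Real.rpow_natCast, ← Real.rpow_mul ht.le, mul_assoc, ← Real.rpow_add ht]
              norm_num
            rw [this, ENNReal.ofReal_mul (by norm_num)]
            simp
        _ ≤ _ := by
            gcongr
            exact hpow _ (by linarith)
  calc (∫⁻ y in Ioo α β, ‖f y‖ₑ * w y) ^ 2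
      ≤ ((∫⁻ y in Ioo α β \ X, ‖f y‖ₑ * w y) + ∫⁻ y in X, ‖f y‖ₑ * w y) ^ 2 := by
        refine ennreal_sq_le_sq ?_
        refine le_trans (lintegral_mono_set ?_) (lintegral_union_le _ _ _)
        rw [sdiff_union_self]; exact subset_union_left
    _ ≤ 2 * (4 * k * P + 2 * (2 * k * J (-1 + s / 4) * N + 2 * k * J (-(3 / 4)) ^ 2 * P)) :=
        (ennreal_add_sq_le _ _).trans (by gcongr)
    _ ≤ 2 * (4 * k * (P + N) + 2 * (2 * k * J (-1 + s / 4) * (P + N) +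
          2 * k * J (-(3 / 4)) ^ 2 * (P + N))) := by
        gcongr
        · exact le_self_add
        · exact le_add_self
        · exact le_self_add
    _ = _ := by ring

/-- Compare the values on the half interval with those on the whole one. All distances are below `2
δ`, so the weighted Cauchy–Schwarz inequality bounds the difference of the averages by `δ ^ (s -
1/2)` times the seminorm, a positive power of `δ` precisely for `s > 1/2`. -/
lemma strip_average_halve {s δ e : ℝ} (h0 : 1 / 2 < s) (h1 : s ≤ 1) (hδ : 0 < δ) (hδ1 : δ ≤ 1)
    (he : e = 0 ∨ e = 1) {f : ℝ → ℝ} (hf : Measurable f) :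
    ENNReal.ofReal (2 / δ) * ∫⁻ y in Ioo 0 1 ∩ Metric.ball e (δ / 2), ‖f y‖ₑ ≤
      ENNReal.ofReal (1 / δ) * (∫⁻ y in Ioo 0 1 ∩ Metric.ball e δ, ‖f y‖ₑ) +
        ENNReal.ofReal (4 * δ ^ (s - 1 / 2)) * slobodeckijSq1 (Ioo 0 1) s f ^ (1 / 2 : ℝ) := by
  set X := Ioo 0 1 ∩ Metric.ball e (δ / 2) with hX
  set Y := Ioo 0 1 ∩ Metric.ball e δ with hY
  set N := slobodeckijSq1 (Ioo 0 1) s f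
  have hXm : MeasurableSet X := measurableSet_Ioo.inter Metric.isOpen_ball.measurableSet
  have hYm : MeasurableSet Y := measurableSet_Ioo.inter Metric.isOpen_ball.measurableSet
  have hXv : volume X = ENNReal.ofReal (δ / 2) :=
    volume_inter_ball_endpoint he (by linarith) (by linarith)
  have hYv : volume Y = ENNReal.ofReal δ := volume_inter_ball_endpoint he hδ (by linarith)
  set D := ∫⁻ x in X, ∫⁻ y in Y, ‖f x - f y‖ₑ * 1 with hD
  have hsplit : ENNReal.ofReal δ * ∫⁻ x in X, ‖f x‖ₑ ≤
      D + ENNReal.ofReal (δ / 2) * ∫⁻ y in Y, ‖f y‖ₑ := by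
    rw [← hXv, mul_comm (volume X), ← setLIntegral_const, ← hYv,
      ← lintegral_const_mul _ (by fun_prop), ← lintegral_add_right _ (by fun_prop)]
    refine lintegral_mono fun x => ?_
    rw [← lintegral_add_right _ (by fun_prop)]
    calc volume Y * ‖f x‖ₑ = ∫⁻ y in Y, ‖f x‖ₑ := by
          rw [setLIntegral_const, mul_comm]
      _ ≤ _ := by
          refine lintegral_mono fun y => ?_
          rw [mul_one]
          calc ‖f x‖ₑ = ‖(f x - f y) + f y‖ₑ := by rw [sub_add_cancel]
            _ ≤ _ := enorm_add_le _ _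
  have hDle : ENNReal.ofReal (2 / δ ^ 2) * D ≤
      ENNReal.ofReal (4 * δ ^ (s - 1 / 2)) * N ^ (1 / 2 : ℝ) := by
    refine ennreal_le_of_sq_le ?_
    rw [mul_pow, mul_pow, ennreal_rpow_half_sq, ← ENNReal.ofReal_pow (by positivity),
      ← ENNReal.ofReal_pow (by positivity)]
    have hD2 : D ^ 2 ≤ N * ENNReal.ofReal ((2 * δ) ^ (1 + 2 * s) * δ * (δ / 2)) := by
      refine (lintegral_lintegral_sub_mul_sq_le (S := Ioo 0 1) (s := s) inter_subset_left
        inter_subset_left (by linarith) hf measurable_const).trans ?_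
      refine mul_le_mul_right ?_ _
      calc ∫⁻ x in X, ∫⁻ y in Y, ENNReal.ofReal (|x - y| ^ (1 + 2 * s)) * 1 ^ 2
          ≤ ∫⁻ x in X, ∫⁻ y in Y, ENNReal.ofReal ((2 * δ) ^ (1 + 2 * s)) := by
            refine setLIntegral_mono' hXm fun x hx => setLIntegral_mono' hYm fun y hy => ?_
            rw [one_pow, mul_one]
            gcongr
            have h1 := hx.2
            have h2 := hy.2
            rw [Metric.mem_ball, Real.dist_eq] at h1 h2
            have : |x - y| ≤ |x - e| + |y - e| := by
              rw [abs_sub_comm y e]; exact abs_sub_le x e y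
            linarith
        _ = _ := by
            rw [setLIntegral_const, setLIntegral_const, hXv, hYv,
              ENNReal.ofReal_mul (by positivity), ENNReal.ofReal_mul (by positivity)]
    refine (mul_le_mul_right hD2 _).trans ?_
    rw [mul_left_comm, ← ENNReal.ofReal_mul (by positivity), mul_comm N]
    gcongr
    have e1 : (2 * δ) ^ (1 + 2 * s) = 2 ^ (1 + 2 * s) * (δ ^ 2 * δ ^ (2 * s - 1)) := by
      rw [Real.mul_rpow (by norm_num) hδ.le, ← Real.rpow_natCast, ← Real.rpow_add hδ]
      congr 2; push_cast; ring
    have e2 : (4 * δ ^ (s - 1 / 2)) ^ 2 = 16 * δ ^ (2 * s - 1) := by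
      rw [mul_pow, ← Real.rpow_natCast (δ ^ (s - 1 / 2)), ← Real.rpow_mul hδ.le]
      norm_num
      congr 1; ring
    have e3 : (2 : ℝ) ^ (1 + 2 * s) ≤ 8 :=
      calc (2 : ℝ) ^ (1 + 2 * s) ≤ 2 ^ (3 : ℝ) :=
            Real.rpow_le_rpow_of_exponent_le (by norm_num) (by linarith)
        _ = 8 := by norm_num
    rw [e1, e2]
    have e4 : 0 ≤ δ ^ (2 * s - 1) := by positivity
    have : (2 / δ ^ 2) ^ 2 * (2 ^ (1 + 2 * s) * (δ ^ 2 * δ ^ (2 * s - 1)) * δ * (δ / 2)) =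
        2 * 2 ^ (1 + 2 * s) * δ ^ (2 * s - 1) := by
      field_simp
    rw [this]
    nlinarith
  calc ENNReal.ofReal (2 / δ) * ∫⁻ y in X, ‖f y‖ₑ
      = ENNReal.ofReal (2 / δ ^ 2) * (ENNReal.ofReal δ * ∫⁻ y in X, ‖f y‖ₑ) := by
        rw [← mul_assoc, ← ENNReal.ofReal_mul (by positivity)]
        congr 2; field_simp
    _ ≤ ENNReal.ofReal (2 / δ ^ 2) * (D + ENNReal.ofReal (δ / 2) * ∫⁻ y in Y, ‖f y‖ₑ) := by gcongr
    _ = ENNReal.ofReal (1 / δ) * (∫⁻ y in Y, ‖f y‖ₑ) + ENNReal.ofReal (2 / δ ^ 2) * D := by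
        rw [mul_add, ← mul_assoc, ← ENNReal.ofReal_mul (by positivity), add_comm]
        congr 3; field_simp
    _ ≤ _ := by gcongr

/-- Averages over small intervals at an end point are controlled for `s > 1/2`. -/
lemma exists_strip_interval {s : ℝ} (h0 : 1 / 2 < s) (h1 : s ≤ 1) :
    ∃ C : ℝ≥0, ∀ (e : ℝ) (f : ℝ → ℝ) (n : ℕ), Measurable f → (e = 0 ∨ e = 1) →
      ENNReal.ofReal (2 ^ n) * ∫⁻ y in Ioo 0 1 ∩ Metric.ball e ((1 / 2) ^ n), ‖f y‖ₑ ≤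
        (∫⁻ y in Ioo 0 1, ‖f y‖ₑ) + C * slobodeckijSq1 (Ioo 0 1) s f ^ (1 / 2 : ℝ) := by
  -- The error of the `n`-th halving is `4 q ^ n` times the seminorm; `q < 1` is where `s > 1/2` is
  -- needed.
  set q : ℝ := (1 / 2) ^ (s - 1 / 2) with hq
  have hq0 : 0 < q := by positivity
  have hq1 : q < 1 := Real.rpow_lt_one (by norm_num) (by norm_num) (by linarith)
  refine ⟨(4 / (1 - q)).toNNReal, fun e f n hf he => ?_⟩
  have key : ENNReal.ofReal (2 ^ n) * ∫⁻ y in Ioo 0 1 ∩ Metric.ball e ((1 / 2) ^ n), ‖f y‖ₑ ≤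
        (∫⁻ y in Ioo 0 1, ‖f y‖ₑ) + ENNReal.ofReal (4 * ∑ i ∈ Finset.range n, q ^ i) *
          slobodeckijSq1 (Ioo 0 1) s f ^ (1 / 2 : ℝ) := by
    induction n with
    | zero =>
      simp only [pow_zero, ENNReal.ofReal_one, one_mul, Finset.range_zero, Finset.sum_empty,
        mul_zero, ENNReal.ofReal_zero, zero_mul, add_zero]
      exact lintegral_mono_set inter_subset_left
    | succ n ih =>
      have hst := strip_average_halve h0 h1 (δ := (1 / 2) ^ n) (by positivity)
        (pow_le_one₀ (by norm_num) (by norm_num)) he hf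
      have e1 : (2 : ℝ) / (1 / 2) ^ n = 2 ^ (n + 1) := by
        rw [one_div, inv_pow, pow_succ]; field_simp
      have e2 : (1 : ℝ) / (1 / 2) ^ n = 2 ^ n := by
        rw [one_div, one_div, inv_pow, inv_inv]
      have e3 : ((1 / 2 : ℝ) ^ n) ^ (s - 1 / 2) = q ^ n := by
        rw [hq, ← Real.rpow_natCast, ← Real.rpow_mul (by norm_num), mul_comm,
          Real.rpow_mul (by norm_num), Real.rpow_natCast]
      rw [e1, e2, e3, show (1 / 2 : ℝ) ^ n / 2 = (1 / 2) ^ (n + 1) by rw [pow_succ]; ring] at hst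
      refine hst.trans ((add_le_add_left ih _).trans (le_of_eq ?_))
      rw [add_assoc, ← add_mul, ← ENNReal.ofReal_add (by positivity) (by positivity), ← mul_add,
        ← Finset.sum_range_succ]
  refine key.trans ?_
  gcongr
  rw [show ((4 / (1 - q)).toNNReal : ℝ≥0∞) = ENNReal.ofReal (4 / (1 - q)) from rfl]
  refine ENNReal.ofReal_le_ofReal ?_
  rw [div_eq_mul_inv]
  gcongr
  rw [geom_sum_eq hq1.ne, ← neg_div_neg_eq, inv_eq_one_div]
  have : 0 < 1 - q := by linarith
  rw [neg_sub, neg_sub]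
  gcongr
  linarith [pow_pos hq0 n]

/-! ### The anisotropic seminorms are bounded by the isotropic one on the square -/

/-- The set consists of two half-lines. Each contributes `c ^ (-2 - 2 s) / (2 + 2 s)`, and `2 / (2 +
2 s) ≤ 1`. -/
lemma lintegral_far_rpow_le {s : ℝ} (h0 : 0 < s) {r c : ℝ} (hc : 0 < c) :
    ∫⁻ y in {y : ℝ | c ≤ |r - y|}, ENNReal.ofReal (|r - y| ^ (-3 - 2 * s)) ≤
      ENNReal.ofReal (c ^ (-2 - 2 * s)) := by
  have hint : ∫⁻ x in Ioi c, ENNReal.ofReal (x ^ (-3 - 2 * s)) =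
      ENNReal.ofReal (c ^ (-2 - 2 * s) / (2 + 2 * s)) := by
    rw [← ofReal_integral_eq_lintegral_ofReal (integrableOn_Ioi_rpow_of_lt (by linarith) hc)
      (ae_restrict_of_forall_mem measurableSet_Ioi fun x hx =>
        Real.rpow_nonneg (hc.le.trans (le_of_lt hx)) _), integral_Ioi_rpow_of_lt (by linarith) hc]
    congr 1
    rw [show -3 - 2 * s + 1 = -(2 + 2 * s) by ring, show -2 - 2 * s = -(2 + 2 * s) by ring,
      neg_div_neg_eq]
  have hIci : ∫⁻ x in Ici c, ENNReal.ofReal (x ^ (-3 - 2 * s)) =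
      ENNReal.ofReal (c ^ (-2 - 2 * s) / (2 + 2 * s)) := by
    rw [← hint]; exact setLIntegral_congr Ioi_ae_eq_Ici.symm
  have hset : {y : ℝ | c ≤ |r - y|} ⊆
      (fun y => r - y) ⁻¹' Ici c ∪ (fun y => y - r) ⁻¹' Ici c := by
    intro y hy
    have hy' : c ≤ |r - y| := hy
    rcases le_abs.1 hy' with h | h
    · exact Or.inl h
    · exact Or.inr (show c ≤ y - r by linarith)
  refine (lintegral_mono_set hset).trans ((lintegral_union_le _ _ _).trans ?_)
  have h1 : ∫⁻ y in (fun y => r - y) ⁻¹' Ici c, ENNReal.ofReal (|r - y| ^ (-3 - 2 * s)) =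
      ENNReal.ofReal (c ^ (-2 - 2 * s) / (2 + 2 * s)) := by
    rw [← hIci, ← (Measure.measurePreserving_sub_left volume r).setLIntegral_comp_preimage_emb
      (MeasurableEquiv.subLeft r).measurableEmbedding (fun x => ENNReal.ofReal (x ^ (-3 - 2 * s)))]
    refine setLIntegral_congr_fun (measurableSet_Ici.preimage (by fun_prop)) fun y hy => ?_
    rw [abs_of_nonneg (hc.le.trans hy)]
  have h2 : ∫⁻ y in (fun y => y - r) ⁻¹' Ici c, ENNReal.ofReal (|r - y| ^ (-3 - 2 * s)) =
      ENNReal.ofReal (c ^ (-2 - 2 * s) / (2 + 2 * s)) := by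
    rw [← hIci, ← (measurePreserving_sub_right volume r).setLIntegral_comp_preimage_emb
      (MeasurableEquiv.subRight r).measurableEmbedding (fun x => ENNReal.ofReal (x ^ (-3 - 2 * s)))]
    refine setLIntegral_congr_fun (measurableSet_Ici.preimage (by fun_prop)) fun y hy => ?_
    rw [abs_sub_comm, abs_of_nonneg (hc.le.trans hy)]
  rw [h1, h2, ← ENNReal.ofReal_add (by positivity) (by positivity)]
  refine ENNReal.ofReal_le_ofReal ?_
  have : 0 ≤ c ^ (-2 - 2 * s) := by positivity
  rw [← add_div, div_le_iff₀ (by linarith)]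
  nlinarith

lemma le_volume_inter_Ioo {t h : ℝ} (ht : t ∈ Ioo (0 : ℝ) 1) (h0 : 0 < h) (h1 : h ≤ 1) :
    ENNReal.ofReal h ≤ volume (Ioo 0 1 ∩ Ioo (t - h) (t + h)) := by
  rw [Ioo_inter_Ioo, Real.volume_Ioo]
  refine ENNReal.ofReal_le_ofReal ?_
  rcases max_cases 0 (t - h) with ⟨h2, _⟩ | ⟨h2, _⟩ <;>
    rcases min_cases 1 (t + h) with ⟨h3, _⟩ | ⟨h3, _⟩ <;>
    rw [h2, h3] <;> linarith [ht.1, ht.2]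

/-- The kernel that arises from inserting an intermediate point. -/
def bridgeKernel (j : Fin 2) (s : ℝ) (v : ℝ × ℝ → ℝ) (t r r' : ℝ) : ℝ≥0∞ :=
  ENNReal.ofReal (2 * |r - r'| ^ (-3 - 2 * s)) *
    ∫⁻ z in {z ∈ refSquare | eucl (pt j r t) z ≤ 2 * |r - r'|}, ‖v (pt j r t) - v z‖ₑ ^ 2

lemma eucl_pt_le (j : Fin 2) (r t a b : ℝ) : eucl (pt j r t) (pt j a b) ≤ |r - a| + |t - b| := by
  refine (eucl_le _ _).trans (le_of_eq ?_)
  unfold pt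
  split_ifs <;> simp [add_comm]

/-- A difference along a line is invisible to a double integral over the plane. Hence an
intermediate point `z` is inserted and averaged over a set of area at least `h²`, where `h = |r -
r'|`, all of whose points are within `2 h` of both end points. -/
lemma kernel_le_bridgeKernel (j : Fin 2) {s t r r' : ℝ} {v : ℝ × ℝ → ℝ}
    (hv : Measurable v) (ht : t ∈ Ioo (0 : ℝ) 1) (hr : r ∈ Ioo (0 : ℝ) 1)
    (hr' : r' ∈ Ioo (0 : ℝ) 1) :
    ENNReal.ofReal ((v (pt j r t) - v (pt j r' t)) ^ 2 / |r - r'| ^ (1 + 2 * s)) ≤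
      bridgeKernel j s v t r r' + bridgeKernel j s v t r' r := by
  rcases eq_or_ne r r' with rfl | hne
  · simp
  set h := |r - r'| with hh
  have h0 : 0 < h := abs_pos.2 (sub_ne_zero.2 hne)
  have h1 : h ≤ 1 := abs_le.2 ⟨by linarith [hr.1, hr'.2], by linarith [hr.2, hr'.1]⟩
  -- The box between `r` and `r'`, of half-width `h` in the other variable. Only this transverse
  -- window can leave the square, and by `le_volume_inter_Ioo` at least the length `h` of it
  -- remains.
  set Z : Set (ℝ × ℝ) := (fun p : ℝ × ℝ => pt j p.2 p.1) ''
    ((Ioo 0 1 ∩ Ioo (t - h) (t + h)) ×ˢ Ioo (min r r') (max r r')) with hZ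
  have hZm : MeasurableSet Z := (measurableEmbedding_pt j).measurableSet_image.2
    ((measurableSet_Ioo.inter measurableSet_Ioo).prod measurableSet_Ioo)
  have hZv : ENNReal.ofReal (h * h) ≤ volume Z := by
    have : volume Z = volume ((Ioo 0 1 ∩ Ioo (t - h) (t + h)) ×ˢ Ioo (min r r') (max r r')) := by
      rw [← (measurePreserving_pt j).measure_preimage_emb (measurableEmbedding_pt j),
        hZ, preimage_image_eq _ (measurableEmbedding_pt j).injective]
    rw [this, Measure.volume_eq_prod, Measure.prod_prod, Real.volume_Ioo, max_sub_min_eq_abs',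
      ENNReal.ofReal_mul h0.le]
    gcongr
    exact le_volume_inter_Ioo ht h0 h1
  have hZs : ∀ z ∈ Z, z ∈ refSquare ∧ eucl (pt j r t) z ≤ 2 * h ∧ eucl (pt j r' t) z ≤ 2 * h := by
    rintro _ ⟨⟨b, a⟩, ⟨⟨hb1, hb2⟩, ha⟩, rfl⟩
    simp only at *
    have hmin : 0 < min r r' := lt_min hr.1 hr'.1
    have hmax : max r r' < 1 := max_lt hr.2 hr'.2
    have htb : |t - b| ≤ h := abs_le.2 ⟨by linarith [hb2.2], by linarith [hb2.1]⟩
    have hra : |r - a| ≤ h ∧ |r' - a| ≤ h := by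
      rcases le_total r r' with hle | hle
      · rw [min_eq_left hle, max_eq_right hle] at ha
        have e1 : h = r' - r := by rw [hh, abs_sub_comm, abs_of_nonneg (by linarith)]
        exact ⟨abs_le.2 ⟨by linarith [ha.2], by linarith [ha.1]⟩,
          abs_le.2 ⟨by linarith [ha.2], by linarith [ha.1]⟩⟩
      · rw [min_eq_right hle, max_eq_left hle] at ha
        have e1 : h = r - r' := by rw [hh, abs_of_nonneg (by linarith)]
        exact ⟨abs_le.2 ⟨by linarith [ha.2], by linarith [ha.1]⟩,
          abs_le.2 ⟨by linarith [ha.2], by linarith [ha.1]⟩⟩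
    refine ⟨mem_refSquare_pt.2 ⟨⟨by linarith [ha.1], by linarith [ha.2]⟩, hb1⟩, ?_, ?_⟩
    · linarith [eucl_pt_le j r t a b]
    · linarith [eucl_pt_le j r' t a b]
  set x := pt j r t with hx
  set y := pt j r' t with hy
  have hmain : ENNReal.ofReal (h * h) * ‖v x - v y‖ₑ ^ 2 ≤
      2 * ((∫⁻ z in Z, ‖v x - v z‖ₑ ^ 2) + ∫⁻ z in Z, ‖v y - v z‖ₑ ^ 2) := by
    calc ENNReal.ofReal (h * h) * ‖v x - v y‖ₑ ^ 2 ≤ volume Z * ‖v x - v y‖ₑ ^ 2 := by gcongr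
      _ = ∫⁻ z in Z, ‖v x - v y‖ₑ ^ 2 := by rw [setLIntegral_const, mul_comm]
      _ ≤ ∫⁻ z in Z, 2 * (‖v x - v z‖ₑ ^ 2 + ‖v y - v z‖ₑ ^ 2) := by
          refine lintegral_mono fun z => ?_
          refine le_trans (ennreal_sq_le_sq ?_) (ennreal_add_sq_le _ _)
          calc ‖v x - v y‖ₑ = ‖(v x - v z) - (v y - v z)‖ₑ := by congr 1; ring
            _ ≤ _ := enorm_sub_le
      _ = _ := by rw [lintegral_const_mul _ (by fun_prop), lintegral_add_left (by fun_prop)]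
  have hk : ENNReal.ofReal ((v x - v y) ^ 2 / h ^ (1 + 2 * s)) =
      ENNReal.ofReal (h ^ (-3 - 2 * s)) * (ENNReal.ofReal (h * h) * ‖v x - v y‖ₑ ^ 2) := by
    rw [enorm_sq_eq, ← ENNReal.ofReal_mul (by positivity), ← ENNReal.ofReal_mul (by positivity)]
    congr 1
    rw [← mul_assoc, div_eq_mul_inv, ← Real.rpow_neg h0.le, mul_comm]
    congr 1
    rw [← sq, ← Real.rpow_natCast, ← Real.rpow_add h0]
    congr 1; push_cast; ring
  rw [hk]
  refine (mul_le_mul_right hmain _).trans ?_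
  unfold bridgeKernel
  rw [abs_sub_comm r' r, ← hh, ← mul_add, ENNReal.ofReal_mul (by norm_num), ← mul_assoc,
    mul_comm (ENNReal.ofReal _) 2]
  simp only [ENNReal.ofReal_ofNat]
  gcongr
  · exact fun z hz => ⟨(hZs z hz).1, (hZs z hz).2.1⟩
  · exact fun z hz => ⟨(hZs z hz).1, (hZs z hz).2.2⟩

lemma measurable_bridgeKernel (j : Fin 2) (s : ℝ) {v : ℝ × ℝ → ℝ} (hv : Measurable v) :
    Measurable fun p : ℝ × ℝ × ℝ => bridgeKernel j s v p.1 p.2.1 p.2.2 := by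
  unfold bridgeKernel
  refine Measurable.mul (by fun_prop) ?_
  have hpt : Measurable fun p : ℝ × ℝ × ℝ => pt j p.2.1 p.1 := by
    unfold pt; split_ifs <;> fun_prop
  have : ∀ p : ℝ × ℝ × ℝ, (∫⁻ z in {z ∈ refSquare | eucl (pt j p.2.1 p.1) z ≤
      2 * |p.2.1 - p.2.2|}, ‖v (pt j p.2.1 p.1) - v z‖ₑ ^ 2) =
      ∫⁻ z, indicator {q : (ℝ × ℝ × ℝ) × ℝ × ℝ | q.2 ∈ refSquare ∧
        eucl (pt j q.1.2.1 q.1.1) q.2 ≤ 2 * |q.1.2.1 - q.1.2.2|}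
        (fun q => ‖v (pt j q.1.2.1 q.1.1) - v q.2‖ₑ ^ 2) (p, z) := by
    intro p
    rw [← lintegral_indicator]
    · rfl
    · have h1 : Measurable (eucl (pt j p.2.1 p.1)) :=
        measurable_eucl.comp (measurable_prodMk_left (x := pt j p.2.1 p.1))
      have h2 : MeasurableSet {z | eucl (pt j p.2.1 p.1) z ≤ 2 * |p.2.1 - p.2.2|} :=
        measurableSet_le h1 measurable_const
      exact isOpen_refSquare.measurableSet.inter h2
  simp_rw [this]
  refine Measurable.lintegral_prod_right' (f := indicator _ _) ?_
  refine Measurable.indicator ?_ ?_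
  · exact (((hv.comp (hpt.comp measurable_fst)).sub (hv.comp measurable_snd)).enorm).pow_const 2
  · have h1 : Measurable fun q : (ℝ × ℝ × ℝ) × ℝ × ℝ => eucl (pt j q.1.2.1 q.1.1) q.2 :=
      measurable_eucl.comp ((hpt.comp measurable_fst).prodMk measurable_snd)
    have h2 : MeasurableSet {q : (ℝ × ℝ × ℝ) × ℝ × ℝ |
        eucl (pt j q.1.2.1 q.1.1) q.2 ≤ 2 * |q.1.2.1 - q.1.2.2|} :=
      measurableSet_le h1 (by fun_prop)
    exact (isOpen_refSquare.measurableSet.preimage measurable_snd).inter h2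

/-- By Tonelli the integral in `r'` is done first, for fixed `z`. The constraint reads `|r - r'| ≥
|x - z| / 2`, and integrating `|r - r'| ^ (-3 - 2 s)` over this range gives the plane kernel `|x -
z| ^ (-2 - 2 s)`. The constant is `32 = 2 · 2⁴`, since `2 + 2 s ≤ 4`. -/
lemma lintegral_bridgeKernel_le (j : Fin 2) {s : ℝ} (h0 : 0 < s) (h1 : s ≤ 1)
    {v : ℝ × ℝ → ℝ} (hv : Measurable v) {t r : ℝ} :
    ∫⁻ r' in Ioo (0 : ℝ) 1, bridgeKernel j s v t r r' ≤
      32 * ∫⁻ z in refSquare, ENNReal.ofReal ((v (pt j r t) - v z) ^ 2 /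
        eucl (pt j r t) z ^ (2 + 2 * s)) := by
  set x := pt j r t with hx
  have hmm : Measurable fun p : ℝ × ℝ × ℝ => eucl x p.2 :=
    measurable_eucl.comp (measurable_const.prodMk measurable_snd)
  have hm2 : Measurable fun p : ℝ × ℝ × ℝ =>
      indicator {p : ℝ × ℝ × ℝ | eucl x p.2 ≤ 2 * |r - p.1|}
      (fun p => ENNReal.ofReal (2 * |r - p.1| ^ (-3 - 2 * s)) * ‖v x - v p.2‖ₑ ^ 2) p := by
    refine Measurable.indicator (by fun_prop) (measurableSet_le hmm (by fun_prop))
  calc ∫⁻ r' in Ioo (0 : ℝ) 1, bridgeKernel j s v t r r'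
      = ∫⁻ r' in Ioo (0 : ℝ) 1, ∫⁻ z in refSquare,
          indicator {p : ℝ × ℝ × ℝ | eucl x p.2 ≤ 2 * |r - p.1|}
          (fun p => ENNReal.ofReal (2 * |r - p.1| ^ (-3 - 2 * s)) * ‖v x - v p.2‖ₑ ^ 2) (r', z) := by
        refine lintegral_congr fun r' => ?_
        have hms : MeasurableSet {z | eucl x z ≤ 2 * |r - r'|} :=
          measurableSet_le (measurable_eucl.comp (measurable_prodMk_left (x := x)))
            measurable_const
        rw [bridgeKernel, ← lintegral_const_mul _ (by fun_prop),
          show {z | z ∈ refSquare ∧ eucl (pt j r t) z ≤ 2 * |r - r'|} =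
            {z | eucl x z ≤ 2 * |r - r'|} ∩ refSquare from inter_comm _ _,
          ← Measure.restrict_restrict hms, ← lintegral_indicator hms]
        rfl
    _ = ∫⁻ z in refSquare, ∫⁻ r' in Ioo (0 : ℝ) 1,
          indicator {p : ℝ × ℝ × ℝ | eucl x p.2 ≤ 2 * |r - p.1|}
          (fun p => ENNReal.ofReal (2 * |r - p.1| ^ (-3 - 2 * s)) * ‖v x - v p.2‖ₑ ^ 2) (r', z) :=
        lintegral_lintegral_swap hm2.aemeasurable
    _ ≤ ∫⁻ z in refSquare, 32 * ENNReal.ofReal ((v x - v z) ^ 2 / eucl x z ^ (2 + 2 * s)) := by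
        refine lintegral_mono fun z => ?_
        -- For `z = x` the far range is everything and the power is not integrable, but then `v x -
        -- v z = 0`.
        rcases (eucl_nonneg x z).eq_or_lt with he | he
        · have : x = z := eucl_eq_zero he.symm
          refine le_trans (le_of_eq ?_) zero_le
          refine (lintegral_congr fun r' => ?_).trans lintegral_zero
          rw [this]
          simp [indicator]
        · have hms : MeasurableSet {r' : ℝ | eucl x z / 2 ≤ |r - r'|} :=
            measurableSet_le measurable_const (by fun_prop)
          calc _ ≤ ∫⁻ r', indicator {p : ℝ × ℝ × ℝ | eucl x p.2 ≤ 2 * |r - p.1|}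
                (fun p => ENNReal.ofReal (2 * |r - p.1| ^ (-3 - 2 * s)) * ‖v x - v p.2‖ₑ ^ 2)
                (r', z) := setLIntegral_le_lintegral _ _
            _ = ∫⁻ r' in {r' : ℝ | eucl x z / 2 ≤ |r - r'|},
                2 * ‖v x - v z‖ₑ ^ 2 * ENNReal.ofReal (|r - r'| ^ (-3 - 2 * s)) := by
                rw [← lintegral_indicator hms]
                refine lintegral_congr fun r' => ?_
                simp only [indicator, mem_ofPred_eq]
                have : eucl x z ≤ 2 * |r - r'| ↔ eucl x z / 2 ≤ |r - r'| := by
                  rw [div_le_iff₀ (by norm_num), mul_comm]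
                simp only [this]
                split_ifs
                · rw [ENNReal.ofReal_mul (by norm_num)]
                  simp only [ENNReal.ofReal_ofNat]; ring
                · rfl
            _ ≤ 2 * ‖v x - v z‖ₑ ^ 2 * ENNReal.ofReal ((eucl x z / 2) ^ (-2 - 2 * s)) := by
                rw [lintegral_const_mul _ (by fun_prop)]
                gcongr
                exact lintegral_far_rpow_le h0 (by linarith)
            _ ≤ _ := by
                have e1 : (eucl x z / 2) ^ (-2 - 2 * s) ≤ 16 * (eucl x z ^ (2 + 2 * s))⁻¹ := by
                  rw [show -2 - 2 * s = -(2 + 2 * s) by ring, Real.rpow_neg (by positivity),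
                    Real.div_rpow he.le (by norm_num), inv_div, div_eq_mul_inv]
                  gcongr
                  calc (2 : ℝ) ^ (2 + 2 * s) ≤ 2 ^ (4 : ℝ) :=
                        Real.rpow_le_rpow_of_exponent_le (by norm_num) (by linarith)
                    _ = 16 := by norm_num
                rw [enorm_sq_eq, mul_assoc, ← ENNReal.ofReal_mul (by positivity),
                  show (32 : ℝ≥0∞) = 2 * ENNReal.ofReal 16 by norm_num, mul_assoc,
                  ← ENNReal.ofReal_mul (by norm_num)]
                refine mul_le_mul_right (ENNReal.ofReal_le_ofReal ?_) _
                refine (mul_le_mul_of_nonneg_left e1 (sq_nonneg _)).trans (le_of_eq ?_)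
                ring
    _ = _ := lintegral_const_mul' _ _ (by simp)

lemma measurable_kernel {s : ℝ} {v : ℝ × ℝ → ℝ} (hv : Measurable v) :
    Measurable fun p : (ℝ × ℝ) × (ℝ × ℝ) =>
      ENNReal.ofReal ((v p.1 - v p.2) ^ 2 / eucl p.1 p.2 ^ (2 + 2 * s)) := by
  fun_prop

/-- On the square, the anisotropic seminorms are bounded by the Slobodeckij seminorm. -/
lemma anisoSq_le_slobSq (j : Fin 2) {s : ℝ} (h0 : 0 < s) (h1 : s ≤ 1) {v : ℝ × ℝ → ℝ}
    (hv : Measurable v) : anisoSq refSquare s j v ≤ 64 * slobSq refSquare s v := by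
  obtain ⟨B, hB, hBk, hBi⟩ : ∃ B : ℝ → ℝ → ℝ → ℝ≥0∞,
      (Measurable fun p : ℝ × ℝ × ℝ => B p.1 p.2.1 p.2.2) ∧
      (∀ t ∈ Ioo (0 : ℝ) 1, ∀ r ∈ Ioo (0 : ℝ) 1, ∀ r' ∈ Ioo (0 : ℝ) 1,
        ENNReal.ofReal ((v (pt j r t) - v (pt j r' t)) ^ 2 / |r - r'| ^ (1 + 2 * s)) ≤
          B t r r' + B t r' r) ∧
      ∀ t r, ∫⁻ r' in Ioo (0 : ℝ) 1, B t r r' ≤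
        32 * ∫⁻ z in refSquare, ENNReal.ofReal ((v (pt j r t) - v z) ^ 2 /
          eucl (pt j r t) z ^ (2 + 2 * s)) :=
    ⟨bridgeKernel j s v, measurable_bridgeKernel j s hv,
      fun t ht r hr r' hr' => kernel_le_bridgeKernel j hv ht hr hr',
      fun t r => lintegral_bridgeKernel_le j h0 h1 hv⟩
  have hstep : ∫⁻ t in Ioo (0 : ℝ) 1, ∫⁻ r in Ioo (0 : ℝ) 1, ∫⁻ r' in Ioo (0 : ℝ) 1,
      B t r r' ≤ 32 * slobSq refSquare s v := by
    rw [slobSq, lintegral_sections isOpen_refSquare.measurableSet subset_rfl j,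
      ← lintegral_const_mul' _ _ (by simp)]
    · refine setLIntegral_mono' measurableSet_Ioo fun t ht => ?_
      rw [refSquare_section j ht, ← lintegral_const_mul' _ _ (by simp)]
      exact lintegral_mono fun r => hBi t r
    · exact Measurable.lintegral_prod_right' (f := fun p : (ℝ × ℝ) × (ℝ × ℝ) =>
        ENNReal.ofReal ((v p.1 - v p.2) ^ 2 / eucl p.1 p.2 ^ (2 + 2 * s))) (measurable_kernel hv)
  calc anisoSq refSquare s j v
      ≤ ∫⁻ t in Ioo (0 : ℝ) 1, ((∫⁻ r in Ioo (0 : ℝ) 1, ∫⁻ r' in Ioo (0 : ℝ) 1,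
          B t r r') + ∫⁻ r in Ioo (0 : ℝ) 1, ∫⁻ r' in Ioo (0 : ℝ) 1,
          B t r' r) := by
        refine setLIntegral_mono' measurableSet_Ioo fun t ht => ?_
        have hBt : Measurable fun p : ℝ × ℝ => B t p.1 p.2 :=
          hB.comp (f := fun p : ℝ × ℝ => (t, p.1, p.2)) (by fun_prop)
        rw [slobodeckijSq1, refSquare_section j ht]
        refine le_trans ?_ (lintegral_add_left hBt.lintegral_prod_right' _).le
        refine setLIntegral_mono' measurableSet_Ioo fun r hr => ?_
        refine le_trans ?_ (lintegral_add_left (hBt.comp (measurable_prodMk_left (x := r))) _).le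
        exact setLIntegral_mono' measurableSet_Ioo fun r' hr' =>
          hBk t ht r hr r' hr'
    _ = 2 * ∫⁻ t in Ioo (0 : ℝ) 1, ∫⁻ r in Ioo (0 : ℝ) 1, ∫⁻ r' in Ioo (0 : ℝ) 1,
          B t r r' := by
        rw [← lintegral_const_mul' _ _ (by simp)]
        refine lintegral_congr fun t => ?_
        have hBt : Measurable fun p : ℝ × ℝ => B t p.2 p.1 :=
          hB.comp (f := fun p : ℝ × ℝ => (t, p.2, p.1)) (by fun_prop)
        rw [lintegral_lintegral_swap (f := fun r r' => B t r' r)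
          hBt.aemeasurable, two_mul]
    _ ≤ 2 * (32 * slobSq refSquare s v) := by gcongr
    _ = _ := by rw [← mul_assoc]; norm_num

/-! ### Weighted estimates on sections -/

lemma measurable_section_slobodeckijSq1 {K : Set (ℝ × ℝ)} (hK : MeasurableSet K) (j : Fin 2)
    (s : ℝ) {v : ℝ × ℝ → ℝ} (hv : Measurable v) :
    Measurable fun t => slobodeckijSq1 {r | pt j r t ∈ K} s (fun r => v (pt j r t)) := by
  have h1 : Measurable fun p : (ℝ × ℝ) × ℝ => pt j p.1.2 p.1.1 :=
    (measurable_pt j).comp measurable_fst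
  have h2 : Measurable fun p : (ℝ × ℝ) × ℝ => pt j p.2 p.1.1 :=
    (measurable_pt j).comp (measurable_fst.fst.prodMk measurable_snd)
  have : ∀ t, slobodeckijSq1 {r | pt j r t ∈ K} s (fun r => v (pt j r t)) =
      ∫⁻ r, ∫⁻ r', indicator ((fun p : (ℝ × ℝ) × ℝ => pt j p.1.2 p.1.1) ⁻¹' K ∩
          (fun p : (ℝ × ℝ) × ℝ => pt j p.2 p.1.1) ⁻¹' K)
        (fun p => ENNReal.ofReal ((v (pt j p.1.2 p.1.1) - v (pt j p.2 p.1.1)) ^ 2 /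
          |p.1.2 - p.2| ^ (1 + 2 * s))) ((t, r), r') := by
    intro t
    have hm := measurableSet_section hK j t
    rw [slobodeckijSq1, ← lintegral_indicator hm]
    refine lintegral_congr fun r => ?_
    by_cases hr : pt j r t ∈ K
    · rw [indicator_of_mem (show r ∈ {r | pt j r t ∈ K} from hr), ← lintegral_indicator hm]
      refine lintegral_congr fun r' => ?_
      by_cases hr' : pt j r' t ∈ K
      · rw [indicator_of_mem (show r' ∈ {r | pt j r t ∈ K} from hr'), indicator_of_mem]
        exact ⟨hr, hr'⟩
      · rw [indicator_of_notMem (show r' ∉ {r | pt j r t ∈ K} from hr'), indicator_of_notMem]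
        exact fun h => hr' h.2
    · rw [indicator_of_notMem (show r ∉ {r | pt j r t ∈ K} from hr)]
      refine (lintegral_zero.symm.trans (lintegral_congr fun r' => ?_))
      rw [indicator_of_notMem]
      exact fun h => hr h.1
  simp_rw [this]
  refine Measurable.lintegral_prod_right' (f := fun p : ℝ × ℝ => ∫⁻ r', indicator _ _ (p, r')) ?_
  refine Measurable.lintegral_prod_right' (f := indicator _ _) ?_
  refine Measurable.indicator ?_ ((h1 hK).inter (h2 hK))
  have h3 := hv.comp h1
  have h4 := hv.comp h2
  simp only [Function.comp_def] at h3 h4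
  fun_prop

lemma measurable_section_lintegral {K : Set (ℝ × ℝ)} (hK : MeasurableSet K) (j : Fin 2)
    {F : ℝ × ℝ → ℝ≥0∞} (hF : Measurable F) :
    Measurable fun t => ∫⁻ r in {r | pt j r t ∈ K}, F (pt j r t) := by
  have : ∀ t, ∫⁻ r in {r | pt j r t ∈ K}, F (pt j r t) =
      ∫⁻ r, (K.indicator F ∘ fun p : ℝ × ℝ => pt j p.2 p.1) (t, r) := by
    intro t
    rw [← lintegral_indicator (measurableSet_section hK j t)]
    rfl
  simp_rw [this]
  exact ((hF.indicator hK).comp (measurable_pt j)).lintegral_prod_right'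

/-- On the section at height `t` the weight is at most `2 / (τ t + |r - e t|)`, where `τ` measures
the height relative to that of the corner. The one-dimensional inequality bounds the integral over
the section by `τ ^ ((s/4 - 1) / 2)` times the norm there. This factor is square integrable, so
Cauchy–Schwarz in `t` concludes. Only differences along sections enter, hence the anisotropic
seminorm. -/
lemma exists_hardy_sections {s : ℝ} (h0 : 0 < s) (h1 : s ≤ 1) :
    ∃ C : ℝ≥0, ∀ (K : Set (ℝ × ℝ)) (j : Fin 2) (α β e τ : ℝ → ℝ) (a : ℝ × ℝ) (v : ℝ × ℝ → ℝ),
      MeasurableSet K → K ⊆ refSquare → Measurable v →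
      (∀ t ∈ Ioo (0 : ℝ) 1, {r | pt j r t ∈ K} = Ioo (α t) (β t)) →
      (∀ t ∈ Ioo (0 : ℝ) 1, (e t = α t ∨ e t = β t) ∧ β t - α t ≤ 1 ∧ 1 - τ t ≤ β t - α t) →
      ((τ = fun t => t) ∨ τ = fun t => 1 - t) →
      (∀ t ∈ Ioo (0 : ℝ) 1, ∀ r ∈ Ioo (α t) (β t),
        τ t + |r - e t| ≤ 2 * dist (pt j r t) a) →
      (∫⁻ x in K, ‖v x‖ₑ * ENNReal.ofReal (dist x a)⁻¹) ^ 2 ≤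
        C * (nsq K v + anisoSq K s j v) := by
  obtain ⟨C, hC⟩ := exists_hardy_interval h0 h1
  set J := ∫⁻ t in Ioo (0 : ℝ) 1, ENNReal.ofReal (t ^ (s / 4 - 1)) with hJ
  have hJt : J ≠ ⊤ :=
    (((intervalIntegral.integrableOn_Ioo_rpow_iff one_pos).2
      (by linarith : -1 < s / 4 - 1)).lintegral_lt_top).ne
  refine ⟨4 * C * J.toNNReal, fun K j α β e τ a v hK hKQ hv hsec hint hτ hdist => ?_⟩
  have hτI : ∀ t ∈ Ioo (0 : ℝ) 1, 0 < τ t ∧ τ t < 1 := by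
    rintro t ⟨ht0, ht1⟩
    rcases hτ with rfl | rfl
    · exact ⟨ht0, ht1⟩
    · exact ⟨by simp only; linarith, by simp only; linarith⟩
  have hτm : Measurable τ := by
    rcases hτ with rfl | rfl <;> fun_prop
  have hJτ : ∫⁻ t in Ioo (0 : ℝ) 1, ENNReal.ofReal (τ t ^ (s / 4 - 1)) = J := by
    rcases hτ with rfl | rfl
    · rfl
    · rw [hJ, ← (Measure.measurePreserving_sub_left volume (1 : ℝ)).setLIntegral_comp_preimage_emb
        (MeasurableEquiv.subLeft (1 : ℝ)).measurableEmbedding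
        (fun t => ENNReal.ofReal (t ^ (s / 4 - 1)))]
      simp
  set E : ℝ → ℝ≥0∞ := fun t => (∫⁻ r in {r | pt j r t ∈ K}, ‖v (pt j r t)‖ₑ ^ 2) +
    slobodeckijSq1 {r | pt j r t ∈ K} s (fun r => v (pt j r t)) with hE
  have hEm : Measurable E :=
    (measurable_section_lintegral hK j (F := fun x => ‖v x‖ₑ ^ 2) (by fun_prop)).add
      (measurable_section_slobodeckijSq1 hK j s hv)
  have hEint : ∫⁻ t in Ioo (0 : ℝ) 1, E t = nsq K v + anisoSq K s j v := by
    rw [lintegral_add_right _ (measurable_section_slobodeckijSq1 hK j s hv), nsq,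
      lintegral_sections hK hKQ j (by fun_prop), anisoSq]
  have hpoint : ∀ t ∈ Ioo (0 : ℝ) 1,
      ∫⁻ r in {r | pt j r t ∈ K}, ‖v (pt j r t)‖ₑ * ENNReal.ofReal (dist (pt j r t) a)⁻¹ ≤
        2 * (C : ℝ≥0∞) ^ (1 / 2 : ℝ) *
          (ENNReal.ofReal (τ t ^ (s / 4 - 1)) ^ (1 / 2 : ℝ) * E t ^ (1 / 2 : ℝ)) := by
    intro t ht
    obtain ⟨he, hl, hl'⟩ := hint t ht
    have hvt : Measurable fun r => v (pt j r t) :=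
      hv.comp ((measurable_pt j).comp measurable_prodMk_left)
    refine ennreal_le_of_sq_le ?_
    rw [mul_pow, mul_pow, mul_pow, ennreal_rpow_half_sq, ennreal_rpow_half_sq,
      ennreal_rpow_half_sq, hE]
    simp only
    rw [hsec t ht]
    have := hC (α t) (β t) (e t) (τ t) _ hvt he (hτI t ht).1 (hτI t ht).2 hl hl'
    calc (∫⁻ r in Ioo (α t) (β t), ‖v (pt j r t)‖ₑ * ENNReal.ofReal (dist (pt j r t) a)⁻¹) ^ 2
        ≤ (2 * ∫⁻ r in Ioo (α t) (β t),
            ‖v (pt j r t)‖ₑ * ENNReal.ofReal (τ t + |r - e t|)⁻¹) ^ 2 := by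
          refine ennreal_sq_le_sq ?_
          rw [← lintegral_const_mul' _ _ (by simp)]
          refine setLIntegral_mono' measurableSet_Ioo fun r hr => ?_
          rw [mul_left_comm]
          gcongr
          rw [← ENNReal.ofReal_ofNat, ← ENNReal.ofReal_mul (by norm_num)]
          refine ENNReal.ofReal_le_ofReal ?_
          have hpos : 0 < τ t + |r - e t| := by linarith [(hτI t ht).1, abs_nonneg (r - e t)]
          have := hdist t ht r hr
          rw [← div_eq_mul_inv, inv_eq_one_div, div_le_div_iff₀ (by linarith) hpos]
          linarith
      _ ≤ 2 ^ 2 * (C * ENNReal.ofReal (τ t ^ (s / 4 - 1)) *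
          ((∫⁻ r in Ioo (α t) (β t), ‖v (pt j r t)‖ₑ ^ 2) +
            slobodeckijSq1 (Ioo (α t) (β t)) s fun r => v (pt j r t))) := by
          rw [mul_pow]; gcongr
      _ = _ := by ring
  rw [lintegral_sections hK hKQ j (by fun_prop)]
  clear_value E
  calc _ ≤ (∫⁻ t in Ioo (0 : ℝ) 1, 2 * (C : ℝ≥0∞) ^ (1 / 2 : ℝ) *
          (ENNReal.ofReal (τ t ^ (s / 4 - 1)) ^ (1 / 2 : ℝ) * E t ^ (1 / 2 : ℝ))) ^ 2 :=
        ennreal_sq_le_sq (setLIntegral_mono' measurableSet_Ioo hpoint)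
    _ = 4 * C * (∫⁻ t in Ioo (0 : ℝ) 1,
          ENNReal.ofReal (τ t ^ (s / 4 - 1)) ^ (1 / 2 : ℝ) * E t ^ (1 / 2 : ℝ)) ^ 2 := by
        rw [lintegral_const_mul _ (by fun_prop), mul_pow, mul_pow, ennreal_rpow_half_sq]
        norm_num
    _ ≤ 4 * C * (J * (nsq K v + anisoSq K s j v)) := by
        gcongr
        refine (lintegral_mul_sq_le (by fun_prop) (by fun_prop)).trans (le_of_eq ?_)
        simp_rw [ennreal_rpow_half_sq]
        rw [hJτ, hEint]
    _ = _ := by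
        push_cast
        rw [ENNReal.coe_toNNReal hJt]; ring

/-! ### Estimates on the square and on the triangle -/

/-- Horizontal sections are used: the first coordinate of the corner selects the end point `e`, the
second selects `τ = t` or `τ = 1 - t`. -/
lemma exists_hardy_refSquare {s : ℝ} (h0 : 0 < s) (h1 : s ≤ 1) :
    ∃ C : ℝ≥0, ∀ (a : ℝ × ℝ) (v : ℝ × ℝ → ℝ), Measurable v →
      (a.1 = 0 ∨ a.1 = 1) → (a.2 = 0 ∨ a.2 = 1) →
      (∫⁻ x in refSquare, ‖v x‖ₑ * ENNReal.ofReal (dist x a)⁻¹) ^ 2 ≤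
        C * (nsq refSquare v + slobSq refSquare s v) := by
  obtain ⟨C, hC⟩ := exists_hardy_sections h0 h1
  refine ⟨64 * C, fun a v hv ha1 ha2 => ?_⟩
  have key := hC refSquare 0 (fun _ => 0) (fun _ => 1) (fun _ => a.1)
    (if a.2 = 0 then fun t => t else fun t => 1 - t) a v
    isOpen_refSquare.measurableSet subset_rfl hv (fun t ht => refSquare_section 0 ht)
    (fun t ht => ⟨ha1, by norm_num, by split_ifs <;> linarith [ht.1, ht.2]⟩)
    (by split_ifs <;> simp) (fun t ht r hr => by
      have h : (if a.2 = 0 then fun t => t else fun t : ℝ => 1 - t) t = |t - a.2| := by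
        rcases ha2 with h | h
        · simp [h, abs_of_pos ht.1]
        · rw [h, if_neg one_ne_zero, abs_sub_comm, abs_of_pos (by linarith [ht.2])]
      rw [h, Prod.dist_eq, Real.dist_eq, Real.dist_eq]
      simp only [pt, if_true]
      linarith [le_max_left |r - a.1| |t - a.2|, le_max_right |r - a.1| |t - a.2|])
  refine key.trans ?_
  push_cast
  calc (C : ℝ≥0∞) * (nsq refSquare v + anisoSq refSquare s 0 v)
      ≤ C * (64 * nsq refSquare v + 64 * slobSq refSquare s v) := by
        gcongr
        · exact le_mul_of_one_le_left zero_le (by norm_num)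
        · exact anisoSq_le_slobSq 0 h0 h1 hv
    _ = _ := by ring

/-- The coordinate `x_l`. -/
def coord (l : Fin 2) (x : ℝ × ℝ) : ℝ := if l = 0 then x.1 else x.2

@[simp]
lemma coord_pt (l : Fin 2) (r t : ℝ) : coord l (pt l r t) = r := by
  unfold coord pt; split_ifs <;> rfl

@[fun_prop]
lemma contDiff_coord (l : Fin 2) {n : WithTop ℕ∞} : ContDiff ℝ n (coord l) := by
  unfold coord; split_ifs <;> fun_prop

@[fun_prop]
lemma continuous_coord (l : Fin 2) : Continuous (coord l) := by
  unfold coord; split_ifs <;> fun_prop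

/-- The strip of width `2⁻ⁿ` at the line `x_l = e`. -/
def strip (l : Fin 2) (e : ℝ) (n : ℕ) : Set (ℝ × ℝ) := {x | |coord l x - e| < (1 / 2) ^ n}

lemma isOpen_strip (l : Fin 2) (e : ℝ) (n : ℕ) : IsOpen (strip l e n) :=
  isOpen_lt (by fun_prop) (by fun_prop)

lemma exists_strip_refSquare {s : ℝ} (h0 : 1 / 2 < s) (h1 : s ≤ 1) :
    ∃ C : ℝ≥0, ∀ (l : Fin 2) (e : ℝ) (n : ℕ) (v : ℝ × ℝ → ℝ), Measurable v → (e = 0 ∨ e = 1) →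
      (ENNReal.ofReal (2 ^ n) * ∫⁻ x in refSquare ∩ strip l e n, ‖v x‖ₑ) ^ 2 ≤
        C * (nsq refSquare v + slobSq refSquare s v) := by
  obtain ⟨C, hC⟩ := exists_strip_interval h0 h1
  -- The 2 comes from squaring a sum, and `128 = 2 · 64` with the 64 of `anisoSq_le_slobSq`.
  refine ⟨2 + 128 * C ^ 2, fun l e n v hv he => ?_⟩
  have hQ := isOpen_refSquare.measurableSet
  have hm : MeasurableSet (refSquare ∩ strip l e n) := hQ.inter (isOpen_strip l e n).measurableSet
  have hN := measurable_section_slobodeckijSq1 hQ l s hv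
  have hv1 : volume refSquare ≤ 1 := by
    have : refSquare ⊆ Ioo (0 : ℝ) 1 ×ˢ Ioo (0 : ℝ) 1 := fun x hx =>
      ⟨⟨hx.1, hx.2.1⟩, hx.2.2⟩
    refine (measure_mono this).trans ?_
    rw [Measure.volume_eq_prod, Measure.prod_prod]
    simp
  have step : ENNReal.ofReal (2 ^ n) * ∫⁻ x in refSquare ∩ strip l e n, ‖v x‖ₑ ≤
      (∫⁻ x in refSquare, ‖v x‖ₑ) + ∫⁻ t in Ioo (0 : ℝ) 1, C * slobodeckijSq1
        {r | pt l r t ∈ refSquare} s (fun r => v (pt l r t)) ^ (1 / 2 : ℝ) := by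
    rw [lintegral_sections hm inter_subset_left l (by fun_prop),
      lintegral_sections hQ subset_rfl l (by fun_prop),
      ← lintegral_const_mul' _ _ (by simp), ← lintegral_add_right _ (by fun_prop)]
    refine setLIntegral_mono' measurableSet_Ioo fun t ht => ?_
    have : {r | pt l r t ∈ refSquare ∩ strip l e n} =
        Ioo 0 1 ∩ Metric.ball e ((1 / 2) ^ n) := by
      rw [← refSquare_section l ht]
      ext r
      simp only [strip, mem_inter_iff, mem_ofPred_eq, coord_pt, Metric.mem_ball, Real.dist_eq]
    rw [this, refSquare_section l ht]
    exact hC e _ n (hv.comp ((measurable_pt l).comp measurable_prodMk_left)) he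
  refine (ennreal_sq_le_sq step).trans ((ennreal_add_sq_le _ _).trans ?_)
  have e1 : (∫⁻ x in refSquare, ‖v x‖ₑ) ^ 2 ≤ nsq refSquare v := by
    refine (sq_lintegral_le (by fun_prop)).trans ?_
    rw [Measure.restrict_apply_univ]
    exact (mul_le_mul_left hv1 _).trans (one_mul _).le
  have e2 : (∫⁻ t in Ioo (0 : ℝ) 1, C * slobodeckijSq1
        {r | pt l r t ∈ refSquare} s (fun r => v (pt l r t)) ^ (1 / 2 : ℝ)) ^ 2 ≤
        C ^ 2 * (64 * slobSq refSquare s v) := by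
    have hN2 := hN.pow_const (1 / 2 : ℝ)
    rw [lintegral_const_mul _ hN2, mul_pow]
    gcongr
    refine (sq_lintegral_le hN2.aemeasurable).trans ?_
    simp_rw [ennreal_rpow_half_sq]
    refine le_trans ?_ (anisoSq_le_slobSq l (by linarith) h1 hv)
    simp [anisoSq]
  calc 2 * _ ≤ 2 * (nsq refSquare v + C ^ 2 * (64 * slobSq refSquare s v)) := by gcongr
    _ = 2 * nsq refSquare v + 128 * C ^ 2 * slobSq refSquare s v := by ring
    _ ≤ (2 + 128 * C ^ 2) * nsq refSquare v + (2 + 128 * C ^ 2) * slobSq refSquare s v := by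
        gcongr
        · exact le_self_add
        · exact le_add_self
    _ = _ := by push_cast; ring

/-- Even reflection at the diagonal of a function on the triangle. -/
def reflect (v : ℝ × ℝ → ℝ) (x : ℝ × ℝ) : ℝ := if x.2 < x.1 then v x else v x.swap

lemma measurable_reflect {v : ℝ × ℝ → ℝ} (hv : Measurable v) : Measurable (reflect v) :=
  Measurable.ite (measurableSet_lt measurable_snd measurable_fst) hv (hv.comp measurable_swap)

lemma reflect_of_mem {v : ℝ × ℝ → ℝ} {x : ℝ × ℝ} (hx : x ∈ refTriangle) : reflect v x = v x :=
  if_pos hx.2.2.2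

lemma reflect_swap_of_mem {v : ℝ × ℝ → ℝ} {x : ℝ × ℝ} (hx : x ∈ refTriangle) :
    reflect v x.swap = v x := by
  have : ¬ x.swap.2 < x.swap.1 := not_lt.2 hx.2.2.2.le
  rw [reflect, if_neg this, Prod.swap_swap]

lemma volume_diagonal : volume {x : ℝ × ℝ | x.1 = x.2} = 0 := by
  have hm : MeasurableSet {x : ℝ × ℝ | x.1 = x.2} :=
    measurableSet_eq_fun measurable_fst measurable_snd
  rw [Measure.volume_eq_prod, Measure.measure_prod_null hm]
  refine ae_of_all _ fun x => ?_
  have : Prod.mk x ⁻¹' {x : ℝ × ℝ | x.1 = x.2} = {x} := by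
    ext y; simp [eq_comm]
  change volume (Prod.mk x ⁻¹' {x : ℝ × ℝ | x.1 = x.2}) = 0
  rw [this]; simp

/-- Up to the null set on the diagonal the square consists of the triangle and its mirror image. -/
lemma lintegral_refSquare_le {F : ℝ × ℝ → ℝ≥0∞} :
    ∫⁻ x in refSquare, F x ≤ (∫⁻ x in refTriangle, F x) + ∫⁻ x in refTriangle, F x.swap := by
  have hsub : refSquare ⊆ (refTriangle ∪ Prod.swap ⁻¹' refTriangle) ∪ {x | x.1 = x.2} := by
    rintro ⟨x, y⟩ ⟨h1, h2, h3, h4⟩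
    rcases lt_trichotomy x y with h | h | h
    · exact Or.inl (Or.inr ⟨h3, h4, h1, h⟩)
    · exact Or.inr h
    · exact Or.inl (Or.inl ⟨h1, h2, h3, h⟩)
  refine (lintegral_mono_set hsub).trans ((lintegral_union_le _ _ _).trans ?_)
  rw [setLIntegral_measure_zero _ _ volume_diagonal, add_zero]
  refine (lintegral_union_le _ _ _).trans (le_of_eq ?_)
  congr 1
  have := (Measure.measurePreserving_swap (μ := (volume : Measure ℝ))
    (ν := (volume : Measure ℝ))).setLIntegral_comp_preimage_emb
    MeasurableEquiv.prodComm.measurableEmbedding (fun x => F x.swap) refTriangle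
  simp only [Prod.swap_swap] at this
  exact this

lemma nsq_reflect_le (v : ℝ × ℝ → ℝ) : nsq refSquare (reflect v) ≤ 2 * nsq refTriangle v := by
  refine lintegral_refSquare_le.trans (le_of_eq ?_)
  rw [two_mul, nsq]
  congr 1 <;> refine setLIntegral_congr_fun isOpen_refTriangle.measurableSet fun x hx => ?_
  · simp only [reflect_of_mem hx]
  · simp only [reflect_swap_of_mem hx]

/-- The squared distances differ by `2 (x₁ - x₂) (y₁ - y₂)`, which is positive for two points on the
same side of the diagonal. -/
lemma eucl_le_eucl_swap {x y : ℝ × ℝ} (hx : x ∈ refTriangle) (hy : y ∈ refTriangle) :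
    eucl x y ≤ eucl x y.swap := by
  unfold eucl
  refine Real.sqrt_le_sqrt ?_
  simp only [Prod.fst_swap, Prod.snd_swap]
  nlinarith [mul_pos (sub_pos.2 hx.2.2.2) (sub_pos.2 hy.2.2.2)]

lemma eucl_swap_swap (x y : ℝ × ℝ) : eucl x.swap y.swap = eucl x y := by
  unfold eucl; simp only [Prod.fst_swap, Prod.snd_swap]; rw [add_comm]

/-- Pairs of points of the square fall into four copies of the pairs of points of the triangle. In
the mixed copies the distance only grows under reflection, so the kernel decreases. -/
lemma slobSq_reflect_le {s : ℝ} (h0 : 0 < s) {v : ℝ × ℝ → ℝ} :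
    slobSq refSquare s (reflect v) ≤ 4 * slobSq refTriangle s v := by
  have hT := isOpen_refTriangle.measurableSet
  have hkey : ∀ {x y z w : ℝ × ℝ}, z ∈ refTriangle → w ∈ refTriangle →
      reflect v x = v z → reflect v y = v w → eucl z w ≤ eucl x y →
      ENNReal.ofReal ((reflect v x - reflect v y) ^ 2 / eucl x y ^ (2 + 2 * s)) ≤
        ENNReal.ofReal ((v z - v w) ^ 2 / eucl z w ^ (2 + 2 * s)) := by
    intro x y z w _ _ h1 h2 h3
    rw [h1, h2]
    refine ENNReal.ofReal_le_ofReal ?_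
    rcases (eucl_nonneg z w).eq_or_lt with h | h
    · rw [eucl_eq_zero h.symm]; simp
    · have : 0 < eucl z w ^ (2 + 2 * s) := Real.rpow_pos_of_pos h _
      gcongr
  have hin : ∀ x z : ℝ × ℝ, z ∈ refTriangle → (x = z ∨ x = z.swap) →
      ∫⁻ y in refSquare, ENNReal.ofReal ((reflect v x - reflect v y) ^ 2 /
        eucl x y ^ (2 + 2 * s)) ≤
      2 * ∫⁻ w in refTriangle, ENNReal.ofReal ((v z - v w) ^ 2 / eucl z w ^ (2 + 2 * s)) := by
    intro x z hz hx
    refine lintegral_refSquare_le.trans (le_trans ?_ (two_mul _).ge)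
    rcases hx with rfl | rfl
    · refine add_le_add (setLIntegral_mono' hT fun w hw => ?_)
        (setLIntegral_mono' hT fun w hw => ?_)
      · exact hkey hz hw (reflect_of_mem hz) (reflect_of_mem hw) le_rfl
      · exact hkey hz hw (reflect_of_mem hz) (reflect_swap_of_mem hw) (eucl_le_eucl_swap hz hw)
    · refine add_le_add (setLIntegral_mono' hT fun w hw => ?_)
        (setLIntegral_mono' hT fun w hw => ?_)
      · refine hkey hz hw (reflect_swap_of_mem hz) (reflect_of_mem hw) ?_
        rw [← eucl_swap_swap z.swap w, Prod.swap_swap]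
        exact eucl_le_eucl_swap hz hw
      · exact hkey hz hw (reflect_swap_of_mem hz) (reflect_swap_of_mem hw)
          (eucl_swap_swap z w).ge
  rw [slobSq]
  refine lintegral_refSquare_le.trans ?_
  rw [show (4 : ℝ≥0∞) = 2 + 2 by norm_num, add_mul, slobSq, ← lintegral_const_mul' _ _ (by simp)]
  exact add_le_add (setLIntegral_mono' hT fun z hz => hin z z hz (Or.inl rfl))
    (setLIntegral_mono' hT fun z hz => hin z.swap z hz (Or.inr rfl))

/-- The domains under consideration. -/
def IsRefDomain (K : Set (ℝ × ℝ)) : Prop := K = refSquare ∨ K = refTriangle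

namespace IsRefDomain

variable {K : Set (ℝ × ℝ)}

lemma isOpen (h : IsRefDomain K) : IsOpen K := by
  rcases h with rfl | rfl
  exacts [isOpen_refSquare, isOpen_refTriangle]

lemma convex (h : IsRefDomain K) : Convex ℝ K := by
  rcases h with rfl | rfl
  exacts [convex_refSquare, convex_refTriangle]

lemma subset (h : IsRefDomain K) : K ⊆ refSquare := by
  rcases h with rfl | rfl
  exacts [subset_rfl, refTriangle_subset]

lemma nonempty (h : IsRefDomain K) : K.Nonempty := by
  rcases h with rfl | rfl
  exacts [refSquare_nonempty, refTriangle_nonempty]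

lemma measurableSet (h : IsRefDomain K) : MeasurableSet K := h.isOpen.measurableSet

lemma volume_lt_top (h : IsRefDomain K) : volume K < ⊤ := volume_lt_top_of_subset h.subset

lemma isCompact_closure (h : IsRefDomain K) : IsCompact (closure K) := by
  refine IsCompact.of_isClosed_subset
    (isCompact_Icc (a := ((0 : ℝ), (0 : ℝ))) (b := ((1 : ℝ), (1 : ℝ)))) isClosed_closure ?_
  refine (closure_mono h.subset).trans (closure_refSquare_subset.trans ?_)
  exact fun x hx => ⟨⟨hx.1, hx.2.2.1⟩, ⟨hx.2.1, hx.2.2.2⟩⟩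

end IsRefDomain

/-- An extension operator to the square. -/
lemma IsRefDomain.exists_extension {K : Set (ℝ × ℝ)} (hK : IsRefDomain K) {s : ℝ} (h0 : 0 < s)
    {v : ℝ × ℝ → ℝ} (hv : Measurable v) :
    ∃ w : ℝ × ℝ → ℝ, Measurable w ∧ (∀ x ∈ K, w x = v x) ∧
      nsq refSquare w + slobSq refSquare s w ≤ 4 * (nsq K v + slobSq K s v) := by
  rcases hK with rfl | rfl
  · exact ⟨v, hv, fun _ _ => rfl, le_mul_of_one_le_left zero_le (by norm_num)⟩
  · refine ⟨reflect v, measurable_reflect hv, fun x hx => reflect_of_mem hx, ?_⟩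
    rw [mul_add]
    refine add_le_add ((nsq_reflect_le v).trans ?_) (slobSq_reflect_le h0)
    gcongr
    norm_num

/-- Sections of the triangle shrink towards a corner, which is why the extension to the square is
used instead of sections of `K`. -/
lemma exists_hardy {s : ℝ} (h0 : 0 < s) (h1 : s ≤ 1) :
    ∃ C : ℝ≥0, ∀ (K : Set (ℝ × ℝ)) (a : ℝ × ℝ) (v : ℝ × ℝ → ℝ), IsRefDomain K → Measurable v →
      (a.1 = 0 ∨ a.1 = 1) → (a.2 = 0 ∨ a.2 = 1) →
      (∫⁻ x in K, ‖v x‖ₑ * ENNReal.ofReal (dist x a)⁻¹) ^ 2 ≤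
        C * (nsq K v + slobSq K s v) := by
  obtain ⟨C, hC⟩ := exists_hardy_refSquare h0 h1
  refine ⟨4 * C, fun K a v hK hv ha1 ha2 => ?_⟩
  obtain ⟨w, hw, hwv, hle⟩ := hK.exists_extension h0 hv
  calc (∫⁻ x in K, ‖v x‖ₑ * ENNReal.ofReal (dist x a)⁻¹) ^ 2
      = (∫⁻ x in K, ‖w x‖ₑ * ENNReal.ofReal (dist x a)⁻¹) ^ 2 := by
        congr 1
        exact setLIntegral_congr_fun hK.measurableSet fun x hx => by simp only [hwv x hx]
    _ ≤ (∫⁻ x in refSquare, ‖w x‖ₑ * ENNReal.ofReal (dist x a)⁻¹) ^ 2 :=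
        ennreal_sq_le_sq (lintegral_mono_set hK.subset)
    _ ≤ C * (nsq refSquare w + slobSq refSquare s w) := hC a w hw ha1 ha2
    _ ≤ C * (4 * (nsq K v + slobSq K s v)) := by gcongr
    _ = _ := by push_cast; ring

lemma exists_strip {s : ℝ} (h0 : 1 / 2 < s) (h1 : s ≤ 1) :
    ∃ C : ℝ≥0, ∀ (K : Set (ℝ × ℝ)) (l : Fin 2) (e : ℝ) (n : ℕ) (v : ℝ × ℝ → ℝ),
      IsRefDomain K → Measurable v → (e = 0 ∨ e = 1) →
      (ENNReal.ofReal (2 ^ n) * ∫⁻ x in K ∩ strip l e n, ‖v x‖ₑ) ^ 2 ≤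
        C * (nsq K v + slobSq K s v) := by
  obtain ⟨C, hC⟩ := exists_strip_refSquare h0 h1
  refine ⟨4 * C, fun K l e n v hK hv he => ?_⟩
  obtain ⟨w, hw, hwv, hle⟩ := hK.exists_extension (by linarith : 0 < s) hv
  calc (ENNReal.ofReal (2 ^ n) * ∫⁻ x in K ∩ strip l e n, ‖v x‖ₑ) ^ 2
      = (ENNReal.ofReal (2 ^ n) * ∫⁻ x in K ∩ strip l e n, ‖w x‖ₑ) ^ 2 := by
        congr 2
        exact setLIntegral_congr_fun (hK.measurableSet.inter (isOpen_strip l e n).measurableSet)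
          fun x hx => by simp only [hwv x hx.1]
    _ ≤ (ENNReal.ofReal (2 ^ n) * ∫⁻ x in refSquare ∩ strip l e n, ‖w x‖ₑ) ^ 2 := by
        refine ennreal_sq_le_sq (mul_le_mul_right (lintegral_mono_set ?_) _)
        exact inter_subset_inter_left _ hK.subset
    _ ≤ C * (nsq refSquare w + slobSq refSquare s w) := hC l e n w hw he
    _ ≤ C * (4 * (nsq K v + slobSq K s v)) := by gcongr
    _ = _ := by push_cast; ring

/-! ### Density of smooth functions -/

instance isAddHaarMeasure_volume_plane : (volume : Measure (ℝ × ℝ)).IsAddHaarMeasure := by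
  rw [Measure.volume_eq_prod]; infer_instance

/-- Difference quotients are functions of pairs of points, and dilations act on the pairs. -/
instance isAddHaarMeasure_volume_plane_prod :
    (volume : Measure ((ℝ × ℝ) × (ℝ × ℝ))).IsAddHaarMeasure := by
  rw [Measure.volume_eq_prod]; infer_instance

/-! ### Continuity of dilations in `L²`. -/

section Dilation

variable {E : Type*} [NormedAddCommGroup E] [NormedSpace ℝ E] [FiniteDimensional ℝ E]
  [MeasurableSpace E] [BorelSpace E] {μ : Measure E} [μ.IsAddHaarMeasure]

/-- The Jacobian factor is the power `(1 - ε)⁻¹ ≤ 2` with the dimension as exponent. -/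
lemma lintegral_comp_dilation_le {F : E → ℝ≥0∞} (hF : Measurable F) {ε : ℝ} (h0 : 0 < ε)
    (h1 : ε ≤ 1 / 2) (b : E) :
    ∫⁻ x, F ((1 - ε) • x + b) ∂μ ≤ 2 ^ Module.finrank ℝ E * ∫⁻ x, F x ∂μ := by
  have hpos : 0 < 1 - ε := by linarith
  have h2 : ∫⁻ x, F ((1 - ε) • x + b) ∂μ =
      ∫⁻ y, F (y + b) ∂(Measure.map ((1 - ε) • ·) μ) :=
    (lintegral_map (f := fun y => F (y + b)) (by fun_prop) (by fun_prop)).symm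
  rw [h2, Measure.map_addHaar_smul μ hpos.ne', lintegral_smul_measure,
    lintegral_add_right_eq_self F b, smul_eq_mul]
  gcongr
  rw [show (2 : ℝ≥0∞) ^ Module.finrank ℝ E = ENNReal.ofReal (2 ^ Module.finrank ℝ E) by
    rw [ENNReal.ofReal_pow (by norm_num)]; simp]
  refine ENNReal.ofReal_le_ofReal ?_
  rw [abs_of_nonneg (by positivity), ← inv_pow]
  gcongr
  rw [inv_le_comm₀ hpos (by norm_num)]
  linarith

lemma enorm_add_add_sq_le (a b c : ℝ) :
    ‖a + b + c‖ₑ ^ 2 ≤ 4 * (‖a‖ₑ ^ 2 + ‖b‖ₑ ^ 2 + ‖c‖ₑ ^ 2) := by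
  calc ‖a + b + c‖ₑ ^ 2 ≤ (‖a + b‖ₑ + ‖c‖ₑ) ^ 2 := ennreal_sq_le_sq (enorm_add_le _ _)
    _ ≤ 2 * (‖a + b‖ₑ ^ 2 + ‖c‖ₑ ^ 2) := ennreal_add_sq_le _ _
    _ ≤ 2 * (2 * (‖a‖ₑ ^ 2 + ‖b‖ₑ ^ 2) + 2 * ‖c‖ₑ ^ 2) := by
        gcongr
        · exact (ennreal_sq_le_sq (enorm_add_le _ _)).trans (ennreal_add_sq_le _ _)
        · exact le_mul_of_one_le_left zero_le (by norm_num)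
    _ = _ := by ring

lemma lintegral_enorm_sq_eq {α : Type*} [MeasurableSpace α] {ν : Measure α} (f : α → ℝ) :
    ∫⁻ x, ‖f x‖ₑ ^ 2 ∂ν = eLpNorm f 2 ν ^ 2 := by
  rw [eLpNorm_eq_lintegral_rpow_enorm_toReal two_ne_zero ENNReal.ofNat_ne_top]
  simp only [ENNReal.toReal_ofNat, ENNReal.rpow_ofNat]
  rw [ennreal_rpow_half_sq]

/-- Dilations towards points of a bounded set act continuously on `L²`: compactly supported
continuous functions. -/
lemma eventually_dilation_sub_sq_le_of_continuous {g : E → ℝ} (hg : Continuous g)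
    (hc : HasCompactSupport g) (R : ℝ) {η : ℝ≥0∞} (hη : η ≠ 0) :
    ∀ᶠ ε in 𝓝[>] (0 : ℝ), ∀ ζ : E, ‖ζ‖ ≤ R →
      ∫⁻ x, ‖g ((1 - ε) • x + ε • ζ) - g x‖ₑ ^ 2 ∂μ ≤ η := by
  rcases lt_or_ge R 0 with hR | hR
  · exact Eventually.of_forall fun ε ζ hζ => absurd (norm_nonneg ζ) (by linarith)
  obtain ⟨R₀, hR₀, hsupp⟩ : ∃ R₀ : ℝ, 0 ≤ R₀ ∧ ∀ x, R₀ < ‖x‖ → g x = 0 := by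
    obtain ⟨r, hr⟩ := hc.isCompact.isBounded.exists_norm_le
    refine ⟨max r 0, le_max_right _ _, fun x hx => ?_⟩
    by_contra h
    exact absurd (hr x (subset_tsupport g h)) (not_le.2 ((le_max_left _ _).trans_lt hx))
  -- For `ε < 1/2` and `x` outside this ball, both `x` and `(1 - ε) x + ε ζ` have norm above `R₀`,
  -- so `g` vanishes at both points.
  set B := Metric.closedBall (0 : E) (2 * R₀ + R) with hB
  have hBt : μ B ≠ ⊤ := (isCompact_closedBall _ _).measure_lt_top.ne
  obtain ⟨κ, hκ0, hκ⟩ : ∃ κ : ℝ, 0 < κ ∧ ENNReal.ofReal (κ ^ 2) * μ B ≤ η := by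
    have : Tendsto (fun κ : ℝ => ENNReal.ofReal (κ ^ 2) * μ B) (𝓝[>] 0) (𝓝 0) := by
      have h1 : Tendsto (fun κ : ℝ => ENNReal.ofReal (κ ^ 2)) (𝓝[>] 0) (𝓝 0) := by
        have : Continuous fun κ : ℝ => ENNReal.ofReal (κ ^ 2) :=
          ENNReal.continuous_ofReal.comp (by fun_prop)
        have h := (this.tendsto 0).mono_left (nhdsWithin_le_nhds (s := Ioi 0))
        simpa using h
      have := ENNReal.Tendsto.mul_const h1 (Or.inr hBt)
      simpa using this
    obtain ⟨κ, hκ, hκ0⟩ := ((this.eventually (ge_mem_nhds (pos_iff_ne_zero.2 hη))).and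
      self_mem_nhdsWithin).exists
    exact ⟨κ, hκ0, hκ⟩
  obtain ⟨δ, hδ0, hδ⟩ := Metric.uniformContinuous_iff.1
    (hc.uniformContinuous_of_continuous hg) κ hκ0
  have hsmall : ∀ᶠ ε in 𝓝[>] (0 : ℝ), ε < min (1 / 2) (δ / (2 * R₀ + 2 * R + 1)) :=
    (eventually_lt_nhds (by positivity)).filter_mono nhdsWithin_le_nhds
  filter_upwards [hsmall, self_mem_nhdsWithin] with ε hε hε0 ζ hζ
  have hε0 : 0 < ε := hε0
  have hε1 : ε < 1 / 2 := hε.trans_le (min_le_left _ _)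
  have hε2 : ε * (2 * R₀ + 2 * R + 1) < δ :=
    (lt_div_iff₀ (by positivity)).1 (hε.trans_le (min_le_right _ _))
  calc ∫⁻ x, ‖g ((1 - ε) • x + ε • ζ) - g x‖ₑ ^ 2 ∂μ
      ≤ ∫⁻ x, B.indicator (fun _ => ENNReal.ofReal (κ ^ 2)) x ∂μ := by
        refine lintegral_mono fun x => ?_
        by_cases hx : ‖x‖ ≤ 2 * R₀ + R
        · rw [indicator_of_mem (by simpa [hB] using hx), enorm_sq_eq]
          refine ENNReal.ofReal_le_ofReal (sq_le_sq' ?_ ?_) <;>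
          · have hd : dist (g ((1 - ε) • x + ε • ζ)) (g x) < κ := by
              refine hδ ?_
              rw [dist_eq_norm, show (1 - ε) • x + ε • ζ - x = ε • (ζ - x) by
                rw [sub_smul, one_smul, smul_sub]; abel, norm_smul, Real.norm_of_nonneg hε0.le]
              have : ‖ζ - x‖ ≤ 2 * R₀ + 2 * R + 1 := (norm_sub_le _ _).trans (by linarith)
              nlinarith
            rw [Real.dist_eq] at hd
            linarith [abs_lt.1 hd |>.1, abs_lt.1 hd |>.2]
        · push Not at hx
          have e1 : g x = 0 := hsupp x (by linarith)
          have e2 : g ((1 - ε) • x + ε • ζ) = 0 := by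
            refine hsupp _ ?_
            have h1 : ‖(1 - ε) • x‖ ≤ ‖(1 - ε) • x + ε • ζ‖ + ‖ε • ζ‖ := by
              simpa using norm_sub_le ((1 - ε) • x + ε • ζ) (ε • ζ)
            rw [norm_smul, norm_smul, Real.norm_of_nonneg (by linarith : 0 ≤ 1 - ε),
              Real.norm_of_nonneg hε0.le] at h1
            nlinarith [norm_nonneg ζ, norm_nonneg x]
          simp [e1, e2]
    _ = ENNReal.ofReal (κ ^ 2) * μ B := by
        rw [lintegral_indicator Metric.isClosed_closedBall.measurableSet, setLIntegral_const]
    _ ≤ η := hκ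

/-- Dilations towards points of a bounded set act continuously on `L²`. -/
lemma eventually_dilation_sub_sq_le {H : E → ℝ} (hm : Measurable H) (hH : MemLp H 2 μ) (R : ℝ)
    {c : ℝ → ℝ} (hc : Tendsto c (𝓝[>] 0) (𝓝 1)) {η : ℝ≥0∞} (hη : η ≠ 0) :
    ∀ᶠ ε in 𝓝[>] (0 : ℝ), ∀ ζ : E, ‖ζ‖ ≤ R →
      ∫⁻ x, ‖c ε * H ((1 - ε) • x + ε • ζ) - H x‖ₑ ^ 2 ∂μ ≤ η := by
  have hη' : min η 1 ≠ 0 := (lt_min (pos_iff_ne_zero.2 hη) one_pos).ne'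
  -- All constants of the estimate below are collected in `D`: the total error is `D * θ` once each
  -- elementary error is at most `θ = η / D`.
  set D : ℝ≥0∞ := 16 * (2 ^ Module.finrank ℝ E + 2 + ∫⁻ x, ‖H x‖ₑ ^ 2 ∂μ) with hD
  have hHt : ∫⁻ x, ‖H x‖ₑ ^ 2 ∂μ ≠ ⊤ := by
    rw [lintegral_enorm_sq_eq]; exact (ENNReal.pow_lt_top hH.2).ne
  have hDt : D ≠ ⊤ := by rw [hD]; finiteness
  have hD1 : 1 ≤ D := by
    rw [hD]
    exact one_le_mul (by norm_num) (le_add_right (le_add_left (by norm_num)))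
  set θ := η / D with hθ
  have hθ0 : θ ≠ 0 := ENNReal.div_ne_zero.2 ⟨hη, hDt⟩
  have hθη : D * θ ≤ η := ENNReal.mul_div_le
  obtain ⟨g, hgs, hgn, hgc, -⟩ := hH.exists_hasCompactSupport_eLpNorm_sub_le
    ENNReal.ofNat_ne_top (ε := θ ^ (1 / 2 : ℝ)) (by
      simpa using fun h => absurd h hθ0)
  have hgn2 : ∫⁻ x, ‖H x - g x‖ₑ ^ 2 ∂μ ≤ θ := by
    rw [lintegral_enorm_sq_eq]
    refine (ennreal_sq_le_sq hgn).trans ?_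
    rw [ennreal_rpow_half_sq]
  have hcθ : ∀ᶠ ε in 𝓝[>] (0 : ℝ), ‖c ε - 1‖ₑ ^ 2 ≤ θ := by
    have : Tendsto (fun ε => ‖c ε - 1‖ₑ ^ 2) (𝓝[>] 0) (𝓝 0) := by
      have h1 : Continuous fun x : ℝ => ‖x - 1‖ₑ ^ 2 := by fun_prop
      simpa [Function.comp_def] using (h1.tendsto 1).comp hc
    exact this.eventually (ge_mem_nhds (pos_iff_ne_zero.2 hθ0))
  have hc2 : ∀ᶠ ε in 𝓝[>] (0 : ℝ), ‖c ε‖ₑ ^ 2 ≤ 2 := by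
    have : Tendsto (fun ε => ‖c ε‖ₑ ^ 2) (𝓝[>] 0) (𝓝 1) := by
      have h1 : Continuous fun x : ℝ => ‖x‖ₑ ^ 2 := by fun_prop
      simpa [Function.comp_def] using (h1.tendsto 1).comp hc
    exact this.eventually (ge_mem_nhds (by norm_num))
  have hhalf : ∀ᶠ ε in 𝓝[>] (0 : ℝ), ε ≤ 1 / 2 :=
    (eventually_le_nhds (by norm_num)).filter_mono nhdsWithin_le_nhds
  filter_upwards [eventually_dilation_sub_sq_le_of_continuous (μ := μ) hgc hgs R hθ0, hcθ, hc2,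
    hhalf, self_mem_nhdsWithin] with ε h1 h2 h3 h4 h5 ζ hζ
  have hA : ∫⁻ x, ‖H ((1 - ε) • x + ε • ζ) - H x‖ₑ ^ 2 ∂μ ≤
      4 * (2 ^ Module.finrank ℝ E * θ + θ + θ) := by
    calc ∫⁻ x, ‖H ((1 - ε) • x + ε • ζ) - H x‖ₑ ^ 2 ∂μ
        ≤ ∫⁻ x, 4 * (‖H ((1 - ε) • x + ε • ζ) - g ((1 - ε) • x + ε • ζ)‖ₑ ^ 2 +
            ‖g ((1 - ε) • x + ε • ζ) - g x‖ₑ ^ 2 + ‖H x - g x‖ₑ ^ 2) ∂μ := by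
          refine lintegral_mono fun x => ?_
          have := enorm_add_add_sq_le (H ((1 - ε) • x + ε • ζ) - g ((1 - ε) • x + ε • ζ))
            (g ((1 - ε) • x + ε • ζ) - g x) (-(H x - g x))
          rw [enorm_neg] at this
          refine le_trans (le_of_eq ?_) this
          congr 2; ring
      _ = 4 * ((∫⁻ x, ‖H ((1 - ε) • x + ε • ζ) - g ((1 - ε) • x + ε • ζ)‖ₑ ^ 2 ∂μ) +
            (∫⁻ x, ‖g ((1 - ε) • x + ε • ζ) - g x‖ₑ ^ 2 ∂μ) + ∫⁻ x, ‖H x - g x‖ₑ ^ 2 ∂μ) := by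
          have hgm := hgc.measurable
          rw [lintegral_const_mul _ (by fun_prop), lintegral_add_left (by fun_prop),
            lintegral_add_left (by fun_prop)]
      _ ≤ _ := by
          gcongr
          · refine (lintegral_comp_dilation_le (F := fun x => ‖H x - g x‖ₑ ^ 2) ?_ h5 h4
              (ε • ζ)).trans ?_
            · have hgm := hgc.measurable
              fun_prop
            · gcongr
          · exact h1 ζ hζ
  calc ∫⁻ x, ‖c ε * H ((1 - ε) • x + ε • ζ) - H x‖ₑ ^ 2 ∂μ
      ≤ ∫⁻ x, 2 * (‖c ε‖ₑ ^ 2 * ‖H ((1 - ε) • x + ε • ζ) - H x‖ₑ ^ 2 +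
          ‖c ε - 1‖ₑ ^ 2 * ‖H x‖ₑ ^ 2) ∂μ := by
        refine lintegral_mono fun x => ?_
        rw [← mul_pow, ← mul_pow, ← enorm_mul, ← enorm_mul]
        refine le_trans (ennreal_sq_le_sq ?_) (ennreal_add_sq_le _ _)
        refine le_trans (le_of_eq ?_) (enorm_add_le _ _)
        congr 1; ring
    _ = 2 * (‖c ε‖ₑ ^ 2 * (∫⁻ x, ‖H ((1 - ε) • x + ε • ζ) - H x‖ₑ ^ 2 ∂μ) +
          ‖c ε - 1‖ₑ ^ 2 * ∫⁻ x, ‖H x‖ₑ ^ 2 ∂μ) := by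
        rw [lintegral_const_mul _ (by fun_prop), lintegral_add_left (by fun_prop),
          lintegral_const_mul _ (by fun_prop), lintegral_const_mul _ (by fun_prop)]
    _ ≤ 2 * (2 * (4 * (2 ^ Module.finrank ℝ E * θ + θ + θ)) + θ * ∫⁻ x, ‖H x‖ₑ ^ 2 ∂μ) := by
        gcongr
    _ ≤ 2 * (2 * (4 * (2 ^ Module.finrank ℝ E * θ + θ + θ)) +
          8 * (θ * ∫⁻ x, ‖H x‖ₑ ^ 2 ∂μ)) := by
        refine mul_le_mul_right (add_le_add le_rfl ?_) _
        exact le_mul_of_one_le_left zero_le (by norm_num)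
    _ = D * θ := by rw [hD]; ring
    _ ≤ η := hθη

end Dilation

/-- Jensen's inequality and Tonelli's theorem, for averages with respect to a parameter. -/
lemma lintegral_enorm_integral_sq_le {α β : Type*} [MeasurableSpace α] [MeasurableSpace β]
    {μ : Measure α} [SFinite μ] {ν : Measure β} [IsProbabilityMeasure ν] {H : α → β → ℝ}
    (hH : Measurable (Function.uncurry H)) {η : ℝ≥0∞}
    (h : ∀ᵐ z ∂ν, ∫⁻ x, ‖H x z‖ₑ ^ 2 ∂μ ≤ η) :
    ∫⁻ x, ‖∫ z, H x z ∂ν‖ₑ ^ 2 ∂μ ≤ η := by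
  have hm : ∀ x, Measurable (H x) := fun x => hH.of_uncurry_left
  calc ∫⁻ x, ‖∫ z, H x z ∂ν‖ₑ ^ 2 ∂μ ≤ ∫⁻ x, ∫⁻ z, ‖H x z‖ₑ ^ 2 ∂ν ∂μ := by
        refine lintegral_mono fun x => ?_
        refine (ennreal_sq_le_sq (enorm_integral_le_lintegral_enorm _)).trans ?_
        refine (sq_lintegral_le (hm x).enorm.aemeasurable).trans ?_
        simp
    _ = ∫⁻ z, ∫⁻ x, ‖H x z‖ₑ ^ 2 ∂μ ∂ν :=
        lintegral_lintegral_swap (hH.enorm.pow_const 2).aemeasurable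
    _ ≤ ∫⁻ z, η ∂ν := lintegral_mono_ae h
    _ = η := by simp

/-- The average of `V` over the contractions of `x` towards the points of the support of `ν`. -/
def contractAverage (ν : Measure (ℝ × ℝ)) (ε : ℝ) (V : ℝ × ℝ → ℝ) (x : ℝ × ℝ) : ℝ :=
  ∫ z, V ((1 - ε) • x + ε • z) ∂ν

/-- The convolution kernel of `contractAverage`. -/
def contractKernel {c : ℝ × ℝ} (ρ : ContDiffBump c) (ε : ℝ) (h : ℝ × ℝ) : ℝ :=
  (ε ^ 2)⁻¹ * ρ.normed volume (-(ε⁻¹ • h))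

/-- The probability measure with a smooth bump function as density. -/
def bumpMeasure {c : ℝ × ℝ} (ρ : ContDiffBump c) : Measure (ℝ × ℝ) :=
  volume.withDensity fun z => ENNReal.ofReal (ρ.normed volume z)

/-! ### Averages over contractions: smoothness, derivatives, weak derivatives. -/

section Kernel

variable {c : ℝ × ℝ} (ρ : ContDiffBump c) {ε : ℝ}

lemma contDiff_contractKernel : ContDiff ℝ (⊤ : ℕ∞) (contractKernel ρ ε) := by
  unfold contractKernel
  exact contDiff_const.mul (ρ.contDiff_normed.comp (by fun_prop))

lemma support_contractKernel_subset (h0 : 0 < ε) :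
    Function.support (contractKernel ρ ε) ⊆
      (fun z => -(ε • z)) '' Metric.closedBall c ρ.rOut := by
  intro h hh
  have h1 : ρ.normed volume (-(ε⁻¹ • h)) ≠ 0 := fun h' => hh (by simp [contractKernel, h'])
  have h2 : -(ε⁻¹ • h) ∈ Metric.ball c ρ.rOut := by
    rw [← ρ.support_normed_eq (μ := volume)]; exact h1
  refine ⟨_, Metric.ball_subset_closedBall h2, ?_⟩
  simp only
  rw [smul_neg, neg_neg, smul_inv_smul₀ h0.ne']

lemma hasCompactSupport_contractKernel (h0 : 0 < ε) :
    HasCompactSupport (contractKernel ρ ε) :=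
  HasCompactSupport.of_support_subset_isCompact
    ((isCompact_closedBall c ρ.rOut).image (by fun_prop)) (support_contractKernel_subset ρ h0)

/-- Substitution `y = X + ε z`. Averaging over contractions thus is a convolution at scale `ε`,
evaluated at the contracted point, and inherits its smoothness. -/
lemma contractKernel_integral_eq (h0 : 0 < ε) (V : ℝ × ℝ → ℝ) (X : ℝ × ℝ) :
    ∫ y, V y * contractKernel ρ ε (X - y) = ∫ z, V (X + ε • z) ∂(bumpMeasure ρ) := by
  have hm : Measurable fun z => ENNReal.ofReal (ρ.normed volume z) :=
    ρ.continuous_normed.measurable.ennreal_ofReal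
  rw [bumpMeasure, integral_withDensity_eq_integral_toReal_smul hm
    (ae_of_all _ fun _ => ENNReal.ofReal_lt_top)]
  have h1 : ∫ y, V y * contractKernel ρ ε (X - y) =
      ∫ y, V (X + y) * contractKernel ρ ε (-y) := by
    rw [← integral_add_left_eq_self (μ := (volume : Measure (ℝ × ℝ)))
      (fun y => V y * contractKernel ρ ε (X - y)) X]
    simp
  have h2 := Measure.integral_comp_smul (volume : Measure (ℝ × ℝ))
    (fun y => V (X + y) * contractKernel ρ ε (-y)) ε
  rw [show Module.finrank ℝ (ℝ × ℝ) = 2 by simp, abs_of_pos (by positivity), smul_eq_mul] at h2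
  rw [h1]
  have h3 : ∫ y, V (X + y) * contractKernel ρ ε (-y) =
      ε ^ 2 * ∫ z, V (X + ε • z) * contractKernel ρ ε (-(ε • z)) := by
    rw [h2, mul_inv_cancel_left₀ (by positivity)]
  rw [h3, ← integral_const_mul]
  refine integral_congr_ae (ae_of_all _ fun z => ?_)
  simp only [contractKernel, smul_neg, neg_neg, inv_smul_smul₀ h0.ne', smul_eq_mul,
    ENNReal.toReal_ofReal (ρ.nonneg_normed z)]
  field_simp

lemma isProbabilityMeasure_bumpMeasure : IsProbabilityMeasure (bumpMeasure ρ) := by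
  constructor
  rw [bumpMeasure, withDensity_apply _ MeasurableSet.univ, Measure.restrict_univ,
    ← ofReal_integral_eq_lintegral_ofReal ρ.integrable_normed
      (ae_of_all _ ρ.nonneg_normed), ρ.integral_normed, ENNReal.ofReal_one]

lemma ae_bumpMeasure_mem : ∀ᵐ z ∂(bumpMeasure ρ), z ∈ Metric.closedBall c ρ.rOut := by
  have hm : Measurable fun z => ENNReal.ofReal (ρ.normed volume z) :=
    ρ.continuous_normed.measurable.ennreal_ofReal
  rw [bumpMeasure, ae_withDensity_iff hm]
  refine ae_of_all _ fun z hz => ?_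
  have : z ∈ Function.support (ρ.normed volume) := fun h => hz (by rw [h, ENNReal.ofReal_zero])
  rw [ρ.support_normed_eq] at this
  exact Metric.ball_subset_closedBall this

lemma integrable_comp_bumpMeasure (h0 : 0 < ε) {V : ℝ × ℝ → ℝ} (hV : Integrable V)
    (X : ℝ × ℝ) : Integrable (fun z => V (X + ε • z)) (bumpMeasure ρ) := by
  have hm : Measurable fun z => ENNReal.ofReal (ρ.normed volume z) :=
    ρ.continuous_normed.measurable.ennreal_ofReal
  rw [bumpMeasure, integrable_withDensity_iff_integrable_smul' hm
    (ae_of_all _ fun _ => ENNReal.ofReal_lt_top)]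
  have h1 : Integrable fun z => V (X + ε • z) :=
    (hV.comp_add_left X).comp_smul (R := ε) h0.ne'
  obtain ⟨C, hC⟩ := ρ.hasCompactSupport_normed.exists_bound_of_continuous
    (ρ.continuous_normed (μ := volume))
  refine h1.bdd_mul (c := C) hm.ennreal_toReal.aestronglyMeasurable (ae_of_all _ fun z => ?_)
  rw [ENNReal.toReal_ofReal (ρ.nonneg_normed z)]
  exact hC z

lemma contractAverage_eq_convolution (h0 : 0 < ε) (V : ℝ × ℝ → ℝ) :
    contractAverage (bumpMeasure ρ) ε V = fun x =>
      convolution V (contractKernel ρ ε) (ContinuousLinearMap.mul ℝ ℝ) volume ((1 - ε) • x) := by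
  ext x
  rw [contractAverage, ← contractKernel_integral_eq ρ h0, convolution_def]
  rfl

lemma contDiff_contractAverage (h0 : 0 < ε) {V : ℝ × ℝ → ℝ} (hV : Integrable V) :
    ContDiff ℝ (⊤ : ℕ∞) (contractAverage (bumpMeasure ρ) ε V) := by
  rw [contractAverage_eq_convolution ρ h0]
  exact ((hasCompactSupport_contractKernel ρ h0).contDiff_convolution_right
    (ContinuousLinearMap.mul ℝ ℝ) hV.locallyIntegrable
    (contDiff_contractKernel ρ)).comp (by fun_prop)

lemma pderiv_contractAverage (h0 : 0 < ε) {V : ℝ × ℝ → ℝ} (hV : Integrable V) (i : Fin 2)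
    (x : ℝ × ℝ) : pderiv i (contractAverage (bumpMeasure ρ) ε V) x =
      (1 - ε) * ∫ y, V y * pderiv i (contractKernel ρ ε) ((1 - ε) • x - y) := by
  rw [contractAverage_eq_convolution ρ h0, pderiv]
  have hcs := hasCompactSupport_contractKernel ρ h0
  have hk1 : ContDiff ℝ 1 (contractKernel ρ ε) :=
    (contDiff_contractKernel ρ).of_le (by exact_mod_cast le_top)
  have h1 := hcs.hasFDerivAt_convolution_right
    (ContinuousLinearMap.mul ℝ ℝ) hV.locallyIntegrable hk1 ((1 - ε) • x)
  have h2 : HasFDerivAt (fun x : ℝ × ℝ => (1 - ε) • x)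
      ((1 - ε) • ContinuousLinearMap.id ℝ (ℝ × ℝ)) x := (hasFDerivAt_id x).const_smul (1 - ε)
  have h3 := h1.comp x h2
  have h4 := h3.fderiv
  simp only [Function.comp_def] at h4
  rw [h4, ContinuousLinearMap.comp_apply, smul_apply,
    ContinuousLinearMap.id_apply, map_smul, smul_eq_mul, convolution_precompR_apply _
    hV.locallyIntegrable (hcs.fderiv ℝ) (hk1.continuous_fderiv one_ne_zero), convolution_def]
  rfl

variable {K : Set (ℝ × ℝ)}

/-- By convexity the contractions of `x ∈ K` towards the ball stay in a compact subset of `K`.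
Unlike plain mollification, the averages therefore need no values from outside `K`, and the kernel
is admissible up to the boundary. -/
lemma isTest_contractKernel (hK : Convex ℝ K) (hρ : Metric.closedBall c ρ.rOut ⊆ K)
    (h0 : 0 < ε) (h1 : ε < 1) {x : ℝ × ℝ} (hx : x ∈ K) :
    IsTest K fun y => contractKernel ρ ε ((1 - ε) • x - y) := by
  set A : Set (ℝ × ℝ) := (fun z => (1 - ε) • x + ε • z) '' Metric.closedBall c ρ.rOut with hA
  have hAc : IsCompact A := (isCompact_closedBall c ρ.rOut).image (by fun_prop)
  have hsub : Function.support (fun y => contractKernel ρ ε ((1 - ε) • x - y)) ⊆ A := by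
    intro y hy
    obtain ⟨z, hz, hzy⟩ := support_contractKernel_subset ρ h0
      (show (1 - ε) • x - y ∈ Function.support (contractKernel ρ ε) from hy)
    refine ⟨z, hz, ?_⟩
    simp only at hzy ⊢
    have : ε • z = -((1 - ε) • x - y) := by rw [← hzy, neg_neg]
    rw [this]; abel
  refine ⟨(contDiff_contractKernel ρ).comp (by fun_prop),
    HasCompactSupport.of_support_subset_isCompact hAc hsub, ?_⟩
  refine (closure_minimal hsub hAc.isClosed).trans ?_
  rintro _ ⟨z, hz, rfl⟩
  exact hK hx (hρ hz) (by linarith) h0.le (by ring)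

/-- The derivative falls on the kernel, and the definition of the weak derivative, with the kernel
as test function, moves it to `V`. The factor `1 - ε` is the derivative of the contraction. -/
lemma pderiv_contractAverage_of_isWeakPartial (hK : Convex ℝ K) (hKm : MeasurableSet K)
    (hρ : Metric.closedBall c ρ.rOut ⊆ K) (h0 : 0 < ε) (h1 : ε < 1) {V g : ℝ × ℝ → ℝ}
    (hV : IntegrableOn V K) {i : Fin 2} (hg : IsWeakPartial K i V g) {x : ℝ × ℝ} (hx : x ∈ K) :
    pderiv i (contractAverage (bumpMeasure ρ) ε (K.indicator V)) x =
      (1 - ε) * contractAverage (bumpMeasure ρ) ε (K.indicator g) x := by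
  rw [pderiv_contractAverage ρ h0 ((integrable_indicator_iff hKm).2 hV), contractAverage,
    ← contractKernel_integral_eq ρ h0]
  congr 1
  have hw := hg _ (isTest_contractKernel ρ hK hρ h0 h1 hx)
  have hd : ∀ y, pderiv i (fun y => contractKernel ρ ε ((1 - ε) • x - y)) y =
      -pderiv i (contractKernel ρ ε) ((1 - ε) • x - y) := by
    intro y
    have hk := ((contDiff_contractKernel ρ (ε := ε)).differentiable (by simp)
      ((1 - ε) • x - y)).hasFDerivAt
    have := (hk.comp y ((hasFDerivAt_id y).const_sub ((1 - ε) • x))).fderiv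
    simp only [Function.comp_def] at this
    rw [pderiv, this]
    simp [pderiv]
  simp only [hd, mul_neg, integral_neg, neg_inj] at hw
  have hind : ∀ (F k : ℝ × ℝ → ℝ), ∫ y, K.indicator F y * k y = ∫ y in K, F y * k y := by
    intro F k
    rw [← integral_indicator hKm]
    congr 1
    ext y
    by_cases hy : y ∈ K <;> simp [hy]
  rw [hind, hind _ (fun y => contractKernel ρ ε ((1 - ε) • x - y)), hw]

end Kernel

lemma IsRefDomain.exists_bump {K : Set (ℝ × ℝ)} (hK : IsRefDomain K) :
    ∃ (c : ℝ × ℝ) (ρ : ContDiffBump c), Metric.closedBall c ρ.rOut ⊆ K := by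
  obtain ⟨c, hc⟩ := hK.nonempty
  obtain ⟨r, hr, hrK⟩ := Metric.nhds_basis_closedBall.mem_iff.1 (hK.isOpen.mem_nhds hc)
  exact ⟨c, ⟨r / 2, r, by positivity, by linarith⟩, hrK⟩

lemma norm_le_one_of_mem {K : Set (ℝ × ℝ)} (hK : IsRefDomain K) {z : ℝ × ℝ} (hz : z ∈ K) :
    ‖z‖ ≤ 1 := by
  obtain ⟨h1, h2, h3, h4⟩ := hK.subset hz
  rw [Prod.norm_def, Real.norm_eq_abs, Real.norm_eq_abs, abs_of_pos h1, abs_of_pos h3]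
  exact max_le h2.le h4.le

lemma eventually_nsq_contractAverage_sub_le {K : Set (ℝ × ℝ)} (hK : IsRefDomain K) {c : ℝ × ℝ}
    (ρ : ContDiffBump c) (hρ : Metric.closedBall c ρ.rOut ⊆ K) {v : ℝ × ℝ → ℝ}
    (hv : Measurable v) (hv2 : MemLp v 2 (volume.restrict K)) {b : ℝ → ℝ}
    (hb : Tendsto b (𝓝[>] 0) (𝓝 1)) {η : ℝ≥0∞} (hη : η ≠ 0) :
    ∀ᶠ ε in 𝓝[>] (0 : ℝ), nsq K (fun x => b ε * contractAverage (bumpMeasure ρ) ε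
      (K.indicator v) x - v x) ≤ η := by
  have hp := isProbabilityMeasure_bumpMeasure ρ
  have hKm := hK.measurableSet
  have : IsFiniteMeasure (volume.restrict K) := ⟨by simpa using hK.volume_lt_top⟩
  have hV2 : MemLp (K.indicator v) 2 volume := (memLp_indicator_iff_restrict hKm).2 hv2
  have hVm : Measurable (K.indicator v) := hv.indicator hKm
  have hVi : Integrable (K.indicator v) :=
    (integrable_indicator_iff hKm).2 (hv2.integrable one_le_two)
  filter_upwards [eventually_dilation_sub_sq_le hVm hV2 1 hb hη, self_mem_nhdsWithin]
    with ε h1 h0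
  have hbd : ∀ᵐ z ∂(bumpMeasure ρ), ∫⁻ x in K,
      ‖b ε * K.indicator v ((1 - ε) • x + ε • z) - K.indicator v x‖ₑ ^ 2 ≤ η := by
    filter_upwards [ae_bumpMeasure_mem ρ] with z hz
    exact (setLIntegral_le_lintegral _ _).trans (h1 z (norm_le_one_of_mem hK (hρ hz)))
  refine le_trans (le_of_eq ?_) (lintegral_enorm_integral_sq_le (μ := volume.restrict K)
    (by fun_prop) hbd)
  refine setLIntegral_congr_fun hKm fun x hx => ?_
  simp only
  rw [integral_sub ((integrable_comp_bumpMeasure ρ h0 hVi _).const_mul _) (integrable_const _),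
    integral_const_mul, contractAverage, indicator_of_mem hx]
  simp

/-- The difference quotient `(v x - v y) / |x - y| ^ (1 + s)` is an `L²` function of the pair `(x,
y)`. Contracting both points towards the same `z` is a dilation of the pair towards `(z, z)`, and
continuity of dilations in `L²` gives convergence in the seminorm. -/
lemma eventually_slobSq_contractAverage_sub_le {K : Set (ℝ × ℝ)} (hK : IsRefDomain K) {c : ℝ × ℝ}
    (ρ : ContDiffBump c) (hρ : Metric.closedBall c ρ.rOut ⊆ K) {s : ℝ} {v : ℝ × ℝ → ℝ}
    (hv : Measurable v) (hv2 : MemLp v 2 (volume.restrict K)) (hvs : slobSq K s v < ⊤)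
    {η : ℝ≥0∞} (hη : η ≠ 0) :
    ∀ᶠ ε in 𝓝[>] (0 : ℝ), slobSq K s (fun x => contractAverage (bumpMeasure ρ) ε
      (K.indicator v) x - v x) ≤ η := by
  have hp := isProbabilityMeasure_bumpMeasure ρ
  have hKm := hK.measurableSet
  have hKK : MeasurableSet (K ×ˢ K) := hKm.prod hKm
  have : IsFiniteMeasure (volume.restrict K) := ⟨by simpa using hK.volume_lt_top⟩
  have hVi : Integrable (K.indicator v) :=
    (integrable_indicator_iff hKm).2 (hv2.integrable one_le_two)
  have hsq : ∀ {r : ℝ}, 0 ≤ r → (r ^ (1 + s)) ^ 2 = r ^ (2 + 2 * s) := fun hr => by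
    rw [← Real.rpow_natCast, ← Real.rpow_mul hr]; congr 1; push_cast; ring
  have hkey : ∀ f : ℝ × ℝ → ℝ, ∀ x y : ℝ × ℝ,
      ENNReal.ofReal ((f x - f y) ^ 2 / eucl x y ^ (2 + 2 * s)) =
        ‖(f x - f y) / eucl x y ^ (1 + s)‖ₑ ^ 2 := fun f x y => by
    rw [enorm_sq_eq, div_pow, hsq (eucl_nonneg x y)]
  set G : (ℝ × ℝ) × (ℝ × ℝ) → ℝ :=
    (K ×ˢ K).indicator fun p => (v p.1 - v p.2) / eucl p.1 p.2 ^ (1 + s) with hG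
  have hG0 : Measurable fun p : (ℝ × ℝ) × (ℝ × ℝ) => (v p.1 - v p.2) / eucl p.1 p.2 ^ (1 + s) := by
    fun_prop
  have hGm : Measurable G := hG0.indicator hKK
  have hprod : ∀ F : (ℝ × ℝ) × (ℝ × ℝ) → ℝ≥0∞, Measurable F →
      ∫⁻ p in K ×ˢ K, F p = ∫⁻ x in K, ∫⁻ y in K, F (x, y) := fun F hF => by
    rw [Measure.volume_eq_prod, ← Measure.prod_restrict, lintegral_prod _ hF.aemeasurable]
  have hG2 : MemLp G 2 volume := by
    rw [memLp_indicator_iff_restrict hKK]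
    refine ⟨hG0.aestronglyMeasurable, ?_⟩
    have h2 : eLpNorm (fun p : (ℝ × ℝ) × (ℝ × ℝ) => (v p.1 - v p.2) / eucl p.1 p.2 ^ (1 + s)) 2
        (volume.restrict (K ×ˢ K)) ^ 2 = slobSq K s v := by
      rw [← lintegral_enorm_sq_eq, hprod _ (by fun_prop), slobSq]
      simp_rw [hkey]
    by_contra h
    rw [not_lt, top_le_iff] at h
    rw [h] at h2
    simp at h2
    exact hvs.ne h2.symm
  -- Contraction multiplies `|x - y|` by `1 - ε`; this factor restores the denominator of the
  -- difference quotient.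
  have hb : Tendsto (fun ε : ℝ => (1 - ε) ^ (1 + s)) (𝓝[>] 0) (𝓝 1) := by
    have : ContinuousAt (fun ε : ℝ => (1 - ε) ^ (1 + s)) 0 :=
      ContinuousAt.rpow_const (by fun_prop) (Or.inl (by norm_num))
    have h := this.tendsto.mono_left (nhdsWithin_le_nhds (s := Ioi 0))
    simpa using h
  have hlt : ∀ᶠ ε in 𝓝[>] (0 : ℝ), ε < 1 :=
    (eventually_lt_nhds one_pos).filter_mono nhdsWithin_le_nhds
  filter_upwards [eventually_dilation_sub_sq_le hGm hG2 1 hb hη, self_mem_nhdsWithin, hlt]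
    with ε h1 h0 hε1
  have h0 : 0 < ε := h0
  set H : (ℝ × ℝ) × (ℝ × ℝ) → ℝ × ℝ → ℝ := fun p z =>
    (1 - ε) ^ (1 + s) * G ((1 - ε) • p + ε • (z, z)) - G p with hH
  have hHm : Measurable (Function.uncurry H) := by
    simp only [hH, Function.uncurry_def]
    fun_prop
  have hbd : ∀ᵐ z ∂(bumpMeasure ρ), ∫⁻ p in K ×ˢ K, ‖H p z‖ₑ ^ 2 ≤ η := by
    filter_upwards [ae_bumpMeasure_mem ρ] with z hz
    refine (setLIntegral_le_lintegral _ _).trans (h1 (z, z) ?_)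
    rw [Prod.norm_def]
    exact max_le (norm_le_one_of_mem hK (hρ hz)) (norm_le_one_of_mem hK (hρ hz))
  refine le_trans (le_of_eq ?_) (lintegral_enorm_integral_sq_le
    (μ := volume.restrict (K ×ˢ K)) hHm hbd)
  rw [hprod _ (hHm.stronglyMeasurable.integral_prod_right.measurable.enorm.pow_const 2), slobSq]
  refine setLIntegral_congr_fun hKm fun x hx => setLIntegral_congr_fun hKm fun y hy => ?_
  rw [hkey (fun x => contractAverage (bumpMeasure ρ) ε (K.indicator v) x - v x)]
  congr 2
  have hHz : ∀ᵐ z ∂(bumpMeasure ρ), H (x, y) z =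
      ((K.indicator v ((1 - ε) • x + ε • z) - K.indicator v ((1 - ε) • y + ε • z)) -
        (v x - v y)) / eucl x y ^ (1 + s) := by
    filter_upwards [ae_bumpMeasure_mem ρ] with z hz
    have hxz : (1 - ε) • x + ε • z ∈ K :=
      hK.convex hx (hρ hz) (by linarith) h0.le (by ring)
    have hyz : (1 - ε) • y + ε • z ∈ K :=
      hK.convex hy (hρ hz) (by linarith) h0.le (by ring)
    have hsum : (1 - ε) • (x, y) + ε • (z, z) = ((1 - ε) • x + ε • z, (1 - ε) • y + ε • z) := rfl
    have he : eucl ((1 - ε) • x + ε • z) ((1 - ε) • y + ε • z) = (1 - ε) * eucl x y := by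
      unfold eucl
      rw [← Real.sqrt_sq (by linarith : 0 ≤ 1 - ε), ← Real.sqrt_mul (sq_nonneg _)]
      congr 1
      simp only [Prod.fst_add, Prod.snd_add, Prod.smul_fst, Prod.smul_snd, smul_eq_mul,
        Real.sqrt_sq (by linarith : 0 ≤ 1 - ε)]
      ring
    have hpos : 0 < (1 - ε) ^ (1 + s) := Real.rpow_pos_of_pos (by linarith) _
    simp only [hH, hsum, hG]
    rw [indicator_of_mem (mk_mem_prod hxz hyz), indicator_of_mem (mk_mem_prod hx hy),
      indicator_of_mem hxz, indicator_of_mem hyz]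
    simp only
    rw [he, Real.mul_rpow (by linarith) (eucl_nonneg _ _)]
    field_simp
  have hI := fun x => integrable_comp_bumpMeasure ρ h0 hVi ((1 - ε) • x)
  have hI2 : Integrable (fun z => K.indicator v ((1 - ε) • x + ε • z) -
    K.indicator v ((1 - ε) • y + ε • z)) (bumpMeasure ρ) := (hI x).sub (hI y)
  rw [integral_congr_ae hHz, integral_div, integral_sub hI2 (integrable_const _),
    integral_sub (hI x) (hI y), integral_const]
  simp only [contractAverage, probReal_univ, one_smul]
  ring

/-- Density of smooth functions in the Slobodeckij spaces. -/
lemma exists_smooth_slobSq {K : Set (ℝ × ℝ)} (hK : IsRefDomain K) {s : ℝ}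
    {v : ℝ × ℝ → ℝ} (hv : Measurable v) (hv2 : MemLp v 2 (volume.restrict K))
    (hvs : slobSq K s v < ⊤) {η : ℝ≥0∞} (hη : η ≠ 0) :
    ∃ w : ℝ × ℝ → ℝ, ContDiff ℝ (⊤ : ℕ∞) w ∧ nsq K (fun x => w x - v x) ≤ η ∧
      slobSq K s (fun x => w x - v x) ≤ η := by
  obtain ⟨c, ρ, hρ⟩ := hK.exists_bump
  have : IsFiniteMeasure (volume.restrict K) := ⟨by simpa using hK.volume_lt_top⟩
  have hVi : Integrable (K.indicator v) :=
    (integrable_indicator_iff hK.measurableSet).2 (hv2.integrable one_le_two)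
  obtain ⟨ε, ⟨h1, h2⟩, h0⟩ := (((eventually_nsq_contractAverage_sub_le hK ρ hρ hv hv2
    (b := fun _ => 1) tendsto_const_nhds hη).and
    (eventually_slobSq_contractAverage_sub_le hK ρ hρ hv hv2 hvs hη)).and
    self_mem_nhdsWithin).exists
  refine ⟨_, contDiff_contractAverage ρ h0 hVi, ?_, h2⟩
  simpa using h1

/-- Density of smooth functions in `H¹`. -/
lemma exists_smooth_h1 {K : Set (ℝ × ℝ)} (hK : IsRefDomain K)
    {v : ℝ × ℝ → ℝ} (hv : Measurable v) (hv2 : MemLp v 2 (volume.restrict K)) {g : Field2}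
    (hg : ∀ i, Measurable (g i)) (hg2 : ∀ i, MemLp (g i) 2 (volume.restrict K))
    (hvg : ∀ i, IsWeakPartial K i v (g i)) {η : ℝ≥0∞} (hη : η ≠ 0) :
    ∃ w : ℝ × ℝ → ℝ, ContDiff ℝ (⊤ : ℕ∞) w ∧ nsq K (fun x => w x - v x) ≤ η ∧
      ∀ i, nsq K (fun x => pderiv i w x - g i x) ≤ η := by
  obtain ⟨c, ρ, hρ⟩ := hK.exists_bump
  have : IsFiniteMeasure (volume.restrict K) := ⟨by simpa using hK.volume_lt_top⟩
  have hVi : Integrable (K.indicator v) :=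
    (integrable_indicator_iff hK.measurableSet).2 (hv2.integrable one_le_two)
  have hlt : ∀ᶠ ε in 𝓝[>] (0 : ℝ), ε < 1 :=
    (eventually_lt_nhds one_pos).filter_mono nhdsWithin_le_nhds
  have hb : Tendsto (fun ε : ℝ => 1 - ε) (𝓝[>] 0) (𝓝 1) := by
    have : Continuous fun ε : ℝ => 1 - ε := by fun_prop
    have h := (this.tendsto 0).mono_left (nhdsWithin_le_nhds (s := Ioi 0))
    simpa using h
  have hgr : ∀ᶠ ε in 𝓝[>] (0 : ℝ), ∀ i, nsq K (fun x => (1 - ε) *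
      contractAverage (bumpMeasure ρ) ε (K.indicator (g i)) x - g i x) ≤ η :=
    eventually_all.2 fun i =>
      eventually_nsq_contractAverage_sub_le hK ρ hρ (hg i) (hg2 i) hb hη
  obtain ⟨ε, ⟨⟨h1, h2⟩, hε1⟩, h0⟩ := ((((eventually_nsq_contractAverage_sub_le hK ρ hρ hv hv2
    (b := fun _ => 1) tendsto_const_nhds hη).and hgr).and hlt).and
    self_mem_nhdsWithin).exists
  refine ⟨_, contDiff_contractAverage ρ h0 hVi, by simpa using h1, fun i => ?_⟩
  refine le_trans (le_of_eq ?_) (h2 i)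
  refine setLIntegral_congr_fun hK.measurableSet fun x hx => ?_
  simp only
  rw [pderiv_contractAverage_of_isWeakPartial ρ hK.convex hK.measurableSet hρ h0 hε1
    (hv2.integrable one_le_two) (hvg i) hx]

/-! ### The embedding of `H¹` -/

lemma continuous_pderiv {w : ℝ × ℝ → ℝ} (hw : ContDiff ℝ 1 w) (i : Fin 2) :
    Continuous (pderiv i w) :=
  (hw.continuous_fderiv one_ne_zero).clm_apply continuous_const

lemma fderiv_apply_eq_pderiv (w : ℝ × ℝ → ℝ) (x h : ℝ × ℝ) :
    fderiv ℝ w x h = h.1 * pderiv 0 w x + h.2 * pderiv 1 w x := by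
  have : h = h.1 • unitVec 0 + h.2 • unitVec 1 := by
    ext <;> simp [unitVec]
  conv_lhs => rw [this]
  rw [map_add, map_smul, map_smul]
  rfl

/-- The fundamental theorem of calculus on the segment from `x` to `x + h`, with Cauchy–Schwarz in
the parameter and in the two components. -/
lemma sq_sub_le_lintegral_pderiv {w : ℝ × ℝ → ℝ} (hw : ContDiff ℝ 1 w) (x h : ℝ × ℝ) :
    ‖w x - w (x + h)‖ₑ ^ 2 ≤ ENNReal.ofReal (eucl x (x + h) ^ 2) *
      ∫⁻ τ in Ioo (0 : ℝ) 1, (‖pderiv 0 w (x + τ • h)‖ₑ ^ 2 + ‖pderiv 1 w (x + τ • h)‖ₑ ^ 2) := by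
  have hd : ∀ τ : ℝ, HasDerivAt (fun τ : ℝ => w (x + τ • h)) (fderiv ℝ w (x + τ • h) h) τ := by
    intro τ
    have h1 := (hw.differentiable one_ne_zero (x + τ • h)).hasFDerivAt
    have h2 : HasDerivAt (fun τ : ℝ => x + τ • h) h τ := by
      simpa using ((hasDerivAt_id τ).smul_const h).const_add x
    exact h1.comp_hasDerivAt τ h2
  have hc : Continuous fun τ : ℝ => fderiv ℝ w (x + τ • h) h :=
    ((hw.continuous_fderiv one_ne_zero).comp (by fun_prop)).clm_apply continuous_const
  have hftc := intervalIntegral.integral_eq_sub_of_hasDerivAt (a := 0) (b := 1)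
    (fun τ _ => hd τ) (hc.intervalIntegrable 0 1)
  rw [one_smul, zero_smul, add_zero, intervalIntegral.integral_of_le zero_le_one,
    integral_Ioc_eq_integral_Ioo] at hftc
  rw [← enorm_neg, neg_sub, ← hftc]
  refine (ennreal_sq_le_sq (enorm_integral_le_lintegral_enorm _)).trans ?_
  refine (sq_lintegral_le hc.measurable.enorm.aemeasurable).trans ?_
  rw [Measure.restrict_apply_univ, Real.volume_Ioo, sub_zero, ENNReal.ofReal_one, one_mul,
    ← lintegral_const_mul' _ _ (by simp)]
  refine lintegral_mono fun τ => ?_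
  rw [enorm_sq_eq, enorm_sq_eq, enorm_sq_eq, ← ENNReal.ofReal_add (by positivity) (by positivity),
    ← ENNReal.ofReal_mul (by positivity)]
  refine ENNReal.ofReal_le_ofReal ?_
  rw [fderiv_apply_eq_pderiv, eucl, Real.sq_sqrt (by positivity)]
  simp only [Prod.fst_add, Prod.snd_add]
  nlinarith [sq_nonneg (h.1 * pderiv 1 w (x + τ • h) - h.2 * pderiv 0 w (x + τ • h))]

lemma lintegral_abs_mul_abs_rpow_lt_top :
    ∫⁻ h in Ioo (-1 : ℝ) 1 ×ˢ Ioo (-1 : ℝ) 1,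
      ENNReal.ofReal (|h.1| ^ (-(3 / 4) : ℝ)) * ENNReal.ofReal (|h.2| ^ (-(3 / 4) : ℝ)) < ⊤ := by
  rw [Measure.volume_eq_prod, ← Measure.prod_restrict,
    lintegral_prod_mul (f := fun x : ℝ => ENNReal.ofReal (|x| ^ (-(3 / 4) : ℝ)))
      (g := fun x : ℝ => ENNReal.ofReal (|x| ^ (-(3 / 4) : ℝ))) (by fun_prop) (by fun_prop)]
  have := lintegral_abs_rpow_lt_top (p := -(3 / 4)) (by norm_num)
  exact ENNReal.mul_lt_top this this

/-- Put `y = x + h` and integrate in `x` first. For each `h`, translation invariance produces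
`‖∇w‖²` times `|h| ^ (2 - 7/2) = |h| ^ (-3/2)`, which is at most `|h₁| ^ (-3/4) |h₂| ^ (-3/4)` and
hence integrable. Convexity of `K` keeps the segments in `K`. -/
lemma exists_slobSq_le_of_contDiff :
    ∃ C : ℝ≥0, ∀ (K : Set (ℝ × ℝ)) (w : ℝ × ℝ → ℝ), IsRefDomain K → ContDiff ℝ 1 w →
      slobSq K (3 / 4) w ≤ C * ∑ i, nsq K (pderiv i w) := by
  set S : Set (ℝ × ℝ) := Ioo (-1 : ℝ) 1 ×ˢ Ioo (-1 : ℝ) 1 with hS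
  set J := ∫⁻ h in S, ENNReal.ofReal (|h.1| ^ (-(3 / 4) : ℝ)) *
    ENNReal.ofReal (|h.2| ^ (-(3 / 4) : ℝ)) with hJ
  have hJt : J ≠ ⊤ := lintegral_abs_mul_abs_rpow_lt_top.ne
  refine ⟨J.toNNReal, fun K w hK hw => ?_⟩
  rw [ENNReal.coe_toNNReal hJt]
  have hKm := hK.measurableSet
  have hSm : MeasurableSet S := measurableSet_Ioo.prod measurableSet_Ioo
  have hwm : Measurable w := hw.continuous.measurable
  have hp0 := (continuous_pderiv hw 0).measurable
  have hp1 := (continuous_pderiv hw 1).measurable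
  set D : ℝ × ℝ → ℝ≥0∞ := fun x => ‖pderiv 0 w x‖ₑ ^ 2 + ‖pderiv 1 w x‖ₑ ^ 2 with hD
  have hDm : Measurable D := by fun_prop
  have hDint : ∫⁻ x in K, D x = ∑ i, nsq K (pderiv i w) := by
    rw [Fin.sum_univ_two, nsq, nsq, ← lintegral_add_left (by fun_prop)]
  set A : (ℝ × ℝ) × (ℝ × ℝ) → ℝ≥0∞ := fun p => {p : (ℝ × ℝ) × (ℝ × ℝ) |
    p.1 ∈ K ∧ p.1 + p.2 ∈ K}.indicator (fun p => ENNReal.ofReal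
      ((w p.1 - w (p.1 + p.2)) ^ 2 / eucl p.1 (p.1 + p.2) ^ (2 + 2 * (3 / 4 : ℝ)))) p with hA
  have hset : MeasurableSet {p : (ℝ × ℝ) × (ℝ × ℝ) | p.1 ∈ K ∧ p.1 + p.2 ∈ K} :=
    (measurable_fst hKm).inter ((measurable_fst.add measurable_snd) hKm)
  have hAm : Measurable A := by
    refine Measurable.indicator ?_ hset
    have : Measurable fun p : (ℝ × ℝ) × (ℝ × ℝ) => eucl p.1 (p.1 + p.2) :=
      measurable_eucl.comp (f := fun p : (ℝ × ℝ) × (ℝ × ℝ) => (p.1, p.1 + p.2)) (by fun_prop)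
    fun_prop
  have h1 : slobSq K (3 / 4) w = ∫⁻ x, ∫⁻ h, A (x, h) := by
    rw [slobSq, ← lintegral_indicator hKm]
    refine lintegral_congr fun x => ?_
    by_cases hx : x ∈ K
    · rw [indicator_of_mem hx, ← lintegral_indicator hKm,
        ← lintegral_add_left_eq_self (μ := (volume : Measure (ℝ × ℝ))) _ x]
      refine lintegral_congr fun h => ?_
      by_cases hh : x + h ∈ K
      · rw [indicator_of_mem hh, hA]
        simp only
        rw [indicator_of_mem (show (x, h) ∈ {p : (ℝ × ℝ) × (ℝ × ℝ) | p.1 ∈ K ∧ p.1 + p.2 ∈ K}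
          from ⟨hx, hh⟩)]
      · rw [indicator_of_notMem hh, hA]
        simp only
        rw [indicator_of_notMem (fun h' => hh h'.2)]
    · rw [indicator_of_notMem hx]
      refine (lintegral_zero.symm.trans (lintegral_congr fun h => ?_))
      rw [hA]
      simp only
      rw [indicator_of_notMem (fun h' => hx h'.1)]
  -- On the coordinate axes the negative powers are zero by convention and the bound may fail; the
  -- axes are null sets.
  have hne : ∀ᵐ h : ℝ × ℝ, h.1 ≠ 0 ∧ h.2 ≠ 0 := by
    have h0 : ∀ᵐ x : ℝ, x ≠ 0 := by simp [ae_iff]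
    exact (Measure.quasiMeasurePreserving_fst.ae h0).and (Measure.quasiMeasurePreserving_snd.ae h0)
  have h2 : ∀ h : ℝ × ℝ, h.1 ≠ 0 ∧ h.2 ≠ 0 → ∫⁻ x, A (x, h) ≤ S.indicator (fun h =>
      ENNReal.ofReal (|h.1| ^ (-(3 / 4) : ℝ)) * ENNReal.ofReal (|h.2| ^ (-(3 / 4) : ℝ)) *
        ∫⁻ x in K, D x) h := by
    intro h hz
    by_cases hh : h ∈ S
    swap
    · rw [indicator_of_notMem hh]
      refine (lintegral_congr fun x => ?_).trans lintegral_zero |>.le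
      rw [hA]
      simp only
      refine indicator_of_notMem (fun h' => hh ?_) _
      obtain ⟨k1, k2, k3, k4⟩ := hK.subset h'.1
      obtain ⟨m1, m2, m3, m4⟩ := hK.subset h'.2
      simp only [Prod.fst_add, Prod.snd_add] at *
      exact ⟨⟨by linarith, by linarith⟩, ⟨by linarith, by linarith⟩⟩
    rw [indicator_of_mem hh]
    set e := Real.sqrt (h.1 ^ 2 + h.2 ^ 2) with he
    have he0 : 0 < e := Real.sqrt_pos.2 (by have := hz.1; positivity)
    have hex : ∀ x : ℝ × ℝ, eucl x (x + h) = e := fun x => by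
      unfold eucl; simp [he]
    have hker : e ^ 2 / e ^ (2 + 2 * (3 / 4 : ℝ)) ≤ |h.1| ^ (-(3 / 4) : ℝ) * |h.2| ^ (-(3 / 4) : ℝ) := by
      have a1 : |h.1| ≤ e := Real.abs_le_sqrt (by nlinarith [sq_nonneg h.2])
      have a2 : |h.2| ≤ e := Real.abs_le_sqrt (by nlinarith [sq_nonneg h.1])
      have : e ^ 2 / e ^ (2 + 2 * (3 / 4 : ℝ)) = e ^ (-(3 / 4) : ℝ) * e ^ (-(3 / 4) : ℝ) := by
        rw [← Real.rpow_natCast, ← Real.rpow_sub he0, ← Real.rpow_add he0]; norm_num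
      rw [this]
      exact mul_le_mul (Real.rpow_le_rpow_of_nonpos (abs_pos.2 hz.1) a1 (by norm_num))
        (Real.rpow_le_rpow_of_nonpos (abs_pos.2 hz.2) a2 (by norm_num)) (by positivity)
        (by positivity)
    calc ∫⁻ x, A (x, h)
        ≤ ∫⁻ x, ENNReal.ofReal (e ^ 2 / e ^ (2 + 2 * (3 / 4 : ℝ))) *
            ∫⁻ τ in Ioo (0 : ℝ) 1, K.indicator D (x + τ • h) := by
          refine lintegral_mono fun x => ?_
          rw [hA]
          simp only
          by_cases hx : x ∈ K ∧ x + h ∈ K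
          swap
          · rw [indicator_of_notMem (show (x, h) ∉ {p : (ℝ × ℝ) × (ℝ × ℝ) |
              p.1 ∈ K ∧ p.1 + p.2 ∈ K} from hx)]
            exact zero_le
          rw [indicator_of_mem (show (x, h) ∈ {p : (ℝ × ℝ) × (ℝ × ℝ) | p.1 ∈ K ∧ p.1 + p.2 ∈ K}
            from hx)]
          simp only
          have hτ : ∫⁻ τ in Ioo (0 : ℝ) 1, K.indicator D (x + τ • h) =
              ∫⁻ τ in Ioo (0 : ℝ) 1, D (x + τ • h) := by
            refine setLIntegral_congr_fun measurableSet_Ioo fun τ hτ => ?_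
            refine indicator_of_mem ?_ _
            have := hK.convex hx.1 hx.2 (by linarith [hτ.2] : 0 ≤ 1 - τ) hτ.1.le (by ring)
            convert this using 1
            rw [sub_smul, one_smul, smul_add]; abel
          have hsq := sq_sub_le_lintegral_pderiv hw x h
          rw [hex] at hsq ⊢
          rw [hτ, div_eq_mul_inv ((w x - w (x + h)) ^ 2), ENNReal.ofReal_mul (by positivity), ← enorm_sq_eq,
            div_eq_mul_inv (e ^ 2), ENNReal.ofReal_mul (by positivity)]
          calc ‖w x - w (x + h)‖ₑ ^ 2 * ENNReal.ofReal (e ^ (2 + 2 * (3 / 4 : ℝ)))⁻¹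
              ≤ (ENNReal.ofReal (e ^ 2) * ∫⁻ τ in Ioo (0 : ℝ) 1, D (x + τ • h)) *
                  ENNReal.ofReal (e ^ (2 + 2 * (3 / 4 : ℝ)))⁻¹ := by gcongr
            _ = _ := by ring
      _ = ENNReal.ofReal (e ^ 2 / e ^ (2 + 2 * (3 / 4 : ℝ))) *
            ∫⁻ τ in Ioo (0 : ℝ) 1, ∫⁻ x in K, D x := by
          have hmm : Measurable fun p : (ℝ × ℝ) × ℝ => K.indicator D (p.1 + p.2 • h) :=
            (hDm.indicator hKm).comp (by fun_prop)
          rw [lintegral_const_mul' _ _ (by simp), lintegral_lintegral_swap hmm.aemeasurable]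
          congr 1
          refine lintegral_congr fun τ => ?_
          rw [lintegral_add_right_eq_self (μ := (volume : Measure (ℝ × ℝ))) (K.indicator D) (τ • h),
            lintegral_indicator hKm]
      _ ≤ _ := by
          rw [setLIntegral_const, Real.volume_Ioo, sub_zero, ENNReal.ofReal_one, mul_one,
            ← ENNReal.ofReal_mul (by positivity)]
          gcongr
  rw [h1, lintegral_lintegral_swap hAm.aemeasurable, ← hDint]
  refine (lintegral_mono_ae (hne.mono h2)).trans (le_of_eq ?_)
  rw [lintegral_indicator hSm, lintegral_mul_const _ (by fun_prop)]

lemma integral_mul_pderiv_eq_neg {K : Set (ℝ × ℝ)} {w : ℝ × ℝ → ℝ} (hw : ContDiff ℝ 1 w)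
    (i : Fin 2) : IsWeakPartial K i w (pderiv i w) := by
  rintro φ ⟨hφ, hφc, hφK⟩
  have hφ1 : ContDiff ℝ 1 φ := hφ.of_le (by exact_mod_cast le_top)
  have hc : HasCompactSupport (pderiv i φ) := hφc.fderiv_apply ℝ (unitVec i)
  have h1 : ∀ f : ℝ × ℝ → ℝ, ∫ x in K, f x * φ x = ∫ x, f x * φ x := fun f => by
    refine setIntegral_eq_integral_of_forall_compl_eq_zero fun x hx => ?_
    rw [image_eq_zero_of_notMem_tsupport (fun h => hx (hφK h)), mul_zero]
  have h2 : ∫ x in K, w x * pderiv i φ x = ∫ x, w x * pderiv i φ x := by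
    refine setIntegral_eq_integral_of_forall_compl_eq_zero fun x hx => ?_
    have : x ∉ tsupport (fderiv ℝ φ) := fun h => hx (hφK (tsupport_fderiv_subset ℝ h))
    rw [pderiv, image_eq_zero_of_notMem_tsupport this, zero_apply, mul_zero]
  rw [h1, h2]
  refine integral_mul_fderiv_eq_neg_fderiv_mul_of_integrable ?_ ?_ ?_
    (fun x _ => hw.differentiable one_ne_zero x) (fun x _ => hφ1.differentiable one_ne_zero x)
  · exact ((continuous_pderiv hw i).mul hφ.continuous).integrable_of_hasCompactSupport
      hφc.mul_left
  · exact (hw.continuous.mul (continuous_pderiv hφ1 i)).integrable_of_hasCompactSupport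
      hc.mul_left
  · exact (hw.continuous.mul hφ.continuous).integrable_of_hasCompactSupport hφc.mul_left

lemma IsWeakPartial.congr {K : Set (ℝ × ℝ)} {i : Fin 2} {v v' g g' : ℝ × ℝ → ℝ}
    (h : IsWeakPartial K i v g) (hv : v =ᵐ[volume.restrict K] v')
    (hg : g =ᵐ[volume.restrict K] g') : IsWeakPartial K i v' g' := by
  intro φ hφ
  have h1 : ∫ x in K, v' x * pderiv i φ x = ∫ x in K, v x * pderiv i φ x :=
    integral_congr_ae (hv.mono fun x hx => by simp only [hx])
  have h2 : ∫ x in K, g' x * φ x = ∫ x in K, g x * φ x :=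
    integral_congr_ae (hg.mono fun x hx => by simp only [hx])
  rw [h1, h2, h φ hφ]

lemma IsWeakPartial.sub {K : Set (ℝ × ℝ)} {i : Fin 2} {v v' g g' : ℝ × ℝ → ℝ}
    (h : IsWeakPartial K i v g) (h' : IsWeakPartial K i v' g')
    (hv : IntegrableOn v K) (hv' : IntegrableOn v' K) (hg : IntegrableOn g K)
    (hg' : IntegrableOn g' K) :
    IsWeakPartial K i (fun x => v x - v' x) (fun x => g x - g' x) := by
  intro φ hφ
  have hφ1 : ContDiff ℝ 1 φ := hφ.1.of_le (by exact_mod_cast le_top)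
  have hc : HasCompactSupport (pderiv i φ) := hφ.2.1.fderiv_apply ℝ (unitVec i)
  obtain ⟨C, hC⟩ := hφ.2.1.exists_bound_of_continuous hφ.1.continuous
  obtain ⟨C', hC'⟩ := hc.exists_bound_of_continuous (continuous_pderiv hφ1 i)
  have m1 : ∀ f : ℝ × ℝ → ℝ, IntegrableOn f K → IntegrableOn (fun x => f x * φ x) K := fun f hf =>
    hf.mul_bdd (c := C) hφ.1.continuous.aestronglyMeasurable (ae_of_all _ hC)
  have m2 : ∀ f : ℝ × ℝ → ℝ, IntegrableOn f K → IntegrableOn (fun x => f x * pderiv i φ x) K :=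
    fun f hf => hf.mul_bdd (c := C') (continuous_pderiv hφ1 i).aestronglyMeasurable
      (ae_of_all _ hC')
  simp only [sub_mul]
  rw [integral_sub (m2 v hv) (m2 v' hv'), integral_sub (m1 g hg) (m1 g' hg'), h φ hφ, h' φ hφ]
  ring

lemma IsRefDomain.memLp_of_continuous {K : Set (ℝ × ℝ)} (hK : IsRefDomain K) {w : ℝ × ℝ → ℝ}
    (hw : Continuous w) : MemLp w 2 (volume.restrict K) := by
  have : IsFiniteMeasure (volume.restrict K) := ⟨by simpa using hK.volume_lt_top⟩
  obtain ⟨C, hC⟩ := hK.isCompact_closure.exists_bound_of_continuousOn hw.continuousOn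
  exact MemLp.of_bound hw.aestronglyMeasurable C
    (ae_restrict_of_forall_mem hK.measurableSet fun x hx => hC x (subset_closure hx))

lemma h1Seminorm_le {K : Set (ℝ × ℝ)} {v : ℝ × ℝ → ℝ} {g : Field2}
    (hg2 : ∀ i, MemLp (g i) 2 (volume.restrict K)) (hvg : ∀ i, IsWeakPartial K i v (g i)) :
    h1Seminorm K v ^ 2 ≤ ∑ i, nsq K (g i) := by
  have : h1Seminorm K v ≤ (∑ i, l2Norm K (g i) ^ 2) ^ (1 / 2 : ℝ) :=
    iInf₂_le g fun i => ⟨hg2 i, hvg i⟩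
  refine (ennreal_sq_le_sq this).trans ?_
  rw [ennreal_rpow_half_sq]
  simp_rw [l2Norm_sq]
  rfl

lemma exists_weakPartial_of_h1Seminorm_lt_top {K : Set (ℝ × ℝ)} {v : ℝ × ℝ → ℝ}
    {a : ℝ≥0∞} (h : h1Seminorm K v < a) :
    ∃ g : Field2, (∀ i, Measurable (g i)) ∧ (∀ i, MemLp (g i) 2 (volume.restrict K)) ∧
      (∀ i, IsWeakPartial K i v (g i)) ∧ ∑ i, nsq K (g i) ≤ a ^ 2 := by
  obtain ⟨g, hg⟩ := iInf_lt_iff.1 h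
  obtain ⟨hg', hga⟩ := iInf_lt_iff.1 hg
  have hae : ∀ i, g i =ᵐ[volume.restrict K] (hg' i).1.1.mk (g i) := fun i =>
    (hg' i).1.1.ae_eq_mk
  refine ⟨fun i => (hg' i).1.1.mk (g i), fun i => (hg' i).1.1.stronglyMeasurable_mk.measurable,
    fun i => (memLp_congr_ae (hae i)).1 (hg' i).1,
    fun i => (hg' i).2.congr (ae_eq_refl _) (hae i), ?_⟩
  have := ennreal_sq_le_sq hga.le
  rw [ennreal_rpow_half_sq] at this
  refine le_trans (le_of_eq (Finset.sum_congr rfl fun i _ => ?_)) this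
  rw [l2Norm_sq]
  exact lintegral_congr_ae ((hae i).mono fun x hx => by simp only [hx])

/-- Fatou's lemma, once for each of the two integrals. -/
lemma slobSq_le_liminf {K : Set (ℝ × ℝ)} {s : ℝ} {v : ℝ × ℝ → ℝ}
    {w : ℕ → ℝ × ℝ → ℝ} (hw : ∀ n, Measurable (w n))
    (h : ∀ᵐ x ∂(volume.restrict K), Tendsto (fun n => w n x) atTop (𝓝 (v x))) :
    slobSq K s v ≤ liminf (fun n => slobSq K s (w n)) atTop := by
  obtain ⟨F, hF, hFm⟩ : ∃ F : ℕ → (ℝ × ℝ) × (ℝ × ℝ) → ℝ≥0∞,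
      (∀ n x y, F n (x, y) = ENNReal.ofReal ((w n x - w n y) ^ 2 / eucl x y ^ (2 + 2 * s))) ∧
        ∀ n, Measurable (F n) := ⟨_, fun _ _ _ => rfl, fun n => measurable_kernel (hw n)⟩
  have h1 : ∀ n, slobSq K s (w n) = ∫⁻ x in K, ∫⁻ y in K, F n (x, y) := fun n => by
    simp only [hF]; rfl
  simp only [h1]
  calc slobSq K s v ≤ ∫⁻ x in K, ∫⁻ y in K, liminf (fun n => F n (x, y)) atTop := by
        refine lintegral_mono_ae (h.mono fun x hx => lintegral_mono_ae (h.mono fun y hy => ?_))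
        simp only [hF]
        exact (ENNReal.tendsto_ofReal (((hx.sub hy).pow 2).div_const _)).liminf_eq.ge
    _ ≤ ∫⁻ x in K, liminf (fun n => ∫⁻ y in K, F n (x, y)) atTop :=
        lintegral_mono fun x => lintegral_liminf_le fun n => (hFm n).comp measurable_prodMk_left
    _ ≤ _ := lintegral_liminf_le fun n => (hFm n).lintegral_prod_right'

/-- The embedding of `H¹` into the Slobodeckij space of order `3/4`. -/
lemma exists_slobSq_le_h1Seminorm :
    ∃ C : ℝ≥0, ∀ (K : Set (ℝ × ℝ)) (v : ℝ × ℝ → ℝ), IsRefDomain K → Measurable v →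
      MemLp v 2 (volume.restrict K) → slobSq K (3 / 4) v ≤ C * h1Seminorm K v ^ 2 := by
  obtain ⟨C, hC⟩ := exists_slobSq_le_of_contDiff
  -- The constant must not be zero, so that the right-hand side is infinite when `v` has no weak
  -- gradient in `L²`.
  refine ⟨(C + 1) * 4, fun K v hK hv hv2 => ?_⟩
  -- The seminorm is an infimum, so the bound is shown for every larger `a`, with a gradient of norm
  -- at most `a`, and `a` is decreased at the end.
  have key : ∀ a : ℝ≥0∞, h1Seminorm K v < a → slobSq K (3 / 4) v ≤ C * (2 * a ^ 2) := by
    intro a ha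
    obtain ⟨g, hgm, hg2, hvg, hga⟩ := exists_weakPartial_of_h1Seminorm_lt_top ha
    have hη : ∀ n : ℕ, ((n : ℝ≥0∞) + 1)⁻¹ ≠ 0 := fun n => ENNReal.inv_ne_zero.2 (by finiteness)
    choose w hw hwv hwg using fun n : ℕ => exists_smooth_h1 hK hv hv2 hgm hg2 hvg (hη n)
    have hlim : Tendsto (fun n : ℕ => ((n : ℝ≥0∞) + 1)⁻¹) atTop (𝓝 0) := by
      have := (ENNReal.tendsto_inv_nat_nhds_zero).comp (tendsto_add_atTop_nat 1)
      simpa [Function.comp_def] using this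
    have hconv : Tendsto (fun n => eLpNorm (w n - v) 2 (volume.restrict K)) atTop (𝓝 0) := by
      have h2 : ∀ n, eLpNorm (w n - v) 2 (volume.restrict K) ≤
          (((n : ℝ≥0∞) + 1)⁻¹) ^ (1 / 2 : ℝ) := fun n => by
        refine ennreal_le_of_sq_le ?_
        rw [← lintegral_enorm_sq_eq, ennreal_rpow_half_sq]
        exact hwv n
      refine tendsto_of_tendsto_of_tendsto_of_le_of_le tendsto_const_nhds ?_
        (fun n => zero_le) h2
      simpa [Function.comp_def] using (ENNReal.continuous_rpow_const (y := 1 / 2)).tendsto 0 |>.comp hlim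
    obtain ⟨ns, hns, hae⟩ := (tendstoInMeasure_of_tendsto_eLpNorm two_ne_zero
      (fun n => (hw n).continuous.aestronglyMeasurable) hv2.1 hconv).exists_seq_tendsto_ae
    refine (slobSq_le_liminf (fun n => (hw (ns n)).continuous.measurable) hae).trans ?_
    have hbd : ∀ n, slobSq K (3 / 4) (w (ns n)) ≤
        C * (2 * (a ^ 2 + 2 * (((ns n : ℕ) : ℝ≥0∞) + 1)⁻¹)) := by
      intro n
      refine (hC K _ hK ((hw _).of_le (by exact_mod_cast le_top))).trans ?_
      gcongr
      have h3 : ∀ i, nsq K (pderiv i (w (ns n))) ≤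
          2 * (nsq K (g i) + (((ns n : ℕ) : ℝ≥0∞) + 1)⁻¹) := by
        intro i
        have := nsq_add_le K (v := g i) (w := fun x => pderiv i (w (ns n)) x - g i x) (hgm i)
        simp only [add_sub_cancel] at this
        refine this.trans ?_
        gcongr
        exact hwg _ i
      refine (Finset.sum_le_sum fun i _ => h3 i).trans ?_
      rw [← Finset.mul_sum, Finset.sum_add_distrib]
      gcongr
      simp [two_mul]
    have hlim2 : Tendsto (fun n => (C : ℝ≥0∞) *
        (2 * (a ^ 2 + 2 * (((ns n : ℕ) : ℝ≥0∞) + 1)⁻¹))) atTop (𝓝 (C * (2 * (a ^ 2 + 2 * 0)))) := by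
      refine ENNReal.Tendsto.const_mul (ENNReal.Tendsto.const_mul (Tendsto.const_add _
        (ENNReal.Tendsto.const_mul (hlim.comp hns.tendsto_atTop) ?_)) ?_) ?_ <;> simp
    refine (liminf_le_liminf (Eventually.of_forall hbd)).trans ?_
    rw [hlim2.liminf_eq]
    simp
  rcases eq_or_ne (h1Seminorm K v) ⊤ with ht | ht
  · rw [ht]
    refine le_trans le_top (le_of_eq ?_)
    rw [ENNReal.top_pow two_ne_zero, ENNReal.mul_top]
    simp
  have hlim : Tendsto (fun n : ℕ => (C : ℝ≥0∞) *
      (2 * (h1Seminorm K v + (((n : ℕ) : ℝ≥0∞) + 1)⁻¹) ^ 2)) atTop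
      (𝓝 (C * (2 * (h1Seminorm K v + 0) ^ 2))) := by
    have h0 : Tendsto (fun n : ℕ => ((n : ℝ≥0∞) + 1)⁻¹) atTop (𝓝 0) := by
      have := (ENNReal.tendsto_inv_nat_nhds_zero).comp (tendsto_add_atTop_nat 1)
      simpa [Function.comp_def] using this
    refine ENNReal.Tendsto.const_mul (ENNReal.Tendsto.const_mul
      (ENNReal.Tendsto.pow (h0.const_add _)) ?_) ?_ <;> simp
  have hle := ge_of_tendsto' hlim fun n => key _ (ENNReal.lt_add_right ht
    (ENNReal.inv_ne_zero.2 (by finiteness)))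
  refine hle.trans ?_
  rw [add_zero, ← mul_assoc]
  gcongr
  push_cast
  calc (C : ℝ≥0∞) * 2 ≤ (C + 1) * 4 := by
        gcongr
        · exact le_self_add
        · norm_num

/-! ### Weights with singularities at the corners -/

/-- The corners of the reference square. -/
def corners : Finset (ℝ × ℝ) := ({0, 1} : Finset ℝ) ×ˢ ({0, 1} : Finset ℝ)

lemma mem_corners {a : ℝ × ℝ} : a ∈ corners ↔ (a.1 = 0 ∨ a.1 = 1) ∧ (a.2 = 0 ∨ a.2 = 1) := by
  simp [corners]

/-- The sum of the inverse distances to the corners. -/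
def cornerWeight (x : ℝ × ℝ) : ℝ := ∑ a ∈ corners, (dist x a)⁻¹

lemma measurable_cornerWeight : Measurable cornerWeight := by
  unfold cornerWeight
  fun_prop

lemma cornerWeight_nonneg (x : ℝ × ℝ) : 0 ≤ cornerWeight x :=
  Finset.sum_nonneg fun _ _ => inv_nonneg.2 dist_nonneg

lemma inv_dist_le_cornerWeight {a : ℝ × ℝ} (ha : a ∈ corners) (x : ℝ × ℝ) :
    (dist x a)⁻¹ ≤ cornerWeight x :=
  Finset.single_le_sum (f := fun a => (dist x a)⁻¹) (fun _ _ => inv_nonneg.2 dist_nonneg) ha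

lemma notMem_corners_of_mem_refSquare {x : ℝ × ℝ} (hx : x ∈ refSquare) : x ∉ corners := by
  obtain ⟨h1, h2, h3, h4⟩ := hx
  rw [mem_corners]
  rintro ⟨h | h, -⟩ <;> linarith

lemma one_le_cornerWeight {x : ℝ × ℝ} (hx : x ∈ refSquare) : 1 ≤ cornerWeight x := by
  have h0 : (0, 0) ∈ corners := by simp [mem_corners]
  refine le_trans ?_ (inv_dist_le_cornerWeight h0 x)
  refine one_le_inv_iff₀.2 ⟨dist_pos.2 fun h => notMem_corners_of_mem_refSquare hx (h ▸ h0), ?_⟩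
  obtain ⟨h1, h2, h3, h4⟩ := hx
  rw [Prod.dist_eq, Real.dist_eq, Real.dist_eq]
  refine max_le ?_ ?_ <;> rw [abs_le] <;> constructor <;> simp <;> linarith

/-- `v` is integrable against the inverse distances to the corners. -/
def CornerIntegrable (K : Set (ℝ × ℝ)) (v : ℝ × ℝ → ℝ) : Prop :=
  Measurable v ∧ IntegrableOn (fun x => v x * cornerWeight x) K

/-- Hardy's inequality at each of the four corners. This makes `(u, ∇φ)` an absolutely convergent
integral for every `s > 0` and supplies the dominating functions in all limits below. -/
lemma cornerIntegrable_of_slobSq_lt_top {K : Set (ℝ × ℝ)} (hK : IsRefDomain K) {s : ℝ}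
    (h0 : 0 < s) (h1 : s < 1) {v : ℝ × ℝ → ℝ} (hv : Measurable v) (hv2 : nsq K v < ⊤)
    (hvs : slobSq K s v < ⊤) : CornerIntegrable K v := by
  obtain ⟨C, hC⟩ := exists_hardy h0 h1.le
  refine ⟨hv, (hv.mul measurable_cornerWeight).aestronglyMeasurable, ?_⟩
  have h : ∀ a ∈ corners, ∫⁻ x in K, ‖v x‖ₑ * ENNReal.ofReal (dist x a)⁻¹ < ⊤ := fun a ha => by
    obtain ⟨ha1, ha2⟩ := mem_corners.1 ha
    have := hC K a v hK hv ha1 ha2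
    have h2 : (C : ℝ≥0∞) * (nsq K v + slobSq K s v) < ⊤ :=
      ENNReal.mul_lt_top ENNReal.coe_lt_top (ENNReal.add_lt_top.2 ⟨hv2, hvs⟩)
    have h3 := this.trans_lt h2
    rwa [ENNReal.pow_lt_top_iff, or_iff_left two_ne_zero] at h3
  have heq : ∀ x, ‖v x * cornerWeight x‖ₑ = ∑ a ∈ corners, ‖v x‖ₑ * ENNReal.ofReal (dist x a)⁻¹ := by
    intro x
    rw [enorm_mul, ← Finset.mul_sum, ← ENNReal.ofReal_sum_of_nonneg
      (fun _ _ => inv_nonneg.2 dist_nonneg), Real.enorm_of_nonneg (cornerWeight_nonneg x)]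
    rfl
  rw [hasFiniteIntegral_def]
  simp only [heq]
  rw [lintegral_finsetSum _ fun a _ => by fun_prop]
  exact ENNReal.sum_lt_top.2 h

lemma cornerIntegrable_const {K : Set (ℝ × ℝ)} (hK : IsRefDomain K) (m : ℝ) :
    CornerIntegrable K fun _ => m := by
  refine cornerIntegrable_of_slobSq_lt_top hK (s := 1 / 2) (by norm_num) (by norm_num)
    measurable_const ?_ ?_
  · rw [nsq, setLIntegral_const]
    exact ENNReal.mul_lt_top (by simp [ENNReal.pow_lt_top_iff]) hK.volume_lt_top
  · simp [slobSq]

lemma CornerIntegrable.sub {K : Set (ℝ × ℝ)} {v w : ℝ × ℝ → ℝ} (hv : CornerIntegrable K v)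
    (hw : CornerIntegrable K w) : CornerIntegrable K fun x => v x - w x :=
  ⟨hv.1.sub hw.1, by simpa only [sub_mul, Pi.sub_def] using hv.2.sub hw.2⟩

lemma CornerIntegrable.mul_of_le {K : Set (ℝ × ℝ)} (hK : MeasurableSet K) {v : ℝ × ℝ → ℝ}
    (hv : CornerIntegrable K v) {f : ℝ × ℝ → ℝ} {M : ℝ}
    (hf : AEStronglyMeasurable f (volume.restrict K))
    (hM : ∀ x ∈ K, |f x| ≤ M * cornerWeight x) : IntegrableOn (fun x => v x * f x) K := by
  refine Integrable.mono' (g := fun x => M * ‖v x * cornerWeight x‖) (hv.2.norm.const_mul M)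
    (hv.1.aestronglyMeasurable.mul hf) (ae_restrict_of_forall_mem hK fun x hx => ?_)
  rw [norm_mul, norm_mul, Real.norm_of_nonneg (cornerWeight_nonneg x), Real.norm_eq_abs (f x)]
  calc ‖v x‖ * |f x| ≤ ‖v x‖ * (M * cornerWeight x) := by gcongr; exact hM x hx
    _ = _ := by ring

lemma CornerIntegrable.integrableOn {K : Set (ℝ × ℝ)} (hK : IsRefDomain K) {v : ℝ × ℝ → ℝ}
    (hv : CornerIntegrable K v) : IntegrableOn v K := by
  have := hv.mul_of_le hK.measurableSet (f := fun _ => 1) (M := 1) aestronglyMeasurable_const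
    fun x hx => by rw [abs_one, one_mul]; exact one_le_cornerWeight (hK.subset hx)
  simpa using this

lemma CornerIntegrable.mul_continuous {K : Set (ℝ × ℝ)} (hK : IsRefDomain K) {v w : ℝ × ℝ → ℝ}
    (hv : CornerIntegrable K v) (hw : Continuous w) : CornerIntegrable K fun x => v x * w x := by
  refine ⟨hv.1.mul hw.measurable, ?_⟩
  obtain ⟨C, hC⟩ := hK.isCompact_closure.exists_bound_of_continuousOn hw.continuousOn
  have := hv.mul_of_le hK.measurableSet (f := fun x => w x * cornerWeight x) (M := C)
    (hw.measurable.mul measurable_cornerWeight).aestronglyMeasurable fun x hx => by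
      rw [abs_mul, abs_of_nonneg (cornerWeight_nonneg x)]
      exact mul_le_mul_of_nonneg_right (hC x (subset_closure hx)) (cornerWeight_nonneg x)
  simpa only [mul_assoc] using this

/-! ### The reference polygons -/

/-- `K` is a reference domain with the given edges, `lam j` being positive in `K` and vanishing on
the edge `j` only. -/
structure IsRefPolygon {n : ℕ} (K : Set (ℝ × ℝ)) (edge : Fin n → Edge)
    (lam : Fin n → ℝ × ℝ → ℝ) : Prop where
  isRefDomain : IsRefDomain K
  contDiff : ∀ j, ContDiff ℝ (⊤ : ℕ∞) (lam j)
  pos : ∀ x ∈ K, ∀ j, 0 < lam j x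
  mem_of_pos : ∀ x, (∀ j, 0 < lam j x) → x ∈ K
  nonneg : ∀ x ∈ closure K, ∀ j, 0 ≤ lam j x
  mem_segment : ∀ x ∈ closure K, ∀ j, lam j x = 0 → x ∈ segment ℝ (edge j).1 (edge j).2
  mem_closure : ∀ j, ∀ x ∈ openSegment ℝ (edge j).1 (edge j).2, x ∈ closure K
  eq_zero : ∀ j, ∀ x ∈ openSegment ℝ (edge j).1 (edge j).2, lam j x = 0
  pos_of_ne : ∀ j, ∀ x ∈ openSegment ℝ (edge j).1 (edge j).2, ∀ k, k ≠ j → 0 < lam k x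
  vertex : ∀ j, (edge j).1 ∈ corners ∧ (edge j).2 ∈ corners
  exists_le : ∃ c > 0, ∀ i, ∀ x ∈ closure K,
    c * min (dist x (edge i).1) (dist x (edge i).2) ≤
      lam i x + ∏ k ∈ Finset.univ.erase i, lam k x

/-- The sections of `K` in the direction `j` are the intervals `(α t, β t)`, from the edge `lo` to
the edge `hi`. -/
structure IsSectioned {n : ℕ} (K : Set (ℝ × ℝ)) (edge : Fin n → Edge) (j : Fin 2)
    (α β : ℝ → ℝ) (lo hi : Fin n) : Prop where
  lt : ∀ t ∈ Ioo (0 : ℝ) 1, α t < β t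
  sub_le : ∀ t ∈ Ioo (0 : ℝ) 1, β t - α t ≤ 1
  section_eq : ∀ t ∈ Ioo (0 : ℝ) 1, {r | pt j r t ∈ K} = Ioo (α t) (β t)
  lo_mem : ∀ t ∈ Ioo (0 : ℝ) 1, pt j (α t) t ∈ openSegment ℝ (edge lo).1 (edge lo).2
  hi_mem : ∀ t ∈ Ioo (0 : ℝ) 1, pt j (β t) t ∈ openSegment ℝ (edge hi).1 (edge hi).2

lemma min_dist_le {x a b : ℝ × ℝ} {D : ℝ} (h : (|x.1 - a.1| ≤ D ∧ |x.2 - a.2| ≤ D) ∨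
    (|x.1 - b.1| ≤ D ∧ |x.2 - b.2| ≤ D)) : min (dist x a) (dist x b) ≤ D := by
  rw [min_le_iff, Prod.dist_eq, Prod.dist_eq, max_le_iff, max_le_iff]
  exact h

/-- The distances to the sides of the square. -/
def squareDist : Fin 4 → ℝ × ℝ → ℝ :=
  ![fun x => x.2, fun x => 1 - x.1, fun x => 1 - x.2, fun x => x.1]

/-- Multiples of the distances to the sides of the triangle. -/
def triangleDist : Fin 3 → ℝ × ℝ → ℝ :=
  ![fun x => x.2, fun x => 1 - x.1, fun x => x.1 - x.2]

lemma closure_refSquare_eq : closure refSquare = Icc 0 1 ×ˢ Icc 0 1 := by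
  have : refSquare = Ioo 0 1 ×ˢ Ioo 0 1 := by
    ext x; simp [refSquare, and_assoc]
  rw [this, closure_prod_eq, closure_Ioo zero_ne_one]

lemma mem_closure_refTriangle {x : ℝ × ℝ} (h0 : 0 ≤ x.2) (h1 : x.2 ≤ x.1) (h2 : x.1 ≤ 1) :
    x ∈ closure refTriangle := by
  -- The segment towards the interior point `(2/3, 1/3)` enters the triangle immediately.
  have hc : Tendsto (fun τ : ℝ => (x.1 + τ * (2 / 3 - x.1), x.2 + τ * (1 / 3 - x.2))) (𝓝[>] 0)
      (𝓝 x) := by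
    have : Continuous fun τ : ℝ => (x.1 + τ * (2 / 3 - x.1), x.2 + τ * (1 / 3 - x.2)) := by
      fun_prop
    have h := this.tendsto 0
    simp only [zero_mul, add_zero] at h
    exact h.mono_left nhdsWithin_le_nhds
  refine mem_closure_of_tendsto hc ?_
  filter_upwards [Ioo_mem_nhdsGT (zero_lt_one (α := ℝ))] with τ hτ
  obtain ⟨hτ0, hτ1⟩ := hτ
  refine ⟨?_, ?_, ?_, ?_⟩ <;> simp only <;> nlinarith

/-- Here `q` is the distance to an edge of the square, `p` the position along it, and `p (1 - p) (1
- q)` the product of the other distances. If `p ≤ 1/2`, then `1 - p ≥ 1/2` and twice the sum is at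
least `2 q + p (1 - q) ≥ p`; the case `p ≥ 1/2` is symmetric. This shows that the denominator of the
edge cutoff vanishes at the end points at most linearly. -/
lemma le_add_prod_of_mem_unit {p q : ℝ} (h0 : 0 ≤ p) (h1 : p ≤ 1) (h2 : 0 ≤ q) (h3 : q ≤ 1) :
    q ≤ 2 * (q + p * (1 - p) * (1 - q)) ∧
      (p ≤ 2 * (q + p * (1 - p) * (1 - q)) ∨ 1 - p ≤ 2 * (q + p * (1 - p) * (1 - q))) := by
  have h4 := mul_nonneg (mul_nonneg h0 (sub_nonneg.2 h1)) (sub_nonneg.2 h3)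
  refine ⟨by linarith, ?_⟩
  have a1 := mul_nonneg h0 (sub_nonneg.2 h3)
  have a2 := mul_nonneg (sub_nonneg.2 h1) (sub_nonneg.2 h3)
  have a3 := mul_nonneg h0 h2
  have a4 := mul_nonneg (sub_nonneg.2 h1) h2
  rcases le_total p (1 / 2) with h | h
  · left
    nlinarith [mul_nonneg a1 (sub_nonneg.2 h)]
  · right
    nlinarith [mul_nonneg a2 (sub_nonneg.2 h)]

lemma isRefPolygon_square : IsRefPolygon refSquare squareEdge squareDist where
  isRefDomain := Or.inl rfl
  contDiff j := by fin_cases j <;> simp [squareDist] <;> fun_prop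
  pos x hx j := by
    obtain ⟨h1, h2, h3, h4⟩ := hx
    fin_cases j <;> simp [squareDist] <;> assumption
  mem_of_pos x h := by
    have h0 := h 0; have h1 := h 1; have h2 := h 2; have h3 := h 3
    simp [squareDist] at h0 h1 h2 h3
    exact ⟨h3, h1, h0, h2⟩
  nonneg x hx j := by
    rw [closure_refSquare_eq] at hx
    obtain ⟨⟨h1, h2⟩, h3, h4⟩ := hx
    fin_cases j <;> simp [squareDist] <;> assumption
  mem_segment x hx j h := by
    rw [closure_refSquare_eq] at hx
    obtain ⟨⟨h1, h2⟩, h3, h4⟩ := hx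
    rw [segment_eq_image']
    fin_cases j <;> simp [squareDist, squareEdge] at h ⊢
    · exact ⟨x.1, ⟨h1, h2⟩, by ext <;> simp [h]⟩
    · exact ⟨x.2, ⟨h3, h4⟩, by ext <;> simp; linarith⟩
    · exact ⟨1 - x.1, ⟨by linarith, by linarith⟩, by ext <;> simp; linarith⟩
    · exact ⟨1 - x.2, ⟨by linarith, by linarith⟩, by ext <;> simp [h]⟩
  mem_closure j x hx := by
    rw [closure_refSquare_eq]
    rw [openSegment_eq_image'] at hx
    obtain ⟨τ, ⟨h0, h1⟩, rfl⟩ := hx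
    fin_cases j <;> simp [squareEdge] <;> (try constructor) <;> linarith
  eq_zero j x hx := by
    rw [openSegment_eq_image'] at hx
    obtain ⟨τ, ⟨h0, h1⟩, rfl⟩ := hx
    fin_cases j <;> simp [squareEdge, squareDist]
  pos_of_ne j x hx k hk := by
    rw [openSegment_eq_image'] at hx
    obtain ⟨τ, ⟨h0, h1⟩, rfl⟩ := hx
    fin_cases j <;> fin_cases k <;> simp [squareEdge, squareDist] at hk ⊢ <;> assumption
  vertex j := by fin_cases j <;> simp [squareEdge, mem_corners]
  exists_le := by
    refine ⟨1 / 2, by norm_num, fun i x hx => ?_⟩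
    rw [closure_refSquare_eq] at hx
    obtain ⟨⟨h1, h2⟩, h3, h4⟩ := hx
    rw [← le_div_iff₀' (by norm_num), div_eq_mul_inv, one_div, inv_inv, mul_comm]
    have b0 := le_add_prod_of_mem_unit h1 h2 h3 h4
    have b1 := le_add_prod_of_mem_unit h3 h4 (sub_nonneg.2 h2) (sub_le_self 1 h1)
    have b2 := le_add_prod_of_mem_unit h1 h2 (sub_nonneg.2 h4) (sub_le_self 1 h3)
    have b3 := le_add_prod_of_mem_unit h3 h4 h1 h2
    have e0 : ∏ k ∈ Finset.univ.erase 0, squareDist k x = x.1 * (1 - x.1) * (1 - x.2) := by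
      rw [show Finset.univ.erase (0 : Fin 4) = {1, 2, 3} from by decide]
      simp [squareDist]; ring
    have e1 : ∏ k ∈ Finset.univ.erase 1, squareDist k x = x.2 * (1 - x.2) * (1 - (1 - x.1)) := by
      rw [show Finset.univ.erase (1 : Fin 4) = {0, 2, 3} from by decide]
      simp [squareDist]; ring
    have e2 : ∏ k ∈ Finset.univ.erase 2, squareDist k x = x.1 * (1 - x.1) * (1 - (1 - x.2)) := by
      rw [show Finset.univ.erase (2 : Fin 4) = {0, 1, 3} from by decide]
      simp [squareDist]; ring
    have e3 : ∏ k ∈ Finset.univ.erase 3, squareDist k x = x.2 * (1 - x.2) * (1 - x.1) := by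
      rw [show Finset.univ.erase (3 : Fin 4) = {0, 1, 2} from by decide]
      simp [squareDist]; ring
    refine min_dist_le ?_
    have f1 : |x.1| = x.1 := abs_of_nonneg h1
    have f2 : |x.2| = x.2 := abs_of_nonneg h3
    have f3 : |x.1 - 1| = 1 - x.1 := by rw [abs_sub_comm, abs_of_nonneg (sub_nonneg.2 h2)]
    have f4 : |x.2 - 1| = 1 - x.2 := by rw [abs_sub_comm, abs_of_nonneg (sub_nonneg.2 h4)]
    fin_cases i
    · simp only [Fin.zero_eta, e0]
      simp only [squareDist, squareEdge, Matrix.cons_val, sub_zero, f1, f2, f3]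
      tauto
    · simp only [Fin.mk_one, e1]
      simp only [squareDist, squareEdge, Matrix.cons_val, sub_zero, f2, f3, f4]
      tauto
    · simp only [Fin.reduceFinMk, e2]
      simp only [squareDist, squareEdge, Matrix.cons_val, sub_zero, f1, f3, f4]
      tauto
    · simp only [Fin.reduceFinMk, e3]
      simp only [squareDist, squareEdge, Matrix.cons_val, sub_zero, f1, f2, f4]
      tauto

lemma isRefPolygon_triangle : IsRefPolygon refTriangle triangleEdge triangleDist where
  isRefDomain := Or.inr rfl
  contDiff j := by fin_cases j <;> simp [triangleDist] <;> fun_prop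
  pos x hx j := by
    obtain ⟨h1, h2, h3, h4⟩ := hx
    fin_cases j <;> simp [triangleDist] <;> assumption
  mem_of_pos x h := by
    have h0 := h 0; have h1 := h 1; have h2 := h 2
    simp [triangleDist] at h0 h1 h2
    exact ⟨h0.trans h2, h1, h0, h2⟩
  nonneg x hx j := by
    obtain ⟨h1, h2, h3, h4⟩ := closure_refTriangle_subset hx
    fin_cases j <;> simp [triangleDist] <;> assumption
  mem_segment x hx j h := by
    obtain ⟨h1, h2, h3, h4⟩ := closure_refTriangle_subset hx
    rw [segment_eq_image']
    fin_cases j <;> simp [triangleDist, triangleEdge] at h ⊢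
    · exact ⟨x.1, ⟨h1, h2⟩, by ext <;> simp [h]⟩
    · exact ⟨x.2, ⟨h3, by linarith⟩, by ext <;> simp; linarith⟩
    · exact ⟨1 - x.1, ⟨by linarith, by linarith⟩, by ext <;> simp; linarith⟩
  mem_closure j x hx := by
    rw [openSegment_eq_image'] at hx
    obtain ⟨τ, ⟨h0, h1⟩, rfl⟩ := hx
    fin_cases j <;> refine mem_closure_refTriangle ?_ ?_ ?_ <;> simp [triangleEdge] <;> linarith
  eq_zero j x hx := by
    rw [openSegment_eq_image'] at hx
    obtain ⟨τ, ⟨h0, h1⟩, rfl⟩ := hx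
    fin_cases j <;> simp [triangleEdge, triangleDist]
  pos_of_ne j x hx k hk := by
    rw [openSegment_eq_image'] at hx
    obtain ⟨τ, ⟨h0, h1⟩, rfl⟩ := hx
    fin_cases j <;> fin_cases k <;> simp [triangleEdge, triangleDist] at hk ⊢ <;> assumption
  vertex j := by fin_cases j <;> simp [triangleEdge, mem_corners]
  exists_le := by
    refine ⟨1 / 2, by norm_num, fun i x hx => ?_⟩
    obtain ⟨h1, h2, h3, h4⟩ := closure_refTriangle_subset hx
    rw [← le_div_iff₀' (by norm_num), div_eq_mul_inv, one_div, inv_inv, mul_comm]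
    have e0 : ∏ k ∈ Finset.univ.erase 0, triangleDist k x = (1 - x.1) * (x.1 - x.2) := by
      rw [show Finset.univ.erase (0 : Fin 3) = {1, 2} from by decide]
      simp [triangleDist]
    have e1 : ∏ k ∈ Finset.univ.erase 1, triangleDist k x = x.2 * (x.1 - x.2) := by
      rw [show Finset.univ.erase (1 : Fin 3) = {0, 2} from by decide]
      simp [triangleDist]
    have e2 : ∏ k ∈ Finset.univ.erase 2, triangleDist k x = x.2 * (1 - x.1) := by
      rw [show Finset.univ.erase (2 : Fin 3) = {0, 1} from by decide]
      simp [triangleDist]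
    refine min_dist_le ?_
    have f1 : |x.1| = x.1 := abs_of_nonneg h1
    have f2 : |x.2| = x.2 := abs_of_nonneg h3
    have f3 : |x.1 - 1| = 1 - x.1 := by rw [abs_sub_comm, abs_of_nonneg (sub_nonneg.2 h2)]
    have f4 : |x.2 - 1| = 1 - x.2 := by
      rw [abs_sub_comm, abs_of_nonneg (sub_nonneg.2 (h4.trans h2))]
    have a1 := mul_nonneg h3 (sub_nonneg.2 h2)
    have a2 := mul_nonneg h3 (sub_nonneg.2 h4)
    have a3 := mul_nonneg (sub_nonneg.2 h2) (sub_nonneg.2 h4)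
    fin_cases i
    · simp only [Fin.zero_eta, e0]
      simp only [triangleDist, triangleEdge, Matrix.cons_val, sub_zero, f1, f2, f3]
      rcases le_total x.1 (1 / 2) with h | h
      · left; constructor <;> nlinarith
      · right; constructor <;> nlinarith
    · simp only [Fin.mk_one, e1]
      simp only [triangleDist, triangleEdge, Matrix.cons_val, sub_zero, f2, f3, f4]
      rcases le_total x.2 (1 / 2) with h | h
      · left; constructor <;> nlinarith
      · right; constructor <;> nlinarith
    · simp only [Fin.reduceFinMk, e2]
      simp only [triangleDist, triangleEdge, Matrix.cons_val, sub_zero, f1, f2, f3, f4]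
      rcases le_total x.2 (1 / 2) with h | h
      · right; constructor <;> nlinarith
      · left; constructor <;> nlinarith

/-! ### Sections of the square and the triangle. -/

lemma isSectioned_square_zero :
    IsSectioned refSquare squareEdge 0 (fun _ => 0) (fun _ => 1) 3 1 where
  lt _ _ := zero_lt_one
  sub_le _ _ := by simp
  section_eq t ht := refSquare_section 0 ht
  lo_mem t ht := by
    rw [openSegment_eq_image']
    exact ⟨1 - t, ⟨by linarith [ht.2], by linarith [ht.1]⟩, by ext <;> simp [squareEdge, pt]⟩
  hi_mem t ht := by
    rw [openSegment_eq_image']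
    exact ⟨t, ht, by ext <;> simp [squareEdge, pt]⟩

lemma isSectioned_square_one :
    IsSectioned refSquare squareEdge 1 (fun _ => 0) (fun _ => 1) 0 2 where
  lt _ _ := zero_lt_one
  sub_le _ _ := by simp
  section_eq t ht := refSquare_section 1 ht
  lo_mem t ht := by
    rw [openSegment_eq_image']
    exact ⟨t, ht, by ext <;> simp [squareEdge, pt]⟩
  hi_mem t ht := by
    rw [openSegment_eq_image']
    exact ⟨1 - t, ⟨by linarith [ht.2], by linarith [ht.1]⟩, by ext <;> simp [squareEdge, pt]⟩

lemma isSectioned_triangle_zero :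
    IsSectioned refTriangle triangleEdge 0 (fun t => t) (fun _ => 1) 2 1 where
  lt _ ht := ht.2
  sub_le _ ht := by linarith [ht.1]
  section_eq t ht := refTriangle_section_zero ht
  lo_mem t ht := by
    rw [openSegment_eq_image']
    exact ⟨1 - t, ⟨by linarith [ht.2], by linarith [ht.1]⟩, by ext <;> simp [triangleEdge, pt]⟩
  hi_mem t ht := by
    rw [openSegment_eq_image']
    exact ⟨t, ht, by ext <;> simp [triangleEdge, pt]⟩

lemma isSectioned_triangle_one :
    IsSectioned refTriangle triangleEdge 1 (fun _ => 0) (fun t => t) 0 2 where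
  lt _ ht := ht.1
  sub_le _ ht := by linarith [ht.2]
  section_eq t ht := refTriangle_section_one ht
  lo_mem t ht := by
    rw [openSegment_eq_image']
    exact ⟨t, ht, by ext <;> simp [triangleEdge, pt]⟩
  hi_mem t ht := by
    rw [openSegment_eq_image']
    exact ⟨1 - t, ⟨by linarith [ht.2], by linarith [ht.1]⟩, by ext <;> simp [triangleEdge, pt]⟩

/-! ### Functions that are regular away from the corners -/

/-- `φ` is `C¹` in `K`, continuous up to the boundary except at the corners, bounded, and its
gradient is of the order of the inverse distance to the corners. -/
def CornerRegular (K : Set (ℝ × ℝ)) (φ : ℝ × ℝ → ℝ) : Prop :=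
  ContDiffOn ℝ 1 φ K ∧ ContinuousOn φ (closure K \ corners) ∧
    ∃ M : ℝ, ∀ x ∈ K, |φ x| ≤ M ∧ ‖fderiv ℝ φ x‖ ≤ M * cornerWeight x

lemma norm_unitVec (i : Fin 2) : ‖unitVec i‖ = 1 := by
  fin_cases i <;> simp [unitVec, Prod.norm_def]

lemma abs_pderiv_le (i : Fin 2) (φ : ℝ × ℝ → ℝ) (x : ℝ × ℝ) :
    |pderiv i φ x| ≤ ‖fderiv ℝ φ x‖ := by
  have := (fderiv ℝ φ x).le_opNorm (unitVec i)
  rwa [norm_unitVec, mul_one] at this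

section

variable {K : Set (ℝ × ℝ)} {φ ψ : ℝ × ℝ → ℝ}

lemma CornerRegular.differentiableAt (hK : IsRefDomain K) (h : CornerRegular K φ) {x : ℝ × ℝ}
    (hx : x ∈ K) : DifferentiableAt ℝ φ x :=
  (h.1.differentiableOn one_ne_zero).differentiableAt (hK.isOpen.mem_nhds hx)

lemma CornerRegular.aestronglyMeasurable (hK : IsRefDomain K) (h : CornerRegular K φ) :
    AEStronglyMeasurable φ (volume.restrict K) :=
  h.1.continuousOn.aestronglyMeasurable hK.measurableSet

lemma CornerRegular.continuousOn_pderiv (hK : IsRefDomain K) (h : CornerRegular K φ) (i : Fin 2) :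
    ContinuousOn (pderiv i φ) K :=
  (h.1.continuousOn_fderiv_of_isOpen hK.isOpen le_rfl).clm_apply continuousOn_const

lemma CornerRegular.integrableOn_mul (hK : IsRefDomain K) (h : CornerRegular K φ)
    {d : ℝ × ℝ → ℝ} (hd : IntegrableOn d K) : IntegrableOn (fun x => d x * φ x) K := by
  obtain ⟨M, hM⟩ := h.2.2
  exact hd.mul_bdd (c := M) (h.aestronglyMeasurable hK)
    (ae_restrict_of_forall_mem hK.measurableSet fun x hx => (hM x hx).1)

lemma CornerRegular.integrableOn_mul_pderiv (hK : IsRefDomain K) (h : CornerRegular K φ)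
    {v : ℝ × ℝ → ℝ} (hv : CornerIntegrable K v) (i : Fin 2) :
    IntegrableOn (fun x => v x * pderiv i φ x) K := by
  obtain ⟨M, hM⟩ := h.2.2
  exact hv.mul_of_le hK.measurableSet (M := M)
    ((h.continuousOn_pderiv hK i).aestronglyMeasurable hK.measurableSet)
    fun x hx => (abs_pderiv_le i φ x).trans (hM x hx).2

lemma CornerRegular.mul (hK : IsRefDomain K) (h : CornerRegular K φ) (h' : CornerRegular K ψ) :
    CornerRegular K fun x => φ x * ψ x := by
  obtain ⟨M, hM⟩ := h.2.2
  obtain ⟨M', hM'⟩ := h'.2.2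
  refine ⟨h.1.mul h'.1, h.2.1.mul h'.2.1, 2 * (M * M'), fun x hx => ?_⟩
  have hx1 := hM x hx
  have hx2 := hM' x hx
  have hM0 : 0 ≤ M := (abs_nonneg _).trans hx1.1
  have hM0' : 0 ≤ M' := (abs_nonneg _).trans hx2.1
  refine ⟨?_, ?_⟩
  · rw [abs_mul]
    nlinarith [mul_le_mul hx1.1 hx2.1 (abs_nonneg _) hM0]
  · rw [fderiv_fun_mul (h.differentiableAt hK hx) (h'.differentiableAt hK hx)]
    refine (norm_add_le _ _).trans ?_
    rw [norm_smul, norm_smul, Real.norm_eq_abs, Real.norm_eq_abs]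
    have := mul_le_mul hx1.1 hx2.2 (norm_nonneg _) hM0
    have := mul_le_mul hx2.1 hx1.2 (norm_nonneg _) hM0'
    linarith

lemma CornerRegular.add (hK : IsRefDomain K) (h : CornerRegular K φ) (h' : CornerRegular K ψ) :
    CornerRegular K fun x => φ x + ψ x := by
  obtain ⟨M, hM⟩ := h.2.2
  obtain ⟨M', hM'⟩ := h'.2.2
  refine ⟨h.1.add h'.1, h.2.1.add h'.2.1, M + M', fun x hx => ⟨?_, ?_⟩⟩
  · exact (abs_add_le _ _).trans (add_le_add (hM x hx).1 (hM' x hx).1)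
  · rw [fderiv_fun_add (h.differentiableAt hK hx) (h'.differentiableAt hK hx), add_mul]
    exact (norm_add_le _ _).trans (add_le_add (hM x hx).2 (hM' x hx).2)

lemma cornerRegular_of_contDiff (hK : IsRefDomain K) {w : ℝ × ℝ → ℝ} (hw : ContDiff ℝ 1 w) :
    CornerRegular K w := by
  obtain ⟨C, hC⟩ := hK.isCompact_closure.exists_bound_of_continuousOn hw.continuous.continuousOn
  obtain ⟨C', hC'⟩ := hK.isCompact_closure.exists_bound_of_continuousOn
    (hw.continuous_fderiv one_ne_zero).continuousOn
  refine ⟨hw.contDiffOn, hw.continuous.continuousOn, max C C', fun x hx => ?_⟩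
  have h1 := hC x (subset_closure hx)
  have h2 := hC' x (subset_closure hx)
  refine ⟨h1.trans (le_max_left _ _), h2.trans ((le_max_right C C').trans ?_)⟩
  exact le_mul_of_one_le_right ((norm_nonneg _).trans (h1.trans (le_max_left _ _)))
    (one_le_cornerWeight (hK.subset hx))

lemma CornerRegular.const_mul (hK : IsRefDomain K) (h : CornerRegular K φ) (c : ℝ) :
    CornerRegular K fun x => c * φ x :=
  (cornerRegular_of_contDiff hK contDiff_const).mul hK h

lemma CornerRegular.sub (hK : IsRefDomain K) (h : CornerRegular K φ) (h' : CornerRegular K ψ) :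
    CornerRegular K fun x => φ x - ψ x := by
  simpa only [sub_eq_add_neg, neg_one_mul] using h.add hK (h'.const_mul hK (-1))

lemma pderiv_add (hK : IsRefDomain K) (h : CornerRegular K φ) (h' : CornerRegular K ψ) {x : ℝ × ℝ}
    (hx : x ∈ K) (i : Fin 2) :
    pderiv i (fun x => φ x + ψ x) x = pderiv i φ x + pderiv i ψ x := by
  rw [pderiv, fderiv_fun_add (h.differentiableAt hK hx) (h'.differentiableAt hK hx)]
  rfl

lemma pderiv_sub (hK : IsRefDomain K) (h : CornerRegular K φ) (h' : CornerRegular K ψ) {x : ℝ × ℝ}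
    (hx : x ∈ K) (i : Fin 2) :
    pderiv i (fun x => φ x - ψ x) x = pderiv i φ x - pderiv i ψ x := by
  rw [pderiv, fderiv_fun_sub (h.differentiableAt hK hx) (h'.differentiableAt hK hx)]
  rfl

lemma pderiv_mul (hK : IsRefDomain K) (h : CornerRegular K φ) (h' : CornerRegular K ψ) {x : ℝ × ℝ}
    (hx : x ∈ K) (i : Fin 2) :
    pderiv i (fun x => φ x * ψ x) x = φ x * pderiv i ψ x + ψ x * pderiv i φ x := by
  rw [pderiv, fderiv_fun_mul (h.differentiableAt hK hx) (h'.differentiableAt hK hx)]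
  rfl

end

/-! ### Cutoff functions for the edges -/

section

variable {n : ℕ} {K : Set (ℝ × ℝ)} {edge : Fin n → Edge} {lam : Fin n → ℝ × ℝ → ℝ} {i : Fin n}
  {φ : ℝ × ℝ → ℝ}

/-- Forgetting at which corners the singularities sit gives one class, closed under sums and
products, that contains the cutoffs of all edges. -/
lemma IsEdgeCutoff.cornerRegular (hP : IsRefPolygon K edge lam) (h : IsEdgeCutoff K edge i φ) :
    CornerRegular K φ := by
  obtain ⟨h1, h2, ⟨M, hM⟩, -, -⟩ := h
  have hv := hP.vertex i
  refine ⟨h1, h2.mono ?_, M, fun x hx => ⟨(hM x hx).1, ?_⟩⟩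
  · refine sdiff_subset_sdiff_right ?_
    rintro a (rfl | rfl)
    exacts [hv.1, hv.2]
  have hM0 : 0 ≤ M := (abs_nonneg _).trans (hM x hx).1
  have hne : ∀ a ∈ corners, 0 < dist x a := fun a ha => dist_pos.2 fun h =>
    notMem_corners_of_mem_refSquare (hP.isRefDomain.subset hx) (h ▸ ha)
  have hmin : 0 < min (dist x (edge i).1) (dist x (edge i).2) := lt_min (hne _ hv.1) (hne _ hv.2)
  calc ‖fderiv ℝ φ x‖ ≤ M * (min (dist x (edge i).1) (dist x (edge i).2))⁻¹ := by
        rw [← div_eq_mul_inv, le_div_iff₀ hmin]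
        exact (hM x hx).2
    _ ≤ M * cornerWeight x := by
        gcongr
        rcases min_choice (dist x (edge i).1) (dist x (edge i).2) with h | h <;> rw [h]
        · exact inv_dist_le_cornerWeight hv.1 x
        · exact inv_dist_le_cornerWeight hv.2 x

/-- This allows a cutoff to be concentrated near its edge, by multiplication with `stripCut`. -/
lemma IsEdgeCutoff.mul (hP : IsRefPolygon K edge lam) (h : IsEdgeCutoff K edge i φ)
    {w : ℝ × ℝ → ℝ} (hw : ContDiff ℝ 1 w)
    (hwe : ∀ x ∈ openSegment ℝ (edge i).1 (edge i).2, w x = 1) :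
    IsEdgeCutoff K edge i fun x => w x * φ x := by
  have hK := hP.isRefDomain
  obtain ⟨C, hC⟩ := hK.isCompact_closure.exists_bound_of_continuousOn hw.continuous.continuousOn
  obtain ⟨C', hC'⟩ := hK.isCompact_closure.exists_bound_of_continuousOn
    (hw.continuous_fderiv one_ne_zero).continuousOn
  have hφ := h.cornerRegular hP
  obtain ⟨h1, h2, ⟨M, hM⟩, h3, h4⟩ := h
  refine ⟨hw.contDiffOn.mul h1, hw.continuous.continuousOn.mul h2, ⟨C * M + M * C', ?_⟩,
    fun x hx => by simp only [hwe x hx, h3 x hx, one_mul],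
    fun j hj x hx => by simp only [h4 j hj x hx, mul_zero]⟩
  intro x hx
  obtain ⟨hx1, hx2⟩ := hM x hx
  have c1 := hC x (subset_closure hx)
  have c2 := hC' x (subset_closure hx)
  have hM0 : 0 ≤ M := (abs_nonneg _).trans hx1
  have hC0 : 0 ≤ C := (norm_nonneg _).trans c1
  have hC0' : 0 ≤ C' := (norm_nonneg _).trans c2
  refine ⟨?_, ?_⟩
  · rw [abs_mul]
    have := mul_le_mul c1 hx1 (abs_nonneg _) hC0
    rw [Real.norm_eq_abs] at this
    nlinarith [mul_nonneg hM0 hC0']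
  have hmin0 : 0 ≤ min (dist x (edge i).1) (dist x (edge i).2) := le_min dist_nonneg dist_nonneg
  have hmin1 : min (dist x (edge i).1) (dist x (edge i).2) ≤ 1 := by
    refine (min_le_left _ _).trans ?_
    obtain ⟨k1, k2, k3, k4⟩ := hK.subset hx
    obtain ⟨e1, e2⟩ := mem_corners.1 (hP.vertex i).1
    rw [Prod.dist_eq, Real.dist_eq, Real.dist_eq]
    refine max_le ?_ ?_ <;> rw [abs_le]
    · rcases e1 with e | e <;> rw [e] <;> constructor <;> linarith
    · rcases e2 with e | e <;> rw [e] <;> constructor <;> linarith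
  rw [fderiv_fun_mul (hw.differentiable one_ne_zero x) (hφ.differentiableAt hK hx)]
  calc ‖w x • fderiv ℝ φ x + φ x • fderiv ℝ w x‖ * min (dist x (edge i).1) (dist x (edge i).2)
      ≤ (‖w x‖ * ‖fderiv ℝ φ x‖ + |φ x| * ‖fderiv ℝ w x‖) *
          min (dist x (edge i).1) (dist x (edge i).2) := by
        gcongr
        refine (norm_add_le _ _).trans ?_
        rw [norm_smul, norm_smul, Real.norm_eq_abs (φ x)]
    _ = ‖w x‖ * (‖fderiv ℝ φ x‖ * min (dist x (edge i).1) (dist x (edge i).2)) +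
          |φ x| * ‖fderiv ℝ w x‖ * min (dist x (edge i).1) (dist x (edge i).2) := by ring
    _ ≤ C * M + M * C' * 1 := by gcongr
    _ = _ := by ring

/-- Take `b / (lam i + b)` with `b` the product of the other `lam k`. It is 1 where `lam i = 0` and
0 where `b = 0`. Its gradient is bounded by a constant over the denominator, and the denominator is
at least a multiple of the distance to the end points by `exists_le`. -/
lemma IsRefPolygon.exists_isEdgeCutoff (hP : IsRefPolygon K edge lam) (i : Fin n) :
    ∃ φ, IsEdgeCutoff K edge i φ := by
  have hK := hP.isRefDomain
  obtain ⟨c, hc, hle⟩ := hP.exists_le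
  set b : ℝ × ℝ → ℝ := fun x => ∏ k ∈ Finset.univ.erase i, lam k x with hb
  have hl1 : ContDiff ℝ 1 (lam i) := (hP.contDiff i).of_le (by exact_mod_cast le_top)
  have hb1 : ContDiff ℝ 1 b := contDiff_prod fun k _ =>
    (hP.contDiff k).of_le (by exact_mod_cast le_top)
  have hb0 : ∀ x ∈ closure K, 0 ≤ b x := fun x hx => Finset.prod_nonneg fun k _ => hP.nonneg x hx k
  have hbK : ∀ x ∈ K, 0 < b x := fun x hx => Finset.prod_pos fun k _ => hP.pos x hx k
  have hD : ∀ x ∈ K, 0 < lam i x + b x := fun x hx => add_pos (hP.pos x hx i) (hbK x hx)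
  obtain ⟨L, hL⟩ := hK.isCompact_closure.exists_bound_of_continuousOn
    (hl1.continuous_fderiv one_ne_zero).continuousOn
  obtain ⟨L', hL'⟩ := hK.isCompact_closure.exists_bound_of_continuousOn
    (hb1.continuous_fderiv one_ne_zero).continuousOn
  refine ⟨fun x => b x / (lam i x + b x), ?_, ?_, ⟨max 1 ((L + L') / c), fun x hx => ⟨?_, ?_⟩⟩,
    ?_, ?_⟩
  · exact hb1.contDiffOn.div (hl1.contDiffOn.add hb1.contDiffOn) fun x hx => (hD x hx).ne'
  · refine hb1.continuous.continuousOn.div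
      (hl1.continuous.continuousOn.add hb1.continuous.continuousOn) fun x hx => ?_
    have h1 := hle i x hx.1
    have h2 : 0 < min (dist x (edge i).1) (dist x (edge i).2) :=
      lt_min (dist_pos.2 fun h => hx.2 (Or.inl h)) (dist_pos.2 fun h => hx.2 (Or.inr h))
    exact (lt_of_lt_of_le (mul_pos hc h2) h1).ne'
  · have h1 := hbK x hx
    have h2 := hP.pos x hx i
    refine le_trans ?_ (le_max_left _ _)
    rw [abs_of_nonneg (by positivity), div_le_one (hD x hx)]
    linarith
  · refine le_trans ?_ (le_max_right _ _)
    have h1 := hbK x hx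
    have h2 := hP.pos x hx i
    have hd1 := (hl1.differentiable one_ne_zero x).hasFDerivAt
    have hd2 := (hb1.differentiable one_ne_zero x).hasFDerivAt
    have hinv := (hasDerivAt_inv (hD x hx).ne').comp_hasFDerivAt x (hd1.add hd2)
    have hdiv := hd2.mul hinv
    have heq : fderiv ℝ (fun x => b x / (lam i x + b x)) x = (((lam i x + b x) ^ 2)⁻¹) •
        (lam i x • fderiv ℝ b x - b x • fderiv ℝ (lam i) x) := by
      have h3 : (fun x => b x / (lam i x + b x)) = b * (Inv.inv ∘ (lam i + b)) := by
        ext x; simp [div_eq_mul_inv]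
      rw [h3, hdiv.fderiv]
      ext <;>
      · simp
        have := (hD x hx).ne'
        field_simp
        ring
    have hL0 := hL x (subset_closure hx)
    have hL0' := hL' x (subset_closure hx)
    have hnn : 0 ≤ L := (norm_nonneg _).trans hL0
    have hnn' : 0 ≤ L' := (norm_nonneg _).trans hL0'
    have hn : ‖fderiv ℝ (fun x => b x / (lam i x + b x)) x‖ ≤ (L + L') / (lam i x + b x) := by
      rw [heq, norm_smul, norm_inv, Real.norm_of_nonneg (by positivity), ← div_eq_inv_mul,
        div_le_div_iff₀ (by have := hD x hx; positivity) (hD x hx)]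
      have : ‖lam i x • fderiv ℝ b x - b x • fderiv ℝ (lam i) x‖ ≤ lam i x * L' + b x * L := by
        refine (norm_sub_le _ _).trans ?_
        rw [norm_smul, norm_smul, Real.norm_of_nonneg h1.le, Real.norm_of_nonneg h2.le]
        gcongr
      have h3 : lam i x * L' + b x * L ≤ (L + L') * (lam i x + b x) := by nlinarith [mul_nonneg hnn h2.le, mul_nonneg hnn' h1.le]
      calc _ ≤ ((L + L') * (lam i x + b x)) * (lam i x + b x) := by
            have := (hD x hx).le
            gcongr
            exact le_trans ‹_› h3
        _ = _ := by ring
    calc _ ≤ (L + L') / (lam i x + b x) * ((lam i x + b x) / c) := by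
          refine mul_le_mul hn ?_ (le_min dist_nonneg dist_nonneg)
            (div_nonneg (add_nonneg hnn hnn') (hD x hx).le)
          · rw [le_div_iff₀' hc]
            exact hle i x (subset_closure hx)
      _ = _ := by
          have := (hD x hx).ne'
          field_simp
  · intro x hx
    have h1 : 0 < b x := Finset.prod_pos fun k hk =>
      hP.pos_of_ne i x hx k (Finset.ne_of_mem_erase hk)
    simp only
    rw [hP.eq_zero i x hx, zero_add, div_self h1.ne']
  · intro j hj x hx
    have h1 : b x = 0 := Finset.prod_eq_zero (Finset.mem_erase.2 ⟨hj, Finset.mem_univ _⟩)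
      (hP.eq_zero j x hx)
    simp only
    rw [h1, zero_div]

/-! ### Integration along sections -/

lemma pt_notMem_corners {j : Fin 2} {r t : ℝ} (ht : t ∈ Ioo (0 : ℝ) 1) : pt j r t ∉ corners := by
  rw [mem_corners]
  rintro ⟨h2, h3⟩
  fin_cases j
  · rcases h3 with h | h <;> simp [pt] at h <;> simp [h] at ht
  · rcases h2 with h | h <;> simp [pt] at h <;> simp [h] at ht

/-- The end points of a section at height `0 < t < 1` lie on open edges, so `φ` is continuous up to
them and the fundamental theorem of calculus applies. -/
lemma integral_section_pderiv (hP : IsRefPolygon K edge lam) {j : Fin 2} {α β : ℝ → ℝ}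
    {lo hi : Fin n} (hS : IsSectioned K edge j α β lo hi) (hφ : CornerRegular K φ) {t : ℝ}
    (ht : t ∈ Ioo (0 : ℝ) 1)
    (hint : IntegrableOn (fun r => pderiv j φ (pt j r t)) (Ioo (α t) (β t))) :
    ∫ r in Ioo (α t) (β t), pderiv j φ (pt j r t) = φ (pt j (β t) t) - φ (pt j (α t) t) := by
  have hsec : ∀ r ∈ Ioo (α t) (β t), pt j r t ∈ K := fun r hr => by
    have : r ∈ {r | pt j r t ∈ K} := by rw [hS.section_eq t ht]; exact hr
    exact this
  have hcl : ∀ r ∈ Icc (α t) (β t), pt j r t ∈ closure K \ corners := fun r hr => by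
    refine ⟨?_, pt_notMem_corners ht⟩
    rcases eq_endpoints_or_mem_Ioo_of_mem_Icc hr with h | h | h
    · rw [h]; exact hP.mem_closure lo _ (hS.lo_mem t ht)
    · rw [h]; exact hP.mem_closure hi _ (hS.hi_mem t ht)
    · exact subset_closure (hsec r h)
  have hc : Continuous fun r => pt j r t :=
    (continuous_pt j).comp (by fun_prop : Continuous fun r : ℝ => (t, r))
  have hpt : ∀ r, HasDerivAt (fun r => pt j r t) (unitVec j) r := fun r => by
    fin_cases j
    · simpa [pt, unitVec] using (hasDerivAt_id r).prodMk (hasDerivAt_const r t)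
    · simpa [pt, unitVec] using (hasDerivAt_const r t).prodMk (hasDerivAt_id r)
  have hle := (hS.lt t ht).le
  rw [← integral_Ioc_eq_integral_Ioo, ← intervalIntegral.integral_of_le hle]
  refine intervalIntegral.integral_eq_sub_of_hasDerivAt_of_le hle
    (f := fun r => φ (pt j r t)) ?_ ?_ ?_
  · exact hφ.2.1.comp hc.continuousOn hcl
  · intro r hr
    exact (hφ.differentiableAt hP.isRefDomain (hsec r hr)).hasFDerivAt.comp_hasDerivAt r (hpt r)
  · rwa [intervalIntegrable_iff_integrableOn_Ioo_of_le hle]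

lemma ae_integrableOn_section {F : ℝ × ℝ → ℝ} (hK : MeasurableSet K) (hF : IntegrableOn F K)
    (j : Fin 2) : ∀ᵐ t : ℝ, IntegrableOn (fun r => F (pt j r t)) {r | pt j r t ∈ K} := by
  have h1 : Integrable (fun p : ℝ × ℝ => K.indicator F (pt j p.2 p.1)) :=
    (measurePreserving_pt j).integrable_comp_of_integrable ((integrable_indicator_iff hK).2 hF)
  rw [Measure.volume_eq_prod] at h1
  refine h1.prod_right_ae.mono fun t ht => ?_
  rw [← integrable_indicator_iff (measurableSet_section hK j t)]
  exact ht

lemma CornerRegular.integrableOn_pderiv (hK : IsRefDomain K) (h : CornerRegular K φ) (j : Fin 2) :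
    IntegrableOn (pderiv j φ) K := by
  simpa using h.integrableOn_mul_pderiv hK (cornerIntegrable_const hK 1) j

lemma integral_pderiv (hP : IsRefPolygon K edge lam) {j : Fin 2} {α β : ℝ → ℝ}
    {lo hi : Fin n} (hS : IsSectioned K edge j α β lo hi) (hφ : CornerRegular K φ) :
    ∫ x in K, pderiv j φ x = ∫ t in Ioo (0 : ℝ) 1, (φ (pt j (β t) t) - φ (pt j (α t) t)) := by
  have hK := hP.isRefDomain
  have hint := hφ.integrableOn_pderiv hK j
  rw [integral_sections hK.measurableSet hK.subset j hint]
  refine integral_congr_ae ?_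
  filter_upwards [ae_restrict_of_ae (ae_integrableOn_section hK.measurableSet hint j),
    ae_restrict_mem measurableSet_Ioo] with t h1 ht
  rw [hS.section_eq t ht] at h1 ⊢
  exact integral_section_pderiv hP hS hφ ht h1

end

/-! ### Test functions of class `C¹` -/

/-- Mollification at a scale below the moduli of continuity of `Ψ` and its derivatives and below the
room between the support and the complement of `K`. -/
lemma exists_isTest_near {K : Set (ℝ × ℝ)} (hK : IsOpen K) {Ψ : ℝ × ℝ → ℝ} (hΨ : ContDiff ℝ 1 Ψ)
    (hc : HasCompactSupport Ψ) (hs : tsupport Ψ ⊆ K) {ε : ℝ} (hε : 0 < ε) :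
    ∃ χ, IsTest K χ ∧ (∀ x, |χ x - Ψ x| ≤ ε) ∧ ∀ i x, |pderiv i χ x - pderiv i Ψ x| ≤ ε := by
  have hpc : ∀ i, HasCompactSupport (pderiv i Ψ) := fun i => hc.fderiv_apply ℝ (unitVec i)
  have hu := hΨ.continuous.uniformContinuous_of_tendsto_cocompact hc.is_zero_at_infty
  have hup := fun i => (continuous_pderiv hΨ i).uniformContinuous_of_tendsto_cocompact
    (hpc i).is_zero_at_infty
  obtain ⟨δ0, h0, hδ0⟩ := Metric.uniformContinuous_iff.1 hu ε hε
  obtain ⟨δ1, h1, hδ1⟩ := Metric.uniformContinuous_iff.1 (hup 0) ε hε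
  obtain ⟨δ2, h2, hδ2⟩ := Metric.uniformContinuous_iff.1 (hup 1) ε hε
  obtain ⟨δ3, h3, hδ3⟩ := hc.isCompact.exists_cthickening_subset_open hK hs
  set δ := min (min δ0 δ1) (min δ2 δ3) with hδ
  have hpos : 0 < δ := lt_min (lt_min h0 h1) (lt_min h2 h3)
  have l0 : δ ≤ δ0 := (min_le_left _ _).trans (min_le_left _ _)
  have l1 : δ ≤ δ1 := (min_le_left _ _).trans (min_le_right _ _)
  have l2 : δ ≤ δ2 := (min_le_right _ _).trans (min_le_left _ _)
  have l3 : δ ≤ δ3 := (min_le_right _ _).trans (min_le_right _ _)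
  let ρ : ContDiffBump (0 : ℝ × ℝ) := ⟨δ / 2, δ, by positivity, by linarith⟩
  have hρ : ρ.rOut = δ := rfl
  have hρi : LocallyIntegrable (ρ.normed volume) volume := ρ.integrable_normed.locallyIntegrable
  have hder : ∀ i x, pderiv i (convolution (ρ.normed volume) Ψ (ContinuousLinearMap.lsmul ℝ ℝ)
      volume) x = (convolution (ρ.normed volume) (pderiv i Ψ) (ContinuousLinearMap.lsmul ℝ ℝ)
      volume) x := by
    intro i x
    have := hc.hasFDerivAt_convolution_right (ContinuousLinearMap.lsmul ℝ ℝ) hρi hΨ x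
    rw [pderiv, this.fderiv]
    exact convolution_precompR_apply _ hρi (hc.fderiv ℝ) (hΨ.continuous_fderiv one_ne_zero) x _
  refine ⟨convolution (ρ.normed volume) Ψ (ContinuousLinearMap.lsmul ℝ ℝ) volume, ⟨?_, ?_, ?_⟩,
    ?_, ?_⟩
  · exact ρ.hasCompactSupport_normed.contDiff_convolution_left _ ρ.contDiff_normed
      hΨ.continuous.locallyIntegrable
  · exact ρ.hasCompactSupport_normed.convolution _ hc
  · refine (closure_minimal ?_ Metric.isClosed_cthickening).trans hδ3
    refine (support_convolution_subset _).trans ?_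
    rintro x ⟨a, ha, b, hb, rfl⟩
    rw [ρ.support_normed_eq, hρ] at ha
    refine Metric.mem_cthickening_of_dist_le _ b _ _ (subset_tsupport _ hb) ?_
    rw [dist_eq_norm, add_sub_cancel_right]
    exact (mem_ball_zero_iff.1 ha).le.trans l3
  · intro x
    rw [← Real.dist_eq]
    exact ρ.dist_normed_convolution_le hΨ.continuous.aestronglyMeasurable fun y hy =>
      (hδ0 (lt_of_lt_of_le hy l0)).le
  · intro i x
    rw [hder, ← Real.dist_eq]
    refine ρ.dist_normed_convolution_le (continuous_pderiv hΨ i).aestronglyMeasurable fun y hy => ?_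
    fin_cases i
    · exact (hδ1 (lt_of_lt_of_le hy l1)).le
    · exact (hδ2 (lt_of_lt_of_le hy l2)).le

/-- The weak divergence is tested with smooth functions, while cutoffs and their truncations are
only `C¹`. Uniform approximation together with first derivatives closes this gap. -/
lemma IsWeakDiv.integral_eq_of_contDiff {K : Set (ℝ × ℝ)} (hK : IsOpen K) {u : Field2}
    {d : ℝ × ℝ → ℝ} (h : IsWeakDiv K u d) (hu : ∀ j, IntegrableOn (u j) K) (hd : IntegrableOn d K)
    {Ψ : ℝ × ℝ → ℝ} (hΨ : ContDiff ℝ 1 Ψ) (hc : HasCompactSupport Ψ) (hs : tsupport Ψ ⊆ K) :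
    ∫ x in K, (u 0 x * pderiv 0 Ψ x + u 1 x * pderiv 1 Ψ x) = -∫ x in K, d x * Ψ x := by
  have hmul : ∀ (v f : ℝ × ℝ → ℝ), IntegrableOn v K → Continuous f → HasCompactSupport f →
      IntegrableOn (fun x => v x * f x) K := fun v f hv hf hfc => by
    obtain ⟨C, hC⟩ := hfc.exists_bound_of_continuous hf
    exact hv.mul_bdd (c := C) hf.aestronglyMeasurable (ae_of_all _ hC)
  have key : ∀ ε > 0, |(∫ x in K, (u 0 x * pderiv 0 Ψ x + u 1 x * pderiv 1 Ψ x)) +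
      ∫ x in K, d x * Ψ x| ≤ ε * ((∫ x in K, |u 0 x|) + (∫ x in K, |u 1 x|) + ∫ x in K, |d x|) := by
    intro ε hε
    obtain ⟨χ, hχ, h1, h2⟩ := exists_isTest_near hK hΨ hc hs hε
    have hχ1 : ContDiff ℝ 1 χ := hχ.1.of_le (by exact_mod_cast le_top)
    have hdiff : ∀ (v f g : ℝ × ℝ → ℝ), IntegrableOn v K → Continuous f → HasCompactSupport f →
        Continuous g → HasCompactSupport g → (∀ x, |g x - f x| ≤ ε) →
        |(∫ x in K, v x * f x) - ∫ x in K, v x * g x| ≤ ε * ∫ x in K, |v x| := by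
      intro v f g hv hf hfc hg hgc hfg
      rw [← integral_sub (hmul v f hv hf hfc) (hmul v g hv hg hgc), ← integral_const_mul]
      have hle : ∀ x, ‖v x * f x - v x * g x‖ ≤ ε * |v x| := fun x => by
        rw [← mul_sub, norm_mul, Real.norm_eq_abs, Real.norm_eq_abs, abs_sub_comm, mul_comm]
        gcongr
        exact hfg x
      have hi : Integrable (fun x => ε * |v x|) (volume.restrict K) := Integrable.const_mul hv.abs ε
      exact norm_integral_le_of_norm_le hi (ae_of_all _ hle)
    have hpc : ∀ (f : ℝ × ℝ → ℝ) i, HasCompactSupport f → HasCompactSupport (pderiv i f) :=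
      fun f i hf => hf.fderiv_apply ℝ (unitVec i)
    have e0 := hdiff (u 0) _ _ (hu 0) (continuous_pderiv hΨ 0) (hpc _ 0 hc)
      (continuous_pderiv hχ1 0) (hpc _ 0 hχ.2.1) (h2 0)
    have e1 := hdiff (u 1) _ _ (hu 1) (continuous_pderiv hΨ 1) (hpc _ 1 hc)
      (continuous_pderiv hχ1 1) (hpc _ 1 hχ.2.1) (h2 1)
    have e2 := hdiff d _ _ hd hΨ.continuous hc hχ1.continuous hχ.2.1 h1
    have e3 := h χ hχ
    have i0 := fun f (hf : ContDiff ℝ 1 f) (hfc : HasCompactSupport f) =>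
      hmul (u 0) _ (hu 0) (continuous_pderiv hf 0) (hpc f 0 hfc)
    have i1 := fun f (hf : ContDiff ℝ 1 f) (hfc : HasCompactSupport f) =>
      hmul (u 1) _ (hu 1) (continuous_pderiv hf 1) (hpc f 1 hfc)
    rw [integral_add (i0 χ hχ1 hχ.2.1) (i1 χ hχ1 hχ.2.1)] at e3
    rw [integral_add (i0 Ψ hΨ hc) (i1 Ψ hΨ hc)]
    rw [abs_le] at *
    constructor <;> linarith [e0.1, e0.2, e1.1, e1.2, e2.1, e2.2]
  set A := (∫ x in K, |u 0 x|) + (∫ x in K, |u 1 x|) + ∫ x in K, |d x|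
  have hlim : Tendsto (fun ε : ℝ => ε * A) (𝓝[>] 0) (𝓝 0) := by
    have : Tendsto (fun ε : ℝ => ε * A) (𝓝 0) (𝓝 (0 * A)) := tendsto_id.mul_const A
    rw [zero_mul] at this
    exact this.mono_left nhdsWithin_le_nhds
  have := ge_of_tendsto hlim (eventually_mem_nhdsWithin.mono key)
  linarith [abs_nonpos_iff.1 this]

/-! ### Green's formula for functions that vanish on the boundary -/

/-- The product of the squared distances to the corners. -/
def cornerProd (x : ℝ × ℝ) : ℝ := ∏ a ∈ corners, ((x.1 - a.1) ^ 2 + (x.2 - a.2) ^ 2)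

lemma contDiff_cornerProd {n : WithTop ℕ∞} : ContDiff ℝ n cornerProd := by
  refine contDiff_prod fun a _ => ?_
  fun_prop

lemma cornerProd_nonneg (x : ℝ × ℝ) : 0 ≤ cornerProd x :=
  Finset.prod_nonneg fun _ _ => by positivity

lemma dist_sq_le (x a : ℝ × ℝ) : dist x a ^ 2 ≤ (x.1 - a.1) ^ 2 + (x.2 - a.2) ^ 2 := by
  rw [Prod.dist_eq, Real.dist_eq, Real.dist_eq]
  rcases max_choice |x.1 - a.1| |x.2 - a.2| with h | h <;> rw [h, sq_abs] <;>
    linarith [sq_nonneg (x.1 - a.1), sq_nonneg (x.2 - a.2)]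

lemma cornerProd_pos {x : ℝ × ℝ} (hx : x ∉ corners) : 0 < cornerProd x :=
  Finset.prod_pos fun a ha => lt_of_lt_of_le
    (by have := dist_pos.2 fun h : x = a => hx (h ▸ ha); positivity) (dist_sq_le x a)

lemma cornerProd_eq_zero {x : ℝ × ℝ} (hx : x ∈ corners) : cornerProd x = 0 :=
  Finset.prod_eq_zero hx (by simp)

/-- Each factor has a gradient of norm at most `4 dist x a`, and `dist x a ^ 2` is at most the
factor itself. So the logarithmic derivative of the product is at most four times the sum of the
inverse distances. -/
lemma norm_fderiv_cornerProd_le {x : ℝ × ℝ} (hx : x ∉ corners) :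
    ‖fderiv ℝ cornerProd x‖ ≤ 4 * (cornerProd x * cornerWeight x) := by
  set q : ℝ × ℝ → ℝ × ℝ → ℝ := fun a y => (y.1 - a.1) ^ 2 + (y.2 - a.2) ^ 2 with hq
  have hqd : ∀ a, DifferentiableAt ℝ (q a) x := fun a => by fun_prop
  have hd : fderiv ℝ cornerProd x =
      ∑ a ∈ corners, (∏ b ∈ corners.erase a, q b x) • fderiv ℝ (q a) x :=
    (HasFDerivAt.finsetProd (u := corners) (g := q) fun a _ => (hqd a).hasFDerivAt).fderiv
  rw [hd, cornerWeight, Finset.mul_sum, Finset.mul_sum]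
  refine (norm_sum_le _ _).trans (Finset.sum_le_sum fun a ha => ?_)
  have hdist : 0 < dist x a := dist_pos.2 fun h : x = a => hx (h ▸ ha)
  have hnn : 0 ≤ ∏ b ∈ corners.erase a, q b x := Finset.prod_nonneg fun _ _ => by
    simp only [hq]; positivity
  have hprod : (∏ b ∈ corners.erase a, q b x) * q a x = cornerProd x :=
    Finset.prod_erase_mul _ _ ha
  have hqn : ‖fderiv ℝ (q a) x‖ ≤ 4 * dist x a := by
    refine ContinuousLinearMap.opNorm_le_bound _ (by positivity) fun v => ?_
    have hv : fderiv ℝ (q a) x v = 2 * (x.1 - a.1) * v.1 + 2 * (x.2 - a.2) * v.2 := by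
      have h1 : HasFDerivAt (fun y : ℝ × ℝ => y.1 - a.1) (ContinuousLinearMap.fst ℝ ℝ ℝ) x :=
        hasFDerivAt_fst.sub_const _
      have h2 : HasFDerivAt (fun y : ℝ × ℝ => y.2 - a.2) (ContinuousLinearMap.snd ℝ ℝ ℝ) x :=
        hasFDerivAt_snd.sub_const _
      have h3 := (h1.pow 2).add (h2.pow 2)
      have h4 : HasFDerivAt (q a) _ x := h3
      rw [h4.fderiv]
      simp
    rw [hv]
    have b1 : |x.1 - a.1| ≤ dist x a := by rw [Prod.dist_eq]; exact le_max_left _ _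
    have b2 : |x.2 - a.2| ≤ dist x a := by rw [Prod.dist_eq]; exact le_max_right _ _
    have b3 := norm_fst_le v
    have b4 := norm_snd_le v
    calc ‖2 * (x.1 - a.1) * v.1 + 2 * (x.2 - a.2) * v.2‖
        ≤ 2 * |x.1 - a.1| * ‖v.1‖ + 2 * |x.2 - a.2| * ‖v.2‖ := by
          refine (norm_add_le _ _).trans ?_
          simp [norm_mul]
      _ ≤ 2 * dist x a * ‖v‖ + 2 * dist x a * ‖v‖ := by gcongr
      _ = _ := by ring
  rw [norm_smul, Real.norm_of_nonneg hnn, ← hprod]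
  calc (∏ b ∈ corners.erase a, q b x) * ‖fderiv ℝ (q a) x‖
      ≤ (∏ b ∈ corners.erase a, q b x) * (4 * dist x a) := by gcongr
    _ = 4 * ((∏ b ∈ corners.erase a, q b x) * (dist x a) ^ 2 * (dist x a)⁻¹) := by
        field_simp
    _ ≤ 4 * ((∏ b ∈ corners.erase a, q b x) * q a x * (dist x a)⁻¹) := by
        gcongr
        exact dist_sq_le x a

/-! ### The profile function of the truncations. -/

lemma contDiff_smoothTransition : ContDiff ℝ 1 Real.smoothTransition :=
  Real.smoothTransition.contDiff

lemma deriv_smoothTransition_of_neg {x : ℝ} (hx : x < 0) : deriv Real.smoothTransition x = 0 := by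
  have : Real.smoothTransition =ᶠ[𝓝 x] fun _ => 0 :=
    (gt_mem_nhds hx).mono fun y hy => Real.smoothTransition.zero_of_nonpos hy.le
  rw [this.deriv_eq, deriv_const]

lemma deriv_smoothTransition_of_one_le {x : ℝ} (hx : 1 ≤ x) :
    deriv Real.smoothTransition x = 0 := by
  -- At `x = 1` the function is not locally constant, but 1 is its global maximum.
  refine IsLocalMax.deriv_eq_zero (Eventually.of_forall fun y => ?_)
  rw [Real.smoothTransition.one_of_one_le hx]
  exact Real.smoothTransition.le_one y

lemma exists_abs_deriv_smoothTransition_le : ∃ C, ∀ x, |deriv Real.smoothTransition x| ≤ C := by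
  obtain ⟨C, hC⟩ := (isCompact_Icc (a := (0 : ℝ)) (b := 1)).exists_bound_of_continuousOn
    (contDiff_smoothTransition.continuous_deriv le_rfl).continuousOn
  have hC0 : 0 ≤ C := (norm_nonneg _).trans (hC 0 (by simp))
  refine ⟨C, fun x => ?_⟩
  by_cases hx : x ∈ Icc (0 : ℝ) 1
  · exact hC x hx
  · rw [mem_Icc, not_and_or, not_le, not_le] at hx
    rcases hx with h | h
    · rw [deriv_smoothTransition_of_neg h, abs_zero]; exact hC0
    · rw [deriv_smoothTransition_of_one_le h.le, abs_zero]; exact hC0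

/-- The function `ψ`, cut off where `n` times the product of `ψ²` and the squared distances to
the corners is at most one. -/
def truncate (K : Set (ℝ × ℝ)) (ψ : ℝ × ℝ → ℝ) (n : ℕ) : ℝ × ℝ → ℝ :=
  K.indicator fun x => ψ x * Real.smoothTransition (n * cornerProd x * ψ x ^ 2 - 1)

/-! ### Truncation away from the zero set, the boundary and the corners; Green's formula. -/

section

variable {K : Set (ℝ × ℝ)} {ψ : ℝ × ℝ → ℝ}

/-- On the support `n Q ψ² > 1`, where `Q` is `cornerProd`. Since `ψ` is bounded, `Q` is bounded
below there, so the corners are avoided. Away from the corners `ψ` is continuous up to the boundary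
and zero on it, so `{n Q ψ² ≥ 1}` is closed and does not meet the boundary. -/
lemma exists_isCompact_support_truncate_subset (hK : IsRefDomain K) (hψ : CornerRegular K ψ)
    (h0 : ∀ x ∈ closure K \ corners, x ∉ K → ψ x = 0) {n : ℕ} (hn : n ≠ 0) :
    ∃ Z, IsCompact Z ∧ Z ⊆ K ∧ Function.support (truncate K ψ n) ⊆ Z := by
  obtain ⟨M, hM⟩ := hψ.2.2
  have hn0 : 0 < (n : ℝ) := by positivity
  -- `M ^ 2 + 1` is used instead of `M ^ 2` so that the bound on `cornerProd` remains meaningful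
  -- when `M = 0`.
  set A : Set (ℝ × ℝ) := closure K ∩ {x | 1 / (n * (M ^ 2 + 1)) ≤ cornerProd x} with hA
  have hAc : IsClosed A := isClosed_closure.inter
    (isClosed_le continuous_const (contDiff_cornerProd (n := 1)).continuous)
  have hAs : A ⊆ closure K \ corners := fun x hx => ⟨hx.1, fun h => by
    have : 1 / (n * (M ^ 2 + 1)) ≤ cornerProd x := hx.2
    rw [cornerProd_eq_zero h] at this
    exact this.not_gt (by positivity)⟩
  have hcont : ContinuousOn (fun x => n * cornerProd x * ψ x ^ 2) A :=
    (continuousOn_const.mul (contDiff_cornerProd (n := 1)).continuous.continuousOn).mul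
      ((hψ.2.1.mono hAs).pow 2)
  refine ⟨A ∩ (fun x => n * cornerProd x * ψ x ^ 2) ⁻¹' Ici 1,
    hK.isCompact_closure.of_isClosed_subset (hcont.preimage_isClosed_of_isClosed hAc isClosed_Ici)
      (inter_subset_left.trans inter_subset_left), fun x hx => ?_, fun x hx => ?_⟩
  · by_contra hxK
    have h1 : 1 ≤ n * cornerProd x * ψ x ^ 2 := hx.2
    rw [h0 x (hAs hx.1) hxK] at h1
    norm_num at h1
  · have hxK : x ∈ K := by
      by_contra h
      exact hx (indicator_of_notMem h _)
    rw [Function.mem_support, truncate, indicator_of_mem hxK] at hx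
    have h1 : 1 < n * cornerProd x * ψ x ^ 2 := by
      by_contra! h
      exact hx (by rw [Real.smoothTransition.zero_of_nonpos (by linarith), mul_zero])
    refine ⟨⟨subset_closure hxK, ?_⟩, h1.le⟩
    have h2 : ψ x ^ 2 ≤ M ^ 2 := by
      rw [← sq_abs]
      have := (hM x hxK).1
      have := abs_nonneg (ψ x)
      gcongr
    have h3 := cornerProd_nonneg x
    show 1 / (n * (M ^ 2 + 1)) ≤ cornerProd x
    rw [div_le_iff₀ (by positivity)]
    have : n * cornerProd x * ψ x ^ 2 ≤ n * cornerProd x * (M ^ 2 + 1) := by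
      gcongr
      linarith
    linarith

lemma hasFDerivAt_truncate (hK : IsRefDomain K) (hψ : CornerRegular K ψ) (n : ℕ) {x : ℝ × ℝ}
    (hx : x ∈ K) : HasFDerivAt (truncate K ψ n)
      (Real.smoothTransition (n * cornerProd x * ψ x ^ 2 - 1) • fderiv ℝ ψ x +
        (ψ x * deriv Real.smoothTransition (n * cornerProd x * ψ x ^ 2 - 1) * n) •
          (ψ x ^ 2 • fderiv ℝ cornerProd x + (2 * cornerProd x * ψ x) • fderiv ℝ ψ x)) x := by
  have h1 := (hψ.differentiableAt hK hx).hasFDerivAt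
  have h2 := ((contDiff_cornerProd (n := 1)).differentiable one_ne_zero x).hasFDerivAt
  have h3 : HasFDerivAt (fun x => n * cornerProd x * ψ x ^ 2 - 1) _ x :=
    ((h2.const_mul (n : ℝ)).mul (h1.pow 2)).sub_const 1
  have h4 := ((contDiff_smoothTransition.differentiable one_ne_zero) _).hasDerivAt.comp_hasFDerivAt
    x h3
  have h5 : HasFDerivAt (fun x => ψ x * Real.smoothTransition (n * cornerProd x * ψ x ^ 2 - 1))
    _ x := h1.mul h4
  refine (h5.congr_of_eventuallyEq ?_).congr_fderiv ?_
  · filter_upwards [hK.isOpen.mem_nhds hx] with y hy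
    exact indicator_of_mem hy _
  · ext <;> simp <;> ring

lemma contDiff_truncate (hK : IsRefDomain K) (hψ : CornerRegular K ψ)
    (h0 : ∀ x ∈ closure K \ corners, x ∉ K → ψ x = 0) {n : ℕ} (hn : n ≠ 0) :
    ContDiff ℝ 1 (truncate K ψ n) ∧ HasCompactSupport (truncate K ψ n) ∧
      tsupport (truncate K ψ n) ⊆ K := by
  obtain ⟨Z, hZc, hZK, hZ⟩ := exists_isCompact_support_truncate_subset hK hψ h0 hn
  have hts : tsupport (truncate K ψ n) ⊆ Z := closure_minimal hZ hZc.isClosed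
  refine ⟨contDiff_iff_contDiffAt.2 fun x => ?_, HasCompactSupport.of_support_subset_isCompact hZc hZ,
    hts.trans hZK⟩
  by_cases hx : x ∈ K
  · have h1 : ContDiffAt ℝ 1 ψ x := hψ.1.contDiffAt (hK.isOpen.mem_nhds hx)
    have h2 : ContDiffAt ℝ 1 (fun x => ψ x *
        Real.smoothTransition (n * cornerProd x * ψ x ^ 2 - 1)) x :=
      h1.mul (contDiff_smoothTransition.contDiffAt.comp x
        (((contDiffAt_const.mul contDiff_cornerProd.contDiffAt).mul (h1.pow 2)).sub
          contDiffAt_const))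
    refine h2.congr_of_eventuallyEq ?_
    filter_upwards [hK.isOpen.mem_nhds hx] with y hy
    exact indicator_of_mem hy _
  · refine contDiffAt_const (c := (0 : ℝ)) |>.congr_of_eventuallyEq ?_
    filter_upwards [hZc.isClosed.isOpen_compl.mem_nhds fun h => hx (hZK h)] with y hy
    by_contra h
    exact hy (hZ h)

/-- Differentiating the cutoff factor produces a large factor `n`, but its derivative is nonzero
only where `n Q ψ² ≤ 2`, with `Q` the product `cornerProd`. Since `|∇Q| ≤ 4 Q W` and `|∇ψ| ≤ M W`,
where `W` is `cornerWeight`, all terms contain `n Q ψ²` and the bound is uniform in `n`. -/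
lemma exists_norm_fderiv_truncate_le (hK : IsRefDomain K) (hψ : CornerRegular K ψ) :
    ∃ C, ∀ n, ∀ x ∈ K, |truncate K ψ n x| ≤ C ∧
      ‖fderiv ℝ (truncate K ψ n) x‖ ≤ C * cornerWeight x := by
  obtain ⟨M, hM⟩ := hψ.2.2
  obtain ⟨Cs, hCs⟩ := exists_abs_deriv_smoothTransition_le
  -- `12 = 2 · (4 + 2)`: the bound 2 for `n Q ψ²`, the 4 of `norm_fderiv_cornerProd_le`, and the 2
  -- from differentiating `ψ²`.
  refine ⟨M + 12 * Cs * M, fun n x hx => ?_⟩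
  obtain ⟨h1, h2⟩ := hM x hx
  have hM0 : 0 ≤ M := (abs_nonneg _).trans h1
  have hCs0 : 0 ≤ Cs := (abs_nonneg _).trans (hCs 0)
  have hW := cornerWeight_nonneg x
  have hQ := cornerProd_nonneg x
  set S := Real.smoothTransition (n * cornerProd x * ψ x ^ 2 - 1) with hS
  have hS1 : |S| ≤ 1 := by
    rw [abs_of_nonneg (Real.smoothTransition.nonneg _)]
    exact Real.smoothTransition.le_one _
  constructor
  · rw [truncate, indicator_of_mem hx, abs_mul]
    calc |ψ x| * |S| ≤ M * 1 := by gcongr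
      _ ≤ _ := by have : 0 ≤ 12 * Cs * M := by positivity
                  linarith
  rw [(hasFDerivAt_truncate hK hψ n hx).fderiv]
  set D := deriv Real.smoothTransition (n * cornerProd x * ψ x ^ 2 - 1) with hD
  have hDb : |D| * (n * cornerProd x * ψ x ^ 2) ≤ Cs * 2 := by
    rcases le_or_gt (n * cornerProd x * ψ x ^ 2) 2 with h | h
    · exact mul_le_mul (hCs _) h (by positivity) hCs0
    · rw [hD, deriv_smoothTransition_of_one_le (by linarith), abs_zero, zero_mul]
      positivity
  have hQf := norm_fderiv_cornerProd_le (notMem_corners_of_mem_refSquare (hK.subset hx))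
  have e1 : ‖S • fderiv ℝ ψ x‖ ≤ M * cornerWeight x := by
    rw [norm_smul, Real.norm_eq_abs]
    calc |S| * ‖fderiv ℝ ψ x‖ ≤ 1 * (M * cornerWeight x) := by gcongr
      _ = _ := one_mul _
  have e2 : ‖(ψ x * D * n) • (ψ x ^ 2 • fderiv ℝ cornerProd x +
      (2 * cornerProd x * ψ x) • fderiv ℝ ψ x)‖ ≤ 12 * Cs * M * cornerWeight x := by
    rw [norm_smul]
    calc ‖ψ x * D * n‖ * ‖ψ x ^ 2 • fderiv ℝ cornerProd x +
          (2 * cornerProd x * ψ x) • fderiv ℝ ψ x‖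
        ≤ (|ψ x| * |D| * n) * (ψ x ^ 2 * (4 * (cornerProd x * cornerWeight x)) +
          (2 * cornerProd x * |ψ x|) * (M * cornerWeight x)) := by
          rw [norm_mul, norm_mul, Real.norm_natCast, Real.norm_eq_abs, Real.norm_eq_abs]
          gcongr
          refine (norm_add_le _ _).trans ?_
          rw [norm_smul, norm_smul, Real.norm_of_nonneg (sq_nonneg (ψ x)), norm_mul,
            Real.norm_of_nonneg (by positivity : 0 ≤ 2 * cornerProd x), Real.norm_eq_abs]
          gcongr
      _ = (|D| * (n * cornerProd x * ψ x ^ 2)) * (4 * |ψ x| + 2 * M) * cornerWeight x := by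
          rw [← sq_abs (ψ x)]; ring
      _ ≤ (Cs * 2) * (4 * M + 2 * M) * cornerWeight x := by gcongr
      _ = _ := by ring
  refine (norm_add_le _ _).trans ?_
  linarith

lemma tendsto_truncate (hK : IsRefDomain K) (hψ : CornerRegular K ψ) {x : ℝ × ℝ} (hx : x ∈ K)
    (hne : ψ x ≠ 0) : ∀ᶠ n in atTop, truncate K ψ n x = ψ x ∧
      fderiv ℝ (truncate K ψ n) x = fderiv ℝ ψ x := by
  have hQ := cornerProd_pos (notMem_corners_of_mem_refSquare (hK.subset hx))
  have hpos : 0 < cornerProd x * ψ x ^ 2 := by positivity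
  have h1 : Tendsto (fun n : ℕ => (n : ℝ) * (cornerProd x * ψ x ^ 2)) atTop atTop :=
    tendsto_natCast_atTop_atTop.atTop_mul_const hpos
  filter_upwards [h1.eventually_gt_atTop 2] with n hn
  rw [← mul_assoc] at hn
  rw [(hasFDerivAt_truncate hK hψ n hx).fderiv, truncate, indicator_of_mem hx,
    Real.smoothTransition.one_of_one_le (by linarith),
    deriv_smoothTransition_of_one_le (by linarith)]
  simp

/-- Apply the weak divergence to the truncations and pass to the limit by dominated convergence,
with a multiple of `|u|` times the corner weight as majorant. At zeros of `ψ` the truncations have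
zero gradient whatever `∇ψ` is, so the zero set is assumed to be null. -/
lemma integral_green_of_ae_ne (hK : IsRefDomain K) {u : Field2} {d : ℝ × ℝ → ℝ}
    (hu : ∀ j, CornerIntegrable K (u j)) (hd : IntegrableOn d K) (hdiv : IsWeakDiv K u d)
    (hψ : CornerRegular K ψ) (h0 : ∀ x ∈ closure K \ corners, x ∉ K → ψ x = 0)
    (hne : ∀ᵐ x ∂(volume.restrict K), ψ x ≠ 0) :
    (∫ x in K, u 0 x * pderiv 0 ψ x) + (∫ x in K, u 1 x * pderiv 1 ψ x) +
      ∫ x in K, d x * ψ x = 0 := by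
  obtain ⟨C, hC⟩ := exists_norm_fderiv_truncate_le hK hψ
  have hreg : ∀ n : ℕ, n ≠ 0 → CornerRegular K (truncate K ψ n) := fun n hn =>
    cornerRegular_of_contDiff hK (contDiff_truncate hK hψ h0 hn).1
  have hKm := hK.measurableSet
  have hev : ∀ᵐ x ∂(volume.restrict K), ∀ᶠ n in atTop, truncate K ψ n x = ψ x ∧
      fderiv ℝ (truncate K ψ n) x = fderiv ℝ ψ x := by
    filter_upwards [hne, ae_restrict_mem hKm] with x hx hxK using tendsto_truncate hK hψ hxK hx
  have hlim1 : ∀ j, Tendsto (fun n : ℕ => ∫ x in K, u j x * pderiv j (truncate K ψ (n + 1)) x) atTop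
      (𝓝 (∫ x in K, u j x * pderiv j ψ x)) := by
    intro j
    refine tendsto_integral_of_dominated_convergence (fun x => C * ‖u j x * cornerWeight x‖)
      (fun n => ((hreg _ n.succ_ne_zero).integrableOn_mul_pderiv hK (hu j) j).1)
      ((hu j).2.norm.const_mul C) (fun n => ?_) ?_
    · refine ae_restrict_of_forall_mem hKm fun x hx => ?_
      rw [norm_mul, norm_mul, Real.norm_of_nonneg (cornerWeight_nonneg x)]
      have := (abs_pderiv_le j _ x).trans (hC (n + 1) x hx).2
      calc ‖u j x‖ * ‖pderiv j (truncate K ψ (n + 1)) x‖ ≤ ‖u j x‖ * (C * cornerWeight x) := by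
            gcongr
            exact this
        _ = _ := by ring
    · filter_upwards [hev] with x hx
      refine tendsto_const_nhds.congr' ?_
      filter_upwards [(tendsto_add_atTop_nat 1).eventually hx] with n hn
      rw [pderiv, pderiv, hn.2]
  have hlim2 : Tendsto (fun n : ℕ => ∫ x in K, d x * truncate K ψ (n + 1) x) atTop
      (𝓝 (∫ x in K, d x * ψ x)) := by
    refine tendsto_integral_of_dominated_convergence (fun x => C * ‖d x‖)
      (fun n => ((hreg _ n.succ_ne_zero).integrableOn_mul hK hd).1)
      (hd.norm.const_mul C) (fun n => ?_) ?_
    · refine ae_restrict_of_forall_mem hKm fun x hx => ?_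
      rw [norm_mul, mul_comm]
      gcongr
      exact (hC (n + 1) x hx).1
    · filter_upwards [hev] with x hx
      refine tendsto_const_nhds.congr' ?_
      filter_upwards [(tendsto_add_atTop_nat 1).eventually hx] with n hn
      rw [hn.1]
  refine tendsto_nhds_unique (((hlim1 0).add (hlim1 1)).add hlim2) ?_
  refine tendsto_const_nhds.congr fun n => ?_
  obtain ⟨k1, k2, k3⟩ := contDiff_truncate hK hψ h0 n.succ_ne_zero
  have := hdiv.integral_eq_of_contDiff hK.isOpen (fun j => (hu j).integrableOn hK) hd k1 k2 k3
  rw [integral_add ((hreg _ n.succ_ne_zero).integrableOn_mul_pderiv hK (hu 0) 0)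
    ((hreg _ n.succ_ne_zero).integrableOn_mul_pderiv hK (hu 1) 1)] at this
  rw [this]
  simp

/-- Green's formula for a function that vanishes on the boundary except at the corners. -/
lemma integral_green_eq_zero {n : ℕ} {edge : Fin n → Edge} {lam : Fin n → ℝ × ℝ → ℝ}
    (hP : IsRefPolygon K edge lam) {u : Field2} {d : ℝ × ℝ → ℝ}
    (hu : ∀ j, CornerIntegrable K (u j)) (hd : IntegrableOn d K) (hdiv : IsWeakDiv K u d)
    (hψ : CornerRegular K ψ) (h0 : ∀ x ∈ closure K \ corners, x ∉ K → ψ x = 0) :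
    (∫ x in K, u 0 x * pderiv 0 ψ x) + (∫ x in K, u 1 x * pderiv 1 ψ x) +
      ∫ x in K, d x * ψ x = 0 := by
  have hK := hP.isRefDomain
  set β : ℝ × ℝ → ℝ := fun x => ∏ j, lam j x with hβ
  have hβ1 : ContDiff ℝ 1 β := contDiff_prod fun k _ =>
    (hP.contDiff k).of_le (by exact_mod_cast le_top)
  have hβK : ∀ x ∈ K, 0 < β x := fun x hx => Finset.prod_pos fun k _ => hP.pos x hx k
  have hβ0 : ∀ x ∈ closure K, x ∉ K → β x = 0 := fun x hx hxK => by
    have : ∃ j, lam j x ≤ 0 := by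
      by_contra! h
      exact hxK (hP.mem_of_pos x h)
    obtain ⟨j, hj⟩ := this
    exact Finset.prod_eq_zero (Finset.mem_univ j) (le_antisymm hj (hP.nonneg x hx j))
  have hβr := cornerRegular_of_contDiff hK hβ1
  -- To remove the assumption on the zero set, `ψ` is perturbed to `ψ + κ β`, with `β` positive in
  -- `K` and zero on the boundary. Its zero set is a level set of `-ψ / β`. Different levels are
  -- disjoint, so at most countably many have positive measure.
  have hcount : Set.Countable {κ : ℝ | 0 < volume.restrict K {x | -ψ x / β x = κ}} := by
    refine Measure.countable_meas_level_set_pos₀ (AEMeasurable.nullMeasurable ?_)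
    exact (hψ.1.continuousOn.neg.div hβ1.continuous.continuousOn
      fun x hx => (hβK x hx).ne').aemeasurable hK.measurableSet
  set A := (∫ x in K, u 0 x * pderiv 0 ψ x) + (∫ x in K, u 1 x * pderiv 1 ψ x) +
      ∫ x in K, d x * ψ x with hA
  set B := (∫ x in K, u 0 x * pderiv 0 β x) + (∫ x in K, u 1 x * pderiv 1 β x) +
      ∫ x in K, d x * β x with hB
  have key : {κ : ℝ | 0 < volume.restrict K {x | -ψ x / β x = κ}}ᶜ ⊆ {κ : ℝ | A + κ * B = 0} := by
    intro κ hκ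
    have hκ0 : volume.restrict K {x | -ψ x / β x = κ} = 0 := by
      by_contra h
      exact hκ (pos_iff_ne_zero.2 h)
    have hr := hψ.add hK (hβr.const_mul hK κ)
    have hne : ∀ᵐ x ∂(volume.restrict K), ψ x + κ * β x ≠ 0 := by
      have h1 : ∀ᵐ x ∂(volume.restrict K), ¬ (-ψ x / β x = κ) := by
        rw [ae_iff]; simpa using hκ0
      filter_upwards [h1, ae_restrict_mem hK.measurableSet] with x hx hxK hz
      refine hx ?_
      rw [div_eq_iff (hβK x hxK).ne']
      linarith
    have := integral_green_of_ae_ne hK hu hd hdiv hr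
      (fun x hx hxK => by simp only [h0 x hx hxK, hβ0 x hx.1 hxK, mul_zero, add_zero]) hne
    have hp : ∀ j, ∫ x in K, u j x * pderiv j (fun x => ψ x + κ * β x) x =
        (∫ x in K, u j x * pderiv j ψ x) + κ * ∫ x in K, u j x * pderiv j β x := by
      intro j
      rw [← integral_const_mul, ← integral_add (hψ.integrableOn_mul_pderiv hK (hu j) j)
        ((hβr.integrableOn_mul_pderiv hK (hu j) j).const_mul κ)]
      refine setIntegral_congr_fun hK.measurableSet fun x hx => ?_
      rw [pderiv_add hK hψ (hβr.const_mul hK κ) hx,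
        pderiv_mul hK (cornerRegular_of_contDiff hK contDiff_const) hβr hx]
      simp [pderiv]
      ring
    have hdd : ∫ x in K, d x * (ψ x + κ * β x) =
        (∫ x in K, d x * ψ x) + κ * ∫ x in K, d x * β x := by
      rw [← integral_const_mul, ← integral_add (hψ.integrableOn_mul hK hd)
        ((hβr.integrableOn_mul hK hd).const_mul κ)]
      refine integral_congr_ae (ae_of_all _ fun x => ?_)
      simp only
      ring
    rw [hp, hp, hdd] at this
    show A + κ * B = 0
    linarith
  -- The identity is affine in `κ` and holds off a countable set, which has a dense complement;
  -- hence it holds at `κ = 0`.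
  have hclosed : IsClosed {κ : ℝ | A + κ * B = 0} :=
    isClosed_eq (by fun_prop) continuous_const
  have hall := (closure_minimal key hclosed)
  rw [(hcount.dense_compl ℝ).closure_eq] at hall
  have : A + 0 * B = 0 := hall (mem_univ 0)
  simpa using this

end

/-! ### Normal fluxes -/

/-- Fields for which Green's formula with the edge cutoffs makes sense. -/
structure IsGreenField (K : Set (ℝ × ℝ)) (u : Field2) (d : ℝ × ℝ → ℝ) : Prop where
  corner : ∀ j, CornerIntegrable K (u j)
  integrable : IntegrableOn d K
  div : IsWeakDiv K u d

/-- The right-hand side of Green's formula. -/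
def greenPairing (K : Set (ℝ × ℝ)) (u : Field2) (d : ℝ × ℝ → ℝ) (φ : ℝ × ℝ → ℝ) : ℝ :=
  (∫ x in K, u 0 x * pderiv 0 φ x) + (∫ x in K, u 1 x * pderiv 1 φ x) + ∫ x in K, d x * φ x

section

variable {n : ℕ} {K : Set (ℝ × ℝ)} {edge : Fin n → Edge} {lam : Fin n → ℝ × ℝ → ℝ} {i : Fin n}
  {φ ψ : ℝ × ℝ → ℝ} {u : Field2} {d : ℝ × ℝ → ℝ}

lemma IsRefPolygon.exists_mem_openSegment (hP : IsRefPolygon K edge lam) {x : ℝ × ℝ}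
    (hx : x ∈ closure K \ corners) (hxK : x ∉ K) :
    ∃ j, x ∈ openSegment ℝ (edge j).1 (edge j).2 := by
  have : ∃ j, lam j x ≤ 0 := by
    by_contra! h
    exact hxK (hP.mem_of_pos x h)
  obtain ⟨j, hj⟩ := this
  have h1 := hP.mem_segment x hx.1 j (le_antisymm hj (hP.nonneg x hx.1 j))
  rw [← insert_endpoints_openSegment] at h1
  obtain ⟨v1, v2⟩ := hP.vertex j
  rcases h1 with h | h | h
  · exact absurd (h ▸ v1) hx.2
  · exact absurd (h ▸ v2) hx.2
  · exact ⟨j, h⟩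

lemma greenPairing_sub (hK : IsRefDomain K) (hu : IsGreenField K u d) (hφ : CornerRegular K φ)
    (hψ : CornerRegular K ψ) :
    greenPairing K u d (fun x => φ x - ψ x) = greenPairing K u d φ - greenPairing K u d ψ := by
  have hp : ∀ j, ∫ x in K, u j x * pderiv j (fun x => φ x - ψ x) x =
      (∫ x in K, u j x * pderiv j φ x) - ∫ x in K, u j x * pderiv j ψ x := fun j => by
    rw [← integral_sub (hφ.integrableOn_mul_pderiv hK (hu.corner j) j)
      (hψ.integrableOn_mul_pderiv hK (hu.corner j) j)]
    refine setIntegral_congr_fun hK.measurableSet fun x hx => ?_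
    rw [pderiv_sub hK hφ hψ hx, mul_sub]
  have hd : ∫ x in K, d x * (φ x - ψ x) = (∫ x in K, d x * φ x) - ∫ x in K, d x * ψ x := by
    rw [← integral_sub (hφ.integrableOn_mul hK hu.integrable) (hψ.integrableOn_mul hK hu.integrable)]
    simp only [mul_sub]
  rw [greenPairing, hp, hp, hd, greenPairing, greenPairing]
  ring

lemma greenPairing_eq_zero (hP : IsRefPolygon K edge lam) (hu : IsGreenField K u d)
    (hψ : CornerRegular K ψ)
    (h0 : ∀ j, ∀ x ∈ openSegment ℝ (edge j).1 (edge j).2, ψ x = 0) : greenPairing K u d ψ = 0 :=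
  integral_green_eq_zero hP hu.corner hu.integrable hu.div hψ fun x hx hxK => by
    obtain ⟨j, hj⟩ := hP.exists_mem_openSegment hx hxK
    exact h0 j x hj

/-- Two cutoffs of the same edge agree on all open edges, so their difference is annihilated by
Green's formula. -/
lemma greenPairing_eq (hP : IsRefPolygon K edge lam) (hu : IsGreenField K u d)
    (hφ : IsEdgeCutoff K edge i φ) (hψ : IsEdgeCutoff K edge i ψ) :
    greenPairing K u d φ = greenPairing K u d ψ := by
  have hK := hP.isRefDomain
  have h1 := hφ.cornerRegular hP
  have h2 := hψ.cornerRegular hP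
  rw [← sub_eq_zero, ← greenPairing_sub hK hu h1 h2]
  refine greenPairing_eq_zero hP hu (h1.sub hK h2) fun j x hx => ?_
  by_cases hj : j = i
  · subst hj
    simp only [hφ.2.2.2.1 x hx, hψ.2.2.2.1 x hx, sub_self]
  · simp only [hφ.2.2.2.2 j hj x hx, hψ.2.2.2.2 j hj x hx, sub_self]

/-- A single cutoff decides, so existence and uniqueness of the flux follow from existence of a
cutoff. -/
lemma isGreenFlux_iff (hP : IsRefPolygon K edge lam) (hu : IsGreenField K u d)
    (hφ : IsEdgeCutoff K edge i φ) {F : ℝ} :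
    IsGreenFlux K edge i u d F ↔ F = greenPairing K u d φ := by
  have hK := hP.isRefDomain
  have hi : ∀ ψ, CornerRegular K ψ → ∀ j, IntegrableOn (fun x => u j x * pderiv j ψ x) K :=
    fun ψ hψ j => hψ.integrableOn_mul_pderiv hK (hu.corner j) j
  have hsplit : ∀ ψ, CornerRegular K ψ →
      (∫ x in K, (u 0 x * pderiv 0 ψ x + u 1 x * pderiv 1 ψ x)) + ∫ x in K, d x * ψ x =
        greenPairing K u d ψ := fun ψ hψ => by
    rw [integral_add (hi ψ hψ 0) (hi ψ hψ 1), greenPairing]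
  constructor
  · intro h
    rw [← hsplit φ (hφ.cornerRegular hP)]
    exact (h φ hφ).2.2
  · rintro rfl ψ hψ
    have hr := hψ.cornerRegular hP
    exact ⟨(hi ψ hr 0).add (hi ψ hr 1), hr.integrableOn_mul hK hu.integrable, by
      rw [hsplit ψ hr, greenPairing_eq hP hu hφ hψ]⟩

/-! ### Edges that are parallel to a coordinate axis -/

/-- The edge `i` lies on the line `x_l = e` and has the outward unit normal `σ e_l`. -/
structure IsNormalEdge (K : Set (ℝ × ℝ)) (edge : Fin n → Edge) (lam : Fin n → ℝ × ℝ → ℝ)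
    (i : Fin n) (l : Fin 2) (σ e : ℝ) : Prop where
  lam_eq : ∀ x, lam i x = σ * (e - coord l x)
  sign : σ = 1 ∧ e = 1 ∨ σ = -1 ∧ e = 0
  integral_pderiv : ∀ φ, IsEdgeCutoff K edge i φ → ∀ w, ContDiff ℝ 1 w →
    ∫ x in K, pderiv l (fun x => φ x * w x) x = σ * ∫ t in Ioo (0 : ℝ) 1, w (pt l e t)
  param : (∀ t, edgePt (edge i) t = pt l e t) ∨ ∀ t, edgePt (edge i) t = pt l e (1 - t)
  edgeIntegral_eq : ∀ q, edgeIntegral (edge i) q = σ * ∫ t in Ioo (0 : ℝ) 1, q l t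

lemma integral_pderiv_cutoff_of_hi (hP : IsRefPolygon K edge lam) {l : Fin 2} {α β : ℝ → ℝ}
    {lo : Fin n} (hS : IsSectioned K edge l α β lo i) (hne : lo ≠ i) (hφ : IsEdgeCutoff K edge i φ)
    {w : ℝ × ℝ → ℝ} (hw : ContDiff ℝ 1 w) :
    ∫ x in K, pderiv l (fun x => φ x * w x) x = ∫ t in Ioo (0 : ℝ) 1, w (pt l (β t) t) := by
  rw [integral_pderiv hP hS ((hφ.cornerRegular hP).mul hP.isRefDomain
    (cornerRegular_of_contDiff hP.isRefDomain hw))]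
  refine setIntegral_congr_fun measurableSet_Ioo fun t ht => ?_
  rw [hφ.2.2.2.1 _ (hS.hi_mem t ht), hφ.2.2.2.2 lo hne _ (hS.lo_mem t ht)]
  ring

lemma integral_pderiv_cutoff_of_lo (hP : IsRefPolygon K edge lam) {l : Fin 2} {α β : ℝ → ℝ}
    {hi : Fin n} (hS : IsSectioned K edge l α β i hi) (hne : hi ≠ i) (hφ : IsEdgeCutoff K edge i φ)
    {w : ℝ × ℝ → ℝ} (hw : ContDiff ℝ 1 w) :
    ∫ x in K, pderiv l (fun x => φ x * w x) x = -∫ t in Ioo (0 : ℝ) 1, w (pt l (α t) t) := by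
  rw [integral_pderiv hP hS ((hφ.cornerRegular hP).mul hP.isRefDomain
    (cornerRegular_of_contDiff hP.isRefDomain hw)), ← integral_neg]
  refine setIntegral_congr_fun measurableSet_Ioo fun t ht => ?_
  rw [hφ.2.2.2.1 _ (hS.lo_mem t ht), hφ.2.2.2.2 hi hne _ (hS.hi_mem t ht)]
  ring

lemma edgeIntegral_eq_setIntegral (e : Edge) (q : Fin 2 → ℝ → ℝ) : edgeIntegral e q =
    ∫ t in Ioo (0 : ℝ) 1, (q 0 t * (e.2.2 - e.1.2) + q 1 t * (e.1.1 - e.2.1)) := by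
  rw [edgeIntegral, intervalIntegral.integral_of_le zero_le_one, integral_Ioc_eq_integral_Ioo]

/-! ### The axis-parallel edges of the square and the triangle. -/

lemma isNormalEdge_square_bottom : IsNormalEdge refSquare squareEdge squareDist 0 1 (-1) 0 where
  lam_eq x := by simp [squareDist, coord]
  sign := Or.inr ⟨rfl, rfl⟩
  integral_pderiv φ hφ w hw := by
    rw [integral_pderiv_cutoff_of_lo isRefPolygon_square isSectioned_square_one (by decide) hφ hw,
      neg_one_mul]
  param := Or.inl fun t => by ext <;> simp [edgePt, squareEdge, pt]
  edgeIntegral_eq q := by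
    rw [edgeIntegral_eq_setIntegral, ← integral_const_mul]
    simp [squareEdge]

lemma isNormalEdge_square_right : IsNormalEdge refSquare squareEdge squareDist 1 0 1 1 where
  lam_eq x := by simp [squareDist, coord]
  sign := Or.inl ⟨rfl, rfl⟩
  integral_pderiv φ hφ w hw := by
    rw [integral_pderiv_cutoff_of_hi isRefPolygon_square isSectioned_square_zero (by decide) hφ hw,
      one_mul]
  param := Or.inl fun t => by ext <;> simp [edgePt, squareEdge, pt]
  edgeIntegral_eq q := by
    rw [edgeIntegral_eq_setIntegral, ← integral_const_mul]
    simp [squareEdge]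

lemma isNormalEdge_square_top : IsNormalEdge refSquare squareEdge squareDist 2 1 1 1 where
  lam_eq x := by simp [squareDist, coord]
  sign := Or.inl ⟨rfl, rfl⟩
  integral_pderiv φ hφ w hw := by
    rw [integral_pderiv_cutoff_of_hi isRefPolygon_square isSectioned_square_one (by decide) hφ hw,
      one_mul]
  param := Or.inr fun t => by ext <;> simp [edgePt, squareEdge, pt]; ring
  edgeIntegral_eq q := by
    rw [edgeIntegral_eq_setIntegral, ← integral_const_mul]
    simp [squareEdge]

lemma isNormalEdge_square_left : IsNormalEdge refSquare squareEdge squareDist 3 0 (-1) 0 where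
  lam_eq x := by simp [squareDist, coord]
  sign := Or.inr ⟨rfl, rfl⟩
  integral_pderiv φ hφ w hw := by
    rw [integral_pderiv_cutoff_of_lo isRefPolygon_square isSectioned_square_zero (by decide) hφ hw,
      neg_one_mul]
  param := Or.inr fun t => by ext <;> simp [edgePt, squareEdge, pt]; ring
  edgeIntegral_eq q := by
    rw [edgeIntegral_eq_setIntegral, ← integral_const_mul]
    simp [squareEdge]

lemma isNormalEdge_triangle_bottom :
    IsNormalEdge refTriangle triangleEdge triangleDist 0 1 (-1) 0 where
  lam_eq x := by simp [triangleDist, coord]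
  sign := Or.inr ⟨rfl, rfl⟩
  integral_pderiv φ hφ w hw := by
    rw [integral_pderiv_cutoff_of_lo isRefPolygon_triangle isSectioned_triangle_one (by decide) hφ
      hw, neg_one_mul]
  param := Or.inl fun t => by ext <;> simp [edgePt, triangleEdge, pt]
  edgeIntegral_eq q := by
    rw [edgeIntegral_eq_setIntegral, ← integral_const_mul]
    simp [triangleEdge]

lemma isNormalEdge_triangle_right :
    IsNormalEdge refTriangle triangleEdge triangleDist 1 0 1 1 where
  lam_eq x := by simp [triangleDist, coord]
  sign := Or.inl ⟨rfl, rfl⟩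
  integral_pderiv φ hφ w hw := by
    rw [integral_pderiv_cutoff_of_hi isRefPolygon_triangle isSectioned_triangle_zero (by decide) hφ
      hw, one_mul]
  param := Or.inl fun t => by ext <;> simp [edgePt, triangleEdge, pt]
  edgeIntegral_eq q := by
    rw [edgeIntegral_eq_setIntegral, ← integral_const_mul]
    simp [triangleEdge]

/-! ### Fluxes as limits of averages over strips -/

/-- A cutoff function for the strip `{λ < 2⁻ᵏ}`. -/
def stripCut (lam : ℝ × ℝ → ℝ) (k : ℕ) (x : ℝ × ℝ) : ℝ :=
  1 - Real.smoothTransition (2 ^ k * lam x)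

variable {l : Fin 2} {σ e : ℝ}

lemma contDiff_stripCut (hP : IsRefPolygon K edge lam) (k : ℕ) :
    ContDiff ℝ 1 (stripCut (lam i) k) :=
  contDiff_const.sub (contDiff_smoothTransition.comp
    (contDiff_const.mul ((hP.contDiff i).of_le (by exact_mod_cast le_top))))

lemma abs_stripCut_le_one (f : ℝ × ℝ → ℝ) (k : ℕ) (x : ℝ × ℝ) : |stripCut f k x| ≤ 1 := by
  have h1 := Real.smoothTransition.nonneg (2 ^ k * f x)
  have h2 := Real.smoothTransition.le_one (2 ^ k * f x)
  rw [stripCut, abs_le]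
  constructor <;> linarith

lemma pderiv_coord (j l : Fin 2) (x : ℝ × ℝ) : pderiv j (coord l) x = if j = l then 1 else 0 := by
  by_cases hl : l = 0
  · have : coord l = Prod.fst := by ext x; simp [coord, hl]
    rw [this, pderiv, (hasFDerivAt_fst (𝕜 := ℝ)).fderiv, hl]
    fin_cases j <;> simp [unitVec]
  · have hl1 : l = 1 := by omega
    have : coord l = Prod.snd := by ext x; simp [coord, hl]
    rw [this, pderiv, (hasFDerivAt_snd (𝕜 := ℝ)).fderiv, hl1]
    fin_cases j <;> simp [unitVec]

lemma pderiv_stripCut (hN : IsNormalEdge K edge lam i l σ e) (j : Fin 2) (k : ℕ) (x : ℝ × ℝ) :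
    pderiv j (stripCut (lam i) k) x =
      if j = l then σ * (2 ^ k * deriv Real.smoothTransition (2 ^ k * lam i x)) else 0 := by
  have h1 : HasFDerivAt (lam i) (σ • -(fderiv ℝ (coord l) x)) x := by
    have : lam i = fun x => σ * (e - coord l x) := funext hN.lam_eq
    rw [this]
    exact ((((contDiff_coord l (n := 1)).differentiable one_ne_zero x).hasFDerivAt).const_sub
      e).const_mul σ
  have h2 : HasFDerivAt (stripCut (lam i) k) _ x :=
    (((contDiff_smoothTransition.differentiable one_ne_zero _).hasDerivAt).comp_hasFDerivAt x
      (h1.const_mul (2 ^ k))).const_sub 1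
  rw [pderiv, h2.fderiv]
  have h3 := pderiv_coord j l x
  rw [pderiv] at h3
  simp [h3]
  split_ifs <;> ring

/-- Every point of `K` eventually leaves the strips, and `|f|` is a majorant. -/
lemma tendsto_integral_stripCut_mul (hP : IsRefPolygon K edge lam) (i : Fin n) {f : ℝ × ℝ → ℝ}
    (hf : IntegrableOn f K) :
    Tendsto (fun k => ∫ x in K, stripCut (lam i) k x * f x) atTop (𝓝 0) := by
  have hKm := hP.isRefDomain.measurableSet
  have : Tendsto (fun k => ∫ x in K, stripCut (lam i) k x * f x) atTop
      (𝓝 (∫ x in K, (0 : ℝ))) := by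
    refine tendsto_integral_of_dominated_convergence (fun x => ‖f x‖)
      (fun k => (contDiff_stripCut hP k).continuous.aestronglyMeasurable.mul hf.1) hf.norm
      (fun k => ae_of_all _ fun x => ?_) (ae_restrict_of_forall_mem hKm fun x hx => ?_)
    · rw [norm_mul]
      exact mul_le_of_le_one_left (norm_nonneg _) (abs_stripCut_le_one _ _ _)
    · have hl := hP.pos x hx i
      have h1 : Tendsto (fun k : ℕ => (2 : ℝ) ^ k * lam i x) atTop atTop :=
        (tendsto_pow_atTop_atTop_of_one_lt one_lt_two).atTop_mul_const hl
      refine tendsto_const_nhds.congr' ?_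
      filter_upwards [h1.eventually_ge_atTop 1] with k hk
      rw [stripCut, Real.smoothTransition.one_of_one_le hk, sub_self, zero_mul]
  simpa using this

/-- The average over a strip along the edge that approximates the flux. -/
def stripFlux (K : Set (ℝ × ℝ)) (lam : ℝ × ℝ → ℝ) (l : Fin 2) (φ : ℝ × ℝ → ℝ) (k : ℕ)
    (v : ℝ × ℝ → ℝ) : ℝ :=
  ∫ x in K, v x * (φ x * pderiv l (stripCut lam k) x)

lemma integrableOn_strip (hP : IsRefPolygon K edge lam) (hφ : IsEdgeCutoff K edge i φ)
    (k : ℕ) {v : ℝ × ℝ → ℝ} (hv : CornerIntegrable K v) :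
    IntegrableOn (fun x => v x * (φ x * pderiv l (stripCut (lam i) k) x)) K := by
  have hK := hP.isRefDomain
  have h1 := (hφ.cornerRegular hP).integrableOn_mul hK (d := fun x => v x *
    pderiv l (stripCut (lam i) k) x) ((hv.mul_continuous hK
      (continuous_pderiv (contDiff_stripCut hP k) l)).integrableOn hK)
  refine h1.congr (ae_of_all _ fun x => ?_)
  simp only
  ring

lemma stripFlux_sub (hP : IsRefPolygon K edge lam) (hφ : IsEdgeCutoff K edge i φ)
    (k : ℕ) {v w : ℝ × ℝ → ℝ} (hv : CornerIntegrable K v) (hw : CornerIntegrable K w) :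
    stripFlux K (lam i) l φ k (fun x => v x - w x) =
      stripFlux K (lam i) l φ k v - stripFlux K (lam i) l φ k w := by
  rw [stripFlux, stripFlux, stripFlux, ← integral_sub (integrableOn_strip hP hφ k hv)
    (integrableOn_strip hP hφ k hw)]
  simp only [sub_mul]

lemma stripCut_mul_isEdgeCutoff (hP : IsRefPolygon K edge lam) (hφ : IsEdgeCutoff K edge i φ)
    (k : ℕ) : IsEdgeCutoff K edge i fun x => stripCut (lam i) k x * φ x :=
  hφ.mul hP (contDiff_stripCut hP k) fun x hx => by
    rw [stripCut, hP.eq_zero i x hx, mul_zero, Real.smoothTransition.zero, sub_zero]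

/-- The Green pairing is unchanged when `φ` is replaced by `χ_k φ`, with `χ_k` the strip cutoff. By
the product rule it splits into terms containing `χ_k` itself, which tend to zero, and one term with
`∇χ_k`. As `χ_k` varies only in the direction `l`, this term sees only `u_l`; the tangential
component and the divergence disappear in the limit. -/
lemma tendsto_stripFlux (hP : IsRefPolygon K edge lam) (hN : IsNormalEdge K edge lam i l σ e)
    (hφ : IsEdgeCutoff K edge i φ) (hu : IsGreenField K u d) :
    Tendsto (fun k => stripFlux K (lam i) l φ k (u l)) atTop (𝓝 (greenPairing K u d φ)) := by
  have hK := hP.isRefDomain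
  have hr := hφ.cornerRegular hP
  have hi : ∀ j, IntegrableOn (fun x => u j x * pderiv j φ x) K := fun j =>
    hr.integrableOn_mul_pderiv hK (hu.corner j) j
  have hlim := (((tendsto_integral_stripCut_mul hP i (hi 0)).add
    (tendsto_integral_stripCut_mul hP i (hi 1))).add (tendsto_integral_stripCut_mul hP i
      (hr.integrableOn_mul hK hu.integrable))).const_sub (greenPairing K u d φ)
  simp only [add_zero, sub_zero] at hlim
  refine hlim.congr fun k => ?_
  have hs := cornerRegular_of_contDiff hK (contDiff_stripCut (i := i) hP k)
  have hj : ∀ j, ∫ x in K, u j x * pderiv j (fun x => stripCut (lam i) k x * φ x) x =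
      (∫ x in K, stripCut (lam i) k x * (u j x * pderiv j φ x)) +
        if j = l then stripFlux K (lam i) l φ k (u l) else 0 := by
    intro j
    have h1 : IntegrableOn (fun x => stripCut (lam i) k x * (u j x * pderiv j φ x)) K := by
      simpa only [mul_comm] using hs.integrableOn_mul hK (hi j)
    have h2 := integrableOn_strip (l := j) hP hφ k (hu.corner j)
    have h3 : (if j = l then stripFlux K (lam i) l φ k (u l) else 0) =
        ∫ x in K, u j x * (φ x * pderiv j (stripCut (lam i) k) x) := by
      split_ifs with h
      · rw [h, stripFlux]
      · simp only [pderiv_stripCut hN, if_neg h, mul_zero, integral_zero]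
    rw [h3, ← integral_add h1 h2]
    refine setIntegral_congr_fun hK.measurableSet fun x hx => ?_
    rw [pderiv_mul hK hs hr hx]
    ring
  rw [greenPairing_eq hP hu hφ (stripCut_mul_isEdgeCutoff hP hφ k), greenPairing, hj, hj]
  have h4 : ((if (0 : Fin 2) = l then stripFlux K (lam i) l φ k (u l) else 0) +
      if (1 : Fin 2) = l then stripFlux K (lam i) l φ k (u l) else 0) =
      stripFlux K (lam i) l φ k (u l) := by
    fin_cases l <;> simp
  have h5 : ∫ x in K, d x * (stripCut (lam i) k x * φ x) =
      ∫ x in K, stripCut (lam i) k x * (d x * φ x) := by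
    simp only [mul_left_comm]
  rw [h5]
  linarith

/-- The same argument with integration along normal sections in place of Green's formula. It
identifies the limit for smooth functions with the edge integral, without any assumption on a second
component. -/
lemma tendsto_stripFlux_of_contDiff (hP : IsRefPolygon K edge lam)
    (hN : IsNormalEdge K edge lam i l σ e) (hφ : IsEdgeCutoff K edge i φ) {w : ℝ × ℝ → ℝ}
    (hw : ContDiff ℝ 1 w) :
    Tendsto (fun k => stripFlux K (lam i) l φ k w) atTop
      (𝓝 (σ * ∫ t in Ioo (0 : ℝ) 1, w (pt l e t))) := by
  have hK := hP.isRefDomain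
  have hr := hφ.cornerRegular hP
  have hwr := cornerRegular_of_contDiff hK hw
  have hprod := hr.mul hK hwr
  have hlim := (tendsto_integral_stripCut_mul hP i
    (hprod.integrableOn_pderiv hK l)).const_sub (σ * ∫ t in Ioo (0 : ℝ) 1, w (pt l e t))
  rw [sub_zero] at hlim
  refine hlim.congr fun k => ?_
  have hs := cornerRegular_of_contDiff hK (contDiff_stripCut (i := i) hP k)
  have hcw : CornerIntegrable K w := by
    simpa using (cornerIntegrable_const hK 1).mul_continuous hK hw.continuous
  have h2 : IntegrableOn (fun x => stripCut (lam i) k x * pderiv l (fun x => φ x * w x) x) K := by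
    simpa only [mul_comm] using hs.integrableOn_mul hK (hprod.integrableOn_pderiv hK l)
  rw [← hN.integral_pderiv _ (stripCut_mul_isEdgeCutoff hP hφ k) w hw, stripFlux, sub_eq_iff_eq_add,
    ← integral_add (integrableOn_strip hP hφ k hcw) h2]
  refine setIntegral_congr_fun hK.measurableSet fun x hx => ?_
  have h1 : (fun x => stripCut (lam i) k x * φ x * w x) =
      fun x => stripCut (lam i) k x * (φ x * w x) := by
    ext; ring
  rw [h1, pderiv_mul hK hs hprod hx]
  ring

/-- The normal derivative of the strip cutoff is `2ᵏ` times a bounded function supported in the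
strip. So the strip flux is at most a multiple of a strip average, and `exists_strip` bounds those
uniformly in `k`. -/
lemma exists_stripFlux_sq_le (hP : IsRefPolygon K edge lam) (hN : IsNormalEdge K edge lam i l σ e)
    (hφ : IsEdgeCutoff K edge i φ) {s : ℝ} (h0 : 1 / 2 < s) (h1 : s ≤ 1) :
    ∃ C : ℝ≥0, ∀ k (v : ℝ × ℝ → ℝ), Measurable v →
      ‖stripFlux K (lam i) l φ k v‖ₑ ^ 2 ≤ C * (nsq K v + slobSq K s v) := by
  have hK := hP.isRefDomain
  obtain ⟨C, hC⟩ := exists_strip h0 h1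
  obtain ⟨M, hM⟩ := (hφ.cornerRegular hP).2.2
  obtain ⟨Cs, hCs⟩ := exists_abs_deriv_smoothTransition_le
  have he : e = 0 ∨ e = 1 := by rcases hN.sign with h | h <;> simp [h.2]
  have hσ : |σ| = 1 := by rcases hN.sign with h | h <;> simp [h.1]
  refine ⟨(M * Cs).toNNReal ^ 2 * C, fun k v hv => ?_⟩
  have hmeas := (isOpen_strip l e k).measurableSet
  have hpt : ∀ x ∈ K, ‖v x * (φ x * pderiv l (stripCut (lam i) k) x)‖ₑ ≤
      (strip l e k).indicator (fun x => ENNReal.ofReal (M * Cs) *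
        (ENNReal.ofReal (2 ^ k) * ‖v x‖ₑ)) x := by
    intro x hx
    have hM0 : 0 ≤ M := (abs_nonneg _).trans (hM x hx).1
    rw [pderiv_stripCut hN, if_pos rfl]
    have habs : |coord l x - e| = lam i x := by
      have := hP.pos x hx i
      rw [← abs_of_pos this, hN.lam_eq, abs_mul, hσ, one_mul, abs_sub_comm]
    by_cases hxs : x ∈ strip l e k
    · rw [indicator_of_mem hxs, enorm_mul, mul_comm ‖v x‖ₑ,
        ← mul_assoc (ENNReal.ofReal (M * Cs))]
      gcongr
      rw [← ENNReal.ofReal_mul' (by positivity), enorm_eq_ofReal_abs]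
      refine ENNReal.ofReal_le_ofReal ?_
      rw [abs_mul, abs_mul, hσ, one_mul, abs_mul, abs_of_pos (by positivity : (0 : ℝ) < 2 ^ k)]
      calc |φ x| * (2 ^ k * |deriv Real.smoothTransition (2 ^ k * lam i x)|) ≤ M * (2 ^ k * Cs) := by
            gcongr
            · exact (hM x hx).1
            · exact hCs _
        _ = _ := by ring
    · have h2 : (1 / 2) ^ k ≤ lam i x := by
        rw [← habs]
        exact not_lt.1 hxs
      have h3 : 1 ≤ 2 ^ k * lam i x := by
        calc (1 : ℝ) = 2 ^ k * (1 / 2) ^ k := by rw [← mul_pow]; norm_num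
          _ ≤ _ := by gcongr
      rw [deriv_smoothTransition_of_one_le h3]
      simp
  calc ‖stripFlux K (lam i) l φ k v‖ₑ ^ 2
      ≤ (∫⁻ x in K, (strip l e k).indicator (fun x => ENNReal.ofReal (M * Cs) *
        (ENNReal.ofReal (2 ^ k) * ‖v x‖ₑ)) x) ^ 2 := by
        refine ennreal_sq_le_sq ((enorm_integral_le_lintegral_enorm _).trans ?_)
        exact setLIntegral_mono' hK.measurableSet hpt
    _ = ENNReal.ofReal (M * Cs) ^ 2 *
          (ENNReal.ofReal (2 ^ k) * ∫⁻ x in K ∩ strip l e k, ‖v x‖ₑ) ^ 2 := by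
        rw [lintegral_indicator hmeas, Measure.restrict_restrict hmeas, inter_comm,
          lintegral_const_mul' _ _ (by simp), lintegral_const_mul' _ _ (by simp), mul_pow]
    _ ≤ ENNReal.ofReal (M * Cs) ^ 2 * (C * (nsq K v + slobSq K s v)) := by
        gcongr
        exact hC K l e k v hK hv he
    _ = _ := by
        push_cast
        rw [ENNReal.ofReal]; ring

end

/-! ### Bounds for the fluxes -/

lemma slobSq_sub_const (K : Set (ℝ × ℝ)) (s : ℝ) (v : ℝ × ℝ → ℝ) (m : ℝ) :
    slobSq K s (fun x => v x - m) = slobSq K s v := by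
  simp [slobSq]

lemma IsRefDomain.volume_le_one {K : Set (ℝ × ℝ)} (hK : IsRefDomain K) : volume K ≤ 1 := by
  refine (measure_mono (μ := volume) hK.subset).trans (le_of_eq ?_)
  have hQ : refSquare = Ioo 0 1 ×ˢ Ioo 0 1 := by
    ext x; simp [refSquare, and_assoc]
  rw [hQ, Measure.volume_eq_prod, Measure.prod_prod]
  simp

lemma IsRefDomain.sq_lintegral_enorm_le {K : Set (ℝ × ℝ)} (hK : IsRefDomain K) {d : ℝ × ℝ → ℝ}
    (hd : AEStronglyMeasurable d (volume.restrict K)) : (∫⁻ x in K, ‖d x‖ₑ) ^ 2 ≤ nsq K d := by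
  refine (sq_lintegral_le hd.enorm).trans ?_
  rw [Measure.restrict_apply_univ]
  exact mul_le_of_le_one_left zero_le hK.volume_le_one

lemma measurable_pderiv (j : Fin 2) (φ : ℝ × ℝ → ℝ) : Measurable (pderiv j φ) :=
  measurable_fderiv_apply_const ℝ φ (unitVec j)

section

variable {n : ℕ} {K : Set (ℝ × ℝ)} {edge : Fin n → Edge} {lam : Fin n → ℝ × ℝ → ℝ} {i : Fin n}
  {φ : ℝ × ℝ → ℝ} {l : Fin 2} {σ e : ℝ}

lemma cornerIntegrable_of_contDiff (hK : IsRefDomain K) {w : ℝ × ℝ → ℝ} (hw : ContDiff ℝ 1 w) :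
    CornerIntegrable K w := by
  simpa using (cornerIntegrable_const hK 1).mul_continuous hK hw.continuous

/-- For `s > 1/2` the flux depends on the normal component of the field only. -/
lemma exists_flux_sub_sq_le (hP : IsRefPolygon K edge lam) (hN : IsNormalEdge K edge lam i l σ e)
    {s : ℝ} (h0 : 1 / 2 < s) (h1 : s ≤ 1) :
    ∃ C : ℝ≥0, ∀ u d F w, IsGreenField K u d → IsGreenFlux K edge i u d F → ContDiff ℝ 1 w →
      ‖F - σ * ∫ t in Ioo (0 : ℝ) 1, w (pt l e t)‖ₑ ^ 2 ≤
        C * (nsq K (fun x => u l x - w x) + slobSq K s (fun x => u l x - w x)) := by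
  have hK := hP.isRefDomain
  obtain ⟨φ, hφ⟩ := hP.exists_isEdgeCutoff i
  obtain ⟨C, hC⟩ := exists_stripFlux_sq_le hP hN hφ h0 h1
  refine ⟨C, fun u d F w hu hF hw => ?_⟩
  rw [(isGreenFlux_iff hP hu hφ).1 hF]
  have hlim := (tendsto_stripFlux hP hN hφ hu).sub (tendsto_stripFlux_of_contDiff hP hN hφ hw)
  refine le_of_tendsto (ENNReal.Tendsto.pow hlim.enorm) (Eventually.of_forall fun k => ?_)
  have hcw := cornerIntegrable_of_contDiff hK hw
  rw [← stripFlux_sub hP hφ k (hu.corner l) hcw]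
  exact hC k _ ((hu.corner l).1.sub hw.continuous.measurable)

lemma exists_edge_integral_sq_le (hP : IsRefPolygon K edge lam)
    (hN : IsNormalEdge K edge lam i l σ e) {s : ℝ} (h0 : 1 / 2 < s) (h1 : s ≤ 1) :
    ∃ C : ℝ≥0, ∀ w, ContDiff ℝ 1 w →
      ‖∫ t in Ioo (0 : ℝ) 1, w (pt l e t)‖ₑ ^ 2 ≤ C * (nsq K w + slobSq K s w) := by
  obtain ⟨φ, hφ⟩ := hP.exists_isEdgeCutoff i
  obtain ⟨C, hC⟩ := exists_stripFlux_sq_le hP hN hφ h0 h1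
  refine ⟨C, fun w hw => ?_⟩
  have hσ : ‖σ‖ₑ = 1 := by rcases hN.sign with h | h <;> simp [h.1]
  have hlim := tendsto_stripFlux_of_contDiff hP hN hφ hw
  have := le_of_tendsto (ENNReal.Tendsto.pow (n := 2) hlim.enorm)
    (Eventually.of_forall fun k => hC k w hw.continuous.measurable)
  rwa [enorm_mul, hσ, one_mul] at this

/-- In contrast to `CornerRegular`, only the two end points of the edge occur. This matters for the
sections of the triangle parallel to an edge: they shrink to a point at the third corner, where
`exists_hardy_sections` is not applicable. -/
lemma IsEdgeCutoff.exists_bound (hP : IsRefPolygon K edge lam) (hφ : IsEdgeCutoff K edge i φ) :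
    ∃ M : ℝ, ∀ x ∈ K, |φ x| ≤ M ∧
      ‖fderiv ℝ φ x‖ ≤ M * ((dist x (edge i).1)⁻¹ + (dist x (edge i).2)⁻¹) := by
  obtain ⟨-, -, ⟨M, hM⟩, -, -⟩ := hφ
  have hv := hP.vertex i
  refine ⟨M, fun x hx => ⟨(hM x hx).1, ?_⟩⟩
  have hM0 : 0 ≤ M := (abs_nonneg _).trans (hM x hx).1
  have hne : ∀ a ∈ corners, 0 < dist x a := fun a ha => dist_pos.2 fun h =>
    notMem_corners_of_mem_refSquare (hP.isRefDomain.subset hx) (h ▸ ha)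
  have hmin : 0 < min (dist x (edge i).1) (dist x (edge i).2) := lt_min (hne _ hv.1) (hne _ hv.2)
  calc ‖fderiv ℝ φ x‖ ≤ M * (min (dist x (edge i).1) (dist x (edge i).2))⁻¹ := by
        rw [← div_eq_mul_inv, le_div_iff₀ hmin]
        exact (hM x hx).2
    _ ≤ _ := by
        gcongr
        rcases min_choice (dist x (edge i).1) (dist x (edge i).2) with h | h <;> rw [h]
        · exact le_add_of_nonneg_right (inv_nonneg.2 dist_nonneg)
        · exact le_add_of_nonneg_left (inv_nonneg.2 dist_nonneg)

lemma lintegral_mul_pderiv_sq_le (hK : MeasurableSet K) {a b : ℝ × ℝ} {M : ℝ}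
    (hM : ∀ x ∈ K, ‖fderiv ℝ φ x‖ ≤ M * ((dist x a)⁻¹ + (dist x b)⁻¹)) {v : ℝ × ℝ → ℝ}
    (hv : Measurable v) (j : Fin 2) {B : ℝ≥0∞}
    (ha : (∫⁻ x in K, ‖v x‖ₑ * ENNReal.ofReal (dist x a)⁻¹) ^ 2 ≤ B)
    (hb : (∫⁻ x in K, ‖v x‖ₑ * ENNReal.ofReal (dist x b)⁻¹) ^ 2 ≤ B) :
    (∫⁻ x in K, ‖v x * pderiv j φ x‖ₑ) ^ 2 ≤ ENNReal.ofReal M ^ 2 * (4 * B) := by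
  calc (∫⁻ x in K, ‖v x * pderiv j φ x‖ₑ) ^ 2
      ≤ (∫⁻ x in K, ENNReal.ofReal M * (‖v x‖ₑ * ENNReal.ofReal (dist x a)⁻¹ +
          ‖v x‖ₑ * ENNReal.ofReal (dist x b)⁻¹)) ^ 2 := by
        refine ennreal_sq_le_sq (setLIntegral_mono' hK fun x hx => ?_)
        rw [enorm_mul, ← mul_add, mul_left_comm, ← ENNReal.ofReal_add (by positivity)
          (by positivity), ← ENNReal.ofReal_mul' (by positivity)]
        gcongr
        rw [enorm_eq_ofReal_abs]
        exact ENNReal.ofReal_le_ofReal ((abs_pderiv_le j φ x).trans (hM x hx))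
    _ = ENNReal.ofReal M ^ 2 * ((∫⁻ x in K, ‖v x‖ₑ * ENNReal.ofReal (dist x a)⁻¹) +
          ∫⁻ x in K, ‖v x‖ₑ * ENNReal.ofReal (dist x b)⁻¹) ^ 2 := by
        rw [lintegral_const_mul' _ _ (by simp), lintegral_add_left (by fun_prop), mul_pow]
    _ ≤ ENNReal.ofReal M ^ 2 * (2 * (B + B)) := by
        gcongr
        refine (ennreal_add_sq_le _ _).trans ?_
        gcongr
    _ = _ := by ring

/-- The sections in the direction `j` do not meet the edge `i`, and the distance to the end points
of this edge is comparable with the distance measured along the sections. -/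
structure IsTangentialEdge (K : Set (ℝ × ℝ)) (edge : Fin n → Edge) (i : Fin n) (j : Fin 2)
    (α β : ℝ → ℝ) (lo hi : Fin n) : Prop where
  sectioned : IsSectioned K edge j α β lo hi
  lo_ne : lo ≠ i
  hi_ne : hi ≠ i
  measurable_lo : Measurable α
  measurable_hi : Measurable β
  endpoint : ∀ a, a = (edge i).1 ∨ a = (edge i).2 → ∃ e τ : ℝ → ℝ,
    (∀ t ∈ Ioo (0 : ℝ) 1, (e t = α t ∨ e t = β t) ∧ 1 - τ t ≤ β t - α t) ∧
    ((τ = fun t => t) ∨ τ = fun t => 1 - t) ∧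
    ∀ t ∈ Ioo (0 : ℝ) 1, ∀ r ∈ Ioo (α t) (β t), τ t + |r - e t| ≤ 2 * dist (pt j r t) a

/-- The mean of `v` over the section of `K` at height `t`. -/
def sectionMean (j : Fin 2) (α β : ℝ → ℝ) (v : ℝ × ℝ → ℝ) (t : ℝ) : ℝ :=
  (β t - α t)⁻¹ * ∫ r in Ioo (α t) (β t), v (pt j r t)

lemma coord_succ_pt (j : Fin 2) (r t : ℝ) : coord (j + 1) (pt j r t) = t := by
  fin_cases j <;> simp [coord, pt]

lemma measurable_sectionMean {j : Fin 2} {α β : ℝ → ℝ} (hα : Measurable α) (hβ : Measurable β)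
    {v : ℝ × ℝ → ℝ} (hv : Measurable v) : Measurable (sectionMean j α β v) := by
  refine (hβ.sub hα).inv.mul ?_
  have hset : MeasurableSet {p : ℝ × ℝ | α p.1 < p.2 ∧ p.2 < β p.1} :=
    (measurableSet_lt (hα.comp measurable_fst) measurable_snd).inter
      (measurableSet_lt measurable_snd (hβ.comp measurable_fst))
  have h1 : Measurable fun p : ℝ × ℝ => {p : ℝ × ℝ | α p.1 < p.2 ∧ p.2 < β p.1}.indicator
      (fun p => v (pt j p.2 p.1)) p := (hv.comp (measurable_pt j)).indicator hset
  have h2 := h1.stronglyMeasurable.integral_prod_right' (ν := (volume : Measure ℝ))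
  have h3 : (fun t => ∫ r in Ioo (α t) (β t), v (pt j r t)) = fun t => ∫ r,
      {p : ℝ × ℝ | α p.1 < p.2 ∧ p.2 < β p.1}.indicator (fun p => v (pt j p.2 p.1)) (t, r) :=
    funext fun t => by
      rw [← integral_indicator measurableSet_Ioo]
      rfl
  rw [h3]
  exact h2.measurable

/-- Sections parallel to the edge end on other edges, where `φ = 0`, so `∂_j φ` has integral zero
over almost every section. Subtracting from `v` its section means therefore does not change the
integral. For the remainder the `L²` norm is bounded by the anisotropic seminorm, by Poincaré on the
sections, and Hardy's inequality along the same sections finishes. -/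
lemma exists_integral_tangential_sq_le (hP : IsRefPolygon K edge lam) {j : Fin 2} {α β : ℝ → ℝ}
    {lo hi : Fin n} (hT : IsTangentialEdge K edge i j α β lo hi) (hφ : IsEdgeCutoff K edge i φ)
    {s : ℝ} (h0 : 0 < s) (h1 : s ≤ 1) :
    ∃ C : ℝ≥0, ∀ v, CornerIntegrable K v →
      ‖∫ x in K, v x * pderiv j φ x‖ₑ ^ 2 ≤ C * anisoSq K s j v := by
  have hK := hP.isRefDomain
  have hKm := hK.measurableSet
  have hS := hT.sectioned
  obtain ⟨C, hC⟩ := exists_hardy_sections h0 h1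
  obtain ⟨M, hM⟩ := hφ.exists_bound hP
  refine ⟨M.toNNReal ^ 2 * (4 * (C * 2)), fun v hv => ?_⟩
  have hr := hφ.cornerRegular hP
  -- The subtracted function is constant along sections, so the anisotropic seminorms of `w` and `v`
  -- coincide.
  set w : ℝ × ℝ → ℝ := fun x => v x - sectionMean j α β v (coord (j + 1) x) with hw
  have hwpt : ∀ r t, w (pt j r t) = v (pt j r t) - sectionMean j α β v t := fun r t => by
    simp only [hw, coord_succ_pt]
  have hwm : Measurable w := hv.1.sub ((measurable_sectionMean hT.measurable_lo hT.measurable_hi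
    hv.1).comp (continuous_coord _).measurable)
  have hvint := hr.integrableOn_mul_pderiv hK hv j
  have heq : ∫ x in K, v x * pderiv j φ x =
      ∫ t in Ioo (0 : ℝ) 1, ∫ r in {r | pt j r t ∈ K}, w (pt j r t) * pderiv j φ (pt j r t) := by
    rw [integral_sections hKm hK.subset j hvint]
    refine integral_congr_ae ?_
    filter_upwards [ae_restrict_of_ae (ae_integrableOn_section hKm hvint j),
      ae_restrict_of_ae (ae_integrableOn_section hKm (hr.integrableOn_pderiv hK j) j),
      ae_restrict_mem measurableSet_Ioo] with t k1 k2 ht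
    have k3 := k2
    rw [hS.section_eq t ht] at k3
    have hz := integral_section_pderiv hP hS hr ht k3
    rw [hφ.2.2.2.2 hi hT.hi_ne _ (hS.hi_mem t ht), hφ.2.2.2.2 lo hT.lo_ne _ (hS.lo_mem t ht),
      sub_zero, ← hS.section_eq t ht] at hz
    simp only [hwpt, sub_mul]
    rw [integral_sub k1 (k2.const_mul _), integral_const_mul, hz, mul_zero, sub_zero]
  have hwa : anisoSq K s j w = anisoSq K s j v := by
    simp only [anisoSq, slobodeckijSq1, hwpt, sub_sub_sub_cancel_right]
  have hwn : nsq K w ≤ anisoSq K s j v := by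
    rw [nsq, lintegral_sections hKm hK.subset j (by fun_prop), anisoSq]
    refine lintegral_mono_ae ?_
    filter_upwards [ae_restrict_of_ae (ae_integrableOn_section hKm (hv.integrableOn hK) j),
      ae_restrict_mem measurableSet_Ioo] with t k1 ht
    rw [hS.section_eq t ht] at k1 ⊢
    simp only [hwpt]
    exact lintegral_sub_mean_sq_le_slobodeckijSq1 (hS.lt t ht) (hS.sub_le t ht) h0 k1
  have hend : ∀ a, a = (edge i).1 ∨ a = (edge i).2 →
      (∫⁻ x in K, ‖w x‖ₑ * ENNReal.ofReal (dist x a)⁻¹) ^ 2 ≤ C * 2 * anisoSq K s j v := by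
    intro a ha
    obtain ⟨e, τ, h2, h3, h4⟩ := hT.endpoint a ha
    refine (hC K j α β e τ a w hKm hK.subset hwm hS.section_eq
      (fun t ht => ⟨(h2 t ht).1, hS.sub_le t ht, (h2 t ht).2⟩) h3 h4).trans ?_
    rw [hwa, mul_assoc, two_mul]
    gcongr
  have hle : ‖∫ x in K, v x * pderiv j φ x‖ₑ ≤ ∫⁻ x in K, ‖w x * pderiv j φ x‖ₑ := by
    rw [heq, lintegral_sections hKm hK.subset j
      (F := fun x => ‖w x * pderiv j φ x‖ₑ) (hwm.mul (measurable_pderiv j φ)).enorm]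
    refine (enorm_integral_le_lintegral_enorm _).trans (lintegral_mono fun t => ?_)
    exact enorm_integral_le_lintegral_enorm _
  refine (ennreal_sq_le_sq hle).trans ((lintegral_mul_pderiv_sq_le hKm (fun x hx => (hM x hx).2)
    hwm j (hend _ (Or.inl rfl)) (hend _ (Or.inr rfl))).trans (le_of_eq ?_))
  push_cast
  rw [ENNReal.ofReal]
  ring

/-- The bound for the flux in the case `s ≤ 1/2`. -/
lemma exists_flux_sub_sq_le_aniso (hP : IsRefPolygon K edge lam)
    (hN : IsNormalEdge K edge lam i l σ e) {α β : ℝ → ℝ} {lo hi : Fin n}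
    (hT : IsTangentialEdge K edge i (l + 1) α β lo hi) {s : ℝ} (h0 : 0 < s) (h1 : s ≤ 1) :
    ∃ C : ℝ≥0, ∀ u d F m, IsGreenField K u d → IsGreenFlux K edge i u d F →
      ‖F - σ * m‖ₑ ^ 2 ≤ C * (nsq K (fun x => u l x - m) + slobSq K s (u l) +
        anisoSq K s (l + 1) (u (l + 1)) + nsq K d) := by
  have hK := hP.isRefDomain
  have hKm := hK.measurableSet
  obtain ⟨φ, hφ⟩ := hP.exists_isEdgeCutoff i
  have hr := hφ.cornerRegular hP
  obtain ⟨C1, hC1⟩ := exists_hardy h0 h1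
  obtain ⟨C2, hC2⟩ := exists_integral_tangential_sq_le hP hT hφ h0 h1
  obtain ⟨M, hM⟩ := hφ.exists_bound hP
  set C3 : ℝ≥0 := M.toNNReal ^ 2 * (4 * C1) with hC3
  refine ⟨4 * (C3 + C2 + M.toNNReal ^ 2), fun u d F m hu hF => ?_⟩
  have hc := hu.corner l
  have hcm := hc.sub (cornerIntegrable_const hK m)
  -- Normal sections run from an edge where `φ = 0` to the edge `i`, where `φ = 1`, or conversely;
  -- so subtracting `m` from `u_l` in the pairing costs exactly `σ m`.
  have hσm : σ * m = ∫ x in K, m * pderiv l φ x := by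
    have := hN.integral_pderiv φ hφ (fun _ => 1) contDiff_const
    simp only [mul_one] at this
    rw [integral_const_mul, this]
    simp
    ring
  have hdecomp : F - σ * m = (∫ x in K, (u l x - m) * pderiv l φ x) +
      (∫ x in K, u (l + 1) x * pderiv (l + 1) φ x) + ∫ x in K, d x * φ x := by
    rw [(isGreenFlux_iff hP hu hφ).1 hF, hσm]
    simp only [sub_mul]
    rw [integral_sub (hr.integrableOn_mul_pderiv hK hc l)
      ((hr.integrableOn_pderiv hK l).const_mul m), greenPairing]
    fin_cases l
    · simp; ring
    · simp; ring
  have e1 : ‖∫ x in K, (u l x - m) * pderiv l φ x‖ₑ ^ 2 ≤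
      C3 * (nsq K (fun x => u l x - m) + slobSq K s (u l)) := by
    have hend : ∀ a ∈ corners, (∫⁻ x in K, ‖u l x - m‖ₑ * ENNReal.ofReal (dist x a)⁻¹) ^ 2 ≤
        C1 * (nsq K (fun x => u l x - m) + slobSq K s (u l)) := fun a ha => by
      obtain ⟨ha1, ha2⟩ := mem_corners.1 ha
      rw [← slobSq_sub_const K s (u l) m]
      exact hC1 K a _ hK hcm.1 ha1 ha2
    refine (ennreal_sq_le_sq (enorm_integral_le_lintegral_enorm _)).trans
      ((lintegral_mul_pderiv_sq_le hKm (fun x hx => (hM x hx).2) hcm.1 l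
        (hend _ (hP.vertex i).1) (hend _ (hP.vertex i).2)).trans (le_of_eq ?_))
    rw [hC3]
    push_cast
    rw [ENNReal.ofReal]
    ring
  have e2 := hC2 (u (l + 1)) (hu.corner (l + 1))
  have e3 : ‖∫ x in K, d x * φ x‖ₑ ^ 2 ≤ (M.toNNReal : ℝ≥0∞) ^ 2 * nsq K d := by
    have hle : ‖∫ x in K, d x * φ x‖ₑ ≤ M.toNNReal * ∫⁻ x in K, ‖d x‖ₑ := by
      refine (enorm_integral_le_lintegral_enorm _).trans ?_
      rw [← lintegral_const_mul' _ _ (by simp)]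
      refine setLIntegral_mono' hKm fun x hx => ?_
      rw [enorm_mul, mul_comm]
      gcongr
      rw [enorm_eq_ofReal_abs]
      exact ENNReal.ofReal_le_ofReal (hM x hx).1
    refine (ennreal_sq_le_sq hle).trans ?_
    rw [mul_pow]
    gcongr
    exact hK.sq_lintegral_enorm_le hu.integrable.1
  set X1 := nsq K (fun x => u l x - m) + slobSq K s (u l)
  set X2 := anisoSq K s (l + 1) (u (l + 1))
  set X3 := nsq K d
  rw [hdecomp]
  calc _ ≤ (‖∫ x in K, (u l x - m) * pderiv l φ x‖ₑ +
        ‖∫ x in K, u (l + 1) x * pderiv (l + 1) φ x‖ₑ + ‖∫ x in K, d x * φ x‖ₑ) ^ 2 := by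
        refine ennreal_sq_le_sq ((enorm_add_le _ _).trans ?_)
        gcongr
        exact enorm_add_le _ _
    _ ≤ 2 * (2 * (C3 * X1 + C2 * X2) + M.toNNReal ^ 2 * X3) := by
        refine (ennreal_add_sq_le _ _).trans ?_
        gcongr
        refine (ennreal_add_sq_le _ _).trans ?_
        gcongr
    _ = 4 * C3 * X1 + 4 * C2 * X2 + 2 * M.toNNReal ^ 2 * X3 := by ring
    _ ≤ 4 * (C3 + C2 + M.toNNReal ^ 2) * X1 + 4 * (C3 + C2 + M.toNNReal ^ 2) * X2 +
          4 * (C3 + C2 + M.toNNReal ^ 2) * X3 := by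
        gcongr
        · rw [add_assoc]; exact le_self_add
        · rw [add_right_comm]; exact le_add_self
        · norm_num
        · exact le_add_self
    _ = _ := by push_cast; ring

end

/-! ### The edges as seen along tangential sections. -/

lemma add_le_two_mul_dist_pt {j : Fin 2} {r t A B : ℝ} {a : ℝ × ℝ} (hA : A ≤ |t - coord (j + 1) a|)
    (hB : B ≤ |r - coord j a|) : A + B ≤ 2 * dist (pt j r t) a := by
  have h1 : |t - coord (j + 1) a| ≤ dist (pt j r t) a ∧ |r - coord j a| ≤ dist (pt j r t) a := by
    fin_cases j
    · simp [coord, pt, Prod.dist_eq, Real.dist_eq]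
    · simp [coord, pt, Prod.dist_eq, Real.dist_eq]
  linarith [h1.1, h1.2]

lemma isTangentialEdge_square_bottom :
    IsTangentialEdge refSquare squareEdge 0 0 (fun _ => 0) (fun _ => 1) 3 1 where
  sectioned := isSectioned_square_zero
  lo_ne := by decide
  hi_ne := by decide
  measurable_lo := measurable_const
  measurable_hi := measurable_const
  endpoint := by
    rintro a (rfl | rfl)
    · refine ⟨fun _ => 0, fun t => t, fun t ht => ⟨Or.inl rfl, by linarith [ht.1]⟩, Or.inl rfl,
        fun t ht r hr => add_le_two_mul_dist_pt ?_ ?_⟩ <;> simp [squareEdge, coord, le_abs_self]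
    · refine ⟨fun _ => 1, fun t => t, fun t ht => ⟨Or.inr rfl, by linarith [ht.1]⟩, Or.inl rfl,
        fun t ht r hr => add_le_two_mul_dist_pt ?_ ?_⟩ <;> simp [squareEdge, coord, le_abs_self]

lemma isTangentialEdge_square_right :
    IsTangentialEdge refSquare squareEdge 1 1 (fun _ => 0) (fun _ => 1) 0 2 where
  sectioned := isSectioned_square_one
  lo_ne := by decide
  hi_ne := by decide
  measurable_lo := measurable_const
  measurable_hi := measurable_const
  endpoint := by
    rintro a (rfl | rfl)
    · refine ⟨fun _ => 0, fun t => 1 - t, fun t ht => ⟨Or.inl rfl, by linarith [ht.2]⟩, Or.inr rfl,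
        fun t ht r hr => add_le_two_mul_dist_pt ?_ ?_⟩ <;>
      simp [squareEdge, coord, abs_sub_comm t, le_abs_self]
    · refine ⟨fun _ => 1, fun t => 1 - t, fun t ht => ⟨Or.inr rfl, by linarith [ht.2]⟩, Or.inr rfl,
        fun t ht r hr => add_le_two_mul_dist_pt ?_ ?_⟩ <;>
      simp [squareEdge, coord, abs_sub_comm t, le_abs_self]

lemma isTangentialEdge_square_top :
    IsTangentialEdge refSquare squareEdge 2 0 (fun _ => 0) (fun _ => 1) 3 1 where
  sectioned := isSectioned_square_zero
  lo_ne := by decide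
  hi_ne := by decide
  measurable_lo := measurable_const
  measurable_hi := measurable_const
  endpoint := by
    rintro a (rfl | rfl)
    · refine ⟨fun _ => 1, fun t => 1 - t, fun t ht => ⟨Or.inr rfl, by linarith [ht.2]⟩, Or.inr rfl,
        fun t ht r hr => add_le_two_mul_dist_pt ?_ ?_⟩ <;>
      simp [squareEdge, coord, abs_sub_comm t, le_abs_self]
    · refine ⟨fun _ => 0, fun t => 1 - t, fun t ht => ⟨Or.inl rfl, by linarith [ht.2]⟩, Or.inr rfl,
        fun t ht r hr => add_le_two_mul_dist_pt ?_ ?_⟩ <;>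
      simp [squareEdge, coord, abs_sub_comm t, le_abs_self]

lemma isTangentialEdge_square_left :
    IsTangentialEdge refSquare squareEdge 3 1 (fun _ => 0) (fun _ => 1) 0 2 where
  sectioned := isSectioned_square_one
  lo_ne := by decide
  hi_ne := by decide
  measurable_lo := measurable_const
  measurable_hi := measurable_const
  endpoint := by
    rintro a (rfl | rfl)
    · refine ⟨fun _ => 1, fun t => t, fun t ht => ⟨Or.inr rfl, by linarith [ht.1]⟩, Or.inl rfl,
        fun t ht r hr => add_le_two_mul_dist_pt ?_ ?_⟩ <;> simp [squareEdge, coord, le_abs_self]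
    · refine ⟨fun _ => 0, fun t => t, fun t ht => ⟨Or.inl rfl, by linarith [ht.1]⟩, Or.inl rfl,
        fun t ht r hr => add_le_two_mul_dist_pt ?_ ?_⟩ <;> simp [squareEdge, coord, le_abs_self]

lemma isTangentialEdge_triangle_bottom :
    IsTangentialEdge refTriangle triangleEdge 0 0 (fun t => t) (fun _ => 1) 2 1 where
  sectioned := isSectioned_triangle_zero
  lo_ne := by decide
  hi_ne := by decide
  measurable_lo := measurable_id
  measurable_hi := measurable_const
  endpoint := by
    rintro a (rfl | rfl)
    · refine ⟨fun t => t, fun t => t, fun t ht => ⟨Or.inl rfl, le_rfl⟩, Or.inl rfl,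
        fun t ht r hr => add_le_two_mul_dist_pt ?_ ?_⟩
      · simp [triangleEdge, coord, le_abs_self]
      · simp only [triangleEdge, coord, Matrix.cons_val, if_true, sub_zero]
        -- The section starts at `r = t` on the oblique edge and not above the corner; its points
        -- satisfy `0 < r - t ≤ r`, which is all that is needed.
        rw [abs_of_pos (by linarith [hr.1]), abs_of_pos (by linarith [hr.1, ht.1])]
        linarith [ht.1]
    · refine ⟨fun _ => 1, fun t => t, fun t ht => ⟨Or.inr rfl, le_rfl⟩, Or.inl rfl,
        fun t ht r hr => add_le_two_mul_dist_pt ?_ ?_⟩ <;> simp [triangleEdge, coord, le_abs_self]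

lemma isTangentialEdge_triangle_right :
    IsTangentialEdge refTriangle triangleEdge 1 1 (fun _ => 0) (fun t => t) 0 2 where
  sectioned := isSectioned_triangle_one
  lo_ne := by decide
  hi_ne := by decide
  measurable_lo := measurable_const
  measurable_hi := measurable_id
  endpoint := by
    rintro a (rfl | rfl)
    · refine ⟨fun _ => 0, fun t => 1 - t, fun t ht => ⟨Or.inl rfl, by linarith⟩, Or.inr rfl,
        fun t ht r hr => add_le_two_mul_dist_pt ?_ ?_⟩ <;>
      simp [triangleEdge, coord, abs_sub_comm t, le_abs_self]
    · refine ⟨fun t => t, fun t => 1 - t, fun t ht => ⟨Or.inr rfl, by linarith⟩, Or.inr rfl,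
        fun t ht r hr => add_le_two_mul_dist_pt ?_ ?_⟩
      · simp [triangleEdge, coord, abs_sub_comm t, le_abs_self]
      · simp only [triangleEdge, coord, Matrix.cons_val]
        norm_num
        rw [abs_of_neg (by linarith [hr.2]), abs_of_neg (by linarith [hr.2, ht.2])]
        linarith [ht.2]

/-! ### Approximation by smooth functions -/

lemma slobSq_add_le (K : Set (ℝ × ℝ)) (s : ℝ) {v w : ℝ × ℝ → ℝ} (hv : Measurable v) :
    slobSq K s (fun x => v x + w x) ≤ 2 * (slobSq K s v + slobSq K s w) := by
  obtain ⟨F, hF, hFm⟩ : ∃ F : (ℝ × ℝ) × (ℝ × ℝ) → ℝ≥0∞,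
      (∀ x y, F (x, y) = ENNReal.ofReal ((v x - v y) ^ 2 / eucl x y ^ (2 + 2 * s))) ∧
        Measurable F := ⟨_, fun _ _ => rfl, measurable_kernel hv⟩
  obtain ⟨G, hG⟩ : ∃ G : (ℝ × ℝ) × (ℝ × ℝ) → ℝ≥0∞,
      ∀ x y, G (x, y) = ENNReal.ofReal ((w x - w y) ^ 2 / eucl x y ^ (2 + 2 * s)) :=
    ⟨fun p => ENNReal.ofReal ((w p.1 - w p.2) ^ 2 / eucl p.1 p.2 ^ (2 + 2 * s)), fun _ _ => rfl⟩
  have h2 : (2 : ℝ≥0∞) = ENNReal.ofReal 2 := by simp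
  have hle : ∀ x y, ENNReal.ofReal ((v x + w x - (v y + w y)) ^ 2 / eucl x y ^ (2 + 2 * s)) ≤
      2 * (F (x, y) + G (x, y)) := fun x y => by
    have he : 0 ≤ eucl x y ^ (2 + 2 * s) := Real.rpow_nonneg (eucl_nonneg x y) _
    rw [hF, hG, ← ENNReal.ofReal_add (by positivity) (by positivity), h2,
      ← ENNReal.ofReal_mul (by norm_num)]
    refine ENNReal.ofReal_le_ofReal ?_
    rw [← add_div, ← mul_div_assoc]
    gcongr
    nlinarith [sq_nonneg (v x - v y - (w x - w y))]
  have e1 : slobSq K s v = ∫⁻ x in K, ∫⁻ y in K, F (x, y) := by simp only [hF, slobSq]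
  have e2 : slobSq K s w = ∫⁻ x in K, ∫⁻ y in K, G (x, y) := by simp only [hG, slobSq]
  rw [e1, e2, ← lintegral_add_left hFm.lintegral_prod_right', ← lintegral_const_mul' _ _ (by simp)]
  refine lintegral_mono fun x => ?_
  have hFx : Measurable fun y => F (x, y) := hFm.comp measurable_prodMk_left
  rw [← lintegral_add_left hFx, ← lintegral_const_mul' _ _ (by simp)]
  exact lintegral_mono fun y => hle x y

lemma nsq_sub_comm (K : Set (ℝ × ℝ)) (v w : ℝ × ℝ → ℝ) :
    nsq K (fun x => v x - w x) = nsq K (fun x => w x - v x) := by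
  simp only [nsq, enorm_sub_rev]

lemma slobSq_sub_comm (K : Set (ℝ × ℝ)) (s : ℝ) (v w : ℝ × ℝ → ℝ) :
    slobSq K s (fun x => v x - w x) = slobSq K s (fun x => w x - v x) := by
  have : ∀ x y, (v x - w x - (v y - w y)) ^ 2 = (w x - v x - (w y - v y)) ^ 2 := fun x y => by ring
  simp only [slobSq, this]

lemma nsq_slobSq_triangle (K : Set (ℝ × ℝ)) (s : ℝ) {v w z : ℝ × ℝ → ℝ} (hv : Measurable v)
    (hw : Measurable w) :
    nsq K (fun x => v x - z x) + slobSq K s (fun x => v x - z x) ≤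
      2 * ((nsq K (fun x => v x - w x) + slobSq K s (fun x => v x - w x)) +
        (nsq K (fun x => w x - z x) + slobSq K s (fun x => w x - z x))) := by
  have h1 := nsq_add_le K (v := fun x => v x - w x) (w := fun x => w x - z x) (hv.sub hw)
  have h2 := slobSq_add_le K s (v := fun x => v x - w x) (w := fun x => w x - z x) (hv.sub hw)
  simp only [sub_add_sub_cancel] at h1 h2
  refine (add_le_add h1 h2).trans (le_of_eq ?_)
  ring

/-- Sobolev spaces of order up to one are contained in Slobodeckij spaces of order below one. -/
lemma exists_slobSq_le_hSeminorm {s : ℝ} (h0 : 1 / 2 < s) (h1 : s ≤ 1) :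
    ∃ s' : ℝ, 1 / 2 < s' ∧ s' < 1 ∧ ∃ C : ℝ≥0, ∀ (K : Set (ℝ × ℝ)) (v : ℝ × ℝ → ℝ),
      IsRefDomain K → Measurable v → MemLp v 2 (volume.restrict K) →
        slobSq K s' v ≤ C * hSeminorm K s v ^ 2 := by
  rcases h1.lt_or_eq with h | rfl
  · refine ⟨s, h0, h, 1, fun K v _ _ _ => ?_⟩
    rw [hSeminorm, if_pos h, slobodeckij_sq]
    simp
  · obtain ⟨C, hC⟩ := exists_slobSq_le_h1Seminorm
    refine ⟨3 / 4, by norm_num, by norm_num, C, fun K v hK hv hv2 => ?_⟩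
    rw [hSeminorm, if_neg (lt_irrefl _)]
    exact hC K v hK hv hv2

lemma exists_smooth_near {K : Set (ℝ × ℝ)} (hK : IsRefDomain K) {s : ℝ}
    {v : ℝ × ℝ → ℝ} (hv : Measurable v) (hvs : MemH K s v) {η : ℝ≥0∞} (hη : η ≠ 0) :
    ∃ w : ℝ × ℝ → ℝ, ContDiff ℝ (⊤ : ℕ∞) w ∧ nsq K (fun x => w x - v x) ≤ η ∧
      hSeminorm K s (fun x => w x - v x) ^ 2 ≤ η := by
  obtain ⟨hv2, hvs⟩ := hvs
  have : IsFiniteMeasure (volume.restrict K) := ⟨by simpa using hK.volume_lt_top⟩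
  by_cases h : s < 1
  · simp only [hSeminorm, if_pos h, slobodeckij_sq] at hvs ⊢
    refine exists_smooth_slobSq hK hv hv2 ?_ hη
    rw [← slobodeckij_sq]
    exact ENNReal.pow_lt_top hvs
  · simp only [hSeminorm, if_neg h] at hvs ⊢
    obtain ⟨g, hgm, hg2, hvg, -⟩ := exists_weakPartial_of_h1Seminorm_lt_top hvs
    obtain ⟨w, hw, hw1, hw2⟩ := exists_smooth_h1 hK hv hv2 hgm hg2 hvg
      (ENNReal.half_pos hη).ne'
    refine ⟨w, hw, hw1.trans ENNReal.half_le_self, ?_⟩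
    have hw' : ContDiff ℝ 1 w := hw.of_le (by exact_mod_cast le_top)
    have hwm := hK.memLp_of_continuous hw.continuous
    have hpm := fun i => hK.memLp_of_continuous (continuous_pderiv hw' i)
    refine (h1Seminorm_le (g := fun i x => pderiv i w x - g i x)
      (fun i => (hpm i).sub (hg2 i)) fun i => ?_).trans ?_
    · exact (integral_mul_pderiv_eq_neg hw' i).sub (hvg i) (hwm.integrable one_le_two)
        (hv2.integrable one_le_two) ((hpm i).integrable one_le_two)
        ((hg2 i).integrable one_le_two)
    · rw [Fin.sum_univ_two]
      exact (add_le_add (hw2 0) (hw2 1)).trans (ENNReal.add_halves η).le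

/-! ### Traces -/

/-- By continuity, averages over shrinking one-sided neighbourhoods of `e` eventually exceed any
number below `‖f e‖ₑ`. -/
lemma enorm_endpoint_le {f : ℝ → ℝ} (hf : Continuous f) {e : ℝ} (he : e = 0 ∨ e = 1) {B : ℝ≥0∞}
    (hB : ∀ k : ℕ, ENNReal.ofReal (2 ^ k) *
      ∫⁻ y in Ioo 0 1 ∩ Metric.ball e ((1 / 2) ^ k), ‖f y‖ₑ ≤ B) : ‖f e‖ₑ ≤ B := by
  refine le_of_forall_lt fun c hc => ?_
  obtain ⟨c', hcc', hc'⟩ := exists_between hc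
  refine lt_of_lt_of_le hcc' ?_
  have hev : ∀ᶠ y in 𝓝 e, c' ≤ ‖f y‖ₑ :=
    (hf.enorm.tendsto e).eventually_const_le hc'
  obtain ⟨ρ, hρ, hball⟩ := Metric.eventually_nhds_iff_ball.1 hev
  obtain ⟨k, hk⟩ := exists_pow_lt_of_lt_one hρ (by norm_num : (1 / 2 : ℝ) < 1)
  refine le_trans ?_ (hB k)
  have hvol : volume (Ioo 0 1 ∩ Metric.ball e ((1 / 2 : ℝ) ^ k)) = ENNReal.ofReal ((1 / 2) ^ k) :=
    volume_inter_ball_endpoint he (by positivity)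
      (by rw [sub_zero]; exact pow_le_one₀ (by norm_num) (by norm_num))
  calc c' = ENNReal.ofReal (2 ^ k) * (c' * ENNReal.ofReal ((1 / 2) ^ k)) := by
        rw [mul_left_comm, ← ENNReal.ofReal_mul (by positivity), ← mul_pow]
        norm_num
    _ = ENNReal.ofReal (2 ^ k) *
          ∫⁻ y in Ioo 0 1 ∩ Metric.ball e ((1 / 2) ^ k), c' := by
        rw [setLIntegral_const, hvol]
    _ ≤ _ := by
        gcongr ENNReal.ofReal (2 ^ k) * ?_
        refine setLIntegral_mono' (measurableSet_Ioo.inter Metric.isOpen_ball.measurableSet)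
          fun y hy => ?_
        exact hball y (Metric.ball_subset_ball hk.le hy.2)

/-- The trace inequality on the square, for continuous functions. -/
lemma exists_trace_sq_le {s : ℝ} (h0 : 1 / 2 < s) (h1 : s ≤ 1) :
    ∃ C : ℝ≥0, ∀ (l : Fin 2) (e : ℝ) (w : ℝ × ℝ → ℝ), Continuous w → (e = 0 ∨ e = 1) →
      ∫⁻ t in Ioo (0 : ℝ) 1, ‖w (pt l e t)‖ₑ ^ 2 ≤
        C * (nsq refSquare w + slobSq refSquare s w) := by
  obtain ⟨C, hC⟩ := exists_strip_interval h0 h1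
  refine ⟨2 + 128 * C ^ 2, fun l e w hw he => ?_⟩
  have hQ := isOpen_refSquare.measurableSet
  have hN := measurable_section_slobodeckijSq1 hQ l s hw.measurable
  have hpoint : ∀ t ∈ Ioo (0 : ℝ) 1, ‖w (pt l e t)‖ₑ ^ 2 ≤
      2 * ((∫⁻ r in {r | pt l r t ∈ refSquare}, ‖w (pt l r t)‖ₑ ^ 2) +
        C ^ 2 * slobodeckijSq1 {r | pt l r t ∈ refSquare} s (fun r => w (pt l r t))) := by
    intro t ht
    have hc : Continuous fun r => w (pt l r t) :=
      hw.comp ((continuous_pt l).comp (by fun_prop : Continuous fun r : ℝ => (t, r)))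
    have h := enorm_endpoint_le hc he fun k => hC e (fun r => w (pt l r t)) k hc.measurable he
    rw [refSquare_section l ht]
    refine (ennreal_sq_le_sq h).trans ((ennreal_add_sq_le _ _).trans ?_)
    gcongr
    · refine (sq_lintegral_le hc.measurable.enorm.aemeasurable).trans ?_
      simp
    · rw [mul_pow, ennreal_rpow_half_sq]
  refine (setLIntegral_mono' measurableSet_Ioo hpoint).trans ?_
  rw [lintegral_const_mul' _ _ (by simp), lintegral_add_right _ (hN.const_mul _),
    lintegral_const_mul' _ _ (by simp), ← lintegral_sections hQ subset_rfl l
      (F := fun x => ‖w x‖ₑ ^ 2) (by fun_prop)]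
  have h64 : ∫⁻ t in Ioo (0 : ℝ) 1, slobodeckijSq1 {r | pt l r t ∈ refSquare} s
      (fun r => w (pt l r t)) ≤ 64 * slobSq refSquare s w :=
    anisoSq_le_slobSq l (by linarith) h1 hw.measurable
  calc _ ≤ 2 * (nsq refSquare w + C ^ 2 * (64 * slobSq refSquare s w)) := by
        gcongr
        exact le_rfl
    _ = 2 * nsq refSquare w + 128 * C ^ 2 * slobSq refSquare s w := by ring
    _ ≤ (2 + 128 * C ^ 2) * nsq refSquare w + (2 + 128 * C ^ 2) * slobSq refSquare s w := by
        gcongr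
        · exact le_self_add
        · exact le_add_self
    _ = _ := by push_cast; ring

section

variable {n : ℕ} {K : Set (ℝ × ℝ)} {edge : Fin n → Edge} {lam : Fin n → ℝ × ℝ → ℝ} {i : Fin n}
  {l : Fin 2} {σ e : ℝ}

lemma IsNormalEdge.lintegral_edgePt (hN : IsNormalEdge K edge lam i l σ e)
    (F : ℝ × ℝ → ℝ≥0∞) : ∫⁻ t in Ioo (0 : ℝ) 1, F (edgePt (edge i) t) =
      ∫⁻ t in Ioo (0 : ℝ) 1, F (pt l e t) := by
  rcases hN.param with h | h <;> simp only [h]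
  rw [← (Measure.measurePreserving_sub_left volume (1 : ℝ)).setLIntegral_comp_preimage_emb
    (MeasurableEquiv.subLeft (1 : ℝ)).measurableEmbedding (fun t => F (pt l e t))]
  simp

lemma IsNormalEdge.integral_edgePt (hN : IsNormalEdge K edge lam i l σ e)
    (f : ℝ × ℝ → ℝ) : ∫ t in Ioo (0 : ℝ) 1, f (edgePt (edge i) t) =
      ∫ t in Ioo (0 : ℝ) 1, f (pt l e t) := by
  rcases hN.param with h | h <;> simp only [h]
  rw [← (Measure.measurePreserving_sub_left volume (1 : ℝ)).setIntegral_preimage_emb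
    (MeasurableEquiv.subLeft (1 : ℝ)).measurableEmbedding (fun t => f (pt l e t))]
  simp

lemma continuous_edgePt (e : Edge) : Continuous (edgePt e) := by
  unfold edgePt
  fun_prop

/-- Functions of order `s > 1/2` on the square have traces. -/
lemma exists_hasTrace (hN : IsNormalEdge refSquare edge lam i l σ e) {s : ℝ} (h0 : 1 / 2 < s)
    (h1 : s ≤ 1) {v : ℝ × ℝ → ℝ} (hv : Measurable v) (hvs : MemH refSquare s v) :
    ∃ g, HasTrace refSquare s (edge i) v g := by
  have hK : IsRefDomain refSquare := Or.inl rfl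
  have he : e = 0 ∨ e = 1 := by rcases hN.sign with h | h <;> simp [h.2]
  obtain ⟨s', hs0, hs1, C, hC⟩ := exists_slobSq_le_hSeminorm h0 h1
  obtain ⟨C', hC'⟩ := exists_trace_sq_le hs0 hs1.le
  set q : ℝ≥0∞ := 2⁻¹ with hq
  have hq0 : q ≠ 0 := by simp [hq]
  -- The squared errors are at most `(2⁻ᵏ)²`, so by the trace inequality the restrictions to the
  -- edge form a Cauchy sequence with geometric rate.
  choose w hw hw1 hw2 using fun k : ℕ => exists_smooth_near hK hv hvs
    (pow_ne_zero 2 (pow_ne_zero k hq0))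
  have hwc := fun k => (hw k).continuous
  have hX : ∀ k, nsq refSquare (fun x => w k x - v x) + slobSq refSquare s' (fun x => w k x - v x) ≤
      (1 + C) * (q ^ k) ^ 2 := fun k => by
    rw [add_mul, one_mul]
    refine add_le_add (hw1 k) ((hC _ _ hK ((hwc k).measurable.sub hv)
      ((hK.memLp_of_continuous (hwc k)).sub hvs.1)).trans (mul_le_mul' le_rfl (hw2 k)))
  have hanti : ∀ {N k : ℕ}, N ≤ k → (q ^ k) ^ 2 ≤ (q ^ N) ^ 2 := fun h =>
    ennreal_sq_le_sq (pow_le_pow_right_of_le_one' (by simp [hq]) h)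
  set A : ℝ≥0∞ := C' * (2 * ((1 + C) + (1 + C))) with hA
  have hAt : A ≠ ⊤ := by finiteness
  have hmem : ∀ k, MemLp (fun t => w k (edgePt (edge i) t)) 2 (volume.restrict (Ioo (0 : ℝ) 1)) := by
    intro k
    have hcc := (hwc k).comp (continuous_edgePt (edge i))
    obtain ⟨D, hD⟩ := (isCompact_Icc (a := (0 : ℝ)) (b := 1)).exists_bound_of_continuousOn
      hcc.continuousOn
    exact MemLp.of_bound hcc.aestronglyMeasurable D (ae_restrict_of_forall_mem measurableSet_Ioo
      fun t ht => hD t (Ioo_subset_Icc_self ht))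
  obtain ⟨g, hg, hlim⟩ := Lp.cauchy_complete_eLpNorm (p := 2) one_le_two hmem
    -- The completeness criterion asks for strict inequalities; the squared distances are at most `A
    -- (q ^ N) ^ 2`, and `A < (A + 1) ^ 2`.
    (B := fun N => (A + 1) * q ^ N) (by
      rw [ENNReal.tsum_mul_left, ENNReal.tsum_geometric, hq, ENNReal.one_sub_inv_two, inv_inv]
      finiteness) (by
      intro N k m hk hm
      refine lt_of_not_ge fun hle => (not_le.2 ?_) (ennreal_sq_le_sq hle)
      have h2 : eLpNorm ((fun t => w k (edgePt (edge i) t)) - fun t => w m (edgePt (edge i) t)) 2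
          (volume.restrict (Ioo (0 : ℝ) 1)) ^ 2 ≤ A * (q ^ N) ^ 2 := by
        rw [← lintegral_enorm_sq_eq]
        have h3 := hN.lintegral_edgePt (fun x => ‖w k x - w m x‖ₑ ^ 2)
        refine (h3.trans_le (hC' l e (fun x => w k x - w m x) ((hwc k).sub (hwc m)) he)).trans ?_
        rw [hA, mul_assoc]
        gcongr
        refine (nsq_slobSq_triangle refSquare s' (hwc k).measurable hv).trans ?_
        rw [mul_assoc, add_mul]
        gcongr
        · exact (hX k).trans (mul_le_mul' le_rfl (hanti hk))
        · rw [nsq_sub_comm, slobSq_sub_comm]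
          exact (hX m).trans (mul_le_mul' le_rfl (hanti hm))
      refine h2.trans_lt ?_
      rw [mul_pow]
      refine (ENNReal.mul_lt_mul_iff_left (by simp [hq]) (by simp [hq])).2 ?_
      calc A < A + 1 := ENNReal.lt_add_right hAt one_ne_zero
        _ ≤ (A + 1) ^ 2 := by
            rw [sq]
            exact le_mul_of_one_le_left zero_le le_add_self)
  have hql : Tendsto (fun k => q ^ k) atTop (𝓝 0) :=
    ENNReal.tendsto_pow_atTop_nhds_zero_of_lt_one (by simp [hq])
  refine ⟨g, hg, w, hw, ?_, ?_, hlim⟩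
  · refine tendsto_of_tendsto_of_tendsto_of_le_of_le tendsto_const_nhds hql (fun _ => zero_le)
      fun k => ennreal_le_of_sq_le ?_
    rw [l2Norm_sq]
    exact hw1 k
  · exact tendsto_of_tendsto_of_tendsto_of_le_of_le tendsto_const_nhds hql (fun _ => zero_le)
      fun k => ennreal_le_of_sq_le (hw2 k)

/-- Only the integral of a trace enters the degrees of freedom. The defining sequence is recast in a
Slobodeckij norm of order `s'`, and its `L²` convergence on the edge weakened to convergence of
integrals. -/
lemma HasTrace.exists_tendsto (hN : IsNormalEdge K edge lam i l σ e) (hK : IsRefDomain K)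
    {s s' : ℝ} {C : ℝ≥0} (hC : ∀ (K : Set (ℝ × ℝ)) (v : ℝ × ℝ → ℝ), IsRefDomain K → Measurable v →
      MemLp v 2 (volume.restrict K) → slobSq K s' v ≤ C * hSeminorm K s v ^ 2)
    {v : ℝ × ℝ → ℝ} (hv : Measurable v) (hv2 : MemLp v 2 (volume.restrict K)) {g : ℝ → ℝ}
    (hg : HasTrace K s (edge i) v g) :
    ∃ w : ℕ → ℝ × ℝ → ℝ, (∀ k, ContDiff ℝ 1 (w k)) ∧
      Tendsto (fun k => nsq K (fun x => w k x - v x) + slobSq K s' (fun x => w k x - v x)) atTop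
        (𝓝 0) ∧
      Tendsto (fun k => ∫ t in Ioo (0 : ℝ) 1, w k (pt l e t)) atTop
        (𝓝 (∫ t in Ioo (0 : ℝ) 1, g t)) := by
  obtain ⟨hg2, w, hw, h1, h2, h3⟩ := hg
  refine ⟨w, fun k => (hw k).of_le (by exact_mod_cast le_top), ?_, ?_⟩
  · have l1 := ENNReal.Tendsto.pow (n := 2) h1
    have l2 := ENNReal.Tendsto.const_mul (a := (C : ℝ≥0∞)) (ENNReal.Tendsto.pow (n := 2) h2)
      (Or.inr ENNReal.coe_ne_top)
    have l3 := l1.add l2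
    simp only [ne_eq, OfNat.ofNat_ne_zero, not_false_eq_true, zero_pow, mul_zero, add_zero,
      l2Norm_sq] at l3
    refine tendsto_of_tendsto_of_tendsto_of_le_of_le tendsto_const_nhds l3 (fun _ => zero_le)
      fun k => add_le_add le_rfl ?_
    exact hC K _ hK ((hw k).continuous.measurable.sub hv)
      ((hK.memLp_of_continuous (hw k).continuous).sub hv2)
  · simp only [← hN.integral_edgePt]
    have : IsFiniteMeasure (volume.restrict (Ioo (0 : ℝ) 1)) := ⟨by simp⟩
    have hwi : ∀ k, Integrable (fun t => w k (edgePt (edge i) t)) (volume.restrict (Ioo (0 : ℝ) 1)) :=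
      fun k => (((hw k).continuous.comp (continuous_edgePt (edge i))).continuousOn.integrableOn_compact
        isCompact_Icc).mono_set Ioo_subset_Icc_self
    rw [tendsto_iff_edist_tendsto_0]
    refine tendsto_of_tendsto_of_tendsto_of_le_of_le tendsto_const_nhds h3 (fun _ => zero_le)
      fun k => ennreal_le_of_sq_le ?_
    rw [edist_eq_enorm_sub, ← integral_sub (hwi k) (hg2.integrable one_le_two),
      ← lintegral_enorm_sq_eq]
    refine (ennreal_sq_le_sq (enorm_integral_le_lintegral_enorm _)).trans
      ((sq_lintegral_le ((hwi k).1.sub hg2.1).enorm).trans ?_)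
    simp

/-- The integral of the trace is controlled. -/
lemma exists_trace_integral_sub_sq_le (hP : IsRefPolygon K edge lam)
    (hN : IsNormalEdge K edge lam i l σ e) {s s' : ℝ} (hs0 : 1 / 2 < s') (hs1 : s' < 1) {C : ℝ≥0}
    (hC : ∀ (K : Set (ℝ × ℝ)) (v : ℝ × ℝ → ℝ), IsRefDomain K → Measurable v →
      MemLp v 2 (volume.restrict K) → slobSq K s' v ≤ C * hSeminorm K s v ^ 2) :
    ∃ C' : ℝ≥0, ∀ v g w, Measurable v → MemLp v 2 (volume.restrict K) →
      HasTrace K s (edge i) v g → ContDiff ℝ 1 w →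
      ‖(∫ t in Ioo (0 : ℝ) 1, g t) - ∫ t in Ioo (0 : ℝ) 1, w (pt l e t)‖ₑ ^ 2 ≤
        C' * (nsq K (fun x => v x - w x) + slobSq K s' (fun x => v x - w x)) := by
  have hK := hP.isRefDomain
  obtain ⟨C1, hC1⟩ := exists_edge_integral_sq_le hP hN hs0 hs1.le
  refine ⟨C1 * 2, fun v g w hv hv2 hg hw => ?_⟩
  obtain ⟨z, hz, hlim, hint⟩ := hg.exists_tendsto hN hK hC hv hv2
  have hpt : Continuous fun t => pt l e t :=
    (continuous_pt l).comp (by fun_prop : Continuous fun t : ℝ => (t, e))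
  have hi : ∀ f : ℝ × ℝ → ℝ, ContDiff ℝ 1 f → IntegrableOn (fun t => f (pt l e t)) (Ioo (0 : ℝ) 1) :=
    fun f hf => ((hf.continuous.comp hpt).continuousOn.integrableOn_compact
      isCompact_Icc).mono_set Ioo_subset_Icc_self
  have l1 := ENNReal.Tendsto.pow (n := 2)
    (hint.sub_const (∫ t in Ioo (0 : ℝ) 1, w (pt l e t))).enorm
  set X := nsq K (fun x => v x - w x) + slobSq K s' (fun x => v x - w x) with hX
  have l2 : Tendsto (fun k => (C1 : ℝ≥0∞) * (2 * ((nsq K (fun x => z k x - v x) +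
      slobSq K s' (fun x => z k x - v x)) + X))) atTop (𝓝 (C1 * (2 * (0 + X)))) := by
    refine ENNReal.Tendsto.const_mul (ENNReal.Tendsto.const_mul (hlim.add_const X) ?_) ?_
    · exact Or.inr (by simp)
    · exact Or.inr (by simp)
  refine (le_of_tendsto_of_tendsto' l1 l2 fun k => ?_).trans (le_of_eq ?_)
  · rw [← integral_sub (hi _ (hz k)) (hi w hw)]
    refine (hC1 (fun x => z k x - w x) ((hz k).sub hw)).trans ?_
    gcongr
    exact nsq_slobSq_triangle K s' (hz k).continuous.measurable hv
  · push_cast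
    rw [zero_add, mul_assoc]

/-- The sequence that defines `g'` consists of smooth functions close to `v`, and by
`exists_trace_integral_sub_sq_le` their edge integrals also converge to that of `g`. -/
lemma HasTrace.integral_eq (hP : IsRefPolygon K edge lam)
    (hN : IsNormalEdge K edge lam i l σ e) {s : ℝ} (h0 : 1 / 2 < s) (h1 : s ≤ 1)
    {v : ℝ × ℝ → ℝ} (hv : Measurable v) (hv2 : MemLp v 2 (volume.restrict K)) {g g' : ℝ → ℝ}
    (hg : HasTrace K s (edge i) v g) (hg' : HasTrace K s (edge i) v g') :
    ∫ t in Ioo (0 : ℝ) 1, g t = ∫ t in Ioo (0 : ℝ) 1, g' t := by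
  have hK := hP.isRefDomain
  obtain ⟨s', hs0, hs1, C, hC⟩ := exists_slobSq_le_hSeminorm h0 h1
  obtain ⟨C', hC'⟩ := exists_trace_integral_sub_sq_le hP hN hs0 hs1 hC
  obtain ⟨z, hz, hlim, hint⟩ := hg'.exists_tendsto hN hK hC hv hv2
  have l1 := ENNReal.Tendsto.pow (n := 2)
    (hint.const_sub (∫ t in Ioo (0 : ℝ) 1, g t)).enorm
  have l2 := ENNReal.Tendsto.const_mul (a := (C' : ℝ≥0∞)) hlim (Or.inr (by simp))
  have := le_of_tendsto_of_tendsto' l1 l2 fun k => by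
    rw [nsq_sub_comm, slobSq_sub_comm]
    exact hC' v g (z k) hv hv2 hg (hz k)
  rw [mul_zero, nonpos_iff_eq_zero] at this
  simpa [sub_eq_zero] using this

/-- The flux defined by Green's formula is the integral of the trace. -/
lemma IsGreenFlux.eq_trace_integral (hP : IsRefPolygon K edge lam)
    (hN : IsNormalEdge K edge lam i l σ e) {s : ℝ} (h0 : 1 / 2 < s) (h1 : s ≤ 1)
    {u : Field2} {d : ℝ × ℝ → ℝ} {F : ℝ} (hu : IsGreenField K u d)
    (hu2 : MemLp (u l) 2 (volume.restrict K)) (hF : IsGreenFlux K edge i u d F) {g : ℝ → ℝ}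
    (hg : HasTrace K s (edge i) (u l) g) : F = σ * ∫ t in Ioo (0 : ℝ) 1, g t := by
  have hK := hP.isRefDomain
  obtain ⟨s', hs0, hs1, C, hC⟩ := exists_slobSq_le_hSeminorm h0 h1
  obtain ⟨C', hC'⟩ := exists_flux_sub_sq_le hP hN hs0 hs1.le
  obtain ⟨z, hz, hlim, hint⟩ := hg.exists_tendsto hN hK hC (hu.corner l).1 hu2
  have l1 := ENNReal.Tendsto.pow (n := 2) ((hint.const_mul σ).const_sub F).enorm
  have l2 := ENNReal.Tendsto.const_mul (a := (C' : ℝ≥0∞)) hlim (Or.inr (by simp))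
  have := le_of_tendsto_of_tendsto' l1 l2 fun k => by
    rw [nsq_sub_comm, slobSq_sub_comm]
    exact hC' u d F (z k) hu hF (hz k)
  rw [mul_zero, nonpos_iff_eq_zero] at this
  simpa [sub_eq_zero] using this

end

/-! ### Independence of the representative -/

section

variable {K : Set (ℝ × ℝ)} {v v' : ℝ × ℝ → ℝ}

lemma l2Norm_congr (h : v =ᵐ[volume.restrict K] v') : l2Norm K v = l2Norm K v' :=
  eLpNorm_congr_ae h

lemma hSeminorm_congr (h : v =ᵐ[volume.restrict K] v') (s : ℝ) :
    hSeminorm K s v = hSeminorm K s v' := by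
  have h1 : slobodeckij K s v = slobodeckij K s v' := by
    rw [slobodeckij, slobodeckij]
    congr 1
    exact lintegral_congr_ae (h.mono fun x hx => lintegral_congr_ae (h.mono fun y hy => by
      simp only [hx, hy]))
  have h2 : ∀ i g, IsWeakPartial K i v g ↔ IsWeakPartial K i v' g := fun i g =>
    ⟨fun hg => hg.congr h (ae_eq_refl _), fun hg => hg.congr h.symm (ae_eq_refl _)⟩
  simp only [hSeminorm, h1, h1Seminorm, h2]

lemma memH_congr (h : v =ᵐ[volume.restrict K] v') {s : ℝ} : MemH K s v ↔ MemH K s v' := by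
  rw [MemH, MemH, memLp_congr_ae h, hSeminorm_congr h]

lemma anisoSeminorm_congr (hK : MeasurableSet K) (h : v =ᵐ[volume.restrict K] v') (s : ℝ)
    (j : Fin 2) : anisoSeminorm K s j v = anisoSeminorm K s j v' := by
  have h1 : ∀ᵐ p : ℝ × ℝ, pt j p.2 p.1 ∈ K → v (pt j p.2 p.1) = v' (pt j p.2 p.1) :=
    (measurePreserving_pt j).quasiMeasurePreserving.ae ((ae_restrict_iff' hK).1 h)
  rw [Measure.volume_eq_prod] at h1
  have h2 := Measure.ae_ae_of_ae_prod h1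
  rw [anisoSeminorm, anisoSeminorm]
  congr 1
  refine lintegral_congr_ae (ae_restrict_of_ae (h2.mono fun t ht => ?_))
  have h3 : ∀ᵐ r ∂(volume.restrict {r | pt j r t ∈ K}), v (pt j r t) = v' (pt j r t) :=
    (ae_restrict_iff' (measurableSet_section hK j t)).2 ht
  exact lintegral_congr_ae (h3.mono fun r hr => lintegral_congr_ae (h3.mono fun r' hr' => by
    simp only [hr, hr']))

lemma hasTrace_congr (h : v =ᵐ[volume.restrict K] v') {s : ℝ} {e : Edge} {g : ℝ → ℝ} :
    HasTrace K s e v g ↔ HasTrace K s e v' g := by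
  have hw : ∀ w : ℝ × ℝ → ℝ, (fun x => w x - v x) =ᵐ[volume.restrict K] fun x => w x - v' x :=
    fun w => h.mono fun x hx => by simp only [hx]
  have h1 := fun w => l2Norm_congr (hw w)
  have h2 := fun w => hSeminorm_congr (hw w) s
  simp only [HasTrace, h1, h2]

variable {u u' : Field2} {d : ℝ × ℝ → ℝ}

lemma ae_eq_pairing (h : ∀ j, u j =ᵐ[volume.restrict K] u' j) (φ : ℝ × ℝ → ℝ) :
    (fun x => u 0 x * pderiv 0 φ x + u 1 x * pderiv 1 φ x) =ᵐ[volume.restrict K]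
      fun x => u' 0 x * pderiv 0 φ x + u' 1 x * pderiv 1 φ x := by
  filter_upwards [h 0, h 1] with x h0 h1
  rw [h0, h1]

lemma hasDiv_congr (h : ∀ j, u j =ᵐ[volume.restrict K] u' j) : HasDiv K u d ↔ HasDiv K u' d := by
  have h1 := fun φ => integral_congr_ae (ae_eq_pairing h φ)
  have h2 := fun j => memLp_congr_ae (p := 2) (h j)
  simp only [HasDiv, IsWeakDiv, h1, h2]

lemma isRTInterpolant_congr {n : ℕ} {edge : Fin n → Edge} {V : Set Field2} {p : Field2}
    (h : ∀ j, u j =ᵐ[volume.restrict K] u' j) :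
    IsRTInterpolant K edge V u d p ↔ IsRTInterpolant K edge V u' d p := by
  have h1 := fun φ => integral_congr_ae (ae_eq_pairing h φ)
  have h2 : ∀ φ, IntegrableOn (fun x => u 0 x * pderiv 0 φ x + u 1 x * pderiv 1 φ x) K ↔
      IntegrableOn (fun x => u' 0 x * pderiv 0 φ x + u' 1 x * pderiv 1 φ x) K :=
    fun φ => integrable_congr (ae_eq_pairing h φ)
  simp only [IsRTInterpolant, IsGreenFlux, h1, h2]

lemma isTraceRTInterpolant_congr {n : ℕ} {edge : Fin n → Edge} {V : Set Field2} {p : Field2}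
    {s : ℝ} (h : ∀ j, u j =ᵐ[volume.restrict K] u' j) :
    IsTraceRTInterpolant K edge V s u p ↔ IsTraceRTInterpolant K edge V s u' p := by
  have h1 := fun e g j => hasTrace_congr (s := s) (e := e) (g := g) (h j)
  simp only [IsTraceRTInterpolant, h1]

/-- The section arguments are carried out for Borel functions. All norms, divergences, traces and
fluxes ignore null sets, so a Borel representative may be used. -/
lemma exists_measurable_field {s : ℝ} (hu : ∀ j, MemH K s (u j)) :
    ∃ u' : Field2, (∀ j, Measurable (u' j)) ∧ (∀ j, u j =ᵐ[volume.restrict K] u' j) ∧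
      ∀ j, MemH K s (u' j) := by
  have hae := fun j => (hu j).1.1.ae_eq_mk
  exact ⟨fun j => (hu j).1.1.mk (u j), fun j => (hu j).1.1.stronglyMeasurable_mk.measurable, hae,
    fun j => (memH_congr (hae j)).1 (hu j)⟩

end

/-! ### Degrees of freedom -/

/-- The field in the lowest order Raviart–Thomas space of the square with the given fluxes. -/
def squareRT (F : Fin 4 → ℝ) : Field2 :=
  ![fun x => -F 3 + (F 1 + F 3) * x.1, fun x => -F 0 + (F 2 + F 0) * x.2]

/-- The field in the lowest order Raviart–Thomas space of the triangle with the given fluxes. -/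
def triangleRT (F : Fin 3 → ℝ) : Field2 :=
  ![fun x => F 1 - (F 0 + F 1 + F 2) + (F 0 + F 1 + F 2) * x.1,
    fun x => -F 0 + (F 0 + F 1 + F 2) * x.2]

lemma edgeFlux_squareEdge (a b c d : ℝ) (i : Fin 4) :
    edgeFlux (squareEdge i) ![fun x => a + c * x.1, fun x => b + d * x.2] =
      (![-b, a + c, b + d, -a] : Fin 4 → ℝ) i := by
  fin_cases i <;> simp [edgeFlux, edgeIntegral, squareEdge, edgePt]

lemma edgeFlux_triangleEdge (a b c : ℝ) (i : Fin 3) :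
    edgeFlux (triangleEdge i) ![fun x => a + c * x.1, fun x => b + c * x.2] =
      (![-b, a + c, b - a] : Fin 3 → ℝ) i := by
  fin_cases i
  · simp [edgeFlux, edgeIntegral, triangleEdge, edgePt]
  · simp [edgeFlux, edgeIntegral, triangleEdge, edgePt]
  · have : ∀ t : ℝ, -(c * (1 + -t)) + -a + (b + c * (1 + -t)) = b - a := fun t => by ring
    simp [edgeFlux, edgeIntegral, triangleEdge, edgePt, this]

lemma squareRT_iff (F : Fin 4 → ℝ) (p : Field2) :
    (p ∈ squareRT0 ∧ ∀ i, edgeFlux (squareEdge i) p = F i) ↔ p = squareRT F := by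
  constructor
  · rintro ⟨⟨a, b, c, d, rfl⟩, h⟩
    simp only [edgeFlux_squareEdge] at h
    have h0 := h 0; have h1 := h 1; have h2 := h 2; have h3 := h 3
    simp at h0 h1 h2 h3
    rw [squareRT, ← h0, ← h1, ← h2, ← h3]
    simp
  · rintro rfl
    refine ⟨⟨-F 3, -F 0, F 1 + F 3, F 2 + F 0, rfl⟩, fun i => ?_⟩
    rw [squareRT, edgeFlux_squareEdge]
    fin_cases i <;> simp

lemma triangleRT_iff (F : Fin 3 → ℝ) (p : Field2) :
    (p ∈ triangleRT0 ∧ ∀ i, edgeFlux (triangleEdge i) p = F i) ↔ p = triangleRT F := by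
  constructor
  · rintro ⟨⟨a, b, c, rfl⟩, h⟩
    simp only [edgeFlux_triangleEdge] at h
    have h0 := h 0; have h1 := h 1; have h2 := h 2
    simp at h0 h1 h2
    have hc : F 0 + F 1 + F 2 = c := by rw [← h0, ← h1, ← h2]; ring
    rw [triangleRT, hc, ← h0, ← h1]
    simp
  · rintro rfl
    refine ⟨⟨F 1 - (F 0 + F 1 + F 2), -F 0, F 0 + F 1 + F 2, rfl⟩, fun i => ?_⟩
    rw [triangleRT, edgeFlux_triangleEdge]
    fin_cases i <;> simp
    ring

section

variable {n : ℕ} {K : Set (ℝ × ℝ)} {edge : Fin n → Edge} {lam : Fin n → ℝ × ℝ → ℝ}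
  {u : Field2} {d : ℝ × ℝ → ℝ}

lemma isGreenField_of_hasDiv (hK : IsRefDomain K) {s : ℝ} (h0 : 0 < s) (h1 : s ≤ 1)
    (hu : ∀ j, Measurable (u j)) (hus : ∀ j, MemH K s (u j)) (hd : HasDiv K u d) :
    IsGreenField K u d := by
  have : IsFiniteMeasure (volume.restrict K) := ⟨by simpa using hK.volume_lt_top⟩
  refine ⟨fun j => ?_, hd.2.1.integrable one_le_two, hd.2.2⟩
  obtain ⟨hu2, hu3⟩ := hus j
  rcases h1.lt_or_eq with h | rfl
  · refine cornerIntegrable_of_slobSq_lt_top hK h0 h (hu j) (nsq_lt_top hu2) ?_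
    rw [← slobodeckij_sq]
    rw [hSeminorm, if_pos h] at hu3
    exact ENNReal.pow_lt_top hu3
  · obtain ⟨s', hs0, hs1, C, hC⟩ := exists_slobSq_le_hSeminorm (s := 1) (by norm_num) le_rfl
    exact cornerIntegrable_of_slobSq_lt_top hK (by linarith) hs1 (hu j) (nsq_lt_top hu2)
      ((hC K _ hK (hu j) hu2).trans_lt (ENNReal.mul_lt_top ENNReal.coe_lt_top
        (ENNReal.pow_lt_top hu3)))

lemma IsGreenField.exists_flux (hP : IsRefPolygon K edge lam) (hu : IsGreenField K u d) :
    ∃ F : Fin n → ℝ, ∀ i F', IsGreenFlux K edge i u d F' ↔ F' = F i := by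
  choose φ hφ using hP.exists_isEdgeCutoff
  exact ⟨fun i => greenPairing K u d (φ i), fun i F' => isGreenFlux_iff hP hu (hφ i)⟩

/-- The divergence theorem on the triangle. -/
lemma sum_flux_triangle (hu : IsGreenField refTriangle u d) {F : Fin 3 → ℝ}
    (hF : ∀ i, IsGreenFlux refTriangle triangleEdge i u d (F i)) :
    F 0 + F 1 + F 2 = ∫ x in refTriangle, d x := by
  have hP := isRefPolygon_triangle
  have hK := hP.isRefDomain
  choose φ hφ using hP.exists_isEdgeCutoff
  have hr := fun i => (hφ i).cornerRegular hP
  have h1 := cornerRegular_of_contDiff hK (w := fun _ => (1 : ℝ)) contDiff_const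
  have h2 := h1.sub hK (hr 0)
  have h3 := h2.sub hK (hr 1)
  have h4 := h3.sub hK (hr 2)
  -- The function `1 - φ₀ - φ₁ - φ₂` vanishes on every open edge, although none of its cutoffs is in
  -- `H¹`; the pairing with the constant 1 is `∫ div u`.
  have hz := greenPairing_eq_zero hP hu h4 fun j x hx => by
    have e1 := (hφ j).2.2.2.1 x hx
    have e2 := fun i hij => (hφ i).2.2.2.2 j hij x hx
    fin_cases j
    · have a := e2 1 (by decide); have b := e2 2 (by decide)
      simp only [Fin.zero_eta] at e1 a b
      simp only [e1, a, b]; ring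
    · have a := e2 0 (by decide); have b := e2 2 (by decide)
      simp only [Fin.mk_one] at e1 a b
      simp only [e1, a, b]; ring
    · have a := e2 0 (by decide); have b := e2 1 (by decide)
      simp only [Fin.reduceFinMk] at e1 a b
      simp only [e1, a, b]; ring
  rw [greenPairing_sub hK hu h3 (hr 2), greenPairing_sub hK hu h2 (hr 1),
    greenPairing_sub hK hu h1 (hr 0), ← (isGreenFlux_iff hP hu (hφ 0)).1 (hF 0),
    ← (isGreenFlux_iff hP hu (hφ 1)).1 (hF 1), ← (isGreenFlux_iff hP hu (hφ 2)).1 (hF 2)] at hz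
  have h5 : greenPairing refTriangle u d (fun _ => 1) = ∫ x in refTriangle, d x := by
    simp [greenPairing, pderiv]
  linarith

lemma nsq_sub_le (hK : IsRefDomain K) {v p : ℝ × ℝ → ℝ} (hv : Measurable v) {m A B : ℝ}
    (h : ∀ x ∈ K, |m - p x| ≤ |A| + |B|) :
    nsq K (fun x => v x - p x) ≤
      4 * (nsq K (fun x => v x - m) + ‖A‖ₑ ^ 2 + ‖B‖ₑ ^ 2) := by
  have h1 := nsq_add_le K (v := fun x => v x - m) (w := fun x => m - p x) (hv.sub_const m)
  simp only [sub_add_sub_cancel] at h1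
  have h2 : nsq K (fun x => m - p x) ≤ 2 * (‖A‖ₑ ^ 2 + ‖B‖ₑ ^ 2) := by
    calc nsq K (fun x => m - p x) ≤ ∫⁻ _ in K, (‖A‖ₑ + ‖B‖ₑ) ^ 2 := by
          refine setLIntegral_mono' hK.measurableSet fun x hx => ennreal_sq_le_sq ?_
          rw [enorm_eq_ofReal_abs, enorm_eq_ofReal_abs, enorm_eq_ofReal_abs,
            ← ENNReal.ofReal_add (abs_nonneg _) (abs_nonneg _)]
          exact ENNReal.ofReal_le_ofReal (h x hx)
      _ ≤ (‖A‖ₑ + ‖B‖ₑ) ^ 2 * 1 := by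
          rw [setLIntegral_const]
          gcongr
          exact hK.volume_le_one
      _ ≤ _ := by
          rw [mul_one]
          exact ennreal_add_sq_le _ _
  calc _ ≤ 2 * (nsq K (fun x => v x - m) + 2 * (‖A‖ₑ ^ 2 + ‖B‖ₑ ^ 2)) :=
        h1.trans (by gcongr)
    _ = 2 * nsq K (fun x => v x - m) + 4 * (‖A‖ₑ ^ 2 + ‖B‖ₑ ^ 2) := by ring
    _ ≤ 4 * nsq K (fun x => v x - m) + 4 * (‖A‖ₑ ^ 2 + ‖B‖ₑ ^ 2) := by
        gcongr
        norm_num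
    _ = _ := by ring

lemma le_sqrt_mul_of_sq_le {a b : ℝ≥0∞} {C : ℝ≥0} (h : a ^ 2 ≤ C * b ^ 2) :
    a ≤ NNReal.sqrt C * b := by
  refine ennreal_le_of_sq_le ?_
  rwa [mul_pow, ← ENNReal.coe_pow, NNReal.sq_sqrt]

end

/-! ### Error bounds for measurable representatives -/

lemma exists_const_forall_fin_two {P : Fin 2 → ℝ≥0 → Prop}
    (hP : ∀ l C C', C ≤ C' → P l C → P l C') (h : ∀ l, ∃ C, P l C) : ∃ C, ∀ l, P l C := by
  choose C hC using h
  refine ⟨C 0 + C 1, fun l => hP l _ _ ?_ (hC l)⟩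
  fin_cases l
  · exact le_self_add
  · exact le_add_self

lemma l2Norm_sub_congr {K : Set (ℝ × ℝ)} {v v' : ℝ × ℝ → ℝ} (h : v =ᵐ[volume.restrict K] v')
    (p : ℝ × ℝ → ℝ) : l2Norm K (fun x => v x - p x) = l2Norm K fun x => v' x - p x :=
  l2Norm_congr (h.sub (ae_eq_refl p))

/-- The error bound in terms of bounds for the errors of two degrees of freedom. -/
lemma l2Norm_sub_le {K : Set (ℝ × ℝ)} (hK : IsRefDomain K) {v p : ℝ × ℝ → ℝ} (hv : Measurable v)
    {m A B : ℝ} (h : ∀ x ∈ K, |m - p x| ≤ |A| + |B|) {S R b : ℝ≥0∞} {C₀ C₁ C₂ : ℝ≥0}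
    (hm : nsq K (fun x => v x - m) ≤ C₀ * S)
    (hA : ‖A‖ₑ ^ 2 ≤ C₁ * (nsq K (fun x => v x - m) + S + R))
    (hB : ‖B‖ₑ ^ 2 ≤ C₂ * (nsq K (fun x => v x - m) + S + R)) (hb : S + R ≤ b ^ 2) :
    l2Norm K (fun x => v x - p x) ≤
      NNReal.sqrt (4 * (C₀ + C₁ * (C₀ + 1) + C₂ * (C₀ + 1))) * b := by
  have h1 : nsq K (fun x => v x - m) ≤ C₀ * (S + R) := hm.trans (by gcongr; exact le_self_add)
  have h2 : nsq K (fun x => v x - m) + S + R ≤ (C₀ + 1) * (S + R) := by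
    rw [add_mul, one_mul, add_assoc]
    gcongr
  refine le_sqrt_mul_of_sq_le ?_
  rw [l2Norm_sq]
  calc _ ≤ 4 * (nsq K (fun x => v x - m) + ‖A‖ₑ ^ 2 + ‖B‖ₑ ^ 2) := nsq_sub_le hK hv h
    _ ≤ 4 * (C₀ * (S + R) + C₁ * ((C₀ + 1) * (S + R)) + C₂ * ((C₀ + 1) * (S + R))) := by
        gcongr
        · exact hA.trans (by gcongr)
        · exact hB.trans (by gcongr)
    _ = ↑(4 * (C₀ + C₁ * (C₀ + 1) + C₂ * (C₀ + 1))) * (S + R) := by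
        push_cast
        ring
    _ ≤ _ := by gcongr

lemma add_sq_le_sq_add (a b c : ℝ≥0∞) : a ^ 2 + (b ^ 2 + c ^ 2) ≤ (a + b + c) ^ 2 := by
  have : (a + b + c) ^ 2 = a ^ 2 + (b ^ 2 + c ^ 2) + 2 * (a * b + a * c + b * c) := by ring
  rw [this]
  exact le_self_add

/-- The edges of the square with normal direction `l`: the one with outer normal `-e_l`. -/
def squareLo : Fin 2 → Fin 4 := ![3, 0]

/-- The edges of the square with normal direction `l`: the one with outer normal `e_l`. -/
def squareHi : Fin 2 → Fin 4 := ![1, 2]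

/-- The edge of the triangle with normal direction `l`. -/
def triangleSide : Fin 2 → Fin 3 := ![1, 0]

/-- The sign of the outer normal on the edge of the triangle with normal direction `l`. -/
def triangleSign : Fin 2 → ℝ := ![1, -1]

/-- The position of the edge of the triangle with normal direction `l`. -/
def trianglePos : Fin 2 → ℝ := ![1, 0]

/-! ### The edges, indexed by their normal direction. -/

lemma isNormalEdge_squareLo (l : Fin 2) :
    IsNormalEdge refSquare squareEdge squareDist (squareLo l) l (-1) 0 := by
  fin_cases l
  · exact isNormalEdge_square_left
  · exact isNormalEdge_square_bottom

lemma isNormalEdge_squareHi (l : Fin 2) :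
    IsNormalEdge refSquare squareEdge squareDist (squareHi l) l 1 1 := by
  fin_cases l
  · exact isNormalEdge_square_right
  · exact isNormalEdge_square_top

lemma isNormalEdge_triangleSide (l : Fin 2) : IsNormalEdge refTriangle triangleEdge triangleDist
    (triangleSide l) l (triangleSign l) (trianglePos l) := by
  fin_cases l
  · exact isNormalEdge_triangle_right
  · exact isNormalEdge_triangle_bottom

lemma exists_isNormalEdge_square (i : Fin 4) :
    ∃ l σ e, IsNormalEdge refSquare squareEdge squareDist i l σ e := by
  fin_cases i
  · exact ⟨_, _, _, isNormalEdge_square_bottom⟩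
  · exact ⟨_, _, _, isNormalEdge_square_right⟩
  · exact ⟨_, _, _, isNormalEdge_square_top⟩
  · exact ⟨_, _, _, isNormalEdge_square_left⟩

lemma exists_isTangentialEdge_squareLo (l : Fin 2) :
    ∃ α β lo hi, IsTangentialEdge refSquare squareEdge (squareLo l) (l + 1) α β lo hi := by
  fin_cases l
  · exact ⟨_, _, _, _, isTangentialEdge_square_left⟩
  · exact ⟨_, _, _, _, isTangentialEdge_square_bottom⟩

lemma exists_isTangentialEdge_squareHi (l : Fin 2) :
    ∃ α β lo hi, IsTangentialEdge refSquare squareEdge (squareHi l) (l + 1) α β lo hi := by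
  fin_cases l
  · exact ⟨_, _, _, _, isTangentialEdge_square_right⟩
  · exact ⟨_, _, _, _, isTangentialEdge_square_top⟩

lemma exists_isTangentialEdge_triangleSide (l : Fin 2) : ∃ α β lo hi,
    IsTangentialEdge refTriangle triangleEdge (triangleSide l) (l + 1) α β lo hi := by
  fin_cases l
  · exact ⟨_, _, _, _, isTangentialEdge_triangle_right⟩
  · exact ⟨_, _, _, _, isTangentialEdge_triangle_bottom⟩

/-- The component is the linear interpolation between `-F` on the lower edge and `F` on the upper
one, so its deviation from `m` is a convex combination of the deviations there. -/
lemma abs_sub_squareRT_le (F : Fin 4 → ℝ) (m : ℝ) (l : Fin 2) :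
    ∀ x ∈ refSquare, |m - squareRT F l x| ≤
      |F (squareLo l) - (-1) * m| + |F (squareHi l) - 1 * m| := by
  rintro x ⟨h1, h2, h3, h4⟩
  have key : ∀ a b t : ℝ, 0 < t → t < 1 →
      |m - (-a + (b + a) * t)| ≤ |a - (-1) * m| + |b - 1 * m| := by
    intro a b t h0 h1
    have e : m - (-a + (b + a) * t) = (1 - t) * (a - (-1) * m) - t * (b - 1 * m) := by ring
    rw [e]
    refine (abs_sub _ _).trans (add_le_add ?_ ?_)
    · rw [abs_mul, abs_of_pos (by linarith : 0 < 1 - t)]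
      exact mul_le_of_le_one_left (abs_nonneg _) (by linarith)
    · rw [abs_mul, abs_of_pos h0]
      exact mul_le_of_le_one_left (abs_nonneg _) h1.le
  fin_cases l
  · exact key (F 3) (F 1) x.1 h1 h2
  · exact key (F 0) (F 2) x.2 h3 h4

/-- On the edge normal to `e_l` the component equals the signed flux, its slope is the total flux,
and points of the triangle have distance at most one from that edge. The flux through the oblique
edge thus enters only via the divergence. -/
lemma abs_sub_triangleRT_le (F : Fin 3 → ℝ) (m : ℝ) (l : Fin 2) :
    ∀ x ∈ refTriangle, |m - triangleRT F l x| ≤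
      |F (triangleSide l) - triangleSign l * m| + |F 0 + F 1 + F 2| := by
  rintro x ⟨h1, h2, h3, h4⟩
  fin_cases l
  · have e : m - (F 1 - (F 0 + F 1 + F 2) + (F 0 + F 1 + F 2) * x.1) =
        (F 0 + F 1 + F 2) * (1 - x.1) - (F 1 - 1 * m) := by ring
    change |m - (F 1 - (F 0 + F 1 + F 2) + (F 0 + F 1 + F 2) * x.1)| ≤
      |F 1 - 1 * m| + |F 0 + F 1 + F 2|
    rw [e, add_comm |F 1 - 1 * m|]
    refine (abs_sub _ _).trans (add_le_add ?_ le_rfl)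
    rw [abs_mul, abs_of_pos (by linarith : 0 < 1 - x.1)]
    exact mul_le_of_le_one_right (abs_nonneg _) (by linarith)
  · have e : m - (-F 0 + (F 0 + F 1 + F 2) * x.2) =
        (F 0 - -1 * m) - (F 0 + F 1 + F 2) * x.2 := by ring
    change |m - (-F 0 + (F 0 + F 1 + F 2) * x.2)| ≤ |F 0 - -1 * m| + |F 0 + F 1 + F 2|
    rw [e]
    refine (abs_sub _ _).trans (add_le_add le_rfl ?_)
    rw [abs_mul, abs_of_pos h3]
    exact mul_le_of_le_one_right (abs_nonneg _) (by linarith)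

/-- On the square, the traces of a field determine the degrees of freedom. -/
lemma exists_traceFlux_square {s : ℝ} (h0 : 1 / 2 < s) (h1 : s ≤ 1) {u : Field2}
    (hu : ∀ j, Measurable (u j)) (hus : ∀ j, MemH refSquare s (u j)) :
    ∃ F : Fin 4 → ℝ, ∀ p, IsTraceRTInterpolant refSquare squareEdge squareRT0 s u p ↔
        p = squareRT F := by
  have hP := isRefPolygon_square
  choose l σ e hN using exists_isNormalEdge_square
  choose g hg using fun i j => exists_hasTrace (hN i) h0 h1 (hu j) (hus j)
  refine ⟨fun i => edgeIntegral (squareEdge i) (g i), fun p => ?_⟩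
  rw [← squareRT_iff, IsTraceRTInterpolant]
  refine and_congr_right fun _ => forall_congr' fun i => ⟨?_, fun h => ⟨g i, hg i, h⟩⟩
  rintro ⟨g', hg', h⟩
  rw [h, (hN i).edgeIntegral_eq, (hN i).edgeIntegral_eq,
    HasTrace.integral_eq hP (hN i) h0 h1 (hu _) (hus _).1 (hg' _) (hg i _)]

lemma IsTraceRTInterpolant.eq_flux {s : ℝ} {i : Fin 4} {l : Fin 2} {σ e : ℝ}
    (hN : IsNormalEdge refSquare squareEdge squareDist i l σ e) {u p : Field2}
    (hp : IsTraceRTInterpolant refSquare squareEdge squareRT0 s u p) :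
    ∃ g, HasTrace refSquare s (squareEdge i) (u l) g ∧
      edgeFlux (squareEdge i) p = σ * ∫ t in Ioo (0 : ℝ) 1, g t := by
  obtain ⟨g, hg, h⟩ := hp.2 i
  exact ⟨g l, hg l, h.trans (hN.edgeIntegral_eq g)⟩

lemma IsTraceRTInterpolant.isRTInterpolant {s : ℝ} (h0 : 1 / 2 < s) (h1 : s ≤ 1) {u p : Field2}
    {d : ℝ × ℝ → ℝ} (hu : ∀ j, Measurable (u j)) (hus : ∀ j, MemH refSquare s (u j))
    (hd : HasDiv refSquare u d)
    (hp : IsTraceRTInterpolant refSquare squareEdge squareRT0 s u p) :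
    IsRTInterpolant refSquare squareEdge squareRT0 u d p := by
  have hP := isRefPolygon_square
  have hG := isGreenField_of_hasDiv hP.isRefDomain (by linarith) h1 hu hus hd
  obtain ⟨F, hF⟩ := hG.exists_flux hP
  refine ⟨hp.1, fun i => ?_⟩
  obtain ⟨l, σ, e, hN⟩ := exists_isNormalEdge_square i
  obtain ⟨g, hg, h⟩ := hp.eq_flux hN
  have hi := (hF i (F i)).2 rfl
  rw [h, ← IsGreenFlux.eq_trace_integral hP hN h0 h1 hG (hus l).1 hi hg]
  exact hi

lemma exists_unique_rtInterpolant_square {s : ℝ} (h0 : 0 < s) (h1 : s ≤ 1) {u : Field2}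
    {d : ℝ × ℝ → ℝ} (hu : ∀ j, Measurable (u j)) (hus : ∀ j, MemH refSquare s (u j))
    (hd : HasDiv refSquare u d) :
    ∃! p, IsRTInterpolant refSquare squareEdge squareRT0 u d p := by
  have hP := isRefPolygon_square
  obtain ⟨F, hF⟩ := (isGreenField_of_hasDiv hP.isRefDomain h0 h1 hu hus hd).exists_flux hP
  simp only [IsRTInterpolant, hF, squareRT_iff]
  exact ⟨_, rfl, fun _ h => h⟩

lemma exists_unique_rtInterpolant_triangle {s : ℝ} (h0 : 0 < s) (h1 : s ≤ 1) {u : Field2}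
    {d : ℝ × ℝ → ℝ} (hu : ∀ j, Measurable (u j)) (hus : ∀ j, MemH refTriangle s (u j))
    (hd : HasDiv refTriangle u d) :
    ∃! p, IsRTInterpolant refTriangle triangleEdge triangleRT0 u d p := by
  have hP := isRefPolygon_triangle
  obtain ⟨F, hF⟩ := (isGreenField_of_hasDiv hP.isRefDomain h0 h1 hu hus hd).exists_flux hP
  simp only [IsRTInterpolant, hF, triangleRT_iff]
  exact ⟨_, rfl, fun _ h => h⟩

/-! ### The error bounds in the four cases. -/

/-- Both fluxes are compared with the constant function `m` by the bound for integrals of traces,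
which involves `u_l` only; hence no remainder, `R = 0`. -/
lemma exists_error_square_le_of_half_lt {s : ℝ} (h0 : 1 / 2 < s) (h1 : s ≤ 1) (l : Fin 2) :
    ∃ C : ℝ≥0, ∀ u p : Field2, (∀ j, Measurable (u j)) → (∀ j, MemH refSquare s (u j)) →
      IsTraceRTInterpolant refSquare squareEdge squareRT0 s u p →
      l2Norm refSquare (fun x => u l x - p l x) ≤ C * hSeminorm refSquare s (u l) := by
  have hP := isRefPolygon_square
  have hK := hP.isRefDomain
  obtain ⟨s', hs0, hs1, C, hC⟩ := exists_slobSq_le_hSeminorm h0 h1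
  obtain ⟨C₀, hC₀⟩ := exists_nsq_sub_const_le hK.isOpen hK.subset hK.nonempty
    (by linarith : 0 < s') hs1.le
  obtain ⟨C₁, hC₁⟩ := exists_trace_integral_sub_sq_le hP (isNormalEdge_squareLo l) hs0 hs1 hC
  obtain ⟨C₂, hC₂⟩ := exists_trace_integral_sub_sq_le hP (isNormalEdge_squareHi l) hs0 hs1 hC
  refine ⟨NNReal.sqrt (4 * (C₀ + C₁ * (C₀ + 1) + C₂ * (C₀ + 1))) * NNReal.sqrt C,
    fun u p hu hus hp => ?_⟩
  obtain ⟨m, hm⟩ := hC₀ (u l) (hus l).1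
  obtain ⟨g, hg, eg⟩ := hp.eq_flux (isNormalEdge_squareLo l)
  obtain ⟨g', hg', eg'⟩ := hp.eq_flux (isNormalEdge_squareHi l)
  have hpe := (squareRT_iff (fun i => edgeFlux (squareEdge i) p) p).1 ⟨hp.1, fun _ => rfl⟩
  have hb := abs_sub_squareRT_le (fun i => edgeFlux (squareEdge i) p) m l
  rw [← hpe] at hb
  simp only [eg, eg'] at hb
  have b1 := hC₁ (u l) g (fun _ => m) (hu l) (hus l).1 hg contDiff_const
  have b2 := hC₂ (u l) g' (fun _ => m) (hu l) (hus l).1 hg' contDiff_const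
  rw [slobSq_sub_const] at b1 b2
  have ei : ∫ _ in Ioo (0 : ℝ) 1, m = m := by simp
  rw [ei] at b1 b2
  rw [ENNReal.coe_mul, mul_assoc]
  refine l2Norm_sub_le hK (hu l) (S := slobSq refSquare s' (u l)) (R := 0) hb hm ?_ ?_ ?_
  · rw [← mul_sub, enorm_mul, enorm_neg, enorm_one, one_mul, add_zero]
    exact b1
  · rw [one_mul, one_mul, add_zero]
    exact b2
  · rw [add_zero, mul_pow, ← ENNReal.coe_pow, NNReal.sq_sqrt]
    exact hC _ _ hK (hu l) (hus l).1

/-- For both edges normal to `e_l` the Green flux is compared with the mean of `u_l`; the remainder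
`R` consists of the tangential seminorm and the divergence. -/
lemma exists_error_square_le {s : ℝ} (h0 : 0 < s) (h1 : s < 1) (l : Fin 2) :
    ∃ C : ℝ≥0, ∀ (u p : Field2) (d : ℝ × ℝ → ℝ), (∀ j, Measurable (u j)) →
      (∀ j, MemH refSquare s (u j)) → HasDiv refSquare u d →
      IsRTInterpolant refSquare squareEdge squareRT0 u d p →
      l2Norm refSquare (fun x => u l x - p l x) ≤ C * (hSeminorm refSquare s (u l) +
        anisoSeminorm refSquare s (l + 1) (u (l + 1)) + l2Norm refSquare d) := by
  have hP := isRefPolygon_square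
  have hK := hP.isRefDomain
  obtain ⟨C₀, hC₀⟩ := exists_nsq_sub_const_le hK.isOpen hK.subset hK.nonempty h0 h1.le
  obtain ⟨_, _, _, _, hT⟩ := exists_isTangentialEdge_squareLo l
  obtain ⟨_, _, _, _, hT'⟩ := exists_isTangentialEdge_squareHi l
  obtain ⟨C₁, hC₁⟩ := exists_flux_sub_sq_le_aniso hP (isNormalEdge_squareLo l) hT h0 h1.le
  obtain ⟨C₂, hC₂⟩ := exists_flux_sub_sq_le_aniso hP (isNormalEdge_squareHi l) hT' h0 h1.le
  refine ⟨NNReal.sqrt (4 * (C₀ + C₁ * (C₀ + 1) + C₂ * (C₀ + 1))), fun u p d hu hus hd hp => ?_⟩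
  have hG := isGreenField_of_hasDiv hK h0 h1.le hu hus hd
  obtain ⟨m, hm⟩ := hC₀ (u l) (hus l).1
  have hb := abs_sub_squareRT_le (fun i => edgeFlux (squareEdge i) p) m l
  rw [← (squareRT_iff (fun i => edgeFlux (squareEdge i) p) p).1 ⟨hp.1, fun _ => rfl⟩] at hb
  have b1 := hC₁ u d _ m hG (hp.2 _)
  have b2 := hC₂ u d _ m hG (hp.2 _)
  rw [add_assoc _ (anisoSq _ _ _ _)] at b1 b2
  refine l2Norm_sub_le hK (hu l) hb hm b1 b2 ?_
  rw [hSeminorm, if_pos h1, ← slobodeckij_sq, ← anisoSeminorm_sq, ← l2Norm_sq]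
  exact add_sq_le_sq_add _ _ _

lemma enorm_sum_flux_triangle_sq_le {u : Field2} {d : ℝ × ℝ → ℝ}
    (hu : IsGreenField refTriangle u d) {F : Fin 3 → ℝ}
    (hF : ∀ i, IsGreenFlux refTriangle triangleEdge i u d (F i)) :
    ‖F 0 + F 1 + F 2‖ₑ ^ 2 ≤ nsq refTriangle d := by
  rw [sum_flux_triangle hu hF]
  exact (ennreal_sq_le_sq (enorm_integral_le_lintegral_enorm d)).trans
    (isRefPolygon_triangle.isRefDomain.sq_lintegral_enorm_le hu.integrable.1)

/-- The axis-parallel edge is treated by strips, without a divergence term. The divergence enters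
through the total flux alone, with constant 1. -/
lemma exists_error_triangle_le_of_half_lt {s : ℝ} (h0 : 1 / 2 < s) (h1 : s ≤ 1) (l : Fin 2) :
    ∃ C : ℝ≥0, ∀ (u p : Field2) (d : ℝ × ℝ → ℝ), (∀ j, Measurable (u j)) →
      (∀ j, MemH refTriangle s (u j)) → HasDiv refTriangle u d →
      IsRTInterpolant refTriangle triangleEdge triangleRT0 u d p →
      l2Norm refTriangle (fun x => u l x - p l x) ≤ C * (hSeminorm refTriangle s (u l) +
        l2Norm refTriangle d) := by
  have hP := isRefPolygon_triangle
  have hK := hP.isRefDomain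
  obtain ⟨s', hs0, hs1, C, hC⟩ := exists_slobSq_le_hSeminorm h0 h1
  obtain ⟨C₀, hC₀⟩ := exists_nsq_sub_const_le hK.isOpen hK.subset hK.nonempty
    (by linarith : 0 < s') hs1.le
  obtain ⟨C₁, hC₁⟩ := exists_flux_sub_sq_le hP (isNormalEdge_triangleSide l) hs0 hs1.le
  refine ⟨NNReal.sqrt (4 * (C₀ + C₁ * (C₀ + 1) + 1 * (C₀ + 1))) * NNReal.sqrt (C + 1),
    fun u p d hu hus hd hp => ?_⟩
  have hG := isGreenField_of_hasDiv hK (by linarith) h1 hu hus hd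
  obtain ⟨m, hm⟩ := hC₀ (u l) (hus l).1
  have hb := abs_sub_triangleRT_le (fun i => edgeFlux (triangleEdge i) p) m l
  rw [← (triangleRT_iff (fun i => edgeFlux (triangleEdge i) p) p).1 ⟨hp.1, fun _ => rfl⟩] at hb
  have b1 := hC₁ u d _ (fun _ => m) hG (hp.2 _) contDiff_const
  have ei : ∫ _ in Ioo (0 : ℝ) 1, m = m := by simp
  rw [slobSq_sub_const, ei] at b1
  have b2 := enorm_sum_flux_triangle_sq_le hG hp.2
  rw [ENNReal.coe_mul, mul_assoc]
  refine l2Norm_sub_le hK (hu l) (S := slobSq refTriangle s' (u l)) (R := nsq refTriangle d) hb hm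
    (b1.trans (mul_le_mul' le_rfl le_self_add)) ?_ ?_
  · rw [ENNReal.coe_one, one_mul]
    exact b2.trans le_add_self
  · rw [mul_pow, ← ENNReal.coe_pow, NNReal.sq_sqrt, ← l2Norm_sq]
    have h3 := hC _ _ hK (hu l) (hus l).1
    calc _ ≤ C * hSeminorm refTriangle s (u l) ^ 2 + l2Norm refTriangle d ^ 2 := by gcongr
      _ ≤ (C + 1) * hSeminorm refTriangle s (u l) ^ 2 + (C + 1) * l2Norm refTriangle d ^ 2 := by
          gcongr
          · exact le_self_add
          · exact le_mul_of_one_le_left zero_le le_add_self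
      _ = (C + 1) * (hSeminorm refTriangle s (u l) ^ 2 + (0 ^ 2 + l2Norm refTriangle d ^ 2)) := by
          ring
      _ ≤ (C + 1) * (hSeminorm refTriangle s (u l) + 0 + l2Norm refTriangle d) ^ 2 := by
          gcongr
          exact add_sq_le_sq_add _ _ _
      _ = _ := by
          push_cast
          rw [add_zero]

lemma exists_error_triangle_le {s : ℝ} (h0 : 0 < s) (h1 : s < 1) (l : Fin 2) :
    ∃ C : ℝ≥0, ∀ (u p : Field2) (d : ℝ × ℝ → ℝ), (∀ j, Measurable (u j)) →
      (∀ j, MemH refTriangle s (u j)) → HasDiv refTriangle u d →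
      IsRTInterpolant refTriangle triangleEdge triangleRT0 u d p →
      l2Norm refTriangle (fun x => u l x - p l x) ≤ C * (hSeminorm refTriangle s (u l) +
        anisoSeminorm refTriangle s (l + 1) (u (l + 1)) + l2Norm refTriangle d) := by
  have hP := isRefPolygon_triangle
  have hK := hP.isRefDomain
  obtain ⟨C₀, hC₀⟩ := exists_nsq_sub_const_le hK.isOpen hK.subset hK.nonempty h0 h1.le
  obtain ⟨_, _, _, _, hT⟩ := exists_isTangentialEdge_triangleSide l
  obtain ⟨C₁, hC₁⟩ := exists_flux_sub_sq_le_aniso hP (isNormalEdge_triangleSide l) hT h0 h1.le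
  refine ⟨NNReal.sqrt (4 * (C₀ + C₁ * (C₀ + 1) + 1 * (C₀ + 1))), fun u p d hu hus hd hp => ?_⟩
  have hG := isGreenField_of_hasDiv hK h0 h1.le hu hus hd
  obtain ⟨m, hm⟩ := hC₀ (u l) (hus l).1
  have hb := abs_sub_triangleRT_le (fun i => edgeFlux (triangleEdge i) p) m l
  rw [← (triangleRT_iff (fun i => edgeFlux (triangleEdge i) p) p).1 ⟨hp.1, fun _ => rfl⟩] at hb
  have b1 := hC₁ u d _ m hG (hp.2 _)
  rw [add_assoc _ (anisoSq _ _ _ _)] at b1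
  refine l2Norm_sub_le hK (hu l) hb hm b1 ?_ ?_
  · rw [ENNReal.coe_one, one_mul]
    exact (enorm_sum_flux_triangle_sq_le hG hp.2).trans (le_add_self.trans le_add_self)
  · rw [hSeminorm, if_pos h1, ← slobodeckij_sq, ← anisoSeminorm_sq, ← l2Norm_sq]
    exact add_sq_le_sq_add _ _ _

end RTInterp

end

open RTInterp

theorem corollary5p1 :
    -- reference square, (i)
    (∀ s : ℝ, 1 / 2 < s → s ≤ 1 → ∃ C : ℝ≥0, ∀ u : RTInterp.Field2,
      (∀ j, RTInterp.MemH RTInterp.refSquare s (u j)) →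
      (∃! p, RTInterp.IsTraceRTInterpolant RTInterp.refSquare RTInterp.squareEdge
        RTInterp.squareRT0 s u p) ∧
      ∀ p, RTInterp.IsTraceRTInterpolant RTInterp.refSquare RTInterp.squareEdge
          RTInterp.squareRT0 s u p →
        (∀ d, RTInterp.HasDiv RTInterp.refSquare u d →
          RTInterp.IsRTInterpolant RTInterp.refSquare RTInterp.squareEdge
            RTInterp.squareRT0 u d p) ∧
        ∀ l : Fin 2, RTInterp.l2Norm RTInterp.refSquare (fun x => u l x - p l x) ≤
          C * RTInterp.hSeminorm RTInterp.refSquare s (u l)) ∧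
    -- reference square, (ii)
    (∀ s : ℝ, 0 < s → s ≤ 1 / 2 → ∃ C : ℝ≥0, ∀ (u : RTInterp.Field2) (d : ℝ × ℝ → ℝ),
      (∀ j, RTInterp.MemH RTInterp.refSquare s (u j)) → RTInterp.HasDiv RTInterp.refSquare u d →
      (∃! p, RTInterp.IsRTInterpolant RTInterp.refSquare RTInterp.squareEdge
        RTInterp.squareRT0 u d p) ∧
      ∀ p, RTInterp.IsRTInterpolant RTInterp.refSquare RTInterp.squareEdge
          RTInterp.squareRT0 u d p →
        ∀ l : Fin 2, RTInterp.l2Norm RTInterp.refSquare (fun x => u l x - p l x) ≤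
          C * (RTInterp.hSeminorm RTInterp.refSquare s (u l) +
            RTInterp.anisoSeminorm RTInterp.refSquare s (l + 1) (u (l + 1)) +
            RTInterp.l2Norm RTInterp.refSquare d)) ∧
    -- reference triangle, (i)
    (∀ s : ℝ, 1 / 2 < s → s ≤ 1 → ∃ C : ℝ≥0, ∀ (u : RTInterp.Field2) (d : ℝ × ℝ → ℝ),
      (∀ j, RTInterp.MemH RTInterp.refTriangle s (u j)) →
      RTInterp.HasDiv RTInterp.refTriangle u d →
      (∃! p, RTInterp.IsRTInterpolant RTInterp.refTriangle RTInterp.triangleEdge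
        RTInterp.triangleRT0 u d p) ∧
      ∀ p, RTInterp.IsRTInterpolant RTInterp.refTriangle RTInterp.triangleEdge
          RTInterp.triangleRT0 u d p →
        ∀ l : Fin 2, RTInterp.l2Norm RTInterp.refTriangle (fun x => u l x - p l x) ≤
          C * (RTInterp.hSeminorm RTInterp.refTriangle s (u l) +
            RTInterp.l2Norm RTInterp.refTriangle d)) ∧
    -- reference triangle, (ii)
    (∀ s : ℝ, 0 < s → s ≤ 1 / 2 → ∃ C : ℝ≥0, ∀ (u : RTInterp.Field2) (d : ℝ × ℝ → ℝ),
      (∀ j, RTInterp.MemH RTInterp.refTriangle s (u j)) →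
      RTInterp.HasDiv RTInterp.refTriangle u d →
      (∃! p, RTInterp.IsRTInterpolant RTInterp.refTriangle RTInterp.triangleEdge
        RTInterp.triangleRT0 u d p) ∧
      ∀ p, RTInterp.IsRTInterpolant RTInterp.refTriangle RTInterp.triangleEdge
          RTInterp.triangleRT0 u d p →
        ∀ l : Fin 2, RTInterp.l2Norm RTInterp.refTriangle (fun x => u l x - p l x) ≤
          C * (RTInterp.hSeminorm RTInterp.refTriangle s (u l) +
            RTInterp.anisoSeminorm RTInterp.refTriangle s (l + 1) (u (l + 1)) +
            RTInterp.l2Norm RTInterp.refTriangle d)) := by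
  refine ⟨fun s h0 h1 => ?_, fun s h0 h1 => ?_, fun s h0 h1 => ?_, fun s h0 h1 => ?_⟩
  · obtain ⟨C, hC⟩ := exists_const_forall_fin_two (fun l C C' h hl u p hu hus hp =>
      (hl u p hu hus hp).trans (by gcongr)) (exists_error_square_le_of_half_lt h0 h1)
    refine ⟨C, fun u hus => ?_⟩
    -- All statements are transferred to a Borel representative of the field, here and in the other
    -- three cases.
    obtain ⟨u', hu', hae, hus'⟩ := exists_measurable_field hus
    have hc := fun p => isTraceRTInterpolant_congr (edge := squareEdge) (V := squareRT0) (p := p)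
      (s := s) hae
    obtain ⟨F, hF⟩ := exists_traceFlux_square h0 h1 hu' hus'
    refine ⟨⟨squareRT F, (hc _).2 ((hF _).2 rfl), fun p hp => (hF p).1 ((hc p).1 hp)⟩,
      fun p hp => ⟨fun d hd => ?_, fun l => ?_⟩⟩
    · exact (isRTInterpolant_congr hae).2
        (((hc p).1 hp).isRTInterpolant h0 h1 hu' hus' ((hasDiv_congr hae).1 hd))
    · rw [hSeminorm_congr (hae l), l2Norm_sub_congr (hae l)]
      exact hC l u' p hu' hus' ((hc p).1 hp)
  · obtain ⟨C, hC⟩ := exists_const_forall_fin_two (fun l C C' h hl u p d hu hus hd hp =>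
      (hl u p d hu hus hd hp).trans (by gcongr)) (exists_error_square_le h0 (by linarith : s < 1))
    refine ⟨C, fun u d hus hd => ?_⟩
    obtain ⟨u', hu', hae, hus'⟩ := exists_measurable_field hus
    have hc := fun p => isRTInterpolant_congr (edge := squareEdge) (V := squareRT0) (p := p)
      (d := d) hae
    have hd' := (hasDiv_congr hae).1 hd
    refine ⟨?_, fun p hp l => ?_⟩
    · simp only [hc]
      exact exists_unique_rtInterpolant_square h0 (by linarith) hu' hus' hd'
    · rw [hSeminorm_congr (hae l), l2Norm_sub_congr (hae l),
        anisoSeminorm_congr isRefPolygon_square.isRefDomain.measurableSet (hae (l + 1))]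
      exact hC l u' p d hu' hus' hd' ((hc p).1 hp)
  · obtain ⟨C, hC⟩ := exists_const_forall_fin_two (fun l C C' h hl u p d hu hus hd hp =>
      (hl u p d hu hus hd hp).trans (by gcongr)) (exists_error_triangle_le_of_half_lt h0 h1)
    refine ⟨C, fun u d hus hd => ?_⟩
    obtain ⟨u', hu', hae, hus'⟩ := exists_measurable_field hus
    have hc := fun p => isRTInterpolant_congr (edge := triangleEdge) (V := triangleRT0) (p := p)
      (d := d) hae
    have hd' := (hasDiv_congr hae).1 hd
    refine ⟨?_, fun p hp l => ?_⟩
    · simp only [hc]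
      exact exists_unique_rtInterpolant_triangle (by linarith) h1 hu' hus' hd'
    · rw [hSeminorm_congr (hae l), l2Norm_sub_congr (hae l)]
      exact hC l u' p d hu' hus' hd' ((hc p).1 hp)
  · obtain ⟨C, hC⟩ := exists_const_forall_fin_two (fun l C C' h hl u p d hu hus hd hp =>
      (hl u p d hu hus hd hp).trans (by gcongr)) (exists_error_triangle_le h0 (by linarith : s < 1))
    refine ⟨C, fun u d hus hd => ?_⟩
    obtain ⟨u', hu', hae, hus'⟩ := exists_measurable_field hus
    have hc := fun p => isRTInterpolant_congr (edge := triangleEdge) (V := triangleRT0) (p := p)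
      (d := d) hae
    have hd' := (hasDiv_congr hae).1 hd
    refine ⟨?_, fun p hp l => ?_⟩
    · simp only [hc]
      exact exists_unique_rtInterpolant_triangle h0 (by linarith) hu' hus' hd'
    · rw [hSeminorm_congr (hae l), l2Norm_sub_congr (hae l),
        anisoSeminorm_congr isRefPolygon_triangle.isRefDomain.measurableSet (hae (l + 1))]
      exact hC l u' p d hu' hus' hd' ((hc p).1 hp)
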